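/- Setting. Let \(\nu_w,\nu_x\) be probability measures on \(\mathbb R\) that are centred, have variances \(\sigma_w^2,\sigma_x^2\) (with \(\sigma_w,\sigma_x\ge 0\)) and finite moments of all orders. Let \(W\in\mathbb R^{n_1\times n_0}\) have entries of law \(\nu_w\) and \(X\in\mathbb R^{n_0\times m}\) entries of law \(\nu_x\), all entries of \(W\) and \(X\) being independent. Let \(f:\mathbb R\to\mathbb R\) be \(C^\infty\), with every derivative (including \(f\) itself) of at most exponential growth, i.e. for each \(j\ge 0\) there is \(C_j\) with \(|f^{(j)}(x)|\le C_j e^{C_j|x|}\), and with \[\int_{\mathbb R} f(\sigma_w\sigma_x x)\,\frac{e^{-x^2/2}}{\sqrt{2\pi}}\,dx=0 .\] Let \(\chi:\mathbb R\to\mathbb R\) be a smooth cut-off, \(\chi=1\) on \(|x|\le 1\) and \(\chi=0\) on \(|x|\ge 2\), put \(f_{n_0}(x)=f(x)\,\chi(x/\log n_0)\), and let \(Y=f_{n_0}(WX/\sqrt{n_0})\in\mathbb R^{n_1\times m}\), with \(f_{n_0}\) applied entrywise; \(Y^*\) is the transpose. Set \[\theta_1(f)=\int_{\mathbb R} f(\sigma_w\sigma_x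 x)^2\frac{e^{-x^2/2}}{\sqrt{2\pi}}dx,\qquad \theta_2(f)=\Bigl(\sigma_w\sigma_x\int_{\mathbb R} f'(\sigma_w\sigma_x x)\frac{e^{-x^2/2}}{\sqrt{2\pi}}dx\Bigr)^2 .\] The joint cumulant of \(Z_1,\dots,Z_q\) is \(\kappa(Z_1,\dots,Z_q)=\sum_\pi(-1)^{|\pi|-1}(|\pi|-1)!\prod_{B\in\pi}\mathbf E\prod_{i\in B}Z_i\), the sum running over the partitions \(\pi\) of \(\{1,\dots,q\}\). Proposition (correlation structure without bias). For every \(K\in\mathbb N\) there are \(C\) and \(N\), depending only on \(K,f,\chi,\nu_w,\nu_x\), such that for all \(n_0\ge N\), all \(n_1,m\), and all \(W,X\) as above: 1. \(|\kappa(Y_{ij})|\le C\,n_0^{-1/2}\) for all \(i,j\). 2. \(|\kappa(Y_{ij},Y^*_{ji})-\theta_1(f)|\le C\,\theta_1(f)\,n_0^{-1/2}\) for all \(i,j\). 3. For \(1<k\le K\), distinct row indices \(i_1,i_3,\dots,i_{2k-1}\) and distinct column indices \(i_2,i_4,\dots,i_{2k}\), \[\bigl|\kappa(Y_{i_1i_2},Y^*_{i_2i_3},Y_{i_3i_4},\dots,Y^*_{i_{2k}i_1})-\theta_2(f)^k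 n_0^{1-k}\bigr|\le C\,n_0^{1-k}\,n_0^{-1/2}.\] In particular, if \(\theta_2(f)\neq 0\), this cumulant is \(\theta_2(f)^k n_0^{1-k}(1+O(n_0^{-1/2}))\). 4. All other cumulants are negligible in the following sense. Let \(1\le q\le K\), and let \(Y_{a_1b_1},\dots,Y_{a_qb_q}\) be entries of \(Y\) (repetitions allowed) that are not, up to their order, the entries of a cycle as in 2 (one entry taken twice) or 3. Let \(v\) be the number of distinct row indices plus the number of distinct column indices among them. Then \[|\kappa(Y_{a_1b_1},\dots,Y_{a_qb_q})|\le C\,n_0^{\,1-v+\max(q,v)/2}\;n_0^{-1/2}.\] (For a cycle, \(q=v=2k\) and \(n_0^{1-v+\max(q,v)/2}=n_0^{1-k}\).) -/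

import Mathlib

open MeasureTheory ProbabilityTheory Matrix
open scoped Nat

noncomputable section

namespace CycleCorrelations

/-- The joint cumulant of a finite family of real random variables:
`κ(X) = ∑_π (-1)^(|π| - 1) (|π| - 1)! ∏_{B ∈ π} 𝔼[∏_{i ∈ B} X i]`,
the sum running over all set partitions `π` of the index set. -/
def jointCumulant {Ω ι : Type*} [MeasurableSpace Ω] [Fintype ι] [DecidableEq ι]
    (P : Measure Ω) (X : ι → Ω → ℝ) : ℝ :=
  ∑ π : Finpartition (Finset.univ : Finset ι),
    (-1 : ℝ) ^ (π.parts.card - 1) * ((π.parts.card - 1)! : ℝ) *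
      ∏ B ∈ π.parts, ∫ ω, ∏ i ∈ B, X i ω ∂P

/-- `θ₁(f) = ∫ f(σ_w σ_x x)² dγ(x)` with `γ` the standard Gaussian measure. -/
def theta₁ (σw σx : ℝ) (f : ℝ → ℝ) : ℝ :=
  ∫ x, f (σw * σx * x) ^ 2 ∂(gaussianReal 0 1)

/-- `θ₂(f) = (σ_w σ_x ∫ f'(σ_w σ_x x) dγ(x))²` with `γ` the standard Gaussian measure. -/
def theta₂ (σw σx : ℝ) (f : ℝ → ℝ) : ℝ :=
  (σw * σx * ∫ x, deriv f (σw * σx * x) ∂(gaussianReal 0 1)) ^ 2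

/-- A smooth cut-off function: equal to one on `[-1, 1]`, zero outside `(-2, 2)`. -/
structure IsCutoff (χ : ℝ → ℝ) : Prop where
  smooth : ContDiff ℝ (⊤ : ℕ∞) χ
  eq_one : ∀ x, |x| ≤ 1 → χ x = 1
  eq_zero : ∀ x, 2 ≤ |x| → χ x = 0

/-- All derivatives (the function itself included) grow at most exponentially. -/
def HasExpGrowth (f : ℝ → ℝ) : Prop :=
  ∀ j : ℕ, ∃ C : ℝ, ∀ x : ℝ, |iteratedDeriv j f x| ≤ C * Real.exp (C * |x|)

/-- The activation function at size `n₀`, cut off at scale `log n₀`. -/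
def cutActivation (f χ : ℝ → ℝ) (n₀ : ℕ) (x : ℝ) : ℝ :=
  f x * χ ((Real.log n₀)⁻¹ * x)

/-- The random feature matrix `Y = f(W X / √n₀)`, with the cut-off activation function
applied entrywise. -/
def featureMatrix {Ω : Type*} {n₀ n₁ m : ℕ} (f χ : ℝ → ℝ)
    (W : Ω → Matrix (Fin n₁) (Fin n₀) ℝ) (X : Ω → Matrix (Fin n₀) (Fin m) ℝ)
    (ω : Ω) : Matrix (Fin n₁) (Fin m) ℝ :=
  ((Real.sqrt n₀)⁻¹ • (W ω * X ω)).map (cutActivation f χ n₀)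

/-- `ν` is centred, has variance `σ²` and finite moments of all orders. -/
structure IsEntryLaw (ν : Measure ℝ) (σ : ℝ) : Prop where
  moments : ∀ p : ℕ, Integrable (fun x : ℝ => x ^ p) ν
  mean : ∫ x, x ∂ν = 0
  variance : ∫ x, x ^ 2 ∂ν = σ ^ 2

/-- The entries of `W` have law `νW`, those of `X` have law `νX`, and all entries of
`W` and `X` together are independent. -/
structure IsIIDModel {Ω : Type*} [MeasurableSpace Ω] {n₀ n₁ m : ℕ} (P : Measure Ω)
    (νW νX : Measure ℝ) (W : Ω → Matrix (Fin n₁) (Fin n₀) ℝ)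
    (X : Ω → Matrix (Fin n₀) (Fin m) ℝ) : Prop where
  law_W : ∀ i a, HasLaw (fun ω => W ω i a) νW P
  law_X : ∀ a j, HasLaw (fun ω => X ω a j) νX P
  indep : iIndepFun (β := fun _ : (Fin n₁ × Fin n₀) ⊕ (Fin n₀ × Fin m) => ℝ)
    (Sum.elim (fun p ω => W ω p.1 p.2) (fun p ω => X ω p.1 p.2)) P

/-- The `2k` entries of `Y` along a cycle with row indices `r 0, …, r (k-1)` and column
indices `c 0, …, c (k-1)`: the variables `Y_{r l, c l}` and `Y*_{c l, r (l+1)}`, with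
`l + 1` taken modulo `k`. -/
def cycleEntries {Ω : Type*} {n₁ m k : ℕ} (Y : Ω → Matrix (Fin n₁) (Fin m) ℝ)
    (r : Fin k → Fin n₁) (c : Fin k → Fin m) : Fin k ⊕ Fin k → Ω → ℝ :=
  Sum.elim (fun l ω => Y ω (r l) (c l)) (fun l ω => (Y ω)ᴴ (c l) (r (finRotate k l)))

/-- The `q` positions `(a l, b l)` form, up to their order, a `2k`-cycle with pairwise
distinct row indices and pairwise distinct column indices. The case `k = 1` is one
position listed twice. -/
def IsCycle {n₁ m q : ℕ} (a : Fin q → Fin n₁) (b : Fin q → Fin m) : Prop :=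
  ∃ (k : ℕ) (e : Fin k ⊕ Fin k ≃ Fin q) (r : Fin k → Fin n₁) (c : Fin k → Fin m),
    Function.Injective r ∧ Function.Injective c ∧
      ∀ l : Fin k, a (e (Sum.inl l)) = r l ∧ b (e (Sum.inl l)) = c l ∧
        a (e (Sum.inr l)) = r (finRotate k l) ∧ b (e (Sum.inr l)) = c l

/-- The number of distinct indices (row indices plus column indices) among the
positions `(a l, b l)`. -/
def numIndices {n₁ m q : ℕ} (a : Fin q → Fin n₁) (b : Fin q → Fin m) : ℕ :=
  (Finset.univ.image a).card + (Finset.univ.image b).card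

end CycleCorrelations

end

open CycleCorrelations

/-! After division of the entries by `σw` and `σx`, the entries of `W X / √n₀` at distinct positions
are normalised sums of independent random vectors with identity covariance: the `a`-th vector
consists of the products `W i a * X a j`. They are close to independent standard Gaussians, and the
theorem measures the correlation that survives. Everything is expanded in powers of `ε = 1 / √n₀`.
If `σw * σx = 0`, then `f 0 = 0`, so `Y = 0` almost surely and all claims are trivial
(`degenerate_bounds`).

Reduction to polynomials. A family of functions is called admissible if all derivatives are bounded
by powers of a weight that behaves like `(1 + x²) min (exp |x|) n`. The cut-off at scale `log n`
makes the activation admissible, and powers of the weight have bounded expectation along all partial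
sums, although the entries only have polynomial moments. If sufficiently many derivatives of one
factor `g` have Gaussian mean zero, Stein's equation `g = x v - v'` and an expansion in one summand
at a time cancel the leading order of the mixed moment. Each such step gains a factor `ε` and uses
up finitely many of the vanishing means (`exists_stein_step`, `exists_abs_mom_le_of_gaussOrth`).
Hence admissible functions at distinct positions may be replaced by polynomials, up to any power of
`ε`, in moments and so in cumulants (`exists_setCumulant_approx`).

Cumulants of powers. Expanding `∏ H_e ^ d e` gives `d e` slots at each position `e` and a selection
`α` of an inner index for every slot. The cumulant of one selection vanishes unless every slot
shares its entry of `W` and its entry of `X` with other slots and the shared entries connect the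
positions. A graph count then gives `2 #values + v ≤ #slots + 2`, where `v` counts rows and columns,
and hence a cumulant of order `ε ^ (v - 2)`; a position alone in its row or column gains one more
`ε`. On a cycle the extremal selections are the tight ones: one value common to all positions, all
other slots paired within their position. Each has cumulant one, and counting them gives `n ε ^ (2k)
∏ d ∫ x ^ (d - 1)`. By multilinearity admissible functions have the leading term `n ε ^ (2k) ∏ ∫
g'`, which is `θ₂ ^ k n ^ (1 - k)` in the limit of the cut-off
(`exists_abs_setCumulant_cycle_sub_le`).

Repeated positions are removed by `setCumulant_merge`, which multiplies two variables at the same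
position at the price of products of smaller cumulants (`exists_abs_setCumulant_decay`). The
non-cycles with at most as many entries as vertices are handled by `forest_or_leaf`: a connected
family of this kind is a forest, or has distinct positions and a leaf. Mean and variance follow from
the comparison of moments with Gaussian integrals. -/

noncomputable section

namespace CycleCorrelations

/-! ### Cumulants as functionals of the family of joint moments. -/

section SetCumulant

variable {ι : Type*} [DecidableEq ι]

/-- The cumulant of a set function `M`, thought of as the family of joint moments. -/
def setCumulant (M : Finset ι → ℝ) (S : Finset ι) : ℝ :=
  ∑ π : Finpartition S,
    (-1 : ℝ) ^ (π.parts.card - 1) * ((π.parts.card - 1)! : ℝ) * ∏ B ∈ π.parts, M B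

theorem setCumulant_congr {M M' : Finset ι → ℝ} {S : Finset ι}
    (h : ∀ B ⊆ S, B.Nonempty → M B = M' B) : setCumulant M S = setCumulant M' S := by
  unfold setCumulant
  refine Finset.sum_congr rfl fun π _ => ?_
  congr 1
  exact Finset.prod_congr rfl fun B hB => h B (π.le hB) (π.nonempty_of_mem_parts hB)

theorem setCumulant_empty (M : Finset ι → ℝ) : setCumulant M ∅ = 1 := by
  unfold setCumulant
  have : ∀ π : Finpartition (∅ : Finset ι), π.parts = ∅ := fun π =>
    π.parts_eq_empty_iff.2 rfl
  simp only [this]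
  have hc : Fintype.card (Finpartition (∅ : Finset ι)) = 1 :=
    Fintype.card_eq_one_iff.2 ⟨Finpartition.empty _, fun y => by ext1; rw [this]; rfl⟩
  simp [hc]

/-- Adding a block to a partition, counted by the new block. -/
theorem sum_extend_eq (i : ι) (A : Finset ι) (hi : i ∉ A) (F : Finset (Finset ι) → Finset ι → ℝ) :
    ∑ B ∈ A.powerset.erase A, ∑ π : Finpartition (insert i B), F (insert (A \ B) π.parts) (A \ B) =
      ∑ ρ : Finpartition (insert i A), ∑ D ∈ ρ.parts.filter (fun D => i ∉ D), F ρ.parts D := by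
  rw [Finset.sum_sigma', Finset.sum_sigma']
  have key : ∀ B ∈ A.powerset.erase A, A \ B ≠ ⊥ ∧ Disjoint (insert i B) (A \ B) ∧
      insert i B ⊔ (A \ B) = insert i A := by
    intro B hB
    rw [Finset.mem_erase, Finset.mem_powerset] at hB
    refine ⟨?_, ?_, ?_⟩
    · intro h
      exact hB.1 (Finset.Subset.antisymm hB.2 (Finset.sdiff_eq_empty_iff_subset.1 h))
    · rw [Finset.disjoint_insert_left]
      exact ⟨fun h => hi (Finset.mem_sdiff.1 h).1, Finset.disjoint_sdiff⟩
    · rw [Finset.sup_eq_union, Finset.insert_union, Finset.union_sdiff_of_subset hB.2]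
  refine Finset.sum_bij (fun x hx =>
    have hB := (Finset.mem_sigma.1 hx).1
    ⟨x.2.extend (key x.1 hB).1 (key x.1 hB).2.1 (key x.1 hB).2.2, A \ x.1⟩) ?_ ?_ ?_ ?_
  · rintro ⟨B, π⟩ hx
    simp only [Finset.mem_sigma, Finset.mem_univ, true_and, Finset.mem_filter]
    refine ⟨?_, fun h => hi (Finset.mem_sdiff.1 h).1⟩
    simp [Finpartition.extend]
  · rintro ⟨B, π⟩ hx ⟨B', π'⟩ hx' h
    have hB := key B (Finset.mem_sigma.1 hx).1
    have hB1 : B ∈ A.powerset.erase A := (Finset.mem_sigma.1 hx).1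
    have hB1' : B' ∈ A.powerset.erase A := (Finset.mem_sigma.1 hx').1
    simp only [Sigma.mk.injEq] at h
    obtain ⟨h1, h2⟩ := h
    have h2 := eq_of_heq h2
    rw [Finset.mem_erase, Finset.mem_powerset] at hB1 hB1'
    have hBB : B = B' := by
      rw [← Finset.sdiff_sdiff_eq_self hB1.2, h2, Finset.sdiff_sdiff_eq_self hB1'.2]
    subst hBB
    have h3 := congrArg Finpartition.parts h1
    simp only [Finpartition.extend] at h3
    have hn : ∀ σ : Finpartition (insert i B), A \ B ∉ σ.parts := by
      intro σ hσ
      exact hB.1 (Finset.disjoint_self_iff_empty _ |>.1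
        (hB.2.1.mono_left (σ.le hσ)))
    have h4 : π.parts = π'.parts := by
      rw [← Finset.erase_insert (hn π), h3, Finset.erase_insert (hn π')]
    have : π = π' := by ext1; exact h4
    subst this
    rfl
  · rintro ⟨ρ, D⟩ hx
    simp only [Finset.mem_sigma, Finset.mem_univ, true_and, Finset.mem_filter] at hx
    obtain ⟨hD, hiD⟩ := hx
    have hDA : D ⊆ A := by
      intro x hx
      have := ρ.le hD hx
      rcases Finset.mem_insert.1 this with h | h
      · exact absurd (h ▸ hx) hiD
      · exact h
    have hDne := ρ.nonempty_of_mem_parts hD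
    have hsup : (ρ.parts.erase D).sup id = insert i (A \ D) := by
      ext x
      rw [Finset.mem_sup]
      constructor
      · rintro ⟨E, hE, hxE⟩
        rw [Finset.mem_erase] at hE
        have hx := ρ.le hE.2 hxE
        have hxD : x ∉ D := fun h => hE.1 (ρ.eq_of_mem_parts hE.2 hD hxE h)
        rw [Finset.mem_insert] at hx ⊢
        rcases hx with h | h
        · exact Or.inl h
        · exact Or.inr (Finset.mem_sdiff.2 ⟨h, hxD⟩)
      · intro hx
        have hx' : x ∈ insert i A ∧ x ∉ D := by
          rw [Finset.mem_insert] at hx ⊢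
          rcases hx with h | h
          · exact ⟨Or.inl h, h ▸ hiD⟩
          · exact ⟨Or.inr (Finset.mem_sdiff.1 h).1, (Finset.mem_sdiff.1 h).2⟩
        obtain ⟨E, hE, hxE⟩ := ρ.exists_mem hx'.1
        exact ⟨E, Finset.mem_erase.2 ⟨fun h => hx'.2 (h ▸ hxE), hE⟩, hxE⟩
    have hBmem : A \ D ∈ A.powerset.erase A := by
      rw [Finset.mem_erase, Finset.mem_powerset]
      refine ⟨fun h => ?_, Finset.sdiff_subset⟩
      obtain ⟨x, hx⟩ := hDne
      have := hDA hx
      rw [← h] at this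
      exact (Finset.mem_sdiff.1 this).2 hx
    refine ⟨⟨A \ D, ⟨ρ.parts.erase D, ρ.supIndep.subset (Finset.erase_subset _ _), hsup,
      fun h => ρ.bot_notMem (Finset.mem_of_mem_erase h)⟩⟩, ?_, ?_⟩
    · simp only [Finset.mem_sigma, Finset.mem_univ, and_true]
      exact hBmem
    · have e1 : A \ (A \ D) = D := Finset.sdiff_sdiff_eq_self hDA
      have : ∀ (E : Finset ι) (hE : E = D) (ρ' : Finpartition (insert i A)),
          ρ'.parts = insert E (ρ.parts.erase D) →
          (⟨ρ', E⟩ : (_ : Finpartition (insert i A)) × Finset ι) = ⟨ρ, D⟩ := by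
        rintro E rfl ρ' h
        have : ρ' = ρ := by ext1; rw [h, Finset.insert_erase hD]
        rw [this]
      exact this _ e1 _ rfl
  · rintro ⟨B, π⟩ hx
    rfl

/-- The recursion determining cumulants from moments. -/
theorem moment_insert_eq (M : Finset ι → ℝ) (hM : M ∅ = 1) {i : ι} {A : Finset ι} (hi : i ∉ A) :
    M (insert i A) = ∑ B ∈ A.powerset, setCumulant M (insert i B) * M (A \ B) := by
  rw [← Finset.add_sum_erase _ _ (Finset.mem_powerset_self A)]
  rw [Finset.sdiff_self, hM, mul_one]
  have h1 : ∑ B ∈ A.powerset.erase A, setCumulant M (insert i B) * M (A \ B) =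
      ∑ B ∈ A.powerset.erase A, ∑ π : Finpartition (insert i B),
        (fun (ps : Finset (Finset ι)) (_ : Finset ι) =>
          -- The family `ps` is `π.parts` with one block added, so `card - 2` is the exponent
          -- `π.parts.card - 1` of the cumulant.
          (-1 : ℝ) ^ (ps.card - 2) * ((ps.card - 2)! : ℝ) * ∏ B ∈ ps, M B)
            (insert (A \ B) π.parts) (A \ B) := by
    refine Finset.sum_congr rfl fun B hB => ?_
    unfold setCumulant
    rw [Finset.sum_mul]
    refine Finset.sum_congr rfl fun π _ => ?_
    rw [Finset.mem_erase, Finset.mem_powerset] at hB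
    have hn : A \ B ∉ π.parts := by
      intro hσ
      obtain ⟨x, hx⟩ := π.nonempty_of_mem_parts hσ
      have h2 := Finset.mem_sdiff.1 hx
      rcases Finset.mem_insert.1 (π.le hσ hx) with h | h
      · exact hi (h ▸ h2.1)
      · exact h2.2 h
    simp only
    rw [Finset.card_insert_of_notMem hn, Finset.prod_insert hn]
    simp only [Nat.reduceSubDiff]
    ring
  rw [h1, sum_extend_eq i A hi (fun ps _ =>
    (-1 : ℝ) ^ (ps.card - 2) * ((ps.card - 2)! : ℝ) * ∏ B ∈ ps, M B)]
  unfold setCumulant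
  rw [← Finset.sum_add_distrib]
  have hne : (insert i A) ≠ ⊥ := Finset.insert_ne_empty i A
  -- A partition with `p ≥ 2` blocks has `p - 1` blocks avoiding `i`, so its total coefficient is
  -- `(-1)^(p-1) (p-1)! + (p-1) (-1)^(p-2) (p-2)! = 0`. Only the one-block partition survives.
  rw [Finset.sum_eq_single (Finpartition.indiscrete hne)]
  · have : Finset.filter (fun D => i ∉ D) (Finpartition.indiscrete hne).parts = ∅ := by
      rw [Finset.filter_eq_empty_iff]
      intro x hx
      simp only [Finpartition.indiscrete, Finset.mem_singleton] at hx
      simp [hx]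
    rw [this]
    simp [Finpartition.indiscrete]
  · intro ρ _ hρ
    rw [Finset.sum_const]
    have hcard : (ρ.parts.filter (fun D => i ∉ D)).card = ρ.parts.card - 1 := by
      obtain ⟨E, hE, hiE⟩ := ρ.exists_mem (Finset.mem_insert_self i A)
      have : ρ.parts.filter (fun D => i ∉ D) = ρ.parts.erase E := by
        ext D
        rw [Finset.mem_filter, Finset.mem_erase]
        constructor
        · rintro ⟨h1, h2⟩
          exact ⟨fun h => h2 (h ▸ hiE), h1⟩
        · rintro ⟨h1, h2⟩
          exact ⟨h2, fun h => h1 (ρ.eq_of_mem_parts h2 hE h hiE)⟩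
      rw [this, Finset.card_erase_of_mem hE]
    rw [hcard]
    have hpos : 0 < ρ.parts.card := Finset.card_pos.2 (ρ.parts_nonempty hne)
    have h2 : 2 ≤ ρ.parts.card := by
      by_contra hlt
      have h1 : ρ.parts.card = 1 := by omega
      obtain ⟨E, hE⟩ := Finset.card_eq_one.1 h1
      apply hρ
      ext1
      have := ρ.sup_parts
      rw [hE] at this
      simp only [Finset.sup_singleton, id] at this
      rw [hE, this]; rfl
    obtain ⟨p, hp⟩ : ∃ p, ρ.parts.card = p + 2 := ⟨_, (Nat.sub_add_cancel h2).symm⟩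
    simp only [hp, Nat.add_sub_cancel, nsmul_eq_mul]
    rw [show p + 2 - 1 = p + 1 by omega, Nat.factorial_succ]
    push_cast
    ring
  · simp

/-- The recursion has only one solution. -/
theorem eq_setCumulant_of_recursion (M k : Finset ι → ℝ) (hM : M ∅ = 1) (S : Finset ι)
    (hk : ∀ i A, i ∉ A → insert i A ⊆ S →
      M (insert i A) = ∑ B ∈ A.powerset, k (insert i B) * M (A \ B)) :
    ∀ T ⊆ S, T.Nonempty → k T = setCumulant M T := by
  intro T
  induction T using Finset.strongInduction with
  | H T ih =>
    intro hTS hT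
    obtain ⟨i, hi⟩ := hT
    have hiA : i ∉ T.erase i := Finset.notMem_erase i T
    have h1 := hk i (T.erase i) hiA (by rwa [Finset.insert_erase hi])
    have h2 := moment_insert_eq M hM hiA
    rw [← Finset.add_sum_erase _ _ (Finset.mem_powerset_self _), Finset.sdiff_self, hM, mul_one,
      Finset.insert_erase hi] at h1 h2
    have h3 : ∑ B ∈ (T.erase i).powerset.erase (T.erase i), k (insert i B) * M (T.erase i \ B) =
        ∑ B ∈ (T.erase i).powerset.erase (T.erase i),
          setCumulant M (insert i B) * M (T.erase i \ B) := by
      refine Finset.sum_congr rfl fun B hB => ?_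
      rw [Finset.mem_erase, Finset.mem_powerset] at hB
      have hBT : insert i B ⊂ T := by
        rw [Finset.ssubset_iff_subset_ne]
        refine ⟨Finset.insert_subset hi (hB.2.trans (Finset.erase_subset _ _)), fun h => hB.1 ?_⟩
        rw [← h, Finset.erase_insert (fun h' => hiA (hB.2 h'))]
      rw [ih _ hBT (hBT.1.trans hTS) (Finset.insert_nonempty _ _)]
    linarith

/-- A cumulant vanishes if the variables split into two independent groups. -/
theorem setCumulant_eq_zero_of_factor (M : Finset ι → ℝ) (hM : M ∅ = 1) (A : Finset ι)
    (hfac : ∀ S, M S = M (S ∩ A) * M (S \ A)) :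
    ∀ S : Finset ι, (S ∩ A).Nonempty → (S \ A).Nonempty → setCumulant M S = 0 := by
  intro S
  induction S using Finset.strongInduction with
  | H S ih =>
    intro h1 h2
    obtain ⟨i, hi⟩ := h1
    have hiS := (Finset.mem_inter.1 hi).1
    have hiA := (Finset.mem_inter.1 hi).2
    set R := S.erase i with hR
    have hiR : i ∉ R := Finset.notMem_erase i S
    have hSR : insert i R = S := Finset.insert_erase hiS
    have hrec := moment_insert_eq M hM hiR
    rw [← Finset.add_sum_erase _ _ (Finset.mem_powerset_self _), Finset.sdiff_self, hM, mul_one,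
      hSR] at hrec
    have hiRA : i ∉ R ∩ A := fun h => hiR (Finset.mem_inter.1 h).1
    have hrec2 := moment_insert_eq M hM hiRA
    have e1 : insert i (R ∩ A) = S ∩ A := by
      rw [← hSR, Finset.insert_inter_of_mem hiA]
    have hRA : (R ∩ A).powerset ⊆ R.powerset.erase R := by
      intro B hB
      rw [Finset.mem_powerset] at hB
      rw [Finset.mem_erase, Finset.mem_powerset]
      refine ⟨fun h => ?_, hB.trans Finset.inter_subset_left⟩
      obtain ⟨x, hx⟩ := h2
      rw [Finset.mem_sdiff] at hx
      have : x ∈ R := Finset.mem_erase.2 ⟨fun h' => hx.2 (h' ▸ hiA), hx.1⟩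
      rw [← h] at this
      exact hx.2 (Finset.mem_inter.1 (hB this)).2
    -- In the recursion for `S` the blocks leaving `A` drop out by induction. The blocks inside `A`
    -- recombine, by the recursion for `S ∩ A`, to `M (S ∩ A) * M (S \ A) = M S`, which leaves
    -- nothing for the cumulant of `S`.
    have h3 : ∑ B ∈ R.powerset.erase R, setCumulant M (insert i B) * M (R \ B) = M S := by
      rw [← Finset.sum_subset hRA]
      · rw [hfac S, ← e1, hrec2, Finset.sum_mul]
        refine Finset.sum_congr rfl fun B hB => ?_
        rw [Finset.mem_powerset] at hB
        rw [mul_assoc, hfac (R \ B)]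
        congr 2
        · congr 1
          ext x; simp only [Finset.mem_inter, Finset.mem_sdiff]; tauto
        · congr 1
          ext x
          simp only [Finset.mem_sdiff, hR, Finset.mem_erase]
          constructor
          · rintro ⟨⟨⟨_, b⟩, _⟩, d⟩; exact ⟨b, d⟩
          · rintro ⟨b, d⟩
            exact ⟨⟨⟨fun h => d (h ▸ hiA), b⟩, fun h => d (Finset.mem_inter.1 (hB h)).2⟩, d⟩
      · intro B hB hB'
        rw [Finset.mem_erase, Finset.mem_powerset] at hB
        rw [Finset.mem_powerset] at hB'
        have hBT : insert i B ⊂ S := by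
          rw [Finset.ssubset_iff_subset_ne]
          refine ⟨?_, fun h => hB.1 ?_⟩
          · rw [← hSR]; exact Finset.insert_subset_insert _ hB.2
          · rw [hR, ← h, Finset.erase_insert (fun h' => hiR (hB.2 h'))]
        rw [ih _ hBT ⟨i, by simp [hiA]⟩, zero_mul]
        by_contra hcon
        rw [Finset.not_nonempty_iff_eq_empty, Finset.sdiff_eq_empty_iff_subset] at hcon
        exact hB' (Finset.subset_inter hB.2 ((Finset.subset_insert _ _).trans hcon))
    linarith

/-- Subset convolution. -/
def subsetConv (f g : Finset ι → ℝ) (S : Finset ι) : ℝ := ∑ A ∈ S.powerset, f A * g (S \ A)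

theorem subsetConv_assoc (f g h : Finset ι → ℝ) (S : Finset ι) :
    subsetConv (subsetConv f g) h S = subsetConv f (subsetConv g h) S := by
  unfold subsetConv
  simp only [Finset.sum_mul, Finset.mul_sum]
  rw [Finset.sum_sigma', Finset.sum_sigma']
  refine Finset.sum_bij' (fun x _ => ⟨x.2, x.1 \ x.2⟩) (fun x _ => ⟨x.1 ∪ x.2, x.1⟩) ?_ ?_ ?_ ?_ ?_
  · rintro ⟨A, B⟩ hx
    simp only [Finset.mem_sigma, Finset.mem_powerset] at hx ⊢
    exact ⟨hx.2.trans hx.1, Finset.sdiff_subset_sdiff hx.1 le_rfl⟩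
  · rintro ⟨A, B⟩ hx
    simp only [Finset.mem_sigma, Finset.mem_powerset] at hx ⊢
    exact ⟨Finset.union_subset hx.1 (hx.2.trans Finset.sdiff_subset), Finset.subset_union_left⟩
  · rintro ⟨A, B⟩ hx
    simp only [Finset.mem_sigma, Finset.mem_powerset] at hx
    simp [Finset.union_sdiff_of_subset hx.2]
  · rintro ⟨A, B⟩ hx
    simp only [Finset.mem_sigma, Finset.mem_powerset] at hx
    have : (A ∪ B) \ A = B := by
      ext x
      have := @hx.2 x
      simp only [Finset.mem_sdiff, Finset.mem_union] at this ⊢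
      tauto
    simp [this]
  · rintro ⟨A, B⟩ hx
    simp only [Finset.mem_sigma, Finset.mem_powerset] at hx
    simp only
    have : (S \ B) \ (A \ B) = S \ A := by
      ext x
      have := @hx.2 x
      simp only [Finset.mem_sdiff] at this ⊢
      tauto
    rw [this, mul_assoc]

/-- Subset convolution by a function with value one at the empty set is injective. -/
theorem subsetConv_right_cancel {f f' g : Finset ι → ℝ} (hg : g ∅ = 1) {R : Finset ι}
    (h : ∀ S ⊆ R, subsetConv f g S = subsetConv f' g S) : ∀ S ⊆ R, f S = f' S := by
  intro S
  induction S using Finset.strongInduction with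
  | H S ih =>
    intro hS
    have h1 := h S hS
    unfold subsetConv at h1
    rw [← Finset.add_sum_erase _ _ (Finset.mem_powerset_self _),
      ← Finset.add_sum_erase _ _ (Finset.mem_powerset_self _), Finset.sdiff_self, hg] at h1
    have : ∑ A ∈ S.powerset.erase S, f A * g (S \ A) = ∑ A ∈ S.powerset.erase S, f' A * g (S \ A) := by
      refine Finset.sum_congr rfl fun B hB => ?_
      rw [Finset.mem_erase, Finset.mem_powerset] at hB
      rw [ih B (Finset.ssubset_iff_subset_ne.2 ⟨hB.2, hB.1⟩) (hB.2.trans hS)]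
    linarith

/-- The joint cumulant of `i, j, …` in terms of the one with `i` and `j` multiplied together. -/
theorem setCumulant_merge (M : Finset ι → ℝ) (hM : M ∅ = 1) {i j : ι} {R : Finset ι}
    (hij : i ≠ j) (hi : i ∉ R) (hj : j ∉ R) :
    setCumulant M (insert i (insert j R)) =
      setCumulant (fun B => if i ∈ B then M (insert j B) else M B) (insert i R) -
        ∑ A ∈ R.powerset, setCumulant M (insert i A) * setCumulant M (insert j (R \ A)) := by
  set M' : Finset ι → ℝ := fun B => if i ∈ B then M (insert j B) else M B with hM'
  have hM'0 : M' ∅ = 1 := by simp [hM', hM]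
  let k1 : Finset ι → ℝ := fun A => setCumulant M (insert i A)
  let k2 : Finset ι → ℝ := fun A => setCumulant M (insert j A)
  let k12 : Finset ι → ℝ := fun A => setCumulant M (insert i (insert j A))
  let k' : Finset ι → ℝ := fun A => setCumulant M' (insert i A)
  -- Both sides, convolved with `M`, give the moment of `insert i (insert j S)`: the right side by
  -- the recursion for `M'`, the left side by the recursion at `i`, sorted by whether `j` lies in
  -- the block of `i`. Convolution by `M` can be cancelled because `M ∅ = 1`.
  have hmain : ∀ S ⊆ R, (fun A => k12 A + subsetConv k1 k2 A) S = k' S := by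
    refine subsetConv_right_cancel hM fun S hS => ?_
    have hiS : i ∉ S := fun h => hi (hS h)
    have hjS : j ∉ S := fun h => hj (hS h)
    have hijS : i ∉ insert j S := by simp [hij, hiS]
    have e1 := moment_insert_eq M hM hijS
    have e2 := moment_insert_eq M' hM'0 hiS
    have e3 : ∀ A ⊆ S, M (insert j A) = subsetConv k2 M A := fun A hA =>
      moment_insert_eq M hM fun h => hjS (hA h)
    have e4 : M' (insert i S) = M (insert i (insert j S)) := by
      simp [hM', Finset.insert_comm]
    have e5 : subsetConv k' M S = M' (insert i S) := by
      rw [e2]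
      refine Finset.sum_congr rfl fun B hB => ?_
      rw [Finset.mem_powerset] at hB
      congr 1
      have : i ∉ S \ B := fun h => hiS (Finset.mem_sdiff.1 h).1
      simp [hM', this]
    rw [e5, e4, e1, Finset.powerset_insert, Finset.sum_union, add_comm]
    · unfold subsetConv
      simp only [add_mul]
      rw [Finset.sum_add_distrib]
      refine congrArg₂ (· + ·) ?_ ?_
      rotate_left
      · change subsetConv (subsetConv k1 k2) M S = _
        rw [subsetConv_assoc]
        refine Finset.sum_congr rfl fun B hB => ?_
        rw [Finset.mem_powerset] at hB
        rw [← e3 _ Finset.sdiff_subset, Finset.insert_sdiff_of_notMem _ (fun h => hjS (hB h))]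
      · rw [Finset.sum_image]
        · refine Finset.sum_congr rfl fun B hB => ?_
          rw [Finset.mem_powerset] at hB
          have : insert j S \ insert j B = S \ B := by
            ext x
            simp only [Finset.mem_sdiff, Finset.mem_insert]
            constructor
            · rintro ⟨h1 | h1, h2⟩
              · exact absurd (Or.inl h1) h2
              · exact ⟨h1, fun h => h2 (Or.inr h)⟩
            · rintro ⟨h1, h2⟩
              exact ⟨Or.inr h1, fun h => h.elim (fun h => hjS (h ▸ h1)) h2⟩
          rw [this]
        · intro B hB B' hB' h
          simp only [Finset.coe_powerset, Set.mem_preimage, Set.mem_powerset_iff,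
            Finset.coe_subset] at hB hB'
          rw [← Finset.erase_insert (fun h => hjS (hB h)), h,
            Finset.erase_insert (fun h => hjS (hB' h))]
    · rw [Finset.disjoint_left]
      intro B hB hB'
      rw [Finset.mem_powerset] at hB
      obtain ⟨B', _, rfl⟩ := Finset.mem_image.1 hB'
      exact hjS (hB (Finset.mem_insert_self _ _))
  have := hmain R le_rfl
  simp only [k12, k', subsetConv] at this
  simp only [k1, k2] at this
  linarith

/-- Both sides satisfy the recursion that determines cumulants, so partitions need not be
transported. -/
theorem setCumulant_map {κ : Type*} [DecidableEq κ] (f : ι ↪ κ) (M : Finset κ → ℝ) (hM : M ∅ = 1)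
    (S : Finset ι) : setCumulant M (S.map f) = setCumulant (fun B => M (B.map f)) S := by
  rcases S.eq_empty_or_nonempty with rfl | hS
  · simp [setCumulant_empty]
  refine eq_setCumulant_of_recursion (fun B => M (B.map f)) (fun T => setCumulant M (T.map f))
    (by simpa using hM) S (fun i A hi _ => ?_) S le_rfl hS
  simp only [Finset.map_insert]
  have hi' : f i ∉ A.map f := by simpa using hi
  rw [moment_insert_eq M hM hi']
  symm
  refine Finset.sum_bij (fun B _ => B.map f) ?_ ?_ ?_ ?_
  · intro B hB
    rw [Finset.mem_powerset] at hB ⊢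
    exact Finset.map_subset_map.2 hB
  · intro B _ B' _ h
    exact Finset.map_injective f h
  · intro B hB
    rw [Finset.mem_powerset, Finset.subset_map_iff] at hB
    obtain ⟨u, hu, rfl⟩ := hB
    exact ⟨u, Finset.mem_powerset.2 hu, rfl⟩
  · intro B hB
    rw [Finset.map_sdiff]

/-- Cumulants depend on the moments in a locally Lipschitz way. -/
theorem abs_setCumulant_sub_le (S : Finset ι) (K : ℝ) (hK : 1 ≤ K) :
    ∃ C : ℝ, 0 ≤ C ∧ ∀ (M M' : Finset ι → ℝ) (ε : ℝ), 0 ≤ ε →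
      (∀ B ⊆ S, B.Nonempty → |M B| ≤ K ∧ |M' B| ≤ K ∧ |M B - M' B| ≤ ε) →
      |setCumulant M S - setCumulant M' S| ≤ C * ε := by
  have hprod : ∀ (T : Finset (Finset ι)) (M M' : Finset ι → ℝ) (ε : ℝ), 0 ≤ ε →
      (∀ B ∈ T, |M B| ≤ K ∧ |M' B| ≤ K ∧ |M B - M' B| ≤ ε) →
      |∏ B ∈ T, M B - ∏ B ∈ T, M' B| ≤ (T.card * K ^ T.card) * ε ∧ |∏ B ∈ T, M B| ≤ K ^ T.card := by
    intro T M M' ε hε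
    induction T using Finset.induction_on with
    | empty => intro _; simp
    | insert B T hB ih =>
      intro h
      obtain ⟨h1, h2⟩ := ih fun B' hB' => h B' (Finset.mem_insert_of_mem hB')
      obtain ⟨a, b, c⟩ := h B (Finset.mem_insert_self _ _)
      rw [Finset.prod_insert hB, Finset.prod_insert hB, Finset.card_insert_of_notMem hB]
      have hKp : (1 : ℝ) ≤ K ^ T.card := one_le_pow₀ hK
      constructor
      · have e : M B * ∏ B ∈ T, M B - M' B * ∏ B ∈ T, M' B =
            (M B - M' B) * ∏ B ∈ T, M B + M' B * (∏ B ∈ T, M B - ∏ B ∈ T, M' B) := by ring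
        rw [e]
        refine (abs_add_le _ _).trans ?_
        rw [abs_mul, abs_mul]
        have e1 : |M B - M' B| * |∏ B ∈ T, M B| ≤ ε * K ^ T.card :=
          mul_le_mul c h2 (abs_nonneg _) hε
        have e2 : |M' B| * |∏ B ∈ T, M B - ∏ B ∈ T, M' B| ≤ K * ((T.card * K ^ T.card) * ε) :=
          mul_le_mul b h1 (abs_nonneg _) (by linarith)
        have e3 : ε * K ^ T.card ≤ ε * K ^ (T.card + 1) :=
          mul_le_mul_of_nonneg_left (pow_le_pow_right₀ hK (Nat.le_succ _)) hε
        push_cast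
        have : K * ((T.card * K ^ T.card) * ε) = T.card * K ^ (T.card + 1) * ε := by ring
        nlinarith
      · rw [abs_mul, pow_succ, mul_comm]
        exact mul_le_mul h2 a (abs_nonneg _) (by positivity)
  refine ⟨∑ π : Finpartition S, (((π.parts.card - 1)! : ℝ) * (π.parts.card * K ^ π.parts.card)),
    Finset.sum_nonneg fun π _ => by positivity, ?_⟩
  intro M M' ε hε h
  unfold setCumulant
  rw [← Finset.sum_sub_distrib, Finset.sum_mul]
  refine (Finset.abs_sum_le_sum_abs _ _).trans (Finset.sum_le_sum fun π _ => ?_)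
  rw [← mul_sub, abs_mul, abs_mul, abs_pow, abs_neg, abs_one, one_pow, one_mul, Nat.abs_cast,
    mul_assoc]
  refine mul_le_mul_of_nonneg_left ?_ (by positivity)
  exact (hprod π.parts M M' ε hε fun B hB =>
    h B (π.le hB) (π.nonempty_of_mem_parts hB)).1

/-- If in every partition some block has moment zero, the cumulant vanishes. -/
theorem setCumulant_eq_zero_of_mem (M : Finset ι → ℝ) (S : Finset ι) {i : ι} (hi : i ∈ S)
    (h : ∀ B ⊆ S, i ∈ B → M B = 0) : setCumulant M S = 0 := by
  refine Finset.sum_eq_zero fun π _ => ?_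
  obtain ⟨B, hB, hiB⟩ := π.exists_mem hi
  rw [Finset.prod_eq_zero hB (h B (π.le hB) hiB), mul_zero]

/-- If all moments of proper nonempty subsets vanish, the cumulant is the moment. -/
theorem setCumulant_eq_moment (M : Finset ι → ℝ) (hM : M ∅ = 1) (S : Finset ι) (hS : S.Nonempty)
    (h : ∀ B ⊆ S, B.Nonempty → B ≠ S → M B = 0) : setCumulant M S = M S := by
  obtain ⟨i, hi⟩ := hS
  have hiR : i ∉ S.erase i := Finset.notMem_erase i S
  have h1 := moment_insert_eq M hM hiR
  rw [Finset.sum_eq_single_of_mem _ (Finset.mem_powerset_self _), Finset.sdiff_self, hM, mul_one,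
    Finset.insert_erase hi] at h1
  · exact h1.symm
  · intro B hB hne
    rw [Finset.mem_powerset] at hB
    rw [h (S.erase i \ B) (Finset.sdiff_subset.trans (Finset.erase_subset _ _)) ?_ ?_, mul_zero]
    · rw [Finset.sdiff_nonempty]
      exact fun h' => hne (Finset.Subset.antisymm hB h')
    · intro h'
      rw [← h'] at hi
      exact hiR (Finset.mem_sdiff.1 hi).1

theorem abs_setCumulant_le (S : Finset ι) (K : ℝ) (hK : 1 ≤ K) :
    ∃ C : ℝ, 0 ≤ C ∧ ∀ M : Finset ι → ℝ, (∀ B ⊆ S, B.Nonempty → |M B| ≤ K) →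
      |setCumulant M S| ≤ C := by
  refine ⟨∑ π : Finpartition S, ((π.parts.card - 1)! : ℝ) * K ^ π.parts.card,
    Finset.sum_nonneg fun π _ => by positivity, fun M h => ?_⟩
  refine (Finset.abs_sum_le_sum_abs _ _).trans (Finset.sum_le_sum fun π _ => ?_)
  rw [abs_mul, abs_mul, abs_pow, abs_neg, abs_one, one_pow, one_mul, Nat.abs_cast, Finset.abs_prod]
  refine mul_le_mul_of_nonneg_left ?_ (by positivity)
  refine (Finset.prod_le_prod (fun _ _ => abs_nonneg _) fun B hB =>
    h B (π.le hB) (π.nonempty_of_mem_parts hB)).trans ?_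
  simp

end SetCumulant

end CycleCorrelations

end

noncomputable section

namespace CycleCorrelations

/-! ### The weight: submultiplicativity, logarithmic derivatives, comparison with exponentials. -/

section Weight

/-- The normalisation `1 / √n`. -/
def eps (n : ℕ) : ℝ := (Real.sqrt n)⁻¹

theorem eps_nonneg (n : ℕ) : 0 ≤ eps n := inv_nonneg.2 (Real.sqrt_nonneg _)

theorem eps_le_one {n : ℕ} (hn : 3 ≤ n) : eps n ≤ 1 := by
  apply inv_le_one_of_one_le₀
  rw [Real.one_le_sqrt]
  exact_mod_cast (by omega : 1 ≤ n)

theorem eps_sq (n : ℕ) : eps n ^ 2 = (n : ℝ)⁻¹ := by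
  rw [eps, inv_pow, Real.sq_sqrt (Nat.cast_nonneg n)]

theorem mul_eps_sq {n : ℕ} (hn : 3 ≤ n) : (n : ℝ) * eps n ^ 2 = 1 := by
  rw [eps_sq, mul_inv_cancel₀]
  exact_mod_cast (by omega : n ≠ 0)

/-- A weight comparable with `(1 + x²) min (exp |x|) n`. -/
def wt (n : ℕ) (x : ℝ) : ℝ := (1 + x ^ 2) * (2 * n * Real.cosh x / (n + Real.cosh x))

theorem one_le_cosh (x : ℝ) : 1 ≤ Real.cosh x := Real.one_le_cosh x

theorem one_le_natCast {n : ℕ} (hn : 3 ≤ n) : (1 : ℝ) ≤ n := by exact_mod_cast (by omega : 1 ≤ n)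

theorem one_le_wt_factor {n : ℕ} (hn : 3 ≤ n) (x : ℝ) :
    1 ≤ 2 * n * Real.cosh x / (n + Real.cosh x) := by
  have h1 := one_le_cosh x
  have h2 := one_le_natCast hn
  rw [le_div_iff₀ (by linarith)]
  nlinarith

theorem one_le_wt {n : ℕ} (hn : 3 ≤ n) (x : ℝ) : 1 ≤ wt n x := by
  unfold wt
  nlinarith [one_le_wt_factor hn x, sq_nonneg x]

theorem wt_pos {n : ℕ} (hn : 3 ≤ n) (x : ℝ) : 0 < wt n x := by linarith [one_le_wt hn x]

theorem one_add_sq_le_wt {n : ℕ} (hn : 3 ≤ n) (x : ℝ) : 1 + x ^ 2 ≤ wt n x := by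
  unfold wt
  nlinarith [one_le_wt_factor hn x, sq_nonneg x]

theorem abs_le_wt {n : ℕ} (hn : 3 ≤ n) (x : ℝ) : |x| ≤ wt n x := by
  have := one_add_sq_le_wt hn x
  rw [← sq_abs] at this
  nlinarith [sq_nonneg (|x| - 1), abs_nonneg x]

theorem wt_factor_mono {n : ℕ} (hn : 3 ≤ n) {s t : ℝ} (hs : 0 ≤ s) (h : s ≤ t) :
    2 * n * s / (n + s) ≤ 2 * n * t / (n + t) := by
  have h2 := one_le_natCast hn
  rw [div_le_div_iff₀ (by linarith) (by linarith)]
  nlinarith [mul_nonneg (by linarith : (0 : ℝ) ≤ n) (sub_nonneg.2 h),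
    mul_nonneg (by positivity : (0 : ℝ) ≤ (n : ℝ) * n) (sub_nonneg.2 h)]

theorem wt_mono {n : ℕ} (hn : 3 ≤ n) {x y : ℝ} (h : |x| ≤ |y|) : wt n x ≤ wt n y := by
  unfold wt
  refine mul_le_mul (by nlinarith [sq_le_sq.2 h]) ?_ (by linarith [one_le_wt_factor hn x])
    (by positivity)
  exact wt_factor_mono hn (by linarith [one_le_cosh x]) (Real.cosh_le_cosh.2 h)

/-- Submultiplicativity allows a bound at an intermediate point `x + θ y` to be split into a factor
in the partial sum and a factor in the new summand, which are independent. -/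
theorem wt_add_le {n : ℕ} (hn : 3 ≤ n) (x y : ℝ) : wt n (x + y) ≤ 4 * wt n x * wt n y := by
  have h1 := one_le_cosh x
  have h2 := one_le_cosh y
  have h3 := one_le_natCast hn
  have hc : Real.cosh (x + y) ≤ 2 * Real.cosh x * Real.cosh y := by
    rw [Real.cosh_add]
    have : Real.sinh x * Real.sinh y ≤ Real.cosh x * Real.cosh y := by
      have := Real.cosh_pos (x - y)
      rw [Real.cosh_sub] at this
      linarith
    linarith
  set s := Real.cosh x
  set t := Real.cosh y
  have hst : s + t ≤ 2 * s * t := by nlinarith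
  have hf : 2 * n * Real.cosh (x + y) / (n + Real.cosh (x + y)) ≤
      2 * ((2 * n * s / (n + s)) * (2 * n * t / (n + t))) := by
    refine (wt_factor_mono hn (by linarith [one_le_cosh (x + y)]) hc).trans ?_
    rw [div_mul_div_comm, ← mul_div_assoc, div_le_div_iff₀ (by positivity) (by positivity)]
    have key : (n + s) * (n + t) ≤ 2 * n * (n + 2 * s * t) := by
      have e1 : (n : ℝ) * (s + t) ≤ n * (2 * s * t) := mul_le_mul_of_nonneg_left hst (by linarith)
      have e2 : s * t ≤ n * (s * t) := le_mul_of_one_le_left (by positivity) h3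
      have e3 : (0 : ℝ) ≤ n * (s * t) := by positivity
      nlinarith [sq_nonneg (n : ℝ)]
    have := mul_le_mul_of_nonneg_left key (by positivity : (0 : ℝ) ≤ 4 * n * s * t)
    nlinarith
  have hq : 1 + (x + y) ^ 2 ≤ 2 * ((1 + x ^ 2) * (1 + y ^ 2)) := by
    nlinarith [sq_nonneg (x - y), mul_nonneg (sq_nonneg x) (sq_nonneg y)]
  unfold wt
  calc _ ≤ (2 * ((1 + x ^ 2) * (1 + y ^ 2))) *
        (2 * ((2 * n * s / (n + s)) * (2 * n * t / (n + t)))) :=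
        mul_le_mul hq hf (by linarith [one_le_wt_factor hn (x + y)]) (by positivity)
    _ = _ := by ring

theorem wt_le_cosh {n : ℕ} (hn : 3 ≤ n) (x : ℝ) : wt n x ≤ 2 * (1 + x ^ 2) * Real.cosh x := by
  have h1 := one_le_cosh x
  have h3 := one_le_natCast hn
  unfold wt
  have : 2 * n * Real.cosh x / (n + Real.cosh x) ≤ 2 * Real.cosh x := by
    rw [div_le_iff₀ (by linarith)]
    nlinarith
  nlinarith [sq_nonneg x]

theorem wt_le_sq {n : ℕ} (hn : 3 ≤ n) (x : ℝ) : wt n x ≤ 2 * n * (1 + x ^ 2) := by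
  have h1 := one_le_cosh x
  have h3 := one_le_natCast hn
  unfold wt
  have : 2 * n * Real.cosh x / (n + Real.cosh x) ≤ 2 * n := by
    rw [div_le_iff₀ (by linarith)]
    nlinarith
  nlinarith [sq_nonneg x]

/-- This is what the cap at `n` achieves: for `y² ≤ n` the argument is at most one in absolute
value, and for `y² ≥ n` the cap itself is at most `y²`. One summand therefore enters only through
polynomial moments. -/
theorem wt_eps_mul_le {n : ℕ} (hn : 3 ≤ n) (y : ℝ) : wt n (eps n * y) ≤ 8 * (1 + y ^ 2) ^ 2 := by
  have he := eps_sq n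
  have h3 := one_le_natCast hn
  have hle := eps_le_one hn
  have h0 := eps_nonneg n
  have hsq : (eps n * y) ^ 2 ≤ y ^ 2 := by
    rw [mul_pow]
    nlinarith [sq_nonneg y, pow_le_one₀ h0 hle (n := 2)]
  rcases le_total (y ^ 2) n with h | h
  · have hy : |eps n * y| ≤ |(1 : ℝ)| := by
      rw [← sq_le_sq, mul_pow, he, inv_mul_le_iff₀ (by linarith)]
      linarith
    have hc : Real.cosh (eps n * y) ≤ 2 := by
      refine (Real.cosh_le_cosh.2 hy).trans ?_
      rw [Real.cosh_eq]
      have := Real.exp_one_lt_d9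
      have h4 : Real.exp (-1) ≤ 1 := Real.exp_le_one_iff.2 (by norm_num)
      linarith
    refine (wt_le_cosh hn _).trans ?_
    nlinarith [sq_nonneg y, one_le_cosh (eps n * y), sq_nonneg (eps n * y)]
  · refine (wt_le_sq hn _).trans ?_
    nlinarith [sq_nonneg y, sq_nonneg (eps n * y)]

/-- The weight grows exponentially until `cosh x` reaches `n`; beyond that point, on the range `|x|
≤ L log n`, the exponential is at most `n ^ L`, which the capped weight still controls. -/
theorem exp_abs_le_wt {n : ℕ} (hn : 3 ≤ n) {L : ℕ} (hL : 1 ≤ L) {x : ℝ}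
    (hx : |x| ≤ L * Real.log n) : Real.exp |x| ≤ (2 * wt n x) ^ L := by
  have h1 := one_le_cosh x
  have h3 := one_le_natCast hn
  have hcx : Real.exp |x| ≤ 2 * Real.cosh x := by
    rw [← Real.cosh_abs, Real.cosh_eq]
    linarith [Real.exp_pos (-|x|)]
  have hw : 2 * n * Real.cosh x / (n + Real.cosh x) ≤ wt n x := by
    unfold wt
    nlinarith [one_le_wt_factor hn x, sq_nonneg x]
  rcases le_total (Real.cosh x) n with h | h
  · have : Real.cosh x ≤ 2 * n * Real.cosh x / (n + Real.cosh x) := by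
      rw [le_div_iff₀ (by linarith)]
      nlinarith
    calc Real.exp |x| ≤ 2 * wt n x := by linarith
      _ = (2 * wt n x) ^ 1 := (pow_one _).symm
      _ ≤ _ := pow_le_pow_right₀ (by linarith [one_le_wt hn x]) hL
  · have : (n : ℝ) ≤ 2 * n * Real.cosh x / (n + Real.cosh x) := by
      rw [le_div_iff₀ (by linarith)]
      nlinarith
    calc Real.exp |x| ≤ Real.exp (L * Real.log n) := Real.exp_le_exp.2 hx
      _ = (n : ℝ) ^ L := by
        rw [mul_comm, ← Real.rpow_def_of_pos (by linarith), Real.rpow_natCast]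
      _ ≤ _ := pow_le_pow_left₀ (by linarith) (by linarith [one_le_wt hn x]) _

/-- `ψ` is twice differentiable, and both derivatives are bounded by a multiple of `ψ`. -/
def LogDerivBdd (C : ℝ) (ψ : ℝ → ℝ) : Prop :=
  ∃ ψ₁ ψ₂ : ℝ → ℝ, (∀ x, HasDerivAt ψ (ψ₁ x) x) ∧ (∀ x, HasDerivAt ψ₁ (ψ₂ x) x) ∧
    (∀ x, 0 ≤ ψ x) ∧ (∀ x, |ψ₁ x| ≤ C * ψ x) ∧ ∀ x, |ψ₂ x| ≤ C * ψ x

theorem LogDerivBdd.mul {C D : ℝ} {ψ ξ : ℝ → ℝ} (hC : 0 ≤ C) (hD : 0 ≤ D)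
    (hψ : LogDerivBdd C ψ) (hξ : LogDerivBdd D ξ) :
    LogDerivBdd (C + D + 2 * C * D) (fun x => ψ x * ξ x) := by
  obtain ⟨ψ₁, ψ₂, a1, a2, a0, a3, a4⟩ := hψ
  obtain ⟨ξ₁, ξ₂, b1, b2, b0, b3, b4⟩ := hξ
  refine ⟨fun x => ψ₁ x * ξ x + ψ x * ξ₁ x,
    fun x => (ψ₂ x * ξ x + ψ₁ x * ξ₁ x) + (ψ₁ x * ξ₁ x + ψ x * ξ₂ x),
    fun x => (a1 x).mul (b1 x), fun x => ((a2 x).mul (b1 x)).add ((a1 x).mul (b2 x)),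
    fun x => mul_nonneg (a0 x) (b0 x), fun x => ?_, fun x => ?_⟩
  · have e1 : |ψ₁ x * ξ x| ≤ C * ψ x * ξ x := by
      rw [abs_mul, abs_of_nonneg (b0 x)]
      exact mul_le_mul_of_nonneg_right (a3 x) (b0 x)
    have e2 : |ψ x * ξ₁ x| ≤ ψ x * (D * ξ x) := by
      rw [abs_mul, abs_of_nonneg (a0 x)]
      exact mul_le_mul_of_nonneg_left (b3 x) (a0 x)
    refine (abs_add_le _ _).trans ?_
    have : 0 ≤ C * D * (ψ x * ξ x) := by have := a0 x; have := b0 x; positivity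
    nlinarith
  · have e1 : |ψ₂ x * ξ x| ≤ C * ψ x * ξ x := by
      rw [abs_mul, abs_of_nonneg (b0 x)]
      exact mul_le_mul_of_nonneg_right (a4 x) (b0 x)
    have e2 : |ψ x * ξ₂ x| ≤ ψ x * (D * ξ x) := by
      rw [abs_mul, abs_of_nonneg (a0 x)]
      exact mul_le_mul_of_nonneg_left (b4 x) (a0 x)
    have e3 : |ψ₁ x * ξ₁ x| ≤ (C * ψ x) * (D * ξ x) := by
      rw [abs_mul]
      exact mul_le_mul (a3 x) (b3 x) (abs_nonneg _) (mul_nonneg hC (a0 x))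
    refine (abs_add_le _ _).trans ?_
    have f1 := abs_add_le (ψ₂ x * ξ x) (ψ₁ x * ξ₁ x)
    have f2 := abs_add_le (ψ₁ x * ξ₁ x) (ψ x * ξ₂ x)
    nlinarith

theorem abs_sinh_le_cosh (x : ℝ) : |Real.sinh x| ≤ Real.cosh x := by
  have := Real.cosh_sq x
  have h := Real.cosh_pos x
  rw [← abs_of_pos h, ← sq_le_sq]
  linarith

theorem logDerivBdd_wt {n : ℕ} (hn : 3 ≤ n) : LogDerivBdd 17 (wt n) := by
  have h3 := one_le_natCast hn
  have hq : LogDerivBdd 2 (fun x : ℝ => 1 + x ^ 2) := by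
    refine ⟨fun x => 2 * x, fun _ => 2, fun x => ?_, fun x => ?_, fun x => by positivity,
      fun x => ?_, fun x => ?_⟩
    · simpa using (hasDerivAt_pow 2 x).const_add 1
    · simpa using (hasDerivAt_id x).const_mul 2
    · change |2 * x| ≤ 2 * (1 + x ^ 2)
      rw [abs_mul, abs_two, ← sq_abs x]
      nlinarith [sq_nonneg (|x| - 1)]
    · change |(2 : ℝ)| ≤ 2 * (1 + x ^ 2)
      rw [abs_two]; nlinarith [sq_nonneg x]
  have hf : LogDerivBdd 3 (fun x : ℝ => 2 * n * Real.cosh x / (n + Real.cosh x)) := by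
    have hp : ∀ x, 0 < n + Real.cosh x := fun x => by linarith [one_le_cosh x]
    refine ⟨fun x => 2 * n ^ 2 * Real.sinh x / (n + Real.cosh x) ^ 2,
      fun x => 2 * n ^ 2 * Real.cosh x / (n + Real.cosh x) ^ 2 -
        4 * n ^ 2 * Real.sinh x ^ 2 / (n + Real.cosh x) ^ 3,
      fun x => ?_, fun x => ?_, fun x => ?_, fun x => ?_, fun x => ?_⟩
    · have := ((Real.hasDerivAt_cosh x).const_mul (2 * (n : ℝ))).div
        ((Real.hasDerivAt_cosh x).const_add (n : ℝ)) (hp x).ne'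
      refine this.congr_deriv ?_
      have := (hp x).ne'
      field_simp
      ring
    · have := ((Real.hasDerivAt_sinh x).const_mul (2 * (n : ℝ) ^ 2)).div
        (((Real.hasDerivAt_cosh x).const_add (n : ℝ)).fun_pow 2) (pow_ne_zero 2 (hp x).ne')
      refine this.congr_deriv ?_
      have := (hp x).ne'
      simp only [Nat.add_one_sub_one, pow_one]
      field_simp
      ring
    · have := hp x; have := one_le_cosh x; positivity
    · have hc := one_le_cosh x
      have hs := abs_sinh_le_cosh x
      have hpx := hp x
      rw [abs_div, abs_mul, abs_of_pos (pow_pos hpx 2), abs_of_nonneg (by positivity),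
        ← mul_div_assoc, div_le_div_iff₀ (by positivity) hpx]
      have e : 2 * (n : ℝ) ^ 2 * |Real.sinh x| * (n + Real.cosh x) ≤
          2 * (n : ℝ) ^ 2 * Real.cosh x * (n + Real.cosh x) := by gcongr
      have e2 : 2 * (n : ℝ) ^ 2 * Real.cosh x * (n + Real.cosh x) ≤
          2 * n * Real.cosh x * (n + Real.cosh x) * (n + Real.cosh x) := by
        have : 0 ≤ 2 * n * Real.cosh x * (n + Real.cosh x) * Real.cosh x := by positivity
        nlinarith
      have : 0 ≤ 2 * n * Real.cosh x * (n + Real.cosh x) ^ 2 := by positivity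
      nlinarith
    · have hc := one_le_cosh x
      have hs := abs_sinh_le_cosh x
      have hpx := hp x
      have hs2 : Real.sinh x ^ 2 ≤ Real.cosh x ^ 2 := by
        have := Real.cosh_sq x; linarith
      have e1 : 2 * n ^ 2 * Real.cosh x / (n + Real.cosh x) ^ 2 ≤
          2 * n * Real.cosh x / (n + Real.cosh x) := by
        rw [div_le_div_iff₀ (by positivity) hpx]
        have : 0 ≤ 2 * n * Real.cosh x * (n + Real.cosh x) * Real.cosh x := by positivity
        nlinarith
      have e2 : 4 * n ^ 2 * Real.sinh x ^ 2 / (n + Real.cosh x) ^ 3 ≤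
          2 * (2 * n * Real.cosh x / (n + Real.cosh x)) := by
        rw [← mul_div_assoc, div_le_div_iff₀ (by positivity) hpx]
        have h1 : 4 * (n : ℝ) ^ 2 * Real.sinh x ^ 2 * (n + Real.cosh x) ≤
            4 * (n : ℝ) ^ 2 * Real.cosh x ^ 2 * (n + Real.cosh x) := by gcongr
        have h2 : (n : ℝ) * Real.cosh x ≤ (n + Real.cosh x) ^ 2 := by nlinarith
        have h3 := mul_le_mul_of_nonneg_left h2
          (by positivity : 0 ≤ 4 * n * Real.cosh x * (n + Real.cosh x))
        nlinarith
      have e3 : 0 ≤ 2 * n ^ 2 * Real.cosh x / (n + Real.cosh x) ^ 2 := by positivity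
      have e4 : 0 ≤ 4 * n ^ 2 * Real.sinh x ^ 2 / (n + Real.cosh x) ^ 3 := by positivity
      rw [abs_le]
      constructor <;> linarith
  -- The product rule gives `2 + 3 + 2 * 2 * 3 = 17`, independently of `n`.
  have := hq.mul (by norm_num) (by norm_num) hf
  norm_num at this
  exact this

theorem logDerivBdd_wt_pow (k : ℕ) :
    ∃ C : ℝ, 0 ≤ C ∧ ∀ n : ℕ, 3 ≤ n → LogDerivBdd C (fun x => wt n x ^ k) := by
  induction k with
  | zero =>
    refine ⟨0, le_rfl, fun n hn => ⟨fun _ => 0, fun _ => 0, fun x => ?_, fun x => ?_,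
      fun x => ?_, fun x => ?_, fun x => ?_⟩⟩
    · simpa using hasDerivAt_const x (1 : ℝ)
    · exact hasDerivAt_const x (0 : ℝ)
    all_goals simp
  | succ k ih =>
    obtain ⟨C, hC, h⟩ := ih
    refine ⟨C + 17 + 2 * C * 17, by positivity, fun n hn => ?_⟩
    simpa only [pow_succ] using (h n hn).mul hC (by norm_num) (logDerivBdd_wt hn)

theorem contDiff_wt {n : ℕ} (hn : 3 ≤ n) : Continuous (wt n) := by
  unfold wt
  have h3 := one_le_natCast hn
  refine Continuous.mul (by fun_prop) (Continuous.div (by fun_prop) (by fun_prop) fun x => ?_)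
  linarith [one_le_cosh x]

end Weight

/-! ### Taylor expansions with remainder bounds. -/

section Taylor

/-- Taylor's formula with a bound on the remainder. -/
theorem abs_sub_taylor_le (p : ℕ) : ∀ (g : ℝ → ℝ), ContDiff ℝ (⊤ : ℕ∞) g → ∀ x y B : ℝ,
    (∀ θ ∈ Set.Icc (0 : ℝ) 1, |iteratedDeriv p g (x + θ * y)| ≤ B) →
    |g (x + y) - ∑ j ∈ Finset.range p, iteratedDeriv j g x * y ^ j / j !| ≤ B * |y| ^ p := by
  induction p with
  | zero =>
    intro g _ x y B h
    simpa using h 1 (by simp)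
  | succ p ih =>
    intro g hg x y B h
    have hB : 0 ≤ B := (abs_nonneg _).trans (h 0 (by simp))
    have hg' : ContDiff ℝ (⊤ : ℕ∞) (deriv g) := (contDiff_infty_iff_deriv.1 hg).2
    -- This is the remainder along the segment from `x` to `x + y`. Its derivative is `y` times the
    -- remainder of one order less for `g'`, so the induction hypothesis and the mean value
    -- inequality suffice.
    set r : ℝ → ℝ := fun t =>
      g (x + t * y) - ∑ j ∈ Finset.range (p + 1), iteratedDeriv j g x * (t * y) ^ j / j ! with hr
    set r' : ℝ → ℝ := fun t => (deriv g (x + t * y) -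
      ∑ j ∈ Finset.range p, iteratedDeriv j (deriv g) x * (t * y) ^ j / j !) * y with hr'
    have hd : ∀ t, HasDerivAt r (r' t) t := by
      intro t
      have hin : HasDerivAt (fun t : ℝ => x + t * y) y t := by
        simpa using ((hasDerivAt_id t).mul_const y).const_add x
      have h1 : HasDerivAt (fun t => g (x + t * y)) (deriv g (x + t * y) * y) t :=
        HasDerivAt.comp t ((hg.differentiable (by simp)) _).hasDerivAt hin
      have h2 : HasDerivAt (fun t => ∑ j ∈ Finset.range (p + 1),
          iteratedDeriv j g x * (t * y) ^ j / j !)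
          (∑ j ∈ Finset.range (p + 1), iteratedDeriv j g x * (j * (t * y) ^ (j - 1) * y) / j !) t := by
        refine HasDerivAt.fun_sum fun j _ => ?_
        have hin2 : HasDerivAt (fun t : ℝ => t * y) y t := by
          simpa using (hasDerivAt_id t).mul_const y
        exact ((hin2.pow j).const_mul _).div_const _
      refine (h1.fun_sub h2).congr_deriv ?_
      simp only [hr']
      rw [Finset.sum_range_succ']
      simp only [sub_mul, Finset.sum_mul]
      congr 1
      simp only [Nat.cast_zero, zero_mul, mul_zero, zero_div, add_zero, Nat.add_sub_cancel]
      refine Finset.sum_congr rfl fun j _ => ?_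
      rw [iteratedDeriv_succ', Nat.factorial_succ]
      have : ((j : ℝ) + 1) ≠ 0 := by positivity
      have h4 : ((j ! : ℕ) : ℝ) ≠ 0 := by positivity
      push_cast
      field_simp
    have hbound : ∀ t ∈ Set.Ico (0 : ℝ) 1, ‖r' t‖ ≤ B * |y| ^ (p + 1) := by
      intro t ht
      have := ih (deriv g) hg' x (t * y) B (fun θ hθ => by
        have := h (θ * t) ⟨mul_nonneg hθ.1 ht.1, mul_le_one₀ hθ.2 ht.1 ht.2.le⟩
        rwa [iteratedDeriv_succ', mul_assoc] at this)
      rw [Real.norm_eq_abs, hr']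
      simp only
      rw [abs_mul, pow_succ, ← mul_assoc]
      refine mul_le_mul_of_nonneg_right (this.trans ?_) (abs_nonneg _)
      refine mul_le_mul_of_nonneg_left (pow_le_pow_left₀ (abs_nonneg _) ?_ _) hB
      rw [abs_mul, abs_of_nonneg ht.1]
      exact mul_le_of_le_one_left (abs_nonneg _) ht.2.le
    have := norm_image_sub_le_of_norm_deriv_le_segment_01'
      (fun t _ => (hd t).hasDerivWithinAt) hbound
    rw [Real.norm_eq_abs] at this
    have h0 : r 0 = 0 := by
      simp only [hr]
      rw [Finset.sum_range_succ']
      simp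
    rw [h0, sub_zero] at this
    simpa [hr] using this

/-- A function with logarithmically bounded derivatives expands to second order. -/
theorem LogDerivBdd.abs_sub_le {C : ℝ} {ψ : ℝ → ℝ} (hψ : LogDerivBdd C ψ) :
    ∃ ψ₁ : ℝ → ℝ, Continuous ψ₁ ∧ (∀ x, |ψ₁ x| ≤ C * ψ x) ∧
      ∀ x y B, (∀ θ ∈ Set.Icc (0 : ℝ) 1, ψ (x + θ * y) ≤ B) →
        |ψ (x + y) - (ψ x + ψ₁ x * y)| ≤ |C| * B * y ^ 2 := by
  obtain ⟨ψ₁, ψ₂, a1, a2, a0, a3, a4⟩ := hψ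
  refine ⟨ψ₁, continuous_iff_continuousAt.2 fun x => (a2 x).continuousAt, a3, fun x y B h => ?_⟩
  have hB : 0 ≤ B := (a0 _).trans (h 0 (by simp))
  have hin : ∀ (t y : ℝ), HasDerivAt (fun t : ℝ => x + t * y) y t := fun t y => by
    simpa using ((hasDerivAt_id t).mul_const y).const_add x
  have hψ₁ : ∀ t ∈ Set.Icc (0 : ℝ) 1, |ψ₁ (x + t * y) - ψ₁ x| ≤ |C| * B * |y| := by
    intro t ht
    have := norm_image_sub_le_of_norm_deriv_le_segment_01' (f := fun s => ψ₁ (x + s * (t * y)))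
      (f' := fun s => ψ₂ (x + s * (t * y)) * (t * y)) (C := |C| * B * |y|)
      (fun s _ => (HasDerivAt.comp s (a2 _) (hin s (t * y))).hasDerivWithinAt) (fun s hs => by
        rw [Real.norm_eq_abs, abs_mul]
        have h1 := h (s * t) ⟨mul_nonneg hs.1 ht.1, mul_le_one₀ hs.2.le ht.1 ht.2⟩
        rw [mul_assoc] at h1
        refine mul_le_mul ((a4 _).trans ?_) ?_ (abs_nonneg _) (by positivity)
        · exact mul_le_mul (le_abs_self _) h1 (a0 _) (abs_nonneg _)
        · rw [abs_mul, abs_of_nonneg ht.1]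
          exact mul_le_of_le_one_left (abs_nonneg _) ht.2)
    simpa using this
  have := norm_image_sub_le_of_norm_deriv_le_segment_01'
    (f := fun s => ψ (x + s * y) - (ψ x + s * (ψ₁ x * y)))
    (f' := fun s => ψ₁ (x + s * y) * y - ψ₁ x * y) (C := |C| * B * y ^ 2)
    (fun s _ => by
      refine HasDerivAt.hasDerivWithinAt ?_
      refine (HasDerivAt.comp s (a1 _) (hin s y)).sub ?_
      simpa using ((hasDerivAt_id s).mul_const (ψ₁ x * y)).const_add (ψ x)) (fun s hs => by
      rw [Real.norm_eq_abs, ← sub_mul, abs_mul, ← sq_abs y, sq, ← mul_assoc]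
      exact mul_le_mul_of_nonneg_right (hψ₁ s ⟨hs.1, hs.2.le⟩) (abs_nonneg _))
  simpa using this

end Taylor

end CycleCorrelations

end

noncomputable section

namespace CycleCorrelations

/-! ### Admissible families of functions and their closure properties. -/

section Admissible

/-- A family of functions bounded by a power of the weight, uniformly in `n`. -/
def Dom (g : ℕ → ℝ → ℝ) : Prop := ∃ C : ℕ, ∀ n, 3 ≤ n → ∀ x, |g n x| ≤ C * wt n x ^ C

/-- A single natural number serves as factor and exponent in `Dom`; separate constants are merged by
taking the maximum, as the weight is at least one. -/
theorem dom_of_le {g : ℕ → ℝ → ℝ} (A : ℝ) (k : ℕ)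
    (h : ∀ n, 3 ≤ n → ∀ x, |g n x| ≤ A * wt n x ^ k) : Dom g := by
  obtain ⟨N, hN⟩ := exists_nat_ge A
  refine ⟨max N k, fun n hn x => (h n hn x).trans ?_⟩
  have h1 := one_le_wt hn x
  calc A * wt n x ^ k ≤ N * wt n x ^ k := mul_le_mul_of_nonneg_right hN (by positivity)
    _ ≤ (max N k : ℕ) * wt n x ^ (max N k) := by
      refine mul_le_mul (by exact_mod_cast le_max_left _ _)
        (pow_le_pow_right₀ h1 (le_max_right _ _)) (by positivity) (by positivity)

theorem Dom.add {g h : ℕ → ℝ → ℝ} (hg : Dom g) (hh : Dom h) : Dom (fun n x => g n x + h n x) := by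
  obtain ⟨C, hC⟩ := hg
  obtain ⟨D, hD⟩ := hh
  refine dom_of_le (C + D) (C + D) fun n hn x => ?_
  have h1 := one_le_wt hn x
  have e1 := pow_le_pow_right₀ h1 (Nat.le_add_right C D)
  have e2 := pow_le_pow_right₀ h1 (Nat.le_add_left D C)
  calc _ ≤ |g n x| + |h n x| := abs_add_le _ _
    _ ≤ C * wt n x ^ (C + D) + D * wt n x ^ (C + D) :=
      add_le_add ((hC n hn x).trans (mul_le_mul_of_nonneg_left e1 (by positivity)))
        ((hD n hn x).trans (mul_le_mul_of_nonneg_left e2 (by positivity)))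
    _ = _ := by ring

theorem Dom.mul {g h : ℕ → ℝ → ℝ} (hg : Dom g) (hh : Dom h) : Dom (fun n x => g n x * h n x) := by
  obtain ⟨C, hC⟩ := hg
  obtain ⟨D, hD⟩ := hh
  refine dom_of_le (C * D) (C + D) fun n hn x => ?_
  have h1 := one_le_wt hn x
  rw [abs_mul, pow_add]
  calc _ ≤ (C * wt n x ^ C) * (D * wt n x ^ D) :=
        mul_le_mul (hC n hn x) (hD n hn x) (abs_nonneg _) (by positivity)
    _ = _ := by ring

theorem dom_const {c : ℕ → ℝ} {B : ℝ} (hc : ∀ n, 3 ≤ n → |c n| ≤ B) : Dom (fun n _ => c n) :=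
  dom_of_le B 0 fun n hn x => by simpa using hc n hn

theorem dom_id : Dom (fun _ x => x) :=
  dom_of_le 1 1 fun n hn x => by simpa using abs_le_wt hn x

/-- A family of smooth functions all of whose derivatives are dominated by powers of the
weight. -/
structure Adm (g : ℕ → ℝ → ℝ) : Prop where
  smooth : ∀ n, ContDiff ℝ (⊤ : ℕ∞) (g n)
  dom : ∀ j, Dom (fun n => iteratedDeriv j (g n))

namespace Adm

variable {g h : ℕ → ℝ → ℝ}

theorem dom_self (hg : Adm g) : Dom g := by simpa using hg.dom 0

theorem differentiable (hg : Adm g) (n : ℕ) : Differentiable ℝ (g n) :=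
  (hg.smooth n).differentiable (by simp)

theorem continuous (hg : Adm g) (n : ℕ) : Continuous (g n) := (hg.smooth n).continuous

theorem deriv (hg : Adm g) : Adm (fun n => deriv (g n)) where
  smooth n := (contDiff_infty_iff_deriv.1 (hg.smooth n)).2
  dom j := by simpa only [← iteratedDeriv_succ'] using hg.dom (j + 1)

theorem iteratedDeriv (hg : Adm g) (i : ℕ) : Adm (fun n => iteratedDeriv i (g n)) := by
  induction i with
  | zero => simpa using hg
  | succ i ih => simpa only [iteratedDeriv_succ] using ih.deriv

/-- Bounds for a function and for its derivative give bounds for all derivatives. -/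
theorem of_deriv (hs : ∀ n, ContDiff ℝ (⊤ : ℕ∞) (g n)) (h0 : Dom g)
    (h1 : ∀ j, Dom (fun n => _root_.iteratedDeriv j (_root_.deriv (g n)))) : Adm g where
  smooth := hs
  dom j := by
    cases j with
    | zero => simpa using h0
    | succ j => simpa only [iteratedDeriv_succ'] using h1 j

theorem add (hg : Adm g) (hh : Adm h) : Adm (fun n x => g n x + h n x) where
  smooth n := (hg.smooth n).add (hh.smooth n)
  dom j := by
    have : ∀ n, _root_.iteratedDeriv j (fun x => g n x + h n x) =
        fun x => _root_.iteratedDeriv j (g n) x + _root_.iteratedDeriv j (h n) x := fun n => by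
      ext x
      exact iteratedDeriv_fun_add ((hg.smooth n).of_le (by exact_mod_cast le_top)).contDiffAt
        ((hh.smooth n).of_le (by exact_mod_cast le_top)).contDiffAt
    simp only [this]
    exact (hg.dom j).add (hh.dom j)

theorem deriv_mul_eq (hg : Adm g) (hh : Adm h) (n : ℕ) :
    _root_.deriv (fun x => g n x * h n x) =
      fun x => _root_.deriv (g n) x * h n x + g n x * _root_.deriv (h n) x := by
  ext x
  exact deriv_fun_mul (hg.differentiable n x) (hh.differentiable n x)

theorem mul (hg : Adm g) (hh : Adm h) : Adm (fun n x => g n x * h n x) where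
  smooth n := (hg.smooth n).mul (hh.smooth n)
  dom j := by
    induction j generalizing g h with
    | zero => simpa using hg.dom_self.mul hh.dom_self
    | succ j ih =>
      simp only [iteratedDeriv_succ', hg.deriv_mul_eq hh]
      have e : ∀ n, _root_.iteratedDeriv j
          (fun x => _root_.deriv (g n) x * h n x + g n x * _root_.deriv (h n) x) =
          fun x => _root_.iteratedDeriv j (fun x => _root_.deriv (g n) x * h n x) x +
            _root_.iteratedDeriv j (fun x => g n x * _root_.deriv (h n) x) x := fun n => by
        ext x
        refine iteratedDeriv_fun_add ?_ ?_
        · exact (((hg.deriv.smooth n).mul (hh.smooth n)).of_le (by exact_mod_cast le_top)).contDiffAt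
        · exact (((hg.smooth n).mul (hh.deriv.smooth n)).of_le (by exact_mod_cast le_top)).contDiffAt
      simp only [e]
      exact (ih hg.deriv hh).add (ih hg hh.deriv)

theorem const {c : ℕ → ℝ} {B : ℝ} (hc : ∀ n, 3 ≤ n → |c n| ≤ B) : Adm (fun n _ => c n) :=
  of_deriv (fun _ => contDiff_const) (dom_const hc) fun j => by
    have : ∀ n, _root_.iteratedDeriv j (_root_.deriv fun _ : ℝ => c n) = fun _ => 0 := fun n => by
      simp only [deriv_const']
      ext x
      rw [iteratedDeriv_const]
      simp
    simp only [this]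
    exact dom_const (B := 0) (by simp)

theorem one : Adm (fun _ _ => 1) := const (c := fun _ => 1) (B := 1) (by simp)

theorem id : Adm (fun _ x => x) :=
  of_deriv (fun _ => contDiff_id) dom_id fun j => by
    have := one.dom j
    simpa using this

theorem const_mul (hg : Adm g) {c : ℕ → ℝ} {B : ℝ} (hc : ∀ n, 3 ≤ n → |c n| ≤ B) :
    Adm (fun n x => c n * g n x) := (const hc).mul hg

theorem neg (hg : Adm g) : Adm (fun n x => -g n x) := by
  have := hg.const_mul (c := fun _ => -1) (B := 1) (by simp)
  simpa using this

theorem sub (hg : Adm g) (hh : Adm h) : Adm (fun n x => g n x - h n x) := by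
  simpa [sub_eq_add_neg] using hg.add hh.neg

theorem sum {ι : Type*} (s : Finset ι) {F : ι → ℕ → ℝ → ℝ} (hF : ∀ i ∈ s, Adm (F i)) :
    Adm (fun n x => ∑ i ∈ s, F i n x) := by
  classical
  induction s using Finset.induction_on with
  | empty => simpa using const (c := fun _ => 0) (B := 0) (by simp)
  | insert i s hi ih =>
    simp only [Finset.sum_insert hi]
    exact (hF i (Finset.mem_insert_self _ _)).add
      (ih fun j hj => hF j (Finset.mem_insert_of_mem hj))

theorem pow (hg : Adm g) (k : ℕ) : Adm (fun n x => g n x ^ k) := by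
  induction k with
  | zero => simpa using one
  | succ k ih => simpa only [pow_succ] using ih.mul hg

end Adm

end Admissible

/-! ### Gaussian integrals, Stein's equation and matching by polynomials. -/

section Gauss

theorem wt_le_exp {n : ℕ} (hn : 3 ≤ n) (x : ℝ) : wt n x ≤ 4 * Real.exp (2 * |x|) := by
  have h1 : 1 + x ^ 2 ≤ 2 * Real.exp |x| := by
    have := Real.quadratic_le_exp_of_nonneg (abs_nonneg x)
    rw [sq_abs] at this
    linarith [abs_nonneg x]
  have h2 : Real.cosh x ≤ Real.exp |x| := by
    rw [← Real.cosh_abs, Real.cosh_eq]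
    have : Real.exp (-|x|) ≤ Real.exp |x| := Real.exp_le_exp.2 (by linarith [abs_nonneg x])
    linarith
  refine (wt_le_cosh hn x).trans ?_
  have h3 := one_le_cosh x
  rw [two_mul |x|, Real.exp_add]
  calc 2 * (1 + x ^ 2) * Real.cosh x ≤ 2 * (2 * Real.exp |x|) * Real.exp |x| := by gcongr
    _ = _ := by ring

theorem wt_pow_le_exp {n : ℕ} (hn : 3 ≤ n) (k : ℕ) (x : ℝ) :
    wt n x ^ k ≤ 4 ^ k * Real.exp ((2 * k) * |x|) := by
  refine (pow_le_pow_left₀ (wt_pos hn x).le (wt_le_exp hn x) k).trans_eq ?_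
  rw [mul_pow, ← Real.exp_nat_mul]
  ring_nf

theorem integrable_exp_abs_gaussian (t : ℝ) :
    Integrable (fun x => Real.exp (t * |x|)) (gaussianReal 0 1) := by
  have h1 := (integrable_exp_mul_gaussianReal (μ := 0) (v := 1) t).add
    (integrable_exp_mul_gaussianReal (μ := 0) (v := 1) (-t))
  refine h1.mono' (by fun_prop) (Filter.Eventually.of_forall fun x => ?_)
  rw [Real.norm_eq_abs, abs_of_pos (Real.exp_pos _)]
  simp only [Pi.add_apply]
  rcases abs_cases x with h | h <;> rw [h.1]
  · linarith [Real.exp_pos (-t * x)]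
  · rw [mul_neg, ← neg_mul]; linarith [Real.exp_pos (t * x)]

theorem Dom.integrable_gaussian {g : ℕ → ℝ → ℝ} (hg : Dom g) {n : ℕ} (hn : 3 ≤ n)
    (hc : Continuous (g n)) : Integrable (g n) (gaussianReal 0 1) := by
  obtain ⟨C, hC⟩ := hg
  refine ((integrable_exp_abs_gaussian (2 * C)).const_mul (C * 4 ^ C)).mono'
    hc.aestronglyMeasurable (Filter.Eventually.of_forall fun x => ?_)
  refine (hC n hn x).trans ?_
  rw [mul_assoc]
  exact mul_le_mul_of_nonneg_left (wt_pow_le_exp hn C x) (by positivity)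

theorem Dom.abs_integral_gaussian_le {g : ℕ → ℝ → ℝ} (hg : Dom g) :
    ∃ B : ℝ, 0 ≤ B ∧ ∀ n, 3 ≤ n → |∫ x, g n x ∂(gaussianReal 0 1)| ≤ B := by
  obtain ⟨C, hC⟩ := hg
  refine ⟨∫ x, (C * 4 ^ C) * Real.exp ((2 * C) * |x|) ∂(gaussianReal 0 1),
    integral_nonneg fun x => by positivity, fun n hn => ?_⟩
  rw [← Real.norm_eq_abs]
  refine norm_integral_le_of_norm_le ((integrable_exp_abs_gaussian (2 * C)).const_mul _)
    (Filter.Eventually.of_forall fun x => ?_)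
  refine (hC n hn x).trans ?_
  rw [mul_assoc]
  exact mul_le_mul_of_nonneg_left (wt_pow_le_exp hn C x) (by positivity)

theorem integrable_gaussian_iff (g : ℝ → ℝ) : Integrable g (gaussianReal 0 1) ↔
    Integrable (fun x => Real.exp (-(x ^ 2 / 2)) * g x) := by
  rw [gaussianReal_of_var_ne_zero _ one_ne_zero, gaussianPDF_def,
    integrable_withDensity_iff_integrable_smul₀' (by fun_prop)
      (Filter.Eventually.of_forall fun x => ENNReal.ofReal_lt_top)]
  have hc : (Real.sqrt (2 * Real.pi * (1 : NNReal)))⁻¹ ≠ 0 := by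
    apply inv_ne_zero
    positivity
  have : (fun x => (ENNReal.ofReal (gaussianPDFReal 0 1 x)).toReal • g x) =
      fun x => (Real.sqrt (2 * Real.pi * (1 : NNReal)))⁻¹ * (Real.exp (-(x ^ 2 / 2)) * g x) := by
    ext x
    rw [ENNReal.toReal_ofReal (gaussianPDFReal_nonneg _ _ _), gaussianPDFReal]
    simp [mul_assoc, neg_div]
  rw [this, integrable_const_mul_iff (Ne.isUnit hc)]

theorem integral_gaussian_eq (g : ℝ → ℝ) : ∫ x, g x ∂(gaussianReal 0 1) =
    (Real.sqrt (2 * Real.pi * (1 : NNReal)))⁻¹ * ∫ x, Real.exp (-(x ^ 2 / 2)) * g x := by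
  rw [integral_gaussianReal_eq_integral_smul one_ne_zero, ← integral_const_mul]
  congr 1
  ext x
  simp [gaussianPDFReal, mul_assoc, neg_div]

/-- Gaussian integration by parts. -/
theorem integral_gaussian_stein {v : ℝ → ℝ} (hv : Differentiable ℝ v)
    (h1 : Integrable v (gaussianReal 0 1))
    (h2 : Integrable (fun x => x * v x - deriv v x) (gaussianReal 0 1)) :
    ∫ x, (x * v x - deriv v x) ∂(gaussianReal 0 1) = 0 := by
  rw [integral_gaussian_eq]
  rw [integrable_gaussian_iff] at h1 h2
  have := integral_eq_zero_of_hasDerivAt_of_integrable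
    (f := fun x => -(Real.exp (-(x ^ 2 / 2)) * v x))
    (f' := fun x => Real.exp (-(x ^ 2 / 2)) * (x * v x - deriv v x)) (fun x => ?_) h2 h1.neg
  · rw [this, mul_zero]
  · have e1 : HasDerivAt (fun x : ℝ => Real.exp (-(x ^ 2 / 2))) (Real.exp (-(x ^ 2 / 2)) * -x) x := by
      have : HasDerivAt (fun x : ℝ => -(x ^ 2 / 2)) (-x) x := by
        have := ((hasDerivAt_pow 2 x).div_const 2).neg
        refine this.congr_deriv ?_
        simp
      exact this.exp
    refine ((e1.mul (hv x).hasDerivAt).neg).congr_deriv ?_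
    ring

/-- The solution of Stein's equation `x v - v' = h`. -/
def steinSol (h : ℝ → ℝ) (x : ℝ) : ℝ :=
  Real.exp (x ^ 2 / 2) * ((∫ y in Set.Ioi (0 : ℝ), Real.exp (-(y ^ 2 / 2)) * h y) -
    ∫ y in (0 : ℝ)..x, Real.exp (-(y ^ 2 / 2)) * h y)

theorem hasDerivAt_steinSol {h : ℝ → ℝ} (hc : Continuous h) (x : ℝ) :
    HasDerivAt (steinSol h) (x * steinSol h x - h x) x := by
  have e1 : HasDerivAt (fun x : ℝ => Real.exp (x ^ 2 / 2)) (Real.exp (x ^ 2 / 2) * x) x := by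
    have : HasDerivAt (fun x : ℝ => x ^ 2 / 2) x x := by
      refine ((hasDerivAt_pow 2 x).div_const 2).congr_deriv ?_
      simp
    exact this.exp
  have hcont : Continuous fun y : ℝ => Real.exp (-(y ^ 2 / 2)) * h y := by fun_prop
  have e2 := (hcont.integral_hasStrictDerivAt 0 x).hasDerivAt
  refine (e1.mul (e2.const_sub (∫ y in Set.Ioi (0 : ℝ), Real.exp (-(y ^ 2 / 2)) * h y))).congr_deriv ?_
  simp only [steinSol]
  have : Real.exp (x ^ 2 / 2) * Real.exp (-(x ^ 2 / 2)) = 1 := by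
    rw [← Real.exp_add]; simp
  linear_combination (- h x) * this

theorem contDiff_steinSol {h : ℝ → ℝ} (hc : ContDiff ℝ (⊤ : ℕ∞) h) :
    ContDiff ℝ (⊤ : ℕ∞) (steinSol h) := by
  unfold steinSol
  have hcont : Continuous fun y : ℝ => Real.exp (-(y ^ 2 / 2)) * h y := by
    have := hc.continuous
    fun_prop
  refine ContDiff.mul (by fun_prop) (contDiff_const.sub ?_)
  rw [contDiff_infty_iff_deriv]
  refine ⟨fun x => (hcont.integral_hasStrictDerivAt 0 x).hasDerivAt.differentiableAt, ?_⟩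
  have : deriv (fun x => ∫ y in (0 : ℝ)..x, Real.exp (-(y ^ 2 / 2)) * h y) =
      fun x => Real.exp (-(x ^ 2 / 2)) * h x :=
    funext fun x => (hcont.integral_hasStrictDerivAt 0 x).hasDerivAt.deriv
  rw [this]
  fun_prop

/-- From `y² - x² = (y - x)² + 2 x (y - x)`, the Gaussian quotient is at most `exp (-(y - x)² / 2)`
on `s`. Submultiplicativity turns the weight at `y` into the weight at `x` times a factor in `y -
x`, which is integrable; the solution thus grows no faster than `h`. -/
theorem abs_setIntegral_stein_le {n : ℕ} (hn : 3 ≤ n) {h : ℝ → ℝ} {C k : ℕ}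
    (hh : ∀ x, |h x| ≤ C * wt n x ^ k) (x : ℝ) (s : Set ℝ) (hs : MeasurableSet s)
    (hsx : ∀ y ∈ s, 0 ≤ x * (y - x)) :
    |Real.exp (x ^ 2 / 2) * ∫ y in s, Real.exp (-(y ^ 2 / 2)) * h y| ≤
      (C * 4 ^ k * ∫ t, Real.exp (-(t ^ 2 / 2)) * (4 ^ k * Real.exp ((2 * k) * |t|))) *
        wt n x ^ k := by
  rw [← integral_const_mul, ← Real.norm_eq_abs]
  have hint : Integrable fun t : ℝ => Real.exp (-(t ^ 2 / 2)) * (4 ^ k * Real.exp ((2 * k) * |t|)) := by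
    rw [← integrable_gaussian_iff]
    exact (integrable_exp_abs_gaussian (2 * k)).const_mul _
  have hint2 := (hint.comp_sub_right x).const_mul (C * 4 ^ k * wt n x ^ k)
  have hle : ∀ y ∈ s, ‖Real.exp (x ^ 2 / 2) * (Real.exp (-(y ^ 2 / 2)) * h y)‖ ≤
      (C * 4 ^ k * wt n x ^ k) *
        (Real.exp (-((y - x) ^ 2 / 2)) * (4 ^ k * Real.exp ((2 * k) * |y - x|))) := by
    intro y hy
    rw [Real.norm_eq_abs, ← mul_assoc, ← Real.exp_add, abs_mul, abs_of_pos (Real.exp_pos _)]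
    have e1 : Real.exp (x ^ 2 / 2 + -(y ^ 2 / 2)) ≤ Real.exp (-((y - x) ^ 2 / 2)) := by
      apply Real.exp_le_exp.2
      nlinarith [hsx y hy]
    have e2 : |h y| ≤ C * (4 ^ k * wt n x ^ k * (4 ^ k * Real.exp ((2 * k) * |y - x|))) := by
      refine (hh y).trans (mul_le_mul_of_nonneg_left ?_ (by positivity))
      have := wt_add_le hn x (y - x)
      rw [add_sub_cancel] at this
      refine (pow_le_pow_left₀ (wt_pos hn y).le this k).trans ?_
      rw [mul_pow, mul_pow]
      refine mul_le_mul_of_nonneg_left (wt_pow_le_exp hn k _) ?_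
      have := wt_pos hn x
      positivity
    calc _ ≤ Real.exp (-((y - x) ^ 2 / 2)) *
          (C * (4 ^ k * wt n x ^ k * (4 ^ k * Real.exp ((2 * k) * |y - x|)))) :=
          mul_le_mul e1 e2 (abs_nonneg _) (Real.exp_pos _).le
      _ = _ := by ring
  have hnn : ∀ y : ℝ, 0 ≤ (C * 4 ^ k * wt n x ^ k) *
        (Real.exp (-((y - x) ^ 2 / 2)) * (4 ^ k * Real.exp ((2 * k) * |y - x|))) := fun y => by
    have := wt_pos hn x
    positivity
  calc _ ≤ ∫ y in s, (C * 4 ^ k * wt n x ^ k) *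
        (Real.exp (-((y - x) ^ 2 / 2)) * (4 ^ k * Real.exp ((2 * k) * |y - x|))) :=
        norm_integral_le_of_norm_le hint2.integrableOn
          ((ae_restrict_iff' hs).2 (Filter.Eventually.of_forall hle))
    _ ≤ ∫ y, (C * 4 ^ k * wt n x ^ k) *
        (Real.exp (-((y - x) ^ 2 / 2)) * (4 ^ k * Real.exp ((2 * k) * |y - x|))) :=
        setIntegral_le_integral hint2 (Filter.Eventually.of_forall hnn)
    _ = _ := by
      rw [integral_const_mul, integral_sub_right_eq_self
        (fun t : ℝ => Real.exp (-(t ^ 2 / 2)) * (4 ^ k * Real.exp ((2 * k) * |t|)))]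
      ring

/-- Mean zero makes the two tail integrals opposite, so for each sign of `x` the solution can be
written with the tail that starts at `x` and points away from the origin. -/
theorem abs_steinSol_le {n : ℕ} (hn : 3 ≤ n) {h : ℝ → ℝ} {C k : ℕ}
    (hh : ∀ x, |h x| ≤ C * wt n x ^ k) (hi : Integrable h (gaussianReal 0 1))
    (h0 : ∫ x, h x ∂(gaussianReal 0 1) = 0) (x : ℝ) :
    |steinSol h x| ≤
      (C * 4 ^ k * ∫ t, Real.exp (-(t ^ 2 / 2)) * (4 ^ k * Real.exp ((2 * k) * |t|))) *
        wt n x ^ k := by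
  rw [integrable_gaussian_iff] at hi
  rw [integral_gaussian_eq] at h0
  have h0' : ∫ x, Real.exp (-(x ^ 2 / 2)) * h x = 0 := by
    rcases mul_eq_zero.1 h0 with h | h
    · exact absurd h (inv_ne_zero (by positivity))
    · exact h
  rcases le_total 0 x with hx | hx
  · have : steinSol h x = Real.exp (x ^ 2 / 2) *
        ∫ y in Set.Ioi x, Real.exp (-(y ^ 2 / 2)) * h y := by
      unfold steinSol
      rw [← intervalIntegral.integral_Ioi_sub_Ioi' hi.integrableOn hi.integrableOn]
      ring
    rw [this]
    exact abs_setIntegral_stein_le hn hh x _ measurableSet_Ioi fun y hy =>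
      mul_nonneg hx (sub_nonneg.2 (le_of_lt hy))
  · have : steinSol h x = -(Real.exp (x ^ 2 / 2) *
        ∫ y in Set.Iic x, Real.exp (-(y ^ 2 / 2)) * h y) := by
      unfold steinSol
      rw [← intervalIntegral.integral_Iic_sub_Iic hi.integrableOn hi.integrableOn]
      have := intervalIntegral.integral_Iic_add_Ioi (b := 0) (f := fun x => Real.exp (-(x ^ 2 / 2)) * h x)
        hi.integrableOn hi.integrableOn
      rw [h0'] at this
      linear_combination (Real.exp (x ^ 2 / 2)) * this
    rw [this, abs_neg]
    exact abs_setIntegral_stein_le hn hh x _ measurableSet_Iic fun y hy =>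
      mul_nonneg_of_nonpos_of_nonpos hx (sub_nonpos.2 hy)

/-- An admissible family whose derivatives of order less than `m` have Gaussian mean zero. -/
def GaussOrth (m : ℕ) (g : ℕ → ℝ → ℝ) : Prop :=
  Adm g ∧ ∀ n, 3 ≤ n → ∀ d < m, ∫ x, iteratedDeriv d (g n) x ∂(gaussianReal 0 1) = 0

theorem GaussOrth.mono {m m' : ℕ} {g : ℕ → ℝ → ℝ} (hg : GaussOrth m g) (h : m' ≤ m) :
    GaussOrth m' g := ⟨hg.1, fun n hn d hd => hg.2 n hn d (hd.trans_le h)⟩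

theorem GaussOrth.iteratedDeriv {m : ℕ} {g : ℕ → ℝ → ℝ} (hg : GaussOrth m g) (i : ℕ) :
    GaussOrth (m - i) (fun n => iteratedDeriv i (g n)) := by
  refine ⟨hg.1.iteratedDeriv i, fun n hn d hd => ?_⟩
  have := hg.2 n hn (d + i) (by omega)
  refine Eq.trans ?_ this
  refine integral_congr_ae (Filter.Eventually.of_forall fun x => ?_)
  simp only
  rw [iteratedDeriv_eq_iterate, iteratedDeriv_eq_iterate, iteratedDeriv_eq_iterate,
    Function.iterate_add_apply]

theorem iteratedDeriv_id_mul {v : ℝ → ℝ} (hv : ContDiff ℝ (⊤ : ℕ∞) v) (d : ℕ) :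
    iteratedDeriv (d + 1) (fun x => x * v x) =
      fun x => x * iteratedDeriv (d + 1) v x + (d + 1) * iteratedDeriv d v x := by
  induction d with
  | zero =>
    ext x
    rw [iteratedDeriv_one]
    have := deriv_fun_mul (differentiableAt_id (x := x) (𝕜 := ℝ)) (hv.differentiable (by simp) x)
    simp only [id] at this
    rw [this]
    simp [add_comm]
  | succ d ih =>
    ext x
    rw [iteratedDeriv_succ, ih]
    have h1 : ∀ i, Differentiable ℝ (iteratedDeriv i v) := fun i =>
      hv.differentiable_iteratedDeriv i (by exact_mod_cast WithTop.coe_lt_top _)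
    have e1 : HasDerivAt (fun x => x * iteratedDeriv (d + 1) v x)
        (1 * iteratedDeriv (d + 1) v x + x * iteratedDeriv (d + 1 + 1) v x) x := by
      refine (hasDerivAt_id x).mul ?_
      rw [iteratedDeriv_succ (n := d + 1)]
      exact (h1 (d + 1) x).hasDerivAt
    have e2 : HasDerivAt (fun x => ((d : ℝ) + 1) * iteratedDeriv d v x)
        ((d + 1) * iteratedDeriv (d + 1) v x) x := by
      refine HasDerivAt.const_mul _ ?_
      rw [iteratedDeriv_succ]
      exact (h1 d x).hasDerivAt
    rw [(e1.fun_add e2).deriv]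
    push_cast
    ring

/-- Every admissible family of mean zero comes from Stein's equation. -/
theorem GaussOrth.exists_stein {m : ℕ} {g : ℕ → ℝ → ℝ} (hg : GaussOrth m g) (hm : 1 ≤ m) :
    ∃ v : ℕ → ℝ → ℝ, GaussOrth (m - 1) v ∧ ∀ n x, g n x = x * v n x - deriv (v n) x := by
  set v : ℕ → ℝ → ℝ := fun n => steinSol (g n) with hv
  have hs : ∀ n, ContDiff ℝ (⊤ : ℕ∞) (v n) := fun n => contDiff_steinSol (hg.1.smooth n)
  have hd : ∀ n, deriv (v n) = fun x => x * v n x - g n x := fun n =>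
    funext fun x => (hasDerivAt_steinSol (hg.1.continuous n) x).deriv
  have hdom0 : Dom v := by
    obtain ⟨C, hC⟩ := hg.1.dom_self
    refine dom_of_le (C * 4 ^ C * ∫ t, Real.exp (-(t ^ 2 / 2)) *
      (4 ^ C * Real.exp ((2 * C) * |t|))) C fun n hn x => ?_
    refine abs_steinSol_le hn (hC n hn)
      (hg.1.dom_self.integrable_gaussian hn (hg.1.continuous n)) ?_ x
    simpa using hg.2 n hn 0 (by omega)
  -- The equation `v' = x v - g` expresses each derivative of `v` by lower ones and by derivatives
  -- of `g`.
  have hdom : ∀ j, Dom (fun n => _root_.iteratedDeriv j (v n)) := by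
    intro j
    induction j using Nat.strong_induction_on with
    | _ j ih =>
      rcases j with _ | j
      · simpa using hdom0
      · have e : ∀ n, _root_.iteratedDeriv (j + 1) (v n) = fun x =>
            _root_.iteratedDeriv j (fun x => x * v n x) x - _root_.iteratedDeriv j (g n) x := by
          intro n
          rw [iteratedDeriv_succ', hd]
          ext x
          exact iteratedDeriv_fun_sub
            ((contDiff_id.mul (hs n)).of_le (by exact_mod_cast le_top)).contDiffAt
            ((hg.1.smooth n).of_le (by exact_mod_cast le_top)).contDiffAt
        simp only [e, sub_eq_add_neg]
        refine Dom.add ?_ ?_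
        · rcases j with _ | i
          · simpa using dom_id.mul hdom0
          · simp only [iteratedDeriv_id_mul (hs _)]
            exact (dom_id.mul (ih (i + 1) (by omega))).add
              ((dom_const (c := fun _ => (i : ℝ) + 1) (B := |(i : ℝ) + 1|) (by simp)).mul
                (ih i (by omega)))
        · have := (dom_const (c := fun _ => -1) (B := 1) (by simp)).mul (hg.1.dom j)
          simpa using this
  have hadm : Adm v := ⟨hs, hdom⟩
  refine ⟨v, ⟨hadm, fun n hn d hdm => ?_⟩, fun n x => by rw [hd]; ring⟩
  have h1 := hg.2 n hn (d + 1) (by omega)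
  -- Differentiating Stein's equation `d + 1` times gives a Stein expression in `v^(d+1)`, of
  -- Gaussian mean zero, plus `(d + 1) v^(d)`. The vanishing mean of `g^(d+1)` thus passes to
  -- `v^(d)`, and exactly one order is lost.
  have e : _root_.iteratedDeriv (d + 1) (g n) = fun x =>
      (x * _root_.iteratedDeriv (d + 1) (v n) x - deriv (_root_.iteratedDeriv (d + 1) (v n)) x) +
        (d + 1) * _root_.iteratedDeriv d (v n) x := by
    have : g n = fun x => x * v n x - deriv (v n) x := by rw [hd]; ext x; ring
    rw [this]
    ext x
    rw [iteratedDeriv_fun_sub (f := fun x => x * v n x)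
      ((contDiff_id.mul (hs n)).of_le (by exact_mod_cast le_top)).contDiffAt
      ((hadm.deriv.smooth n).of_le (by exact_mod_cast le_top)).contDiffAt,
      iteratedDeriv_id_mul (hs n), ← iteratedDeriv_succ', iteratedDeriv_succ (n := d + 1)]
    ring
  set u := fun n => _root_.iteratedDeriv (d + 1) (v n) with hu
  have hua : Adm u := hadm.iteratedDeriv (d + 1)
  have i1 : Integrable (fun x => x * u n x - deriv (u n) x) (gaussianReal 0 1) :=
    ((Adm.id.mul hua).sub hua.deriv).dom_self.integrable_gaussian hn
      (((Adm.id.mul hua).sub hua.deriv).continuous n)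
  have i2 : Integrable (_root_.iteratedDeriv d (v n)) (gaussianReal 0 1) :=
    (hadm.dom d).integrable_gaussian hn ((hadm.iteratedDeriv d).continuous n)
  rw [e, integral_add i1 (i2.const_mul _), integral_gaussian_stein (hua.differentiable n)
    (hua.dom_self.integrable_gaussian hn (hua.continuous n)) i1, zero_add, integral_const_mul] at h1
  rcases mul_eq_zero.1 h1 with h | h
  · exact absurd h (by positivity)
  · exact h

/-- Polynomials of degree less than `m` match an admissible family to order `m`. -/
theorem Adm.exists_poly (m : ℕ) : ∀ {g : ℕ → ℝ → ℝ}, Adm g →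
    ∃ (c : ℕ → ℕ → ℝ) (B : ℝ), (∀ d n, 3 ≤ n → |c d n| ≤ B) ∧
      GaussOrth m (fun n x => g n x - ∑ d ∈ Finset.range m, c d n * x ^ d) := by
  induction m with
  | zero =>
    intro g hg
    exact ⟨fun _ _ => 0, 0, by simp, by simpa using hg, by simp⟩
  | succ m ih =>
    intro g hg
    obtain ⟨c, B, hB, horth⟩ := ih hg.deriv
    have hcd : ∀ d n, 3 ≤ n → |c d n / (d + 1)| ≤ B := fun d n hn => by
      rw [abs_div]
      have h1 : (1 : ℝ) ≤ |(d : ℝ) + 1| := by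
        rw [abs_of_pos (by positivity)]; linarith [Nat.cast_nonneg (α := ℝ) d]
      exact (div_le_self (abs_nonneg _) h1).trans (hB d n hn)
    -- An antiderivative of the polynomial matched to `g'`; the free constant `c0` then corrects the
    -- mean of `g` itself.
    set q : ℕ → ℝ → ℝ := fun n x => ∑ d ∈ Finset.range m, c d n / (d + 1) * x ^ (d + 1) with hq
    have hqa : Adm q := Adm.sum _ fun d _ =>
      (Adm.id.pow (d + 1)).const_mul (c := fun n => c d n / (d + 1)) (hcd d)
    obtain ⟨B', hB'0, hB'⟩ := (hg.sub hqa).dom_self.abs_integral_gaussian_le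
    set c0 : ℕ → ℝ := fun n => ∫ x, (g n x - q n x) ∂(gaussianReal 0 1) with hc0
    set r : ℕ → ℝ → ℝ := fun n x => (g n x - q n x) - c0 n with hr
    have hra : Adm r := (hg.sub hqa).sub (Adm.const hB')
    have hdr : ∀ n, _root_.deriv (r n) = fun x =>
        _root_.deriv (g n) x - ∑ d ∈ Finset.range m, c d n * x ^ d := by
      intro n
      ext x
      have hq' : HasDerivAt (q n) (∑ d ∈ Finset.range m, c d n * x ^ d) x := by
        refine (HasDerivAt.fun_sum (A' := fun d => c d n * x ^ d) fun d _ => ?_)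
        refine ((hasDerivAt_pow (d + 1) x).const_mul (c d n / (d + 1))).congr_deriv ?_
        have : (d : ℝ) + 1 ≠ 0 := by positivity
        push_cast
        field_simp
      exact (((hg.differentiable n x).hasDerivAt.sub hq').sub_const (c0 n)).deriv
    refine ⟨fun d n => if d = 0 then c0 n else c (d - 1) n / ((d - 1 : ℕ) + 1), max B B',
      fun d n hn => ?_, ?_⟩
    · dsimp only
      split_ifs with h
      · exact (hB' n hn).trans (le_max_right _ _)
      · exact (hcd _ n hn).trans (le_max_left _ _)
    · have e : (fun n x => g n x - ∑ d ∈ Finset.range (m + 1),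
          (if d = 0 then c0 n else c (d - 1) n / ((d - 1 : ℕ) + 1)) * x ^ d) = r := by
        ext n x
        rw [Finset.sum_range_succ']
        simp [hr, hq, sub_sub]
      rw [e]
      refine ⟨hra, fun n hn d hd => ?_⟩
      rcases d with _ | d
      · simp only [iteratedDeriv_zero, hr]
        rw [integral_sub ((hg.sub hqa).dom_self.integrable_gaussian hn
          ((hg.sub hqa).continuous n)) (integrable_const _)]
        simp [hc0]
      · rw [iteratedDeriv_succ', hdr]
        exact horth.2 n hn d (by omega)

end Gauss

end CycleCorrelations

end

noncomputable section

namespace CycleCorrelations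

/-! ### Random variables with all moments. -/

section AllMom

variable {Ω : Type*} [MeasurableSpace Ω] {P : Measure Ω}

/-- Random variables with finite moments of all orders. -/
def AllMom (P : Measure Ω) (Z : Ω → ℝ) : Prop :=
  AEStronglyMeasurable Z P ∧ ∀ p : ℕ, Integrable (fun ω => |Z ω| ^ p) P

namespace AllMom

variable {Y Z : Ω → ℝ}

theorem integrable (hZ : AllMom P Z) : Integrable Z P := by
  have := hZ.2 1
  simp only [pow_one] at this
  exact (integrable_norm_iff hZ.1).1 this

theorem mono (hZ : AllMom P Z) (hY : AEStronglyMeasurable Y P) (h : ∀ ω, |Y ω| ≤ |Z ω|) :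
    AllMom P Y :=
  ⟨hY, fun p => (hZ.2 p).mono' ((continuous_abs.comp_aestronglyMeasurable hY).pow p)
    (Filter.Eventually.of_forall fun ω => by
      rw [Real.norm_eq_abs, abs_pow, abs_abs]
      exact pow_le_pow_left₀ (abs_nonneg _) (h ω) p)⟩

theorem const [IsFiniteMeasure P] (c : ℝ) : AllMom P (fun _ : Ω => c) :=
  ⟨aestronglyMeasurable_const, fun _ => integrable_const _⟩

theorem add (hY : AllMom P Y) (hZ : AllMom P Z) : AllMom P (fun ω => Y ω + Z ω) := by
  refine ⟨hY.1.add hZ.1, fun p => ?_⟩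
  refine (((hY.2 p).add (hZ.2 p)).const_mul (2 ^ p)).mono'
    ((continuous_abs.comp_aestronglyMeasurable (hY.1.add hZ.1)).pow p)
    (Filter.Eventually.of_forall fun ω => ?_)
  rw [Real.norm_eq_abs, abs_pow, abs_abs]
  simp only [Pi.add_apply]
  have h1 : |Y ω + Z ω| ≤ 2 * max |Y ω| |Z ω| := by
    refine (abs_add_le _ _).trans ?_
    linarith [le_max_left |Y ω| |Z ω|, le_max_right |Y ω| |Z ω|]
  refine (pow_le_pow_left₀ (abs_nonneg _) h1 p).trans ?_
  rw [mul_pow]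
  refine mul_le_mul_of_nonneg_left ?_ (by positivity)
  rcases max_choice |Y ω| |Z ω| with h | h <;> rw [h]
  · linarith [pow_nonneg (abs_nonneg (Z ω)) p]
  · linarith [pow_nonneg (abs_nonneg (Y ω)) p]

theorem mul (hY : AllMom P Y) (hZ : AllMom P Z) : AllMom P (fun ω => Y ω * Z ω) := by
  refine ⟨hY.1.mul hZ.1, fun p => ?_⟩
  refine ((hY.2 (2 * p)).add (hZ.2 (2 * p))).mono'
    ((continuous_abs.comp_aestronglyMeasurable (hY.1.mul hZ.1)).pow p)
    (Filter.Eventually.of_forall fun ω => ?_)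
  rw [Real.norm_eq_abs, abs_pow, abs_abs]
  simp only [Pi.add_apply]
  rw [abs_mul, mul_pow, pow_mul', pow_mul']
  nlinarith [sq_nonneg (|Y ω| ^ p - |Z ω| ^ p), sq_nonneg (|Y ω| ^ p), sq_nonneg (|Z ω| ^ p)]

theorem const_mul [IsFiniteMeasure P] (hZ : AllMom P Z) (c : ℝ) : AllMom P (fun ω => c * Z ω) :=
  (const c).mul hZ

theorem pow [IsFiniteMeasure P] (hZ : AllMom P Z) (k : ℕ) : AllMom P (fun ω => Z ω ^ k) := by
  induction k with
  | zero => simpa using const (P := P) 1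
  | succ k ih => simpa only [pow_succ] using ih.mul hZ

theorem abs (hZ : AllMom P Z) : AllMom P (fun ω => |Z ω|) :=
  hZ.mono (continuous_abs.comp_aestronglyMeasurable hZ.1) fun ω => by rw [abs_abs]

theorem sum [IsFiniteMeasure P] {ι : Type*} (s : Finset ι) {Z : ι → Ω → ℝ}
    (hZ : ∀ i ∈ s, AllMom P (Z i)) : AllMom P (fun ω => ∑ i ∈ s, Z i ω) := by
  classical
  induction s using Finset.induction_on with
  | empty => simpa using const (P := P) 0
  | insert i s hi ih =>
    simp only [Finset.sum_insert hi]
    exact (hZ i (Finset.mem_insert_self _ _)).add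
      (ih fun j hj => hZ j (Finset.mem_insert_of_mem hj))

theorem prod [IsFiniteMeasure P] {ι : Type*} (s : Finset ι) {Z : ι → Ω → ℝ}
    (hZ : ∀ i ∈ s, AllMom P (Z i)) : AllMom P (fun ω => ∏ i ∈ s, Z i ω) := by
  classical
  induction s using Finset.induction_on with
  | empty => simpa using const (P := P) 1
  | insert i s hi ih =>
    simp only [Finset.prod_insert hi]
    exact (hZ i (Finset.mem_insert_self _ _)).mul
      (ih fun j hj => hZ j (Finset.mem_insert_of_mem hj))

theorem one_add_sq [IsFiniteMeasure P] (hZ : AllMom P Z) : AllMom P (fun ω => 1 + Z ω ^ 2) :=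
  (const 1).add (hZ.pow 2)

theorem comp_wt [IsFiniteMeasure P] (hZ : AllMom P Z) {n : ℕ} (hn : 3 ≤ n) :
    AllMom P (fun ω => wt n (Z ω)) := by
  refine (hZ.one_add_sq.const_mul (2 * n)).mono
    ((contDiff_wt hn).comp_aestronglyMeasurable hZ.1) fun ω => ?_
  rw [abs_of_pos (wt_pos hn _)]
  exact (wt_le_sq hn _).trans (le_abs_self _)

theorem comp_dom [IsFiniteMeasure P] (hZ : AllMom P Z) {g : ℕ → ℝ → ℝ} (hg : Dom g) {n : ℕ}
    (hn : 3 ≤ n) (hc : Continuous (g n)) : AllMom P (fun ω => g n (Z ω)) := by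
  obtain ⟨C, hC⟩ := hg
  refine (((hZ.comp_wt hn).pow C).const_mul C).mono (hc.comp_aestronglyMeasurable hZ.1) fun ω => ?_
  exact (hC n hn _).trans (le_abs_self _)

theorem comp_adm [IsFiniteMeasure P] (hZ : AllMom P Z) {g : ℕ → ℝ → ℝ} (hg : Adm g) {n : ℕ}
    (hn : 3 ≤ n) : AllMom P (fun ω => g n (Z ω)) :=
  hZ.comp_dom hg.dom_self hn (hg.continuous n)

end AllMom

end AllMom

/-- Comparison with the largest factor; it takes the place of Hölder's inequality in reducing mixed
moments to moments of one variable. -/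
theorem prod_le_one_add_sum_pow {E : Type*} [Fintype E] (a : E → ℝ) (ha : ∀ e, 1 ≤ a e) :
    ∏ e, a e ≤ 1 + ∑ e, a e ^ Fintype.card E := by
  have h0 : ∀ e, 0 ≤ a e ^ Fintype.card E := fun e => pow_nonneg (by linarith [ha e]) _
  rcases isEmpty_or_nonempty E with hE | hE
  · simp
  · obtain ⟨e, _, he⟩ := Finset.exists_max_image Finset.univ a Finset.univ_nonempty
    have h1 : ∏ e', a e' ≤ ∏ _e' : E, a e :=
      Finset.prod_le_prod (fun e' _ => by linarith [ha e']) fun e' he' => he e' he'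
    rw [Finset.prod_const, Finset.card_univ] at h1
    have h2 := Finset.single_le_sum (fun e' _ => h0 e') (Finset.mem_univ e)
    linarith

/-- The factors are exchanged one at a time, and the relative errors `δ` add up. -/
theorem abs_prod_sub_prod_le {E : Type*} [DecidableEq E] (s : Finset E) (a b H δ : E → ℝ)
    (hH : ∀ e ∈ s, 0 ≤ H e) (hδ : ∀ e ∈ s, 0 ≤ δ e)
    (ha : ∀ e ∈ s, |a e| ≤ H e) (hb : ∀ e ∈ s, |b e| ≤ H e)
    (hab : ∀ e ∈ s, |a e - b e| ≤ δ e * H e) :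
    |∏ e ∈ s, a e - ∏ e ∈ s, b e| ≤ (∑ e ∈ s, δ e) * ∏ e ∈ s, H e := by
  induction s using Finset.induction_on with
  | empty => simp
  | insert i s hi ih =>
    simp only [Finset.forall_mem_insert] at hH hδ ha hb hab
    have h1 := ih hH.2 hδ.2 ha.2 hb.2 hab.2
    have h2 : |∏ e ∈ s, a e| ≤ ∏ e ∈ s, H e := by
      rw [Finset.abs_prod]
      exact Finset.prod_le_prod (fun _ _ => abs_nonneg _) ha.2
    have h3 : 0 ≤ ∏ e ∈ s, H e := Finset.prod_nonneg hH.2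
    rw [Finset.prod_insert hi, Finset.prod_insert hi, Finset.prod_insert hi, Finset.sum_insert hi]
    have e : a i * ∏ e ∈ s, a e - b i * ∏ e ∈ s, b e =
        (a i - b i) * ∏ e ∈ s, a e + b i * (∏ e ∈ s, a e - ∏ e ∈ s, b e) := by ring
    rw [e]
    refine (abs_add_le _ _).trans ?_
    rw [abs_mul, abs_mul]
    have e1 := mul_le_mul hab.1 h2 (abs_nonneg _) (mul_nonneg hδ.1 hH.1)
    have e2 := mul_le_mul hb.1 h1 (abs_nonneg _) hH.1
    nlinarith

/-! ### Normalised sums of independent vectors and uniform bounds for the weight. -/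

/-- Independent random vectors `ξ 0, …, ξ (n-1)` indexed by `E`, with identity covariance and
absolute moments bounded by `mb`. -/
structure IndepArray (E : Type) [Fintype E] [DecidableEq E] (mb : ℕ → ℝ) (n : ℕ) where
  Ω : Type
  [mΩ : MeasurableSpace Ω]
  P : Measure Ω
  [prob : IsProbabilityMeasure P]
  ξ : Fin n → E → Ω → ℝ
  meas : ∀ a e, Measurable (ξ a e)
  indep : iIndepFun (fun a ω e => ξ a e ω) P
  mom_int : ∀ a e (p : ℕ), Integrable (fun ω => |ξ a e ω| ^ p) P
  mom_le : ∀ a e (p : ℕ), ∫ ω, |ξ a e ω| ^ p ∂P ≤ mb p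
  mean : ∀ a e, ∫ ω, ξ a e ω ∂P = 0
  cov : ∀ a e e', ∫ ω, ξ a e ω * ξ a e' ω ∂P = if e = e' then 1 else 0

attribute [instance] IndepArray.mΩ IndepArray.prob

namespace IndepArray

variable {E : Type} [Fintype E] [DecidableEq E] {mb : ℕ → ℝ} {n : ℕ} (M : IndepArray E mb n)

theorem allMom_ξ (a : Fin n) (e : E) : AllMom M.P (M.ξ a e) :=
  ⟨(M.meas a e).aestronglyMeasurable, M.mom_int a e⟩

/-- The normalised partial sum over `A`. -/
def G (A : Finset (Fin n)) (e : E) (ω : M.Ω) : ℝ := eps n * ∑ a ∈ A, M.ξ a e ω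

theorem measurable_G (A : Finset (Fin n)) (e : E) : Measurable (M.G A e) :=
  (Finset.measurable_fun_sum A fun a _ => M.meas a e).const_mul _

theorem allMom_G (A : Finset (Fin n)) (e : E) : AllMom M.P (M.G A e) :=
  (AllMom.sum A fun a _ => M.allMom_ξ a e).const_mul _

theorem G_insert {A : Finset (Fin n)} {a : Fin n} (ha : a ∉ A) (e : E) (ω : M.Ω) :
    M.G (insert a A) e ω = M.G A e ω + eps n * M.ξ a e ω := by
  unfold G
  rw [Finset.sum_insert ha]
  ring

theorem indepFun_G {A : Finset (Fin n)} {a : Fin n} (ha : a ∉ A) :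
    IndepFun (fun ω e => M.G A e ω) (fun ω e => M.ξ a e ω) M.P := by
  have h := M.indep.indepFun_finsetSum_of_notMem
    (fun a => measurable_pi_lambda _ fun e => M.meas a e) ha
  have hm : Measurable fun (x : E → ℝ) e => eps n * x e :=
    measurable_pi_lambda _ fun e => (measurable_pi_apply e).const_mul _
  have h2 := h.comp hm measurable_id
  have e1 : (fun ω e => M.G A e ω) =
      (fun (x : E → ℝ) e => eps n * x e) ∘ ∑ a ∈ A, fun ω e => M.ξ a e ω := by
    ext ω e
    simp [G]
  rw [e1]
  exact h2

/-- Expectations of products factorize. -/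
theorem integral_mul_G_ξ {A : Finset (Fin n)} {a : Fin n} (ha : a ∉ A) (u v : (E → ℝ) → ℝ)
    (hu : Measurable u) (hv : Measurable v) :
    ∫ ω, u (fun e => M.G A e ω) * v (fun e => M.ξ a e ω) ∂M.P =
      (∫ ω, u (fun e => M.G A e ω) ∂M.P) * ∫ ω, v (fun e => M.ξ a e ω) ∂M.P := by
  have h := (M.indepFun_G ha).comp hu hv
  have hG : Measurable (fun ω e => M.G A e ω) := measurable_pi_lambda _ fun e => M.measurable_G A e
  have hX : Measurable (fun ω e => M.ξ a e ω) := measurable_pi_lambda _ fun e => M.meas a e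
  exact h.integral_fun_mul_eq_mul_integral (hu.comp hG).aestronglyMeasurable
    (hv.comp hX).aestronglyMeasurable

end IndepArray

theorem one_add_sq_pow_le (x : ℝ) (k : ℕ) : (1 + x ^ 2) ^ k ≤ 2 ^ k * (1 + |x| ^ (2 * k)) := by
  rw [pow_mul, sq_abs]
  rcases le_total (x ^ 2) 1 with h | h
  · calc (1 + x ^ 2) ^ k ≤ 2 ^ k := pow_le_pow_left₀ (by positivity) (by linarith) k
      _ ≤ _ := by nlinarith [pow_nonneg (sq_nonneg x) k, pow_pos (two_pos (α := ℝ)) k]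
  · calc (1 + x ^ 2) ^ k ≤ (2 * x ^ 2) ^ k := pow_le_pow_left₀ (by positivity) (by linarith) k
      _ = 2 ^ k * (x ^ 2) ^ k := mul_pow _ _ _
      _ ≤ _ := by nlinarith [pow_pos (two_pos (α := ℝ)) k]

section Uniform

variable (E : Type) [Fintype E] [DecidableEq E] (mb : ℕ → ℝ)

theorem exists_integral_prod_ξ_le (N : ℕ) : ∃ C : ℝ, 0 ≤ C ∧ ∀ n, 3 ≤ n → ∀ M : IndepArray E mb n,
    ∀ a, ∫ ω, ∏ e, (1 + M.ξ a e ω ^ 2) ^ N ∂M.P ≤ C := by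
  refine ⟨1 + ∑ _e : E, 2 ^ (N * Fintype.card E) * (1 + |mb (2 * (N * Fintype.card E))|),
    by positivity, fun n hn M a => ?_⟩
  have h1 : ∀ e, AllMom M.P (fun ω => 1 + M.ξ a e ω ^ 2) := fun e => (M.allMom_ξ a e).one_add_sq
  have hI : ∀ e, Integrable (fun ω => (2 : ℝ) ^ (N * Fintype.card E) *
      (1 + |M.ξ a e ω| ^ (2 * (N * Fintype.card E)))) M.P := fun e =>
    ((integrable_const 1).add (M.mom_int a e _)).const_mul _
  calc ∫ ω, ∏ e, (1 + M.ξ a e ω ^ 2) ^ N ∂M.P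
      ≤ ∫ ω, (1 + ∑ e, 2 ^ (N * Fintype.card E) *
          (1 + |M.ξ a e ω| ^ (2 * (N * Fintype.card E)))) ∂M.P := by
        refine integral_mono (AllMom.prod _ fun e _ => (h1 e).pow N).integrable
          ((integrable_const 1).add (integrable_finsetSum _ fun e _ => hI e)) fun ω => ?_
        refine (prod_le_one_add_sum_pow _ fun e =>
          one_le_pow₀ (by nlinarith [sq_nonneg (M.ξ a e ω)])).trans ?_
        simp only [← pow_mul]
        gcongr with e
        exact one_add_sq_pow_le _ _
    _ = 1 + ∑ e, 2 ^ (N * Fintype.card E) *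
          (1 + ∫ ω, |M.ξ a e ω| ^ (2 * (N * Fintype.card E)) ∂M.P) := by
        rw [integral_add (integrable_const 1) (integrable_finsetSum _ fun e _ => hI e),
          integral_finsetSum _ fun e _ => hI e]
        simp only [integral_const_mul]
        simp only [integral_add (integrable_const (1 : ℝ)) (M.mom_int a _ _)]
        simp
    _ ≤ _ := by
        gcongr with e
        exact (M.mom_le a e _).trans (le_abs_self _)

/-- Adding one summand multiplies the expectation by at most `1 + κ / n`: the linear term of the
expansion has mean zero by independence, and the quadratic term carries `ε² = 1 / n` times a moment
of the summand. After at most `n` summands the factor is at most `exp κ`. -/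
theorem exists_integral_wt_le (k : ℕ) : ∃ C : ℝ, 0 ≤ C ∧ ∀ n, 3 ≤ n → ∀ M : IndepArray E mb n,
    ∀ A e, ∫ ω, wt n (M.G A e ω) ^ k ∂M.P ≤ C := by
  obtain ⟨C, hC0, hC⟩ := logDerivBdd_wt_pow k
  obtain ⟨D, hD0, hD⟩ := exists_integral_prod_ξ_le E mb (2 * k + 1)
  set κ : ℝ := C * 4 ^ k * (8 ^ k * D) with hκ
  have hκ0 : 0 ≤ κ := by positivity
  refine ⟨2 ^ k * Real.exp κ, by positivity, fun n hn M A e => ?_⟩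
  obtain ⟨ψ₁, hψc, hψb, hψ⟩ := (hC n hn).abs_sub_le
  have hn0 : (0 : ℝ) < n := by linarith [one_le_natCast hn]
  have key : ∀ A : Finset (Fin n), ∫ ω, wt n (M.G A e ω) ^ k ∂M.P ≤
      2 ^ k * (1 + κ / n) ^ A.card := by
    intro A
    induction A using Finset.induction_on with
    | empty =>
      simp only [IndepArray.G, Finset.sum_empty, mul_zero, Finset.card_empty, pow_zero, mul_one,
        integral_const, probReal_univ, one_smul]
      refine pow_le_pow_left₀ (wt_pos hn _).le ((wt_le_cosh hn 0).trans ?_) k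
      simp
    | insert a A ha ih =>
      have hG := M.allMom_G A e
      have hξ := M.allMom_ξ a e
      have hεξ := hξ.const_mul (eps n)
      have hψG : AllMom M.P (fun ω => ψ₁ (M.G A e ω)) := by
        refine (((hG.comp_wt hn).pow k).const_mul C).mono
          (hψc.comp_aestronglyMeasurable hG.1) fun ω => (hψb _).trans (le_abs_self _)
      have hpt : ∀ ω, wt n (M.G (insert a A) e ω) ^ k ≤ wt n (M.G A e ω) ^ k +
          ψ₁ (M.G A e ω) * (eps n * M.ξ a e ω) + wt n (M.G A e ω) ^ k *
            (C * 4 ^ k * (eps n ^ 2 * (8 ^ k * ∏ e, (1 + M.ξ a e ω ^ 2) ^ (2 * k + 1)))) := by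
        intro ω
        rw [M.G_insert ha]
        set x := M.G A e ω
        set z := M.ξ a e ω with hz
        have h1 := hψ x (eps n * z) (4 ^ k * wt n x ^ k * (8 * (1 + z ^ 2) ^ 2) ^ k) (fun θ hθ => by
          have hw := wt_add_le hn x (θ * (eps n * z))
          have hw2 : wt n (θ * (eps n * z)) ≤ 8 * (1 + z ^ 2) ^ 2 := by
            refine (wt_mono hn ?_).trans (wt_eps_mul_le hn z)
            rw [abs_mul, abs_of_nonneg hθ.1]
            exact mul_le_of_le_one_left (abs_nonneg _) hθ.2
          rw [← mul_pow, ← mul_pow]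
          refine pow_le_pow_left₀ (wt_pos hn _).le (hw.trans ?_) k
          exact mul_le_mul_of_nonneg_left hw2 (by linarith [wt_pos hn x]))
        have h2 := (abs_le.1 h1).2
        rw [abs_of_nonneg hC0] at h2
        have h3 : (1 + z ^ 2) ^ (2 * k + 1) ≤ ∏ e, (1 + M.ξ a e ω ^ 2) ^ (2 * k + 1) := by
          have h4 : ∀ e, 1 ≤ (1 + M.ξ a e ω ^ 2) ^ (2 * k + 1) := fun e =>
            one_le_pow₀ (by nlinarith [sq_nonneg (M.ξ a e ω)])
          rw [← Finset.mul_prod_erase _ _ (Finset.mem_univ e)]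
          refine le_mul_of_one_le_right (by positivity) ?_
          have := Finset.prod_le_prod (s := Finset.univ.erase e) (f := fun _ => (1 : ℝ))
            (fun _ _ => zero_le_one) (fun e _ => h4 e)
          simpa using this
        have h4 : (8 * (1 + z ^ 2) ^ 2) ^ k * z ^ 2 ≤ 8 ^ k * (1 + z ^ 2) ^ (2 * k + 1) := by
          calc (8 * (1 + z ^ 2) ^ 2) ^ k * z ^ 2 = 8 ^ k * (1 + z ^ 2) ^ (2 * k) * z ^ 2 := by
                rw [mul_pow, ← pow_mul]
            _ ≤ 8 ^ k * (1 + z ^ 2) ^ (2 * k) * (1 + z ^ 2) := by gcongr; linarith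
            _ = _ := by ring
        have h5 : C * (4 ^ k * wt n x ^ k * (8 * (1 + z ^ 2) ^ 2) ^ k) * (eps n * z) ^ 2 =
            wt n x ^ k * (C * 4 ^ k * (eps n ^ 2 * ((8 * (1 + z ^ 2) ^ 2) ^ k * z ^ 2))) := by
          ring
        have h6 : wt n x ^ k * (C * 4 ^ k * (eps n ^ 2 * ((8 * (1 + z ^ 2) ^ 2) ^ k * z ^ 2))) ≤
            wt n x ^ k * (C * 4 ^ k *
              (eps n ^ 2 * (8 ^ k * ∏ e, (1 + M.ξ a e ω ^ 2) ^ (2 * k + 1)))) := by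
          have := wt_pos hn x
          have h7 := h4.trans (mul_le_mul_of_nonneg_left h3 (by positivity : (0 : ℝ) ≤ 8 ^ k))
          gcongr
        linarith
      have hprod : AllMom M.P (fun ω => ∏ e, (1 + M.ξ a e ω ^ 2) ^ (2 * k + 1)) :=
        AllMom.prod _ fun e _ => ((M.allMom_ξ a e).one_add_sq).pow _
      have hV : AllMom M.P (fun ω => C * 4 ^ k *
          (eps n ^ 2 * (8 ^ k * ∏ e, (1 + M.ξ a e ω ^ 2) ^ (2 * k + 1)))) :=
        ((hprod.const_mul (8 ^ k)).const_mul (eps n ^ 2)).const_mul (C * 4 ^ k)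
      have hw := (hG.comp_wt hn).pow k
      have i2 := hψG.mul hεξ
      have i3 := hw.mul hV
      have hI := integral_mono (((M.allMom_G (insert a A) e).comp_wt hn).pow k).integrable
        ((hw.add i2).add i3).integrable hpt
      rw [integral_add (hw.add i2).integrable i3.integrable,
        integral_add hw.integrable i2.integrable] at hI
      have j2 : ∫ ω, ψ₁ (M.G A e ω) * (eps n * M.ξ a e ω) ∂M.P = 0 := by
        rw [M.integral_mul_G_ξ ha (fun x => ψ₁ (x e)) (fun x => eps n * x e)
          (hψc.measurable.comp (measurable_pi_apply e)) ((measurable_pi_apply e).const_mul _),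
          integral_const_mul, M.mean]
        simp
      have j3 : ∫ ω, wt n (M.G A e ω) ^ k * (C * 4 ^ k *
          (eps n ^ 2 * (8 ^ k * ∏ e, (1 + M.ξ a e ω ^ 2) ^ (2 * k + 1)))) ∂M.P ≤
          (∫ ω, wt n (M.G A e ω) ^ k ∂M.P) * (κ / n) := by
        rw [M.integral_mul_G_ξ ha (fun x => wt n (x e) ^ k) (fun x => C * 4 ^ k *
          (eps n ^ 2 * (8 ^ k * ∏ e, (1 + x e ^ 2) ^ (2 * k + 1))))
          (((contDiff_wt hn).measurable.comp (measurable_pi_apply e)).pow_const _) (by fun_prop)]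
        refine mul_le_mul_of_nonneg_left ?_ (integral_nonneg fun ω => pow_nonneg (wt_pos hn _).le _)
        rw [integral_const_mul, integral_const_mul, integral_const_mul, eps_sq, hκ]
        have := hD n hn M a
        rw [div_eq_mul_inv]
        have hni : (0 : ℝ) ≤ (n : ℝ)⁻¹ := by positivity
        calc _ ≤ C * 4 ^ k * ((n : ℝ)⁻¹ * (8 ^ k * D)) := by gcongr
          _ = _ := by ring
      rw [j2] at hI
      rw [Finset.card_insert_of_notMem ha, pow_succ]
      have hκn : 0 ≤ 1 + κ / n := by positivity
      calc _ ≤ (∫ ω, wt n (M.G A e ω) ^ k ∂M.P) * (1 + κ / n) := by linarith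
        _ ≤ (2 ^ k * (1 + κ / n) ^ A.card) * (1 + κ / n) := mul_le_mul_of_nonneg_right ih hκn
        _ = _ := by ring
  refine (key A).trans (mul_le_mul_of_nonneg_left ?_ (by positivity))
  have hcard : A.card ≤ n := by simpa using A.card_le_univ
  calc (1 + κ / n) ^ A.card ≤ (1 + κ / n) ^ n :=
        pow_le_pow_right₀ (by linarith [div_nonneg hκ0 hn0.le]) hcard
    _ ≤ Real.exp (κ / n) ^ n :=
        pow_le_pow_left₀ (by positivity) (by linarith [Real.add_one_le_exp (κ / n)]) n
    _ = Real.exp κ := by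
        rw [← Real.exp_nat_mul]
        congr 1
        field_simp

theorem exists_integral_prod_wt_le (k : ℕ) : ∃ C : ℝ, 0 ≤ C ∧ ∀ n, 3 ≤ n →
    ∀ M : IndepArray E mb n, ∀ A, ∫ ω, ∏ e, wt n (M.G A e ω) ^ k ∂M.P ≤ C := by
  obtain ⟨C, hC0, hC⟩ := exists_integral_wt_le E mb (k * Fintype.card E)
  refine ⟨1 + ∑ _e : E, C, by positivity, fun n hn M A => ?_⟩
  have h1 : ∀ e, AllMom M.P (fun ω => wt n (M.G A e ω) ^ (k * Fintype.card E)) := fun e =>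
    ((M.allMom_G A e).comp_wt hn).pow _
  calc ∫ ω, ∏ e, wt n (M.G A e ω) ^ k ∂M.P
      ≤ ∫ ω, (1 + ∑ e, wt n (M.G A e ω) ^ (k * Fintype.card E)) ∂M.P := by
        refine integral_mono (AllMom.prod _ fun e _ =>
          ((M.allMom_G A e).comp_wt hn).pow _).integrable
          ((integrable_const 1).add (integrable_finsetSum _ fun e _ => (h1 e).integrable))
          fun ω => ?_
        refine (prod_le_one_add_sum_pow _ fun e => one_le_pow₀ (one_le_wt hn _)).trans ?_
        simp only [← pow_mul, le_refl]
    _ = 1 + ∑ e, ∫ ω, wt n (M.G A e ω) ^ (k * Fintype.card E) ∂M.P := by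
        rw [integral_add (integrable_const 1)
          (integrable_finsetSum _ fun e _ => (h1 e).integrable),
          integral_finsetSum _ fun e _ => (h1 e).integrable]
        simp
    _ ≤ _ := by
        gcongr with e
        exact hC n hn M A e

end Uniform

end CycleCorrelations

end

noncomputable section

namespace CycleCorrelations

/-! ### Expansion of mixed moments in a single summand. -/

/-- The Taylor polynomial of order `p` at `x`. -/
def taylorSum (g : ℝ → ℝ) (p : ℕ) (x y : ℝ) : ℝ :=
  ∑ j ∈ Finset.range p, iteratedDeriv j g x * (y ^ j / j !)

/-- The product form of the bounds is needed for integration: `x` will be a partial sum and `y` an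
independent increment. -/
theorem exists_taylor_bound {F : ℕ → ℝ → ℝ} (hF : Adm F) (p : ℕ) :
    ∃ K : ℕ, ∀ n, 3 ≤ n → ∀ x y, |F n (x + y)| ≤ K * (wt n x * wt n y) ^ K ∧
      |taylorSum (F n) p x y| ≤ K * (wt n x * wt n y) ^ K ∧
      |F n (x + y) - taylorSum (F n) p x y| ≤ |y| ^ p * (K * (wt n x * wt n y) ^ K) := by
  choose C hC using hF.dom
  set D := ∑ j ∈ Finset.range (p + 1), C j with hD
  have hCD : ∀ j ≤ p, ∀ n, 3 ≤ n → ∀ x, |iteratedDeriv j (F n) x| ≤ D * wt n x ^ D := by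
    intro j hj n hn x
    have h1 : C j ≤ D := Finset.single_le_sum (f := C) (fun _ _ => Nat.zero_le _)
      (Finset.mem_range.2 (by omega))
    refine (hC j n hn x).trans ?_
    have := one_le_wt hn x
    have h2 : (C j : ℝ) ≤ D := by exact_mod_cast h1
    gcongr
  set K := D * 4 ^ D + D * p + D + p with hK
  refine ⟨K, fun n hn x y => ?_⟩
  have hx := one_le_wt hn x
  have hy := one_le_wt hn y
  have hxy : 1 ≤ wt n x * wt n y := by nlinarith
  have hKD : D + p ≤ K := by
    rw [hK]
    have := Nat.zero_le (D * 4 ^ D + D * p)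
    omega
  have hpow : (wt n x * wt n y) ^ (D + p) ≤ (wt n x * wt n y) ^ K := pow_le_pow_right₀ hxy hKD
  have hB : ∀ z, wt n z ≤ 4 * wt n x * wt n y → (D : ℝ) * wt n z ^ D ≤
      K * (wt n x * wt n y) ^ K := by
    intro z hz
    have h1 : wt n z ^ D ≤ 4 ^ D * (wt n x * wt n y) ^ (D + p) := by
      calc wt n z ^ D ≤ (4 * (wt n x * wt n y)) ^ D :=
            pow_le_pow_left₀ (wt_pos hn z).le (by linarith) D
        _ = 4 ^ D * (wt n x * wt n y) ^ D := mul_pow _ _ _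
        _ ≤ _ := by gcongr; omega
    have h2 : (D : ℝ) * 4 ^ D ≤ K := by
      rw [hK]; push_cast
      have : (0 : ℝ) ≤ D * p + D + p := by positivity
      linarith
    calc (D : ℝ) * wt n z ^ D ≤ D * (4 ^ D * (wt n x * wt n y) ^ (D + p)) := by gcongr
      _ = (D * 4 ^ D) * (wt n x * wt n y) ^ (D + p) := by ring
      _ ≤ _ := by gcongr
  refine ⟨?_, ?_, ?_⟩
  · refine le_trans ?_ (hB _ (wt_add_le hn x y))
    simpa using hCD 0 (Nat.zero_le _) n hn (x + y)
  · unfold taylorSum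
    refine (Finset.abs_sum_le_sum_abs _ _).trans ?_
    have h1 : ∀ j ∈ Finset.range p, |iteratedDeriv j (F n) x * (y ^ j / j !)| ≤
        D * (wt n x * wt n y) ^ (D + p) := by
      intro j hj
      have hjp := Finset.mem_range.1 hj
      rw [abs_mul, abs_div, abs_pow, Nat.abs_cast]
      have e1 : |y| ^ j / (j ! : ℝ) ≤ wt n y ^ (D + p) := by
        refine (div_le_self (by positivity)
          (by exact_mod_cast Nat.succ_le_of_lt (Nat.factorial_pos j))).trans ?_
        refine (pow_le_pow_left₀ (abs_nonneg _) (abs_le_wt hn y) j).trans ?_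
        exact pow_le_pow_right₀ hy (by omega)
      have e2 : |iteratedDeriv j (F n) x| ≤ D * wt n x ^ (D + p) := by
        refine (hCD j hjp.le n hn x).trans ?_
        gcongr
        omega
      calc _ ≤ (D * wt n x ^ (D + p)) * wt n y ^ (D + p) :=
            mul_le_mul e2 e1 (by positivity) (by positivity)
        _ = _ := by rw [mul_pow]; ring
    refine (Finset.sum_le_sum h1).trans ?_
    rw [Finset.sum_const, Finset.card_range, nsmul_eq_mul, ← mul_assoc]
    have h2 : (p : ℝ) * D ≤ K := by
      rw [hK]; push_cast
      have : (0 : ℝ) ≤ D * 4 ^ D + D + p := by positivity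
      linarith
    gcongr
  · have h1 := abs_sub_taylor_le p (F n) (hF.smooth n) x y (K * (wt n x * wt n y) ^ K)
      fun θ hθ => by
        refine (hCD p le_rfl n hn _).trans (hB _ ?_)
        refine (wt_add_le hn _ _).trans ?_
        have : wt n (θ * y) ≤ wt n y := wt_mono hn (by
          rw [abs_mul, abs_of_nonneg hθ.1]
          exact mul_le_of_le_one_left (abs_nonneg _) hθ.2)
        gcongr
    rw [mul_comm (|y| ^ p)]
    refine le_trans (le_of_eq ?_) h1
    unfold taylorSum
    simp only [mul_div_assoc]

section Uniform

variable {E : Type} [Fintype E] [DecidableEq E] (mb : ℕ → ℝ)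

theorem exists_taylor_bound_family {F : E → ℕ → ℝ → ℝ} (hF : ∀ e, Adm (F e)) (p : ℕ) :
    ∃ K : ℕ, ∀ n, 3 ≤ n → ∀ e x y, |F e n (x + y)| ≤ K * (wt n x * wt n y) ^ K ∧
      |taylorSum (F e n) p x y| ≤ K * (wt n x * wt n y) ^ K ∧
      |F e n (x + y) - taylorSum (F e n) p x y| ≤ |y| ^ p * (K * (wt n x * wt n y) ^ K) := by
  choose K hK using fun e => exists_taylor_bound (hF e) p
  refine ⟨∑ e, K e, fun n hn e x y => ?_⟩
  have hle : K e ≤ ∑ e, K e :=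
    Finset.single_le_sum (f := K) (fun _ _ => Nat.zero_le _) (Finset.mem_univ e)
  have hx := one_le_wt hn x
  have hy := one_le_wt hn y
  have hxy : 1 ≤ wt n x * wt n y := by nlinarith
  have h1 : (K e : ℝ) * (wt n x * wt n y) ^ (K e) ≤
      (∑ e, K e : ℕ) * (wt n x * wt n y) ^ (∑ e, K e) := by
    have : (K e : ℝ) ≤ (∑ e, K e : ℕ) := by exact_mod_cast hle
    gcongr
  obtain ⟨a, b, c⟩ := hK e n hn x y
  exact ⟨a.trans h1, b.trans h1, c.trans (mul_le_mul_of_nonneg_left h1 (by positivity))⟩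

theorem exists_abs_integral_prod_pow_le (N : ℕ) : ∃ C : ℝ, 0 ≤ C ∧ ∀ n, 3 ≤ n →
    ∀ M : IndepArray E mb n, ∀ a, ∀ t : E → ℕ, (∀ e, t e ≤ N) →
      |∫ ω, ∏ e, M.ξ a e ω ^ t e ∂M.P| ≤ C := by
  obtain ⟨C, hC0, hC⟩ := exists_integral_prod_ξ_le E mb N
  refine ⟨C, hC0, fun n hn M a t ht => ?_⟩
  refine le_trans ?_ (hC n hn M a)
  rw [← Real.norm_eq_abs]
  refine norm_integral_le_of_norm_le
    (AllMom.prod _ fun e _ => ((M.allMom_ξ a e).one_add_sq).pow N).integrable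
    (Filter.Eventually.of_forall fun ω => ?_)
  rw [Real.norm_eq_abs, Finset.abs_prod]
  refine Finset.prod_le_prod (fun _ _ => abs_nonneg _) fun e _ => ?_
  rw [abs_pow]
  have h1 : |M.ξ a e ω| ≤ 1 + M.ξ a e ω ^ 2 := by
    rw [← sq_abs]; nlinarith [sq_nonneg (|M.ξ a e ω| - 1), abs_nonneg (M.ξ a e ω)]
  exact (pow_le_pow_left₀ (abs_nonneg _) h1 _).trans
    (pow_le_pow_right₀ (by nlinarith [sq_nonneg (M.ξ a e ω)]) (ht e))

/-- Mixed moments of functions of the partial sums. -/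
def IndepArray.mom {n : ℕ} (M : IndepArray E mb n) (A : Finset (Fin n)) (F : E → ℕ → ℝ → ℝ) : ℝ :=
  ∫ ω, ∏ e, F e n (M.G A e ω) ∂M.P

theorem exists_abs_mom_le {F : E → ℕ → ℝ → ℝ} (hF : ∀ e, Adm (F e)) : ∃ C : ℝ, 0 ≤ C ∧
    ∀ n, 3 ≤ n → ∀ M : IndepArray E mb n, ∀ A, |M.mom mb A F| ≤ C := by
  choose K hK using fun e => (hF e).dom_self
  obtain ⟨C, hC0, hC⟩ := exists_integral_prod_wt_le E mb (∑ e, K e)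
  refine ⟨(∏ e, (K e : ℝ)) * C, by positivity, fun n hn M A => ?_⟩
  unfold IndepArray.mom
  refine le_trans ?_ (mul_le_mul_of_nonneg_left (hC n hn M A) (by positivity))
  rw [← integral_const_mul, ← Real.norm_eq_abs]
  refine norm_integral_le_of_norm_le ((AllMom.prod _ fun e _ =>
    ((M.allMom_G A e).comp_wt hn).pow _).const_mul _).integrable
    (Filter.Eventually.of_forall fun ω => ?_)
  rw [Real.norm_eq_abs, Finset.abs_prod, ← Finset.prod_mul_distrib]
  refine Finset.prod_le_prod (fun _ _ => abs_nonneg _) fun e _ => ?_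
  refine (hK e n hn _).trans ?_
  have h1 := one_le_wt hn (M.G A e ω)
  gcongr
  exact Finset.single_le_sum (f := K) (fun _ _ => Nat.zero_le _) (Finset.mem_univ e)

/-- Expansion of the mixed moments in one of the summands. -/
theorem exists_expansion {F : E → ℕ → ℝ → ℝ} (hF : ∀ e, Adm (F e)) (p : ℕ) (t : E → ℕ) :
    ∃ C : ℝ, 0 ≤ C ∧ ∀ n, 3 ≤ n → ∀ M : IndepArray E mb n, ∀ A : Finset (Fin n), ∀ a, a ∉ A →
      |∫ ω, (∏ e, M.ξ a e ω ^ t e) * ∏ e, F e n (M.G A e ω + eps n * M.ξ a e ω) ∂M.P -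
        ∑ j ∈ Fintype.piFinset fun _ : E => Finset.range p,
          (∏ e, eps n ^ j e / (j e)!) * (∫ ω, ∏ e, M.ξ a e ω ^ (t e + j e) ∂M.P) *
            M.mom mb A fun e n => iteratedDeriv (j e) (F e n)| ≤ C * eps n ^ p := by
  obtain ⟨K, hK⟩ := exists_taylor_bound_family hF p
  -- The power of the summand in the remainder: `∑ t` from the prefactor, `p` from the Taylor
  -- remainder, and `2 * K` from `wt_eps_mul_le` applied to the `K`-th power of the weight.
  set N : ℕ := ∑ e, t e + p + 2 * K with hN
  obtain ⟨C₁, hC₁0, hC₁⟩ := exists_integral_prod_wt_le E mb K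
  obtain ⟨C₂, hC₂0, hC₂⟩ := exists_integral_prod_ξ_le E mb N
  set c : ℝ := (Fintype.card E : ℝ) * (∏ _e : E, (K : ℝ) * 8 ^ K) with hc
  refine ⟨C₁ * (c * C₂), by positivity, fun n hn M A a ha => ?_⟩
  have hε := eps_nonneg n
  set S : M.Ω → ℝ := fun ω => ∏ e, M.ξ a e ω ^ t e with hS
  have hmain : ∫ ω, S ω * ∏ e, taylorSum (F e n) p (M.G A e ω) (eps n * M.ξ a e ω) ∂M.P =
      ∑ j ∈ Fintype.piFinset fun _ : E => Finset.range p,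
          (∏ e, eps n ^ j e / (j e)!) * (∫ ω, ∏ e, M.ξ a e ω ^ (t e + j e) ∂M.P) *
            M.mom mb A fun e n => iteratedDeriv (j e) (F e n) := by
    have e1 : ∀ ω, S ω * ∏ e, taylorSum (F e n) p (M.G A e ω) (eps n * M.ξ a e ω) =
        ∑ j ∈ Fintype.piFinset fun _ : E => Finset.range p, (∏ e, eps n ^ j e / (j e)!) *
          ((∏ e, iteratedDeriv (j e) (F e n) (M.G A e ω)) * ∏ e, M.ξ a e ω ^ (t e + j e)) := by
      intro ω
      simp only [taylorSum, hS]
      rw [Finset.prod_univ_sum, Finset.mul_sum]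
      refine Finset.sum_congr rfl fun j _ => ?_
      rw [← Finset.prod_mul_distrib, ← Finset.prod_mul_distrib, ← Finset.prod_mul_distrib]
      refine Finset.prod_congr rfl fun e _ => ?_
      rw [mul_pow, pow_add]
      ring
    have hi : ∀ j : E → ℕ, Integrable (fun ω => (∏ e, eps n ^ j e / ((j e)! : ℝ)) *
        ((∏ e, iteratedDeriv (j e) (F e n) (M.G A e ω)) * ∏ e, M.ξ a e ω ^ (t e + j e))) M.P :=
      fun j => (((AllMom.prod _ fun e _ =>
        (M.allMom_G A e).comp_adm ((hF e).iteratedDeriv (j e)) hn).mul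
        (AllMom.prod _ fun e _ => (M.allMom_ξ a e).pow _)).const_mul _).integrable
    simp only [e1]
    rw [integral_finsetSum _ fun j _ => hi j]
    refine Finset.sum_congr rfl fun j _ => ?_
    rw [integral_const_mul, M.integral_mul_G_ξ ha
      (fun x => ∏ e, iteratedDeriv (j e) (F e n) (x e)) (fun x => ∏ e, x e ^ (t e + j e))
      (Finset.measurable_prod _ fun e _ => (((hF e).iteratedDeriv (j e)).continuous n).measurable.comp
        (measurable_pi_apply e)) (by fun_prop)]
    unfold IndepArray.mom
    ring
  have hSa : AllMom M.P S := AllMom.prod _ fun e _ => (M.allMom_ξ a e).pow _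
  have hFa : AllMom M.P (fun ω => ∏ e, F e n (M.G A e ω + eps n * M.ξ a e ω)) :=
    AllMom.prod _ fun e _ => ((M.allMom_G A e).add ((M.allMom_ξ a e).const_mul _)).comp_adm
      (hF e) hn
  have hTa : AllMom M.P (fun ω => ∏ e, taylorSum (F e n) p (M.G A e ω) (eps n * M.ξ a e ω)) := by
    refine AllMom.prod _ fun e _ => AllMom.sum _ fun j _ => ?_
    refine ((M.allMom_G A e).comp_adm ((hF e).iteratedDeriv j) hn).mul ?_
    simpa only [div_eq_inv_mul] using
      (((M.allMom_ξ a e).const_mul (eps n)).pow j).const_mul ((j ! : ℝ)⁻¹)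
  rw [← hmain, ← integral_sub (hSa.mul hFa).integrable (hSa.mul hTa).integrable,
    ← Real.norm_eq_abs]
  have hpt : ∀ ω, ‖S ω * ∏ e, F e n (M.G A e ω + eps n * M.ξ a e ω) -
      S ω * ∏ e, taylorSum (F e n) p (M.G A e ω) (eps n * M.ξ a e ω)‖ ≤
      eps n ^ p * ((∏ e, wt n (M.G A e ω) ^ K) * (c * ∏ e, (1 + M.ξ a e ω ^ 2) ^ N)) := by
    intro ω
    rw [← mul_sub, Real.norm_eq_abs, abs_mul]
    have h1 : ∀ e, 1 ≤ 1 + M.ξ a e ω ^ 2 := fun e => by nlinarith [sq_nonneg (M.ξ a e ω)]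
    have hξ : ∀ e, |M.ξ a e ω| ≤ 1 + M.ξ a e ω ^ 2 := fun e => by
      rw [← sq_abs]; nlinarith [sq_nonneg (|M.ξ a e ω| - 1), abs_nonneg (M.ξ a e ω)]
    have hd := abs_prod_sub_prod_le Finset.univ
      (fun e => F e n (M.G A e ω + eps n * M.ξ a e ω))
      (fun e => taylorSum (F e n) p (M.G A e ω) (eps n * M.ξ a e ω))
      (fun e => K * (wt n (M.G A e ω) * wt n (eps n * M.ξ a e ω)) ^ K)
      (fun e => |eps n * M.ξ a e ω| ^ p)
      (fun e _ => by
        have := wt_pos hn (M.G A e ω); have := wt_pos hn (eps n * M.ξ a e ω); positivity)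
      (fun e _ => by positivity) (fun e _ => (hK n hn e _ _).1) (fun e _ => (hK n hn e _ _).2.1)
      (fun e _ => (hK n hn e _ _).2.2)
    have hS1 : |S ω| ≤ ∏ e, (1 + M.ξ a e ω ^ 2) ^ (∑ e, t e) := by
      rw [hS, Finset.abs_prod]
      refine Finset.prod_le_prod (fun _ _ => abs_nonneg _) fun e _ => ?_
      rw [abs_pow]
      exact (pow_le_pow_left₀ (abs_nonneg _) (hξ e) _).trans (pow_le_pow_right₀ (h1 e)
        (Finset.single_le_sum (f := t) (fun _ _ => Nat.zero_le _) (Finset.mem_univ e)))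
    have hsum : ∑ e, |eps n * M.ξ a e ω| ^ p ≤
        eps n ^ p * (Fintype.card E * ∏ e, (1 + M.ξ a e ω ^ 2) ^ p) := by
      have : ∀ e ∈ (Finset.univ : Finset E), |eps n * M.ξ a e ω| ^ p ≤
          eps n ^ p * ∏ e, (1 + M.ξ a e ω ^ 2) ^ p := by
        intro e _
        rw [abs_mul, abs_of_nonneg hε, mul_pow]
        refine mul_le_mul_of_nonneg_left ?_ (by positivity)
        rw [← Finset.mul_prod_erase _ _ (Finset.mem_univ e)]
        have h3 := Finset.prod_le_prod (s := Finset.univ.erase e) (f := fun _ => (1 : ℝ))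
            (fun _ _ => zero_le_one) (fun e _ => one_le_pow₀ (n := p) (h1 e))
        rw [Finset.prod_const_one] at h3
        exact (pow_le_pow_left₀ (abs_nonneg _) (hξ e) p).trans
          (le_mul_of_one_le_right (by have := h1 e; positivity) h3)
      refine (Finset.sum_le_sum this).trans (le_of_eq ?_)
      rw [Finset.sum_const, Finset.card_univ, nsmul_eq_mul]
      ring
    have hprod : ∏ e, (K : ℝ) * (wt n (M.G A e ω) * wt n (eps n * M.ξ a e ω)) ^ K ≤
        (∏ e, wt n (M.G A e ω) ^ K) * ((∏ _e : E, (K : ℝ) * 8 ^ K) *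
          ∏ e, (1 + M.ξ a e ω ^ 2) ^ (2 * K)) := by
      rw [← Finset.prod_mul_distrib, ← Finset.prod_mul_distrib]
      refine Finset.prod_le_prod (fun e _ => by
        have := wt_pos hn (M.G A e ω); have := wt_pos hn (eps n * M.ξ a e ω); positivity)
        fun e _ => ?_
      have e1 := pow_le_pow_left₀ (wt_pos hn _).le (wt_eps_mul_le hn (M.ξ a e ω)) K
      rw [mul_pow, ← pow_mul] at e1
      have e2 := wt_pos hn (M.G A e ω)
      calc _ = K * (wt n (M.G A e ω) ^ K * wt n (eps n * M.ξ a e ω) ^ K) := by rw [mul_pow]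
        _ ≤ K * (wt n (M.G A e ω) ^ K * (8 ^ K * (1 + M.ξ a e ω ^ 2) ^ (2 * K))) := by gcongr
        _ = _ := by ring
    have hnn : 0 ≤ ∏ e, (K : ℝ) * (wt n (M.G A e ω) * wt n (eps n * M.ξ a e ω)) ^ K :=
      Finset.prod_nonneg fun e _ => by
        have := wt_pos hn (M.G A e ω); have := wt_pos hn (eps n * M.ξ a e ω); positivity
    have hA : 0 ≤ ∏ e, (1 + M.ξ a e ω ^ 2) ^ (∑ e, t e) :=
      Finset.prod_nonneg fun e _ => by positivity
    have hB : 0 ≤ ∏ e, (1 + M.ξ a e ω ^ 2) ^ p := Finset.prod_nonneg fun e _ => by positivity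
    calc |S ω| * |∏ e, F e n (M.G A e ω + eps n * M.ξ a e ω) -
          ∏ e, taylorSum (F e n) p (M.G A e ω) (eps n * M.ξ a e ω)|
        ≤ (∏ e, (1 + M.ξ a e ω ^ 2) ^ (∑ e, t e)) *
          ((eps n ^ p * (Fintype.card E * ∏ e, (1 + M.ξ a e ω ^ 2) ^ p)) *
          ((∏ e, wt n (M.G A e ω) ^ K) * ((∏ _e : E, (K : ℝ) * 8 ^ K) *
          ∏ e, (1 + M.ξ a e ω ^ 2) ^ (2 * K)))) :=
          mul_le_mul hS1 (hd.trans (mul_le_mul hsum hprod hnn (by positivity))) (abs_nonneg _) hA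
      _ = _ := by
        have : ∏ e, (1 + M.ξ a e ω ^ 2) ^ N = (∏ e, (1 + M.ξ a e ω ^ 2) ^ (∑ e, t e)) *
            (∏ e, (1 + M.ξ a e ω ^ 2) ^ p) * ∏ e, (1 + M.ξ a e ω ^ 2) ^ (2 * K) := by
          rw [← Finset.prod_mul_distrib, ← Finset.prod_mul_distrib]
          refine Finset.prod_congr rfl fun e _ => ?_
          rw [hN, pow_add, pow_add]
        rw [this, hc]
        ring
  have hU : AllMom M.P (fun ω => ∏ e, wt n (M.G A e ω) ^ K) :=
    AllMom.prod _ fun e _ => ((M.allMom_G A e).comp_wt hn).pow K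
  have hV : AllMom M.P (fun ω => c * ∏ e, (1 + M.ξ a e ω ^ 2) ^ N) :=
    (AllMom.prod _ fun e _ => ((M.allMom_ξ a e).one_add_sq).pow N).const_mul c
  refine (norm_integral_le_of_norm_le ((hU.mul hV).const_mul (eps n ^ p)).integrable
    (Filter.Eventually.of_forall hpt)).trans ?_
  rw [integral_const_mul, M.integral_mul_G_ξ ha (fun x => ∏ e, wt n (x e) ^ K)
    (fun x => c * ∏ e, (1 + x e ^ 2) ^ N)
    (Finset.measurable_prod _ fun e _ =>
      ((contDiff_wt hn).measurable.comp (measurable_pi_apply e)).pow_const _) (by fun_prop),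
    integral_const_mul, mul_comm]
  refine mul_le_mul_of_nonneg_right ?_ (by positivity)
  have hc0 : 0 ≤ c := by positivity
  have h2 : 0 ≤ ∫ ω, ∏ e, (1 + M.ξ a e ω ^ 2) ^ N ∂M.P :=
    integral_nonneg fun ω => Finset.prod_nonneg fun e _ => by positivity
  exact mul_le_mul (hC₁ n hn M A) (mul_le_mul_of_nonneg_left (hC₂ n hn M a) hc0)
    (mul_nonneg hc0 h2) hC₁0

end Uniform

end CycleCorrelations

end

noncomputable section

namespace CycleCorrelations

/-! ### Stein's method for mixed moments. -/

section Stein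

variable {E : Type} [Fintype E] [DecidableEq E] (mb : ℕ → ℝ)

theorem prod_pow_single (x : E → ℝ) (e : E) : ∏ e', x e' ^ (Pi.single e 1 : E → ℕ) e' = x e := by
  rw [Finset.prod_eq_single e]
  · simp
  · intro e' _ h
    simp [Pi.single_eq_of_ne h]
  · simp

theorem eq_single_of_sum_eq_one {j : E → ℕ} (h : ∑ e, j e = 1) : ∃ e, j = Pi.single e 1 := by
  have h1 : ∃ e, j e ≠ 0 := by
    by_contra hcon
    push Not at hcon
    simp [hcon] at h
  obtain ⟨e, he⟩ := h1
  refine ⟨e, ?_⟩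
  rw [← Finset.add_sum_erase _ _ (Finset.mem_univ e)] at h
  have h2 : ∑ e ∈ Finset.univ.erase e, j e = 0 := by omega
  rw [Finset.sum_eq_zero_iff] at h2
  ext e'
  by_cases hee : e' = e
  · subst hee; rw [Pi.single_eq_same]; omega
  · rw [Pi.single_eq_of_ne hee]
    exact h2 e' (by simp [hee])

theorem abs_prod_eps_le {n : ℕ} (hn : 3 ≤ n) (j : E → ℕ) {k : ℕ} (hk : k ≤ ∑ e, j e) :
    |∏ e, eps n ^ j e / ((j e)! : ℝ)| ≤ eps n ^ k := by
  have hε := eps_nonneg n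
  rw [Finset.abs_prod]
  calc ∏ e, |eps n ^ j e / ((j e)! : ℝ)| ≤ ∏ e, eps n ^ j e := by
        refine Finset.prod_le_prod (fun _ _ => abs_nonneg _) fun e _ => ?_
        rw [abs_of_nonneg (by positivity)]
        exact div_le_self (by positivity)
          (by exact_mod_cast Nat.succ_le_of_lt (Nat.factorial_pos (j e)))
    _ = eps n ^ ∑ e, j e := Finset.prod_pow_eq_pow_sum _ _ _
    _ ≤ _ := pow_le_pow_of_le_one hε (eps_le_one hn) hk

theorem mom_update_add {n : ℕ} (hn : 3 ≤ n) (M : IndepArray E mb n) (A : Finset (Fin n))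
    {F : E → ℕ → ℝ → ℝ} (hF : ∀ e, Adm (F e)) (e₀ : E) {u v : ℕ → ℝ → ℝ} (hu : Adm u)
    (hv : Adm v) :
    M.mom mb A (Function.update F e₀ fun n x => u n x - v n x) =
      M.mom mb A (Function.update F e₀ u) - M.mom mb A (Function.update F e₀ v) := by
  have hup : ∀ w : ℕ → ℝ → ℝ, Adm w → ∀ e, Adm (Function.update F e₀ w e) := by
    intro w hw e
    by_cases h : e = e₀
    · subst h; simpa using hw
    · simpa [Function.update_of_ne h] using hF e
  have hint : ∀ w : ℕ → ℝ → ℝ, Adm w →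
      Integrable (fun ω => ∏ e, Function.update F e₀ w e n (M.G A e ω)) M.P := fun w hw =>
    (AllMom.prod _ fun e _ => (M.allMom_G A e).comp_adm (hup w hw e) hn).integrable
  unfold IndepArray.mom
  rw [← integral_sub (hint u hu) (hint v hv)]
  congr 1
  ext ω
  have : ∀ w : ℕ → ℝ → ℝ, ∏ e, Function.update F e₀ w e n (M.G A e ω) =
      w n (M.G A e₀ ω) * ∏ e ∈ Finset.univ.erase e₀, F e n (M.G A e ω) := by
    intro w
    rw [← Finset.mul_prod_erase _ _ (Finset.mem_univ e₀), Function.update_self]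
    congr 1
    exact Finset.prod_congr rfl fun e he => by rw [Function.update_of_ne (Finset.ne_of_mem_erase he)]
  rw [this, this, this]
  ring

/-- The extra factor is the sum `G = ε ∑ ξ a` itself. It is distributed over its summands, and in
each term the same summand is split off from the remaining factors, ready for expansion. -/
theorem mom_update_id_mul {n : ℕ} (hn : 3 ≤ n) (M : IndepArray E mb n) (A : Finset (Fin n))
    {F : E → ℕ → ℝ → ℝ} (hF : ∀ e, Adm (F e)) (e₀ : E) :
    M.mom mb A (Function.update F e₀ fun n x => x * F e₀ n x) = ∑ a ∈ A, eps n *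
      ∫ ω, (∏ e, M.ξ a e ω ^ (Pi.single e₀ 1 : E → ℕ) e) *
        ∏ e, F e n (M.G (A.erase a) e ω + eps n * M.ξ a e ω) ∂M.P := by
  unfold IndepArray.mom
  simp only [prod_pow_single (fun e => M.ξ _ e _) e₀]
  have h1 : ∀ ω, ∏ e, Function.update F e₀ (fun n x => x * F e₀ n x) e n (M.G A e ω) =
      ∑ a ∈ A, eps n * (M.ξ a e₀ ω * ∏ e, F e n (M.G (A.erase a) e ω + eps n * M.ξ a e ω)) := by
    intro ω
    have e1 : ∀ a ∈ A, eps n * (M.ξ a e₀ ω *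
        ∏ e, F e n (M.G (A.erase a) e ω + eps n * M.ξ a e ω)) =
        (eps n * M.ξ a e₀ ω) * ∏ e, F e n (M.G A e ω) := by
      intro a ha
      rw [mul_assoc]
      congr 2
      refine Finset.prod_congr rfl fun e _ => ?_
      rw [← M.G_insert (Finset.notMem_erase a A), Finset.insert_erase ha]
    rw [Finset.sum_congr rfl e1, ← Finset.sum_mul, ← Finset.mul_sum]
    rw [← Finset.mul_prod_erase _ _ (Finset.mem_univ e₀), Function.update_self,
      ← Finset.mul_prod_erase _ (fun e => F e n (M.G A e ω)) (Finset.mem_univ e₀), ← mul_assoc]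
    congr 1
    exact Finset.prod_congr rfl fun e he => by rw [Function.update_of_ne (Finset.ne_of_mem_erase he)]
  simp only [h1]
  rw [integral_finsetSum]
  · exact Finset.sum_congr rfl fun a _ => integral_const_mul _ _
  · intro a _
    exact (((M.allMom_ξ a e₀).mul (AllMom.prod _ fun e _ => ((M.allMom_G _ e).add
      ((M.allMom_ξ a e).const_mul _)).comp_adm (hF e) hn)).const_mul _).integrable

/-- One step of Stein's method. -/
theorem exists_stein_step {F : E → ℕ → ℝ → ℝ} (hF : ∀ e, Adm (F e)) (e₀ : E) {p : ℕ} (hp : 2 ≤ p)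
    (R : ℕ) : ∃ C : ℝ, 0 ≤ C ∧ ∀ n, 3 ≤ n → ∀ M : IndepArray E mb n, ∀ A : Finset (Fin n),
      n ≤ A.card + R → ∀ b : ℝ,
      (∀ a ∈ A, ∀ j ∈ Fintype.piFinset fun _ : E => Finset.range p,
        |M.mom mb (A.erase a) fun e n => iteratedDeriv (j e) (F e n)| ≤ b) →
      (∀ a ∈ A, ∀ j ∈ Fintype.piFinset fun _ : E => Finset.range p,
        |M.mom mb (A.erase a) fun e n =>
          iteratedDeriv (j e) (Function.update F e₀ (fun n => deriv (F e₀ n)) e n)| ≤ b) →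
      |M.mom mb A (Function.update F e₀ fun n => deriv (F e₀ n))| ≤ b →
      |M.mom mb A (Function.update F e₀ fun n x => x * F e₀ n x - deriv (F e₀ n) x)| ≤
        C * (eps n * b + eps n ^ (p - 1)) := by
  set D : E → ℕ → ℝ → ℝ := Function.update F e₀ fun n => deriv (F e₀ n) with hDdef
  have hD : ∀ e, Adm (D e) := by
    intro e
    by_cases h : e = e₀
    · subst h; simpa [hDdef] using (hF e).deriv
    · simpa [hDdef, Function.update_of_ne h] using hF e
  obtain ⟨C₁, hC₁0, hC₁⟩ := exists_expansion mb hF p (Pi.single e₀ 1)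
  obtain ⟨C₂, hC₂0, hC₂⟩ := exists_expansion mb hD p 0
  obtain ⟨C₃, hC₃0, hC₃⟩ := exists_abs_integral_prod_pow_le (E := E) mb (p + 1)
  set J := Fintype.piFinset fun _ : E => Finset.range p with hJ
  refine ⟨2 * (J.card * C₃) + (C₁ + C₂) + R, by positivity, fun n hn M A hA b hb1 hb2 hb3 => ?_⟩
  have hε := eps_nonneg n
  have hε1 := eps_le_one hn
  have hnε := mul_eps_sq hn
  have hb0 : 0 ≤ b := (abs_nonneg _).trans hb3
  set ε := eps n with hεdef
  set j₁ : E → ℕ := Pi.single e₀ 1 with hj₁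
  have hj₁J : j₁ ∈ J := by
    rw [hJ, Fintype.mem_piFinset]
    intro e
    rw [Finset.mem_range]
    by_cases h : e = e₀
    · subst h; simp [hj₁]; omega
    · rw [hj₁, Pi.single_eq_of_ne h]; omega
  have h0J : (0 : E → ℕ) ∈ J := by
    rw [hJ, Fintype.mem_piFinset]
    intro e
    simp; omega
  have hexpJ : ∀ j ∈ J, ∀ t : E → ℕ, (∀ e, t e ≤ 1) → ∀ a,
      |∫ ω, ∏ e, M.ξ a e ω ^ (t e + j e) ∂M.P| ≤ C₃ := fun j hj t ht a =>
    hC₃ n hn M a (fun e => t e + j e) fun e => by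
      have := Finset.mem_range.1 (Fintype.mem_piFinset.1 hj e)
      have := ht e
      omega
  -- In the expansion with the prefactor `ξ a e₀`, degree zero vanishes by the mean and degree one
  -- by the covariance, except in direction `e₀`, where it gives `ε` times the moment with the
  -- derivative. All further terms carry `ε²`.
  have hX : ∀ a ∈ A, |∫ ω, (∏ e, M.ξ a e ω ^ j₁ e) *
        ∏ e, F e n (M.G (A.erase a) e ω + ε * M.ξ a e ω) ∂M.P - ε * M.mom mb (A.erase a) D| ≤
      J.card * C₃ * (ε ^ 2 * b) + C₁ * ε ^ p := by
    intro a ha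
    have h1 := hC₁ n hn M (A.erase a) a (Finset.notMem_erase a A)
    rw [← Finset.add_sum_erase J _ hj₁J] at h1
    have h2 : (∏ e, eps n ^ j₁ e / ((j₁ e)! : ℝ)) * (∫ ω, ∏ e, M.ξ a e ω ^ (j₁ e + j₁ e) ∂M.P) *
        (M.mom mb (A.erase a) fun e n => iteratedDeriv (j₁ e) (F e n)) =
        ε * M.mom mb (A.erase a) D := by
      have e1 : (∏ e, eps n ^ j₁ e / ((j₁ e)! : ℝ)) = ε := by
        rw [Finset.prod_div_distrib, prod_pow_single (fun _ => eps n) e₀]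
        have : ∀ e, ((j₁ e)! : ℝ) = 1 := fun e => by
          by_cases h : e = e₀
          · subst h; simp [hj₁]
          · rw [hj₁, Pi.single_eq_of_ne h]; simp
        simp [this, hεdef]
      have e2 : ∫ ω, ∏ e, M.ξ a e ω ^ (j₁ e + j₁ e) ∂M.P = 1 := by
        have : ∀ ω, ∏ e, M.ξ a e ω ^ (j₁ e + j₁ e) = M.ξ a e₀ ω * M.ξ a e₀ ω := fun ω => by
          simp only [pow_add, Finset.prod_mul_distrib]
          rw [prod_pow_single (fun e => M.ξ a e ω) e₀]
        simp only [this]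
        rw [M.cov, if_pos rfl]
      have e3 : (fun e n => iteratedDeriv (j₁ e) (F e n)) = D := by
        ext e n x
        by_cases h : e = e₀
        · subst h; simp [hj₁, hDdef]
        · rw [hj₁, Pi.single_eq_of_ne h, hDdef, Function.update_of_ne h]; simp
      rw [e1, e2, e3, mul_one]
    rw [h2] at h1
    have h3 : |∑ j ∈ J.erase j₁, (∏ e, eps n ^ j e / ((j e)! : ℝ)) *
        (∫ ω, ∏ e, M.ξ a e ω ^ (j₁ e + j e) ∂M.P) *
        M.mom mb (A.erase a) fun e n => iteratedDeriv (j e) (F e n)| ≤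
        J.card * C₃ * (ε ^ 2 * b) := by
      refine (Finset.abs_sum_le_sum_abs _ _).trans ?_
      have hterm : ∀ j ∈ J.erase j₁, |(∏ e, eps n ^ j e / ((j e)! : ℝ)) *
          (∫ ω, ∏ e, M.ξ a e ω ^ (j₁ e + j e) ∂M.P) *
          M.mom mb (A.erase a) fun e n => iteratedDeriv (j e) (F e n)| ≤ C₃ * (ε ^ 2 * b) := by
        intro j hj
        have hjJ := Finset.mem_of_mem_erase hj
        by_cases hs : 2 ≤ ∑ e, j e
        · rw [abs_mul, abs_mul]
          have f1 := abs_prod_eps_le hn j hs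
          have f2 := hexpJ j hjJ j₁ (fun e => by
            by_cases h : e = e₀
            · subst h; simp [hj₁]
            · rw [hj₁, Pi.single_eq_of_ne h]; omega) a
          have f3 := hb1 a ha j hjJ
          calc _ ≤ (ε ^ 2 * C₃) * b := mul_le_mul (mul_le_mul f1 f2 (abs_nonneg _)
                (by positivity)) f3 (abs_nonneg _) (by positivity)
            _ = _ := by ring
        · have hz : ∫ ω, ∏ e, M.ξ a e ω ^ (j₁ e + j e) ∂M.P = 0 := by
            have hcase : ∑ e, j e = 0 ∨ ∑ e, j e = 1 := by omega
            rcases hcase with h | h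
            · have hj0 : ∀ e, j e = 0 := fun e => by
                rw [Finset.sum_eq_zero_iff] at h
                exact h e (Finset.mem_univ e)
              simp only [hj0, add_zero]
              simp only [prod_pow_single (fun e => M.ξ a e _) e₀, hj₁]
              exact M.mean a e₀
            · obtain ⟨e', rfl⟩ := eq_single_of_sum_eq_one h
              have hne : e₀ ≠ e' := fun h' => (Finset.ne_of_mem_erase hj) (by rw [hj₁, h'])
              have : ∀ ω, ∏ e, M.ξ a e ω ^ (j₁ e + (Pi.single e' 1 : E → ℕ) e) =
                  M.ξ a e₀ ω * M.ξ a e' ω := fun ω => by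
                simp only [pow_add, Finset.prod_mul_distrib]
                rw [prod_pow_single (fun e => M.ξ a e ω) e₀, prod_pow_single (fun e => M.ξ a e ω) e']
              simp only [this]
              rw [M.cov, if_neg hne]
          rw [hz]
          simp only [mul_zero, zero_mul, abs_zero]
          positivity
      refine (Finset.sum_le_sum hterm).trans ?_
      rw [Finset.sum_const, nsmul_eq_mul, mul_assoc]
      have : ((J.erase j₁).card : ℝ) ≤ J.card := by exact_mod_cast Finset.card_erase_le
      gcongr
    have h4 := abs_le.1 h1
    have h5 := abs_le.1 h3
    rw [abs_le]
    constructor <;> linarith [h4.1, h4.2, h5.1, h5.2]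
  -- Putting the omitted summand back costs only one factor `ε`; this is enough, since the leading
  -- terms carry `ε²` each and there are at most `n` of them.
  have hY : ∀ a ∈ A, |M.mom mb A D - M.mom mb (A.erase a) D| ≤
      J.card * C₃ * (ε * b) + C₂ * ε ^ p := by
    intro a ha
    have h1 := hC₂ n hn M (A.erase a) a (Finset.notMem_erase a A)
    rw [← Finset.add_sum_erase J _ h0J] at h1
    have h0 : ∫ ω, (∏ e, M.ξ a e ω ^ (0 : E → ℕ) e) *
        ∏ e, D e n (M.G (A.erase a) e ω + eps n * M.ξ a e ω) ∂M.P = M.mom mb A D := by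
      unfold IndepArray.mom
      congr 1
      ext ω
      simp only [Pi.zero_apply, pow_zero, Finset.prod_const_one, one_mul]
      refine Finset.prod_congr rfl fun e _ => ?_
      rw [← M.G_insert (Finset.notMem_erase a A), Finset.insert_erase ha]
    have h2 : (∏ e, eps n ^ (0 : E → ℕ) e / (((0 : E → ℕ) e)! : ℝ)) *
        (∫ ω, ∏ e, M.ξ a e ω ^ ((0 : E → ℕ) e + (0 : E → ℕ) e) ∂M.P) *
        (M.mom mb (A.erase a) fun e n => iteratedDeriv ((0 : E → ℕ) e) (D e n)) =
        M.mom mb (A.erase a) D := by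
      simp
    rw [h0, h2] at h1
    have h3 : |∑ j ∈ J.erase 0, (∏ e, eps n ^ j e / ((j e)! : ℝ)) *
        (∫ ω, ∏ e, M.ξ a e ω ^ ((0 : E → ℕ) e + j e) ∂M.P) *
        M.mom mb (A.erase a) fun e n => iteratedDeriv (j e) (D e n)| ≤
        J.card * C₃ * (ε * b) := by
      refine (Finset.abs_sum_le_sum_abs _ _).trans ?_
      have hterm : ∀ j ∈ J.erase 0, |(∏ e, eps n ^ j e / ((j e)! : ℝ)) *
          (∫ ω, ∏ e, M.ξ a e ω ^ ((0 : E → ℕ) e + j e) ∂M.P) *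
          M.mom mb (A.erase a) fun e n => iteratedDeriv (j e) (D e n)| ≤ C₃ * (ε * b) := by
        intro j hj
        have hjJ := Finset.mem_of_mem_erase hj
        have hs : 1 ≤ ∑ e, j e := by
          by_contra hcon
          have h : ∑ e, j e = 0 := by omega
          rw [Finset.sum_eq_zero_iff] at h
          exact Finset.ne_of_mem_erase hj (funext fun e => h e (Finset.mem_univ e))
        rw [abs_mul, abs_mul]
        have f1 := abs_prod_eps_le hn j hs
        rw [pow_one] at f1
        have f2 := hexpJ j hjJ 0 (fun e => by simp) a
        have f3 := hb2 a ha j hjJ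
        calc _ ≤ (ε * C₃) * b := mul_le_mul (mul_le_mul f1 f2 (abs_nonneg _)
              hε) f3 (abs_nonneg _) (by positivity)
          _ = _ := by ring
      refine (Finset.sum_le_sum hterm).trans ?_
      rw [Finset.sum_const, nsmul_eq_mul, mul_assoc]
      have : ((J.erase 0).card : ℝ) ≤ J.card := by exact_mod_cast Finset.card_erase_le
      gcongr
    have h4 := abs_le.1 h1
    have h5 := abs_le.1 h3
    rw [abs_le]
    constructor <;> linarith [h4.1, h4.2, h5.1, h5.2]
  rw [mom_update_add mb hn M A hF e₀ (Adm.id.mul (hF e₀)) (hF e₀).deriv,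
    mom_update_id_mul mb hn M A hF e₀]
  change |∑ a ∈ A, ε * ∫ ω, (∏ e, M.ξ a e ω ^ j₁ e) *
        ∏ e, F e n (M.G (A.erase a) e ω + ε * M.ξ a e ω) ∂M.P - M.mom mb A D| ≤ _
  set X : Fin n → ℝ := fun a => ∫ ω, (∏ e, M.ξ a e ω ^ j₁ e) *
        ∏ e, F e n (M.G (A.erase a) e ω + ε * M.ξ a e ω) ∂M.P with hXdef
  -- The errors of the two expansions are separated from the defect of `A.card * ε² = 1`, which is
  -- at most `R * ε²` because at most `R` of the `n` summands are missing.
  have hdecomp : ∑ a ∈ A, ε * X a - M.mom mb A D =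
      ∑ a ∈ A, (ε * (X a - ε * M.mom mb (A.erase a) D) -
        ε ^ 2 * (M.mom mb A D - M.mom mb (A.erase a) D)) +
        (A.card * ε ^ 2 - 1) * M.mom mb A D := by
    have : ∀ a, ε * (X a - ε * M.mom mb (A.erase a) D) -
        ε ^ 2 * (M.mom mb A D - M.mom mb (A.erase a) D) = ε * X a - ε ^ 2 * M.mom mb A D := by
      intro a; ring
    simp only [this]
    rw [Finset.sum_sub_distrib, Finset.sum_const, nsmul_eq_mul]
    ring
  rw [hdecomp]
  have hcard : (A.card : ℝ) ≤ n := by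
    have : A.card ≤ n := by simpa using A.card_le_univ
    exact_mod_cast this
  have hlast : |(A.card * ε ^ 2 - 1) * M.mom mb A D| ≤ R * (ε * b) := by
    rw [abs_mul, ← hnε]
    have h1 : |(A.card : ℝ) * ε ^ 2 - n * ε ^ 2| ≤ R * ε ^ 2 := by
      rw [← sub_mul, abs_mul, abs_of_nonneg (by positivity : 0 ≤ ε ^ 2)]
      refine mul_le_mul_of_nonneg_right ?_ (by positivity)
      rw [abs_sub_comm, abs_of_nonneg (by linarith)]
      have : (n : ℝ) ≤ A.card + R := by exact_mod_cast hA
      linarith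
    calc _ ≤ (R * ε ^ 2) * b := mul_le_mul h1 hb3 (abs_nonneg _) (by positivity)
      _ ≤ (R * ε) * b := by
        have : ε ^ 2 ≤ ε := by nlinarith
        gcongr
      _ = _ := by ring
  have hterm : ∀ a ∈ A, |ε * (X a - ε * M.mom mb (A.erase a) D) -
        ε ^ 2 * (M.mom mb A D - M.mom mb (A.erase a) D)| ≤
      ε ^ 2 * (2 * (J.card * C₃) * (ε * b) + (C₁ + C₂) * ε ^ (p - 1)) := by
    intro a ha
    refine (abs_sub _ _).trans ?_
    rw [abs_mul, abs_mul, abs_of_nonneg hε, abs_of_nonneg (by positivity : 0 ≤ ε ^ 2)]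
    have e1 := mul_le_mul_of_nonneg_left (hX a ha) hε
    have e2 := mul_le_mul_of_nonneg_left (hY a ha) (by positivity : 0 ≤ ε ^ 2)
    obtain ⟨q, rfl⟩ : ∃ q, p = q + 1 := ⟨p - 1, by omega⟩
    simp only [Nat.add_sub_cancel]
    have e3 : ε ^ 2 * (C₂ * ε ^ (q + 1)) ≤ ε ^ 2 * (C₂ * ε ^ q) := by
      have : ε ^ (q + 1) ≤ ε ^ q := pow_le_pow_of_le_one hε hε1 (Nat.le_succ q)
      gcongr
    have e4 : ε * (C₁ * ε ^ (q + 1)) = ε ^ 2 * (C₁ * ε ^ q) := by ring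
    have e5 : ε * (J.card * C₃ * (ε ^ 2 * b)) = ε ^ 2 * (J.card * C₃ * (ε * b)) := by ring
    rw [mul_add] at e1 e2
    nlinarith
  refine (abs_add_le _ _).trans ?_
  refine (add_le_add ((Finset.abs_sum_le_sum_abs _ _).trans (Finset.sum_le_sum hterm)) hlast).trans ?_
  rw [Finset.sum_const, nsmul_eq_mul, ← mul_assoc]
  have e1 : (A.card : ℝ) * ε ^ 2 ≤ 1 := by
    rw [← hnε]
    gcongr
  have e2 : 0 ≤ 2 * (J.card * C₃) * (ε * b) + (C₁ + C₂) * ε ^ (p - 1) := by positivity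
  have e3 := mul_le_mul_of_nonneg_right e1 e2
  have e4 : 0 ≤ R * ε ^ (p - 1) := by positivity
  have e5 : 0 ≤ 2 * (J.card * C₃) * ε ^ (p - 1) := by positivity
  have e6 : 0 ≤ (C₁ + C₂) * (ε * b) := by positivity
  nlinarith

/-- Functions orthogonal to polynomials of low degree contribute a small mixed moment. -/
theorem exists_abs_mom_le_of_gaussOrth {p : ℕ} (hp : 2 ≤ p) (r : ℕ) (hr : r + 1 ≤ p) :
    ∀ {F : E → ℕ → ℝ → ℝ}, (∀ e, Adm (F e)) → ∀ e₀ : E, GaussOrth (r * (p + 1) - p) (F e₀) →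
      ∀ R : ℕ, ∃ C : ℝ, 0 ≤ C ∧ ∀ n, 3 ≤ n → ∀ M : IndepArray E mb n, ∀ A : Finset (Fin n),
        n ≤ A.card + R → |M.mom mb A F| ≤ C * eps n ^ r := by
  induction r with
  | zero =>
    intro F hF e₀ _ R
    obtain ⟨C, hC0, hC⟩ := exists_abs_mom_le mb hF
    exact ⟨C, hC0, fun n hn M A _ => by simpa using hC n hn M A⟩
  | succ r ih =>
    intro F hF e₀ horth R
    -- Solving Stein's equation costs one vanishing mean, and the expansions take up to `p`
    -- derivatives of the solution. Each factor `ε` therefore costs `p + 1` orders, except that the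
    -- last one needs only mean zero, whence `r * (p + 1) - p`.
    have hmul : (r + 1) * (p + 1) = r * (p + 1) + p + 1 := by ring
    obtain ⟨v, hv, hvF⟩ := horth.exists_stein (by omega)
    set F₀ : E → ℕ → ℝ → ℝ := Function.update F e₀ v with hF₀
    have hF₀e : F₀ e₀ = v := by simp [hF₀]
    have hF₀a : ∀ e, Adm (F₀ e) := by
      intro e
      by_cases h : e = e₀
      · subst h; rw [hF₀e]; exact hv.1
      · simpa [hF₀, Function.update_of_ne h] using hF e
    set D : E → ℕ → ℝ → ℝ := Function.update F₀ e₀ fun n => deriv (F₀ e₀ n) with hD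
    have hDe : D e₀ = fun n => deriv (v n) := by simp [hD, hF₀e]
    have hDa : ∀ e, Adm (D e) := by
      intro e
      by_cases h : e = e₀
      · subst h; rw [hDe]; exact hv.1.deriv
      · simpa [hD, Function.update_of_ne h] using hF₀a e
    have hFeq : Function.update F₀ e₀ (fun n x => x * F₀ e₀ n x - deriv (F₀ e₀ n) x) = F := by
      rw [hF₀e, hF₀, Function.update_idem]
      have : (fun n x => x * v n x - deriv (v n) x) = F e₀ := by
        ext n x; rw [hvF]
      rw [this, Function.update_eq_self]
    have hv' : ∀ i ≤ p, GaussOrth (r * (p + 1) - p) (fun n => iteratedDeriv i (v n)) := fun i hi =>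
      (hv.iteratedDeriv i).mono (by omega)
    -- The moments in the expansion omit one summand, so the induction hypothesis is used with `R +
    -- 1`. Indices out of range get a dummy constant, so that a choice over all `j` is possible.
    have h1 : ∀ j : E → ℕ, ∃ C : ℝ, 0 ≤ C ∧ (j e₀ < p → ∀ n, 3 ≤ n → ∀ M : IndepArray E mb n,
        ∀ A : Finset (Fin n), n ≤ A.card + (R + 1) →
        |M.mom mb A fun e n => iteratedDeriv (j e) (F₀ e n)| ≤ C * eps n ^ r) := by
      intro j
      by_cases hj : j e₀ < p
      · obtain ⟨C, hC0, hC⟩ := ih (by omega) (F := fun e n => iteratedDeriv (j e) (F₀ e n))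
          (fun e => (hF₀a e).iteratedDeriv _) e₀ (by rw [hF₀e]; exact hv' _ hj.le) (R + 1)
        exact ⟨C, hC0, fun _ => hC⟩
      · exact ⟨0, le_rfl, fun h => absurd h hj⟩
    have h2 : ∀ j : E → ℕ, ∃ C : ℝ, 0 ≤ C ∧ (j e₀ < p → ∀ n, 3 ≤ n → ∀ M : IndepArray E mb n,
        ∀ A : Finset (Fin n), n ≤ A.card + (R + 1) →
        |M.mom mb A fun e n => iteratedDeriv (j e) (D e n)| ≤ C * eps n ^ r) := by
      intro j
      by_cases hj : j e₀ < p
      · obtain ⟨C, hC0, hC⟩ := ih (by omega) (F := fun e n => iteratedDeriv (j e) (D e n))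
          (fun e => (hDa e).iteratedDeriv _) e₀ (by
            simp only [hDe, ← iteratedDeriv_succ']; exact hv' _ hj) (R + 1)
        exact ⟨C, hC0, fun _ => hC⟩
      · exact ⟨0, le_rfl, fun h => absurd h hj⟩
    choose C₁ hC₁0 hC₁ using h1
    choose C₂ hC₂0 hC₂ using h2
    obtain ⟨C₃, hC₃0, hC₃⟩ := ih (by omega) hDa e₀ (by
      rw [hDe]; simpa using hv' 1 (by omega)) R
    obtain ⟨C, hC0, hC⟩ := exists_stein_step mb hF₀a e₀ hp R
    set J := Fintype.piFinset fun _ : E => Finset.range p with hJ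
    have hB1 : ∀ j ∈ J, C₁ j ≤ ∑ j ∈ J, C₁ j := fun j hj =>
      Finset.single_le_sum (fun j _ => hC₁0 j) hj
    have hB2 : ∀ j ∈ J, C₂ j ≤ ∑ j ∈ J, C₂ j := fun j hj =>
      Finset.single_le_sum (fun j _ => hC₂0 j) hj
    have hS1 : 0 ≤ ∑ j ∈ J, C₁ j := Finset.sum_nonneg fun j _ => hC₁0 j
    have hS2 : 0 ≤ ∑ j ∈ J, C₂ j := Finset.sum_nonneg fun j _ => hC₂0 j
    set B := ∑ j ∈ J, C₁ j + ∑ j ∈ J, C₂ j + C₃ with hBdef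
    have hB0 : 0 ≤ B := by positivity
    refine ⟨C * (B + 1), by positivity, fun n hn M A hA => ?_⟩
    have hε := eps_nonneg n
    have key := hC n hn M A hA (B * eps n ^ r)
      (fun a ha j hj => by
        refine (hC₁ j (Finset.mem_range.1 (Fintype.mem_piFinset.1 hj e₀)) n hn M _ ?_).trans ?_
        · rw [Finset.card_erase_of_mem ha]; omega
        · refine mul_le_mul_of_nonneg_right ?_ (by positivity)
          linarith [hB1 j hj])
      (fun a ha j hj => by
        refine (hC₂ j (Finset.mem_range.1 (Fintype.mem_piFinset.1 hj e₀)) n hn M _ ?_).trans ?_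
        · rw [Finset.card_erase_of_mem ha]; omega
        · refine mul_le_mul_of_nonneg_right ?_ (by positivity)
          linarith [hB2 j hj])
      ((hC₃ n hn M A hA).trans (mul_le_mul_of_nonneg_right (by linarith) (by positivity)))
    rw [hFeq] at key
    refine key.trans ?_
    rw [mul_assoc]
    refine mul_le_mul_of_nonneg_left ?_ hC0
    have : eps n ^ (p - 1) ≤ eps n ^ (r + 1) :=
      pow_le_pow_of_le_one hε (eps_le_one hn) (by omega)
    rw [pow_succ] at this ⊢
    nlinarith

/-- Matching the Gaussian means of sufficiently many derivatives matches the mixed moments. -/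
theorem exists_abs_mom_sub_le {p : ℕ} (hp : 2 ≤ p) (r : ℕ) (hr : r + 1 ≤ p)
    {F F' : E → ℕ → ℝ → ℝ} (hF : ∀ e, Adm (F e)) (hF' : ∀ e, Adm (F' e))
    (horth : ∀ e, GaussOrth (r * (p + 1) - p) (fun n x => F e n x - F' e n x)) :
    ∃ C : ℝ, 0 ≤ C ∧ ∀ n, 3 ≤ n → ∀ M : IndepArray E mb n,
      |M.mom mb Finset.univ F - M.mom mb Finset.univ F'| ≤ C * eps n ^ r := by
  -- Functions are exchanged one factor at a time; the hybrid family equals `F` on `s` and `F'`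
  -- elsewhere.
  have key : ∀ s : Finset E, ∃ C : ℝ, 0 ≤ C ∧ ∀ n, 3 ≤ n → ∀ M : IndepArray E mb n,
      |M.mom mb Finset.univ (fun e => if e ∈ s then F e else F' e) - M.mom mb Finset.univ F'| ≤
        C * eps n ^ r := by
    intro s
    induction s using Finset.induction_on with
    | empty => exact ⟨0, le_rfl, fun n hn M => by simp⟩
    | insert i s hi ih =>
      obtain ⟨C, hC0, hC⟩ := ih
      set H : E → ℕ → ℝ → ℝ := fun e => if e ∈ s then F e else F' e with hH
      have hHa : ∀ e, Adm (H e) := fun e => by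
        simp only [hH]; split_ifs
        · exact hF e
        · exact hF' e
      have hu : ∀ e, Adm (Function.update H i (fun n x => F i n x - F' i n x) e) := by
        intro e
        by_cases h : e = i
        · subst h; simpa using (horth e).1
        · simpa [Function.update_of_ne h] using hHa e
      obtain ⟨C', hC'0, hC'⟩ := exists_abs_mom_le_of_gaussOrth mb hp r hr hu i
        (by simpa using horth i) 0
      refine ⟨C + C', by positivity, fun n hn M => ?_⟩
      have h1 := hC n hn M
      have h2 := hC' n hn M Finset.univ (by simp)
      rw [mom_update_add mb hn M _ hHa i (hF i) (hF' i)] at h2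
      have e1 : Function.update H i (F i) = fun e => if e ∈ insert i s then F e else F' e := by
        ext e
        by_cases h : e = i
        · subst h; simp
        · simp [Function.update_of_ne h, hH, h]
      have e2 : Function.update H i (F' i) = H := by
        rw [Function.update_eq_iff]
        simp [hH, hi]
      rw [e1, e2] at h2
      have h3 := abs_add_le (M.mom mb Finset.univ (fun e => if e ∈ insert i s then F e else F' e) -
        M.mom mb Finset.univ H) (M.mom mb Finset.univ H - M.mom mb Finset.univ F')
      rw [sub_add_sub_cancel] at h3
      linarith
  simpa using key Finset.univ

end Stein

end CycleCorrelations

end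

noncomputable section

namespace CycleCorrelations

/-! ### The random feature model and the moments of its summands. -/

/-- Functions of disjoint groups of independent variables are independent. -/
theorem iIndepFun_group {Ω ι κ β : Type*} [MeasurableSpace Ω] [MeasurableSpace β] [Fintype ι]
    [DecidableEq κ] {P : Measure Ω} [IsProbabilityMeasure P] {V : ι → Ω → ℝ} (h : iIndepFun V P)
    (hV : ∀ i, Measurable (V i)) (key : ι → κ) (F : κ → (ι → ℝ) → β) (hF : ∀ a, Measurable (F a))
    (hdep : ∀ a x y, (∀ i, key i = a → x i = y i) → F a x = F a y) :
    iIndepFun (fun a ω => F a fun i => V i ω) P := by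
  classical
  rw [iIndepFun_iff_measure_inter_preimage_eq_mul]
  intro S
  induction S using Finset.induction_on with
  | empty => intro sets _; simp
  | insert a S ha ih =>
    intro sets hsets
    rw [Finset.prod_insert ha, ← ih fun i hi => hsets i (Finset.mem_insert_of_mem hi)]
    let A : Finset ι := Finset.univ.filter fun i => key i = a
    let B : Finset ι := Finset.univ.filter fun i => key i ∈ S
    have hAB : Disjoint A B := by
      rw [Finset.disjoint_filter]
      rintro i - rfl
      exact ha
    have hind := h.indepFun_finset A B hAB hV
    -- Tuples on a subset are extended by zero; by `hdep` the functions in question do not see the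
    -- difference.
    let ext (A : Finset ι) (x : A → ℝ) (i : ι) : ℝ := if hi : i ∈ A then x ⟨i, hi⟩ else 0
    have hext : ∀ A, Measurable (ext A) := by
      intro A
      refine measurable_pi_lambda _ fun i => ?_
      by_cases hi : i ∈ A
      · simp only [ext, hi, dite_true]
        exact measurable_pi_apply _
      · simp only [ext, hi, dite_false]
        exact measurable_const
    have hFA : ∀ ω, F a (fun i => V i ω) = F a (ext A fun i => V i ω) := fun ω =>
      hdep _ _ _ fun i hi => by simp [ext, A, hi]
    have hFB : ∀ b ∈ S, ∀ ω, F b (fun i => V i ω) = F b (ext B fun i => V i ω) := fun b hb ω =>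
      hdep _ _ _ fun i hi => by simp [ext, B, hi, hb]
    have key1 := hind.measure_inter_preimage_eq_mul ((fun x => F a (ext A x)) ⁻¹' sets a)
      (⋂ b ∈ S, (fun x => F b (ext B x)) ⁻¹' sets b)
      (((hF a).comp (hext A)) (hsets a (Finset.mem_insert_self _ _)))
      (S.measurableSet_biInter fun b hb =>
        ((hF b).comp (hext B)) (hsets b (Finset.mem_insert_of_mem hb)))
    have e1 : (fun ω (i : A) => V i ω) ⁻¹' ((fun x => F a (ext A x)) ⁻¹' sets a) =
        (fun ω => F a fun i => V i ω) ⁻¹' sets a := by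
      ext ω
      simp only [Set.mem_preimage, hFA ω]
    have e2 : (fun ω (i : B) => V i ω) ⁻¹' (⋂ b ∈ S, (fun x => F b (ext B x)) ⁻¹' sets b) =
        ⋂ b ∈ S, (fun ω => F b fun i => V i ω) ⁻¹' sets b := by
      ext ω
      simp only [Set.mem_preimage, Set.mem_iInter]
      refine forall₂_congr fun b hb => ?_
      rw [hFB b hb ω]
    rw [e1, e2] at key1
    rw [Finset.set_biInter_insert]
    exact key1

/-- The normalised random feature model: the entries `V (inl (i, a))` of the weight matrix and
`V (inr (a, j))` of the data matrix are independent, with moments `mW` and `mX`. -/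
structure RFModel (mW mX : ℕ → ℝ) (n : ℕ) where
  n₁ : ℕ
  m : ℕ
  Ω : Type
  [mΩ : MeasurableSpace Ω]
  P : Measure Ω
  [prob : IsProbabilityMeasure P]
  V : (Fin n₁ × Fin n) ⊕ (Fin n × Fin m) → Ω → ℝ
  meas : ∀ x, Measurable (V x)
  indep : iIndepFun V P
  int : ∀ x (p : ℕ), Integrable (fun ω => |V x ω| ^ p) P
  mom_W : ∀ x (p : ℕ), ∫ ω, V (Sum.inl x) ω ^ p ∂P = mW p
  mom_X : ∀ x (p : ℕ), ∫ ω, V (Sum.inr x) ω ^ p ∂P = mX p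
  mW0 : mW 0 = 1
  mX0 : mX 0 = 1
  mW1 : mW 1 = 0
  mX1 : mX 1 = 0
  mW2 : mW 2 = 1
  mX2 : mX 2 = 1

attribute [instance] RFModel.mΩ RFModel.prob

namespace RFModel

variable {mW mX : ℕ → ℝ} {n : ℕ} (M : RFModel mW mX n)

/-- The summands of the entries of the product matrix. -/
def ξ (i : Fin M.n₁) (a : Fin n) (j : Fin M.m) (ω : M.Ω) : ℝ :=
  M.V (Sum.inl (i, a)) ω * M.V (Sum.inr (a, j)) ω

/-- The entries of the normalised product matrix. -/
def H (i : Fin M.n₁) (j : Fin M.m) (ω : M.Ω) : ℝ := eps n * ∑ a, M.ξ i a j ω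

theorem allMom_V (x) : AllMom M.P (M.V x) := ⟨(M.meas x).aestronglyMeasurable, M.int x⟩

theorem allMom_ξ (i a j) : AllMom M.P (M.ξ i a j) := (M.allMom_V _).mul (M.allMom_V _)

theorem measurable_ξ (i a j) : Measurable (M.ξ i a j) := (M.meas _).mul (M.meas _)

theorem allMom_H (i j) : AllMom M.P (M.H i j) :=
  (AllMom.sum Finset.univ fun a _ => M.allMom_ξ i a j).const_mul _

/-- The product is a monomial in independent entries, and the exponent of an entry is the number of
factors using it. An entry used once annihilates the moment; if all entries are used zero or two
times, the moment is one. -/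
theorem integral_prod_ξ {σ : Type*} [DecidableEq σ] (T : Finset σ) (r : σ → Fin M.n₁)
    (a : σ → Fin n) (c : σ → Fin M.m) :
    ∫ ω, ∏ s ∈ T, M.ξ (r s) (a s) (c s) ω ∂M.P =
      (∏ p : Fin M.n₁ × Fin n, mW (T.filter fun s => (r s, a s) = p).card) *
        ∏ p : Fin n × Fin M.m, mX (T.filter fun s => (a s, c s) = p).card := by
  have h1 : ∀ ω, ∏ s ∈ T, M.ξ (r s) (a s) (c s) ω =
      ∏ x, M.V x ω ^ (Sum.elim (fun p => (T.filter fun s => (r s, a s) = p).card)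
        (fun p => (T.filter fun s => (a s, c s) = p).card) x) := by
    intro ω
    simp only [ξ, Finset.prod_mul_distrib, Fintype.prod_sum_type, Sum.elim_inl, Sum.elim_inr]
    congr 1
    · rw [← Finset.prod_fiberwise T (fun s => (r s, a s))]
      refine Finset.prod_congr rfl fun p _ => ?_
      rw [← Finset.prod_const]
      exact Finset.prod_congr rfl fun s hs => by rw [(Finset.mem_filter.1 hs).2]
    · rw [← Finset.prod_fiberwise T (fun s => (a s, c s))]
      refine Finset.prod_congr rfl fun p _ => ?_
      rw [← Finset.prod_const]
      exact Finset.prod_congr rfl fun s hs => by rw [(Finset.mem_filter.1 hs).2]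
  simp_rw [h1]
  rw [M.indep.integral_fun_prod_comp (f := fun x y => y ^ (Sum.elim
    (fun p => (T.filter fun s => (r s, a s) = p).card)
        (fun p => (T.filter fun s => (a s, c s) = p).card) x)) (fun x => (M.meas x).aemeasurable)
        (fun x => (continuous_pow _).aestronglyMeasurable)]
  rw [Fintype.prod_sum_type]
  simp only [Sum.elim_inl, Sum.elim_inr, M.mom_W, M.mom_X]

theorem integral_prod_ξ_eq_zero_of_row {σ : Type*} [DecidableEq σ] {T : Finset σ}
    {r : σ → Fin M.n₁} {a : σ → Fin n} {c : σ → Fin M.m} (p : Fin M.n₁ × Fin n)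
    (hp : (T.filter fun s => (r s, a s) = p).card = 1) :
    ∫ ω, ∏ s ∈ T, M.ξ (r s) (a s) (c s) ω ∂M.P = 0 := by
  rw [integral_prod_ξ, Finset.prod_eq_zero (Finset.mem_univ p) (by rw [hp, M.mW1]), zero_mul]

theorem integral_prod_ξ_eq_zero_of_col {σ : Type*} [DecidableEq σ] {T : Finset σ}
    {r : σ → Fin M.n₁} {a : σ → Fin n} {c : σ → Fin M.m} (p : Fin n × Fin M.m)
    (hp : (T.filter fun s => (a s, c s) = p).card = 1) :
    ∫ ω, ∏ s ∈ T, M.ξ (r s) (a s) (c s) ω ∂M.P = 0 := by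
  rw [integral_prod_ξ, Finset.prod_eq_zero (i := p) (f := fun p => mX _) (Finset.mem_univ p)
    (by rw [hp, M.mX1]), mul_zero]

theorem integral_prod_ξ_eq_one {σ : Type*} [DecidableEq σ] {T : Finset σ}
    {r : σ → Fin M.n₁} {a : σ → Fin n} {c : σ → Fin M.m}
    (hr : ∀ p, (T.filter fun s => (r s, a s) = p).card = 0 ∨
      (T.filter fun s => (r s, a s) = p).card = 2)
    (hc : ∀ p, (T.filter fun s => (a s, c s) = p).card = 0 ∨
      (T.filter fun s => (a s, c s) = p).card = 2) :
    ∫ ω, ∏ s ∈ T, M.ξ (r s) (a s) (c s) ω ∂M.P = 1 := by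
  rw [integral_prod_ξ, Finset.prod_eq_one, Finset.prod_eq_one, one_mul]
  · intro p _
    rcases hc p with h | h <;> rw [h]
    exacts [M.mX0, M.mX2]
  · intro p _
    rcases hr p with h | h <;> rw [h]
    exacts [M.mW0, M.mW2]

theorem abs_pow_le_one_add (x : ℝ) (p : ℕ) : |x| ^ p ≤ 1 + x ^ (2 * p) := by
  have h : x ^ (2 * p) = (|x| ^ p) ^ 2 := by rw [pow_mul, ← sq_abs, ← pow_mul, ← pow_mul, mul_comm]
  rw [h]
  nlinarith [sq_nonneg (|x| ^ p - 1), sq_nonneg (|x| ^ p)]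

theorem integral_abs_V_pow_le (x) (p : ℕ) : ∫ ω, |M.V x ω| ^ p ∂M.P ≤
    Sum.elim (fun _ => 1 + mW (2 * p)) (fun _ => 1 + mX (2 * p)) x := by
  have h2 : Integrable (fun ω => M.V x ω ^ (2 * p)) M.P := ((M.allMom_V x).pow _).integrable
  have h1 : ∫ ω, |M.V x ω| ^ p ∂M.P ≤ ∫ ω, (1 + M.V x ω ^ (2 * p)) ∂M.P :=
    integral_mono (M.int x p) ((integrable_const _).add h2) fun ω => abs_pow_le_one_add _ _
  rw [integral_add (integrable_const _) h2] at h1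
  rcases x with x | x
  · rw [M.mom_W] at h1
    simpa using h1
  · rw [M.mom_X] at h1
    simpa using h1

/-- The array of summands at distinct positions. -/
def toArray {E : Type} [Fintype E] [DecidableEq E] (r : E → Fin M.n₁) (c : E → Fin M.m)
    (hinj : Function.Injective fun e => (r e, c e)) :
    IndepArray E (fun p => (1 + mW (2 * p)) * (1 + mX (2 * p))) n where
  Ω := M.Ω
  P := M.P
  ξ a e := M.ξ (r e) a (c e)
  meas a e := M.measurable_ξ _ _ _
  -- The entries are grouped by their inner index, and different inner indices use disjoint entries.
  indep := iIndepFun_group M.indep M.meas (Sum.elim (fun p => p.2) fun p => p.1)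
    (fun a x e => x (Sum.inl (r e, a)) * x (Sum.inr (a, c e)))
    (fun a => measurable_pi_lambda _ fun e =>
      (measurable_pi_apply _).mul (measurable_pi_apply _))
    (fun a x y h => by
      ext e
      rw [h (Sum.inl (r e, a)) rfl, h (Sum.inr (a, c e)) rfl])
  mom_int a e := (M.allMom_ξ _ _ _).2
  mom_le a e p := by
    simp only [ξ, abs_mul, mul_pow]
    have hm : Measurable fun x : ℝ => |x| ^ p := by fun_prop
    have h0 : IndepFun (M.V (Sum.inl (r e, a))) (M.V (Sum.inr (a, c e))) M.P :=
      M.indep.indepFun (by simp)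
    have hind : IndepFun (fun ω => |M.V (Sum.inl (r e, a)) ω| ^ p)
        (fun ω => |M.V (Sum.inr (a, c e)) ω| ^ p) M.P := h0.comp hm hm
    rw [hind.integral_fun_mul_eq_mul_integral (M.int _ _).aestronglyMeasurable
      (M.int _ _).aestronglyMeasurable]
    have h1 := M.integral_abs_V_pow_le (Sum.inl (r e, a)) p
    have h2 := M.integral_abs_V_pow_le (Sum.inr (a, c e)) p
    have h3 : 0 ≤ ∫ ω, |M.V (Sum.inl (r e, a)) ω| ^ p ∂M.P :=
      integral_nonneg fun ω => by positivity
    have h4 : 0 ≤ ∫ ω, |M.V (Sum.inr (a, c e)) ω| ^ p ∂M.P :=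
      integral_nonneg fun ω => by positivity
    exact mul_le_mul h1 h2 h4 (h3.trans h1)
  mean a e := by
    have := M.integral_prod_ξ_eq_zero_of_row (T := ({()} : Finset Unit)) (r := fun _ => r e)
      (a := fun _ => a) (c := fun _ => c e) (r e, a) (by simp)
    simpa using this
  cov a e e' := by
    have h0 : ∫ ω, M.ξ (r e) a (c e) ω * M.ξ (r e') a (c e') ω ∂M.P =
        ∫ ω, ∏ s ∈ (Finset.univ : Finset Bool), M.ξ (r (if s then e else e')) a
          (c (if s then e else e')) ω ∂M.P := by
      simp
    rw [h0]
    split_ifs with h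
    · subst h
      apply M.integral_prod_ξ_eq_one (a := fun _ => a)
      · intro p
        by_cases hp : (r e, a) = p <;> simp [hp]
      · intro p
        by_cases hp : (a, c e) = p <;> simp [hp]
    -- Distinct positions differ in their column or in their row, so some entry of `X` or of `W`
    -- occurs exactly once.
    · by_cases hr : r e = r e'
      · have hc : c e ≠ c e' := fun hc => h (hinj (Prod.ext hr hc))
        apply M.integral_prod_ξ_eq_zero_of_col (a := fun _ => a) (a, c e)
        rw [Finset.card_eq_one]
        refine ⟨true, ?_⟩
        ext s
        cases s <;> simp [hc.symm]
      · apply M.integral_prod_ξ_eq_zero_of_row (a := fun _ => a) (r e, a)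
        rw [Finset.card_eq_one]
        refine ⟨true, ?_⟩
        ext s
        cases s <;> simp [Ne.symm hr]

end RFModel

end CycleCorrelations

end

noncomputable section

namespace CycleCorrelations

/-! ### Counting selections of inner indices. -/

section Combinatorics

variable {E R K : Type*} [DecidableEq E] [DecidableEq R] [DecidableEq K]

/-- The number of rows and columns met by the positions in `F`. -/
def numVert (r : E → R) (c : E → K) (F : Finset E) : ℕ := (F.image r).card + (F.image c).card

theorem two_le_numVert (r : E → R) (c : E → K) {F : Finset E} (h : F.Nonempty) :
    2 ≤ numVert r c F := by
  have h1 := Finset.card_pos.2 (h.image r)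
  have h2 := Finset.card_pos.2 (h.image c)
  unfold numVert
  omega

/-- A common position contributes both its row and its column to the intersection. -/
theorem numVert_union_le (r : E → R) (c : E → K) {F F' : Finset E} {e : E} (h : e ∈ F)
    (h' : e ∈ F') : numVert r c (F ∪ F') + 2 ≤ numVert r c F + numVert r c F' := by
  have key : ∀ {R : Type _} [DecidableEq R] (r : E → R),
      ((F ∪ F').image r).card + 1 ≤ (F.image r).card + (F'.image r).card := by
    intro R _ r
    rw [Finset.image_union, ← Finset.card_union_add_card_inter]
    have : 0 < (F.image r ∩ F'.image r).card := Finset.card_pos.2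
      ⟨r e, Finset.mem_inter.2 ⟨Finset.mem_image_of_mem r h, Finset.mem_image_of_mem r h'⟩⟩
    omega
  have h1 := key r
  have h2 : ((F ∪ F').image c).card + 1 ≤ (F.image c).card + (F'.image c).card := by
    rw [Finset.image_union, ← Finset.card_union_add_card_inter]
    have : 0 < (F.image c ∩ F'.image c).card := Finset.card_pos.2
      ⟨c e, Finset.mem_inter.2 ⟨Finset.mem_image_of_mem c h, Finset.mem_image_of_mem c h'⟩⟩
    omega
  unfold numVert
  omega

theorem two_mul_card_image_le {σ : Type*} [DecidableEq σ] (S : Finset σ) (f : σ → R)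
    (h : ∀ s ∈ S, ∃ s' ∈ S, s' ≠ s ∧ f s' = f s) : 2 * (S.image f).card ≤ S.card := by
  refine Finset.mul_card_image_le_card_of_maps_to (fun a ha => Finset.mem_image_of_mem f ha) 2 ?_
  intro b hb
  obtain ⟨s, hs, rfl⟩ := Finset.mem_image.1 hb
  obtain ⟨s', hs', hne, he⟩ := h s hs
  exact Finset.one_lt_card.2 ⟨s, by simp [hs], s', by simp [hs', he], hne.symm⟩

/-- If every value has at least two preimages and the total is twice the number of values, every
value has exactly two preimages. -/
theorem card_fiber_eq_two {σ : Type*} [DecidableEq σ] (S : Finset σ) (f : σ → R)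
    (h : ∀ s ∈ S, ∃ s' ∈ S, s' ≠ s ∧ f s' = f s) (hS : S.card ≤ 2 * (S.image f).card) {b : R}
    (hb : b ∈ S.image f) : (S.filter fun s => f s = b).card = 2 := by
  have h2 : ∀ b ∈ S.image f, 2 ≤ (S.filter fun s => f s = b).card := by
    intro b hb
    obtain ⟨s, hs, rfl⟩ := Finset.mem_image.1 hb
    obtain ⟨s', hs', hne, he⟩ := h s hs
    exact Finset.one_lt_card.2 ⟨s, by simp [hs], s', by simp [hs', he], hne.symm⟩
  have hsum := Finset.card_eq_sum_card_image f S
  by_contra hne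
  have : ∑ b ∈ S.image f, 2 < ∑ b ∈ S.image f, (S.filter fun s => f s = b).card :=
    Finset.sum_lt_sum h2 ⟨b, hb, lt_of_le_of_ne (h2 b hb) (Ne.symm hne)⟩
  rw [← hsum, Finset.sum_const, smul_eq_mul] at this
  omega

variable {σ τ : Type*} [Fintype σ] [DecidableEq σ] [DecidableEq τ]

/-- The positions having a slot with value in `A`. -/
def slotPos (p : σ → E) (α : σ → τ) (A : Finset τ) : Finset E :=
  (Finset.univ.filter fun s => α s ∈ A).image p

theorem mem_slotPos {p : σ → E} {α : σ → τ} {A : Finset τ} {e : E} :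
    e ∈ slotPos p α A ↔ ∃ s, α s ∈ A ∧ p s = e := by
  simp [slotPos]

theorem slotPos_insert (p : σ → E) (α : σ → τ) (A : Finset τ) (t : τ) :
    slotPos p α (insert t A) = slotPos p α A ∪ slotPos p α {t} := by
  ext e
  simp only [mem_slotPos, Finset.mem_union, Finset.mem_insert, Finset.mem_singleton]
  constructor
  · rintro ⟨s, h | h, rfl⟩
    · exact Or.inr ⟨s, h, rfl⟩
    · exact Or.inl ⟨s, h, rfl⟩
  · rintro (⟨s, h, rfl⟩ | ⟨s, h, rfl⟩)
    · exact ⟨s, Or.inr h, rfl⟩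
    · exact ⟨s, Or.inl h, rfl⟩

/-- The values of the slots connect the positions. -/
def SlotConn (p : σ → E) (α : σ → τ) : Prop :=
  ∀ F : Finset E, F.Nonempty → (∃ e, e ∉ F) → ∃ s s', α s = α s' ∧ p s ∈ F ∧ p s' ∉ F

/-- A set of values is enlarged one value at a time so that each new value meets a position already
reached, and every such overlap saves two vertices. A maximal set of this kind reaches all positions
by connectedness, and each value left over accounts for at least two vertices. -/
theorem numVert_add_le_sum [Fintype E] [Nonempty σ] (r : E → R) (c : E → K) {p : σ → E}
    {α : σ → τ} (hconn : SlotConn p α) :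
    numVert r c Finset.univ + 2 * (Finset.univ.image α).card ≤
      ∑ t ∈ Finset.univ.image α, numVert r c (slotPos p α {t}) + 2 := by
  set I := Finset.univ.image α with hI
  let good : Finset τ → Prop := fun A => A.Nonempty ∧ A ⊆ I ∧
    numVert r c (slotPos p α A) + 2 * A.card ≤ ∑ t ∈ A, numVert r c (slotPos p α {t}) + 2
  classical
  obtain ⟨A, hA, hmax⟩ : ∃ A ∈ I.powerset.filter good, ∀ B ∈ I.powerset.filter good,
      B.card ≤ A.card := by
    refine Finset.exists_max_image _ _ ?_
    obtain ⟨s⟩ := ‹Nonempty σ›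
    refine ⟨{α s}, Finset.mem_filter.2 ⟨?_, ?_, ?_, ?_⟩⟩
    · simp [hI]
    · simp
    · simp [hI]
    · simp
  obtain ⟨-, hAne, hAI, hAle⟩ := Finset.mem_filter.1 hA
  have hUne : (slotPos p α A).Nonempty := by
    obtain ⟨t, ht⟩ := hAne
    obtain ⟨s, -, rfl⟩ := Finset.mem_image.1 (hAI ht)
    exact ⟨p s, mem_slotPos.2 ⟨s, ht, rfl⟩⟩
  have hU : slotPos p α A = Finset.univ := by
    by_contra hU
    have hex : ∃ e, e ∉ slotPos p α A := by
      by_contra hall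
      push Not at hall
      exact hU (Finset.eq_univ_iff_forall.2 hall)
    obtain ⟨s, s', hss, hs, hs'⟩ := hconn _ hUne hex
    have htA : α s ∉ A := fun h => hs' (mem_slotPos.2 ⟨s', hss ▸ h, rfl⟩)
    have hgood : good (insert (α s) A) := by
      refine ⟨Finset.insert_nonempty _ _, ?_, ?_⟩
      · exact Finset.insert_subset (Finset.mem_image_of_mem _ (Finset.mem_univ _)) hAI
      · rw [Finset.card_insert_of_notMem htA, Finset.sum_insert htA, slotPos_insert]
        have := numVert_union_le r c hs (mem_slotPos.2 ⟨s, Finset.mem_singleton_self _, rfl⟩ :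
          p s ∈ slotPos p α {α s})
        omega
    have := hmax _ (Finset.mem_filter.2 ⟨Finset.mem_powerset.2 hgood.2.1, hgood⟩)
    rw [Finset.card_insert_of_notMem htA] at this
    omega
  rw [hU] at hAle
  have h1 : ∑ t ∈ I \ A, 2 ≤ ∑ t ∈ I \ A, numVert r c (slotPos p α {t}) := by
    refine Finset.sum_le_sum fun t ht => two_le_numVert r c ?_
    obtain ⟨s, -, rfl⟩ := Finset.mem_image.1 (Finset.mem_sdiff.1 ht).1
    exact ⟨p s, mem_slotPos.2 ⟨s, by simp, rfl⟩⟩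
  rw [Finset.sum_const, smul_eq_mul, Finset.card_sdiff_of_subset hAI] at h1
  have h2 := Finset.sum_sdiff hAI (f := fun t => numVert r c (slotPos p α {t}))
  have h3 := Finset.card_le_card hAI
  omega

/-- Every slot shares its row value and its column value with another slot. -/
def NoSingle (r : E → R) (c : E → K) (p : σ → E) (α : σ → τ) : Prop :=
  ∀ s, (∃ s', s' ≠ s ∧ α s' = α s ∧ r (p s') = r (p s)) ∧
    ∃ s', s' ≠ s ∧ α s' = α s ∧ c (p s') = c (p s)

theorem image_slotPos_singleton (r : E → R) (p : σ → E) (α : σ → τ) (t : τ) :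
    (slotPos p α {t}).image r = (Finset.univ.filter fun s => α s = t).image fun s => r (p s) := by
  ext i
  simp only [Finset.mem_image, mem_slotPos, Finset.mem_singleton, Finset.mem_filter,
    Finset.mem_univ, true_and]
  constructor
  · rintro ⟨_, ⟨s, hs, rfl⟩, rfl⟩
    exact ⟨s, hs, rfl⟩
  · rintro ⟨s, hs, rfl⟩
    exact ⟨_, ⟨s, hs, rfl⟩, rfl⟩

theorem NoSingle.two_mul_card_row {r : E → R} {c : E → K} {p : σ → E} {α : σ → τ}
    (h : NoSingle r c p α) (t : τ) :
    2 * ((slotPos p α {t}).image r).card ≤ (Finset.univ.filter fun s => α s = t).card := by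
  rw [image_slotPos_singleton]
  refine two_mul_card_image_le _ _ fun s hs => ?_
  simp only [Finset.mem_filter, Finset.mem_univ, true_and] at hs ⊢
  obtain ⟨⟨s', hne, h1, h2⟩, -⟩ := h s
  exact ⟨s', h1.trans hs, hne, h2⟩

theorem NoSingle.swap {r : E → R} {c : E → K} {p : σ → E} {α : σ → τ}
    (h : NoSingle r c p α) : NoSingle c r p α := fun s => ⟨(h s).2, (h s).1⟩

/-- Each row met by the value `t` holds at least two of its slots, so the rows account for at most
half of the slots, and likewise the columns. -/
theorem NoSingle.numVert_le {r : E → R} {c : E → K} {p : σ → E} {α : σ → τ}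
    (h : NoSingle r c p α) (t : τ) :
    numVert r c (slotPos p α {t}) ≤ (Finset.univ.filter fun s => α s = t).card := by
  have h1 := h.two_mul_card_row t
  have h2 := h.swap.two_mul_card_row t
  unfold numVert
  omega

/-- The basic power count: with `j` values there are of order `n ^ j = ε ^ (-2 j)` selections, each
weighted by `ε` to the number of slots, which leaves `ε ^ (v - 2)` for `v` rows and columns. -/
theorem NoSingle.card_image_add_numVert_le [Fintype E] [Nonempty σ] {r : E → R} {c : E → K}
    {p : σ → E} {α : σ → τ} (h : NoSingle r c p α) (hconn : SlotConn p α) :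
    2 * (Finset.univ.image α).card + numVert r c Finset.univ ≤ Fintype.card σ + 2 := by
  have h1 := numVert_add_le_sum r c hconn
  have h2 : ∑ t ∈ Finset.univ.image α, numVert r c (slotPos p α {t}) ≤
      ∑ t ∈ Finset.univ.image α, (Finset.univ.filter fun s => α s = t).card :=
    Finset.sum_le_sum fun t _ => h.numVert_le t
  rw [← Finset.card_eq_sum_card_image, Finset.card_univ] at h2
  omega

theorem NoSingle.card_image_add_numVert_lt [Fintype E] [Nonempty σ] {r : E → R} {c : E → K}
    {p : σ → E} {α : σ → τ} (h : NoSingle r c p α) (hconn : SlotConn p α) {s₀ : σ}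
    (hs₀ : numVert r c (slotPos p α {α s₀}) < (Finset.univ.filter fun s => α s = α s₀).card) :
    2 * (Finset.univ.image α).card + numVert r c Finset.univ + 1 ≤ Fintype.card σ + 2 := by
  have h1 := numVert_add_le_sum r c hconn
  have h2 : ∑ t ∈ Finset.univ.image α, numVert r c (slotPos p α {t}) <
      ∑ t ∈ Finset.univ.image α, (Finset.univ.filter fun s => α s = t).card :=
    Finset.sum_lt_sum (fun t _ => h.numVert_le t) ⟨α s₀, by simp, hs₀⟩
  rw [← Finset.card_eq_sum_card_image, Finset.card_univ] at h2
  omega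

/-- A value shared, through its column, between the only position of a row and another position
is taken by more slots than the vertices it meets. -/
theorem NoSingle.numVert_lt_of_leaf {r : E → R} {c : E → K}
    {p : σ → E} {α : σ → τ} (h : NoSingle r c p α) {s s' : σ} (hα : α s' = α s)
    (hp : p s' ≠ p s) (hc : c (p s') = c (p s)) (hleaf : ∀ e, r e = r (p s) → e = p s) :
    numVert r c (slotPos p α {α s}) < (Finset.univ.filter fun s' => α s' = α s).card := by
  have h1 := h.two_mul_card_row (α s)
  have h2 := h.swap.two_mul_card_row (α s)
  by_contra hle
  unfold numVert at hle
  set T := Finset.univ.filter fun s' => α s' = α s with hT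
  have h3 : T.card ≤ 2 * (T.image fun s => c (p s)).card := by
    rw [image_slotPos_singleton] at h1 h2 hle
    rw [image_slotPos_singleton] at hle
    simp only [← hT] at h1 h2 hle
    omega
  have h4 := card_fiber_eq_two T (fun s => c (p s)) (fun s hs => by
    simp only [hT, Finset.mem_filter, Finset.mem_univ, true_and] at hs ⊢
    obtain ⟨-, s', hne, h1, h2⟩ := h s
    exact ⟨s', h1.trans hs, hne, h2⟩) h3 (b := c (p s))
    (Finset.mem_image.2 ⟨s, by simp [hT], rfl⟩)
  -- The row partner of `s` must sit at the same position, as no other position lies in that row.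
  -- The column then contains the three slots `s`, `s₁`, `s'`, against the two that equality allows.
  obtain ⟨⟨s₁, hne, hα₁, hr₁⟩, -⟩ := h s
  have hp₁ := hleaf _ hr₁
  have h5 : ({s, s₁, s'} : Finset σ) ⊆ T.filter fun x => c (p x) = c (p s) := by
    intro x hx
    simp only [Finset.mem_insert, Finset.mem_singleton] at hx
    simp only [hT, Finset.mem_filter, Finset.mem_univ, true_and]
    rcases hx with rfl | rfl | rfl
    · simp
    · exact ⟨hα₁, by rw [hp₁]⟩
    · exact ⟨hα, hc⟩
  have h6 := Finset.card_le_card h5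
  rw [h4, Finset.card_eq_three.2 ⟨s, s₁, s', hne.symm, fun h => hp (by rw [h]),
    fun h => hp (by rw [← h, hp₁]), rfl⟩] at h6
  omega

theorem card_filter_card_image_le (n k : ℕ) :
    (Finset.univ.filter fun α : σ → Fin n => (Finset.univ.image α).card = k).card ≤
      n ^ k * k ^ Fintype.card σ := by
  have h1 : (Finset.univ.filter fun α : σ → Fin n => (Finset.univ.image α).card = k) ⊆
      Finset.univ.image (fun x : (Fin k → Fin n) × (σ → Fin k) => x.1 ∘ x.2) := by
    intro α hα
    have hα := (Finset.mem_filter.1 hα).2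
    let f := (Finset.univ.image α).equivFinOfCardEq hα
    refine Finset.mem_image.2 ⟨(fun i => (f.symm i : Fin n), fun s => f ⟨α s, by simp⟩),
      Finset.mem_univ _, ?_⟩
    ext s
    simp
  refine (Finset.card_le_card h1).trans (Finset.card_image_le.trans ?_)
  simp

/-- Sorted by the number `j` of values: of the order of `n ^ j` selections take exactly `j` values,
and `n ^ j ε ^ (2 j) = 1`. -/
theorem exists_card_filter_mul_eps_le (σ : Type*) [Fintype σ] [DecidableEq σ] :
    ∃ C : ℝ, 0 ≤ C ∧ ∀ n, 3 ≤ n → ∀ k,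
    ((Finset.univ.filter fun α : σ → Fin n =>
      2 * (Finset.univ.image α).card + k ≤ Fintype.card σ).card : ℝ) * eps n ^ Fintype.card σ ≤
        C * eps n ^ k := by
  set N := Fintype.card σ with hN
  refine ⟨∑ j ∈ Finset.range (N + 1), (j : ℝ) ^ N, Finset.sum_nonneg fun j _ => by positivity,
    fun n hn k => ?_⟩
  have h1 : (Finset.univ.filter fun α : σ → Fin n =>
      2 * (Finset.univ.image α).card + k ≤ N) ⊆
      ((Finset.range (N + 1)).filter fun j => 2 * j + k ≤ N).biUnion fun j =>
        Finset.univ.filter fun α : σ → Fin n => (Finset.univ.image α).card = j := by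
    intro α hα
    have hα := (Finset.mem_filter.1 hα).2
    simp only [Finset.mem_biUnion, Finset.mem_filter, Finset.mem_range, Finset.mem_univ, true_and]
    exact ⟨_, ⟨by omega, hα⟩, rfl⟩
  have h2 := (Finset.card_le_card h1).trans Finset.card_biUnion_le
  have h3 : ((Finset.univ.filter fun α : σ → Fin n =>
      2 * (Finset.univ.image α).card + k ≤ N).card : ℝ) ≤
      ∑ j ∈ (Finset.range (N + 1)).filter fun j => 2 * j + k ≤ N, (n : ℝ) ^ j * (j : ℝ) ^ N := by
    refine (Nat.cast_le.2 h2).trans ?_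
    push_cast
    refine Finset.sum_le_sum fun j _ => ?_
    exact_mod_cast card_filter_card_image_le (σ := σ) n j
  refine (mul_le_mul_of_nonneg_right h3 (pow_nonneg (eps_nonneg n) _)).trans ?_
  rw [Finset.sum_mul, Finset.sum_mul, Finset.sum_filter]
  refine Finset.sum_le_sum fun j _ => ?_
  have he := eps_nonneg n
  split_ifs with hj
  · obtain ⟨l, hl⟩ := Nat.exists_eq_add_of_le hj
    have h4 : eps n ^ N = eps n ^ (2 * j) * (eps n ^ k * eps n ^ l) := by
      rw [← pow_add, ← pow_add, hl]
      ring_nf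
    have h5 : (n : ℝ) ^ j * eps n ^ (2 * j) = 1 := by
      rw [pow_mul, ← mul_pow, mul_eps_sq hn, one_pow]
    calc (n : ℝ) ^ j * (j : ℝ) ^ N * eps n ^ N
        = ((n : ℝ) ^ j * eps n ^ (2 * j)) * ((j : ℝ) ^ N * eps n ^ k) * eps n ^ l := by
          rw [h4]; ring
      _ ≤ 1 * ((j : ℝ) ^ N * eps n ^ k) * 1 := by
          rw [h5]
          exact mul_le_mul_of_nonneg_left (pow_le_one₀ he (eps_le_one hn)) (by positivity)
      _ = _ := by ring
  · positivity

end Combinatorics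

end CycleCorrelations

end

noncomputable section

namespace CycleCorrelations

/-! ### Extremal selections on a cycle of positions. -/

section Tight

variable {E R K σ τ : Type*}

/-- Every position shares its row with exactly one other position. -/
def TwoPerRow (r : E → R) : Prop :=
  ∀ e, ∃ e', e' ≠ e ∧ r e' = r e ∧ ∀ e'', r e'' = r e → e'' = e ∨ e'' = e'

/-- The positions are connected by their rows and columns. -/
def PosConn (r : E → R) (c : E → K) : Prop :=
  ∀ F : Finset E, F.Nonempty → (∃ e, e ∉ F) → ∃ e ∈ F, ∃ e', e' ∉ F ∧ (r e = r e' ∨ c e = c e')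

/-- The positions are connected by slots having the same value and the same row or column. -/
def StrongSlotConn (r : E → R) (c : E → K) (p : σ → E) (α : σ → τ) : Prop :=
  ∀ F : Finset E, F.Nonempty → (∃ e, e ∉ F) → ∃ s s', α s = α s' ∧ p s ∈ F ∧ p s' ∉ F ∧
    (r (p s) = r (p s') ∨ c (p s) = c (p s'))

theorem StrongSlotConn.slotConn {r : E → R} {c : E → K} {p : σ → E} {α : σ → τ}
    (h : StrongSlotConn r c p α) : SlotConn p α := fun F hF hF' => by
  obtain ⟨s, s', h1, h2, h3, -⟩ := h F hF hF'
  exact ⟨s, s', h1, h2, h3⟩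

/-- Every position has exactly one slot with value `t`, and the other slots are matched in pairs
at the same position with values not taken elsewhere. -/
def TightAt (p : σ → E) (α : σ → τ) (t : τ) : Prop :=
  (∀ e, ∃ s, p s = e ∧ α s = t ∧ ∀ s', p s' = e → α s' = t → s' = s) ∧
    ∀ s, α s ≠ t → ∃ s', s' ≠ s ∧ p s' = p s ∧ α s' = α s ∧ ∀ s'', α s'' = α s → s'' = s ∨ s'' = s'

/-- The slot is the only one of its value at its position. -/
def SingleSlot (p : σ → E) (α : σ → τ) (s : σ) : Prop := ∀ s', p s' = p s → α s' = α s → s' = s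

/-- Every slot has exactly one partner with the same value and the same row. -/
def UniquePartner (r : E → R) (p : σ → E) (α : σ → τ) : Prop :=
  ∀ s, ∃ s', s' ≠ s ∧ α s' = α s ∧ r (p s') = r (p s) ∧
    ∀ s'', α s'' = α s → r (p s'') = r (p s) → s'' = s ∨ s'' = s'

/-- The partner of a slot that is alone at its position must sit at the other position of the row,
and by uniqueness it is alone there. The property therefore propagates along rows, and by symmetry
along columns. -/
theorem UniquePartner.single_of_row {r : E → R} {p : σ → E} {α : σ → τ}
    (h : UniquePartner r p α) (hr : TwoPerRow r) {s : σ} (hs : SingleSlot p α s) {e : E}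
    (he : r e = r (p s)) : ∃ s', SingleSlot p α s' ∧ p s' = e ∧ α s' = α s := by
  by_cases hes : e = p s
  · exact ⟨s, hs, hes.symm, rfl⟩
  obtain ⟨s₁, hne, hα, hr₁, huniq⟩ := h s
  have hp₁ : p s₁ ≠ p s := fun hp => hne (hs s₁ hp hα)
  obtain ⟨e', hne', hre', hall⟩ := hr (p s)
  have h1 : p s₁ = e' := (hall _ hr₁).resolve_left hp₁
  have h2 : e = e' := (hall _ he).resolve_left hes
  refine ⟨s₁, fun s₂ hp₂ hα₂ => ?_, h1.trans h2.symm, hα⟩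
  rcases huniq s₂ (hα₂.trans hα) (by rw [hp₂, hr₁]) with h | h
  · exact absurd (by rw [← hp₂, h]) hp₁
  · exact h

/-- The slot `s'` at another position already is the unique partner, which leaves no room for a
second slot at the position of `s`. -/
theorem UniquePartner.single_of_ne {r : E → R} {p : σ → E} {α : σ → τ}
    (h : UniquePartner r p α) {s s' : σ} (hα : α s = α s') (hp : p s' ≠ p s)
    (hr : r (p s) = r (p s')) : SingleSlot p α s := by
  intro s₂ hp₂ hα₂
  by_contra hne
  obtain ⟨s₁, -, -, -, huniq⟩ := h s
  have h1 := (huniq s' hα.symm hr.symm).resolve_left fun h => hp (by rw [h])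
  have h2 := (huniq s₂ hα₂ (by rw [hp₂])).resolve_left hne
  exact hp (by rw [h1, ← h2, hp₂])

variable [DecidableEq E] [DecidableEq R] [DecidableEq K] [Fintype σ] [DecidableEq σ]
  [DecidableEq τ]

/-- The equality case of `NoSingle.numVert_le`: every row and every column met by a value holds
exactly two of its slots. -/
theorem uniquePartner_of_card {r : E → R} {c : E → K} {p : σ → E} {α : σ → τ}
    (h : NoSingle r c p α) (heq : ∀ s, numVert r c (slotPos p α {α s}) =
      (Finset.univ.filter fun s' => α s' = α s).card) : UniquePartner r p α := by
  intro s
  have h1 := h.two_mul_card_row (α s)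
  have h2 := h.swap.two_mul_card_row (α s)
  have h3 := heq s
  unfold numVert at h3
  rw [image_slotPos_singleton] at h1 h2 h3
  rw [image_slotPos_singleton] at h3
  set T := Finset.univ.filter fun s' => α s' = α s with hT
  have h4 := card_fiber_eq_two T (fun s => r (p s)) (fun s hs => by
    simp only [hT, Finset.mem_filter, Finset.mem_univ, true_and] at hs ⊢
    obtain ⟨⟨s', hne, h1, h2⟩, -⟩ := h s
    exact ⟨s', h1.trans hs, hne, h2⟩) (by omega) (b := r (p s))
    (Finset.mem_image.2 ⟨s, by simp [hT], rfl⟩)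
  obtain ⟨⟨s', hne, hα, hr⟩, -⟩ := h s
  refine ⟨s', hne, hα, hr, fun s'' hα'' hr'' => ?_⟩
  by_contra hcon
  push Not at hcon
  have h5 : ({s, s', s''} : Finset σ) ⊆ T.filter fun x => r (p x) = r (p s) := by
    intro x hx
    simp only [Finset.mem_insert, Finset.mem_singleton] at hx
    simp only [hT, Finset.mem_filter, Finset.mem_univ, true_and]
    rcases hx with rfl | rfl | rfl
    · simp
    · exact ⟨hα, hr⟩
    · exact ⟨hα'', hr''⟩
  have h6 := Finset.card_le_card h5
  rw [h4, Finset.card_eq_three.2 ⟨s, s', s'', hne.symm, hcon.1.symm, hcon.2.symm, rfl⟩] at h6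
  omega

/-- For a cycle of positions, the extremal slot values are the tight ones. -/
theorem exists_tightAt [Fintype E] [Nonempty E] {r : E → R} {c : E → K} {p : σ → E} {α : σ → τ}
    (hinj : Function.Injective fun e => (r e, c e)) (hr : TwoPerRow r) (hc : TwoPerRow c)
    (hpos : PosConn r c) (h : NoSingle r c p α) (hconn : StrongSlotConn r c p α)
    (hcard : Fintype.card σ + 2 ≤ 2 * (Finset.univ.image α).card + numVert r c Finset.univ) :
    ∃ t, TightAt p α t := by
  obtain ⟨e₀⟩ := ‹Nonempty E›
  obtain ⟨e₁, hne₁, -⟩ := hr e₀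
  obtain ⟨s₀, s₁, hα₀₁, hp₀, hp₁, hrc⟩ := hconn {e₀} (Finset.singleton_nonempty _)
    ⟨e₁, by simpa using hne₁⟩
  have hp₀₁ : p s₁ ≠ p s₀ := by
    rw [Finset.mem_singleton.1 hp₀]
    simpa using hp₁
  have : Nonempty σ := ⟨s₀⟩
  have hsum1 := numVert_add_le_sum r c hconn.slotConn
  have hsum2 : ∑ t ∈ Finset.univ.image α, (Finset.univ.filter fun s => α s = t).card =
      Fintype.card σ := by
    rw [← Finset.card_eq_sum_card_image, Finset.card_univ]
  -- `hcard` is the reverse of the counting bound, so equality holds in the estimate of every single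
  -- value.
  have heq : ∀ t ∈ Finset.univ.image α, numVert r c (slotPos p α {t}) =
      (Finset.univ.filter fun s => α s = t).card := by
    intro t ht
    by_contra hne
    have := Finset.sum_lt_sum (fun t _ => h.numVert_le t)
      ⟨t, ht, lt_of_le_of_ne (h.numVert_le t) hne⟩
    omega
  have heqs : ∀ s, numVert r c (slotPos p α {α s}) =
      (Finset.univ.filter fun s' => α s' = α s).card := fun s => heq _ (by simp)
  have hUr : UniquePartner r p α := uniquePartner_of_card h heqs
  have hUc : UniquePartner c p α := by
    refine uniquePartner_of_card h.swap fun s => ?_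
    rw [← heqs s]
    unfold numVert
    rw [add_comm]
  have hs₀ : SingleSlot p α s₀ := by
    rcases hrc with h' | h'
    · exact hUr.single_of_ne hα₀₁ hp₀₁ h'
    · exact hUc.single_of_ne hα₀₁ hp₀₁ h'
  -- The value `α s₀` is shared between two positions; from there it spreads along rows and columns
  -- to the whole connected family.
  have hall : ∀ e, ∃ s, SingleSlot p α s ∧ p s = e ∧ α s = α s₀ := by
    classical
    by_contra hcon
    push Not at hcon
    obtain ⟨e, he⟩ := hcon
    let F : Finset E := Finset.univ.filter fun e => ∃ s, SingleSlot p α s ∧ p s = e ∧ α s = α s₀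
    obtain ⟨e, heF, e', heF', hee⟩ := hpos F ⟨p s₀, by simpa [F] using ⟨s₀, hs₀, rfl, rfl⟩⟩
      ⟨e, by simpa [F] using he⟩
    simp only [F, Finset.mem_filter, Finset.mem_univ, true_and] at heF heF'
    obtain ⟨s, hs, rfl, hα⟩ := heF
    apply heF'
    rcases hee with h' | h'
    · obtain ⟨s', h1, h2, h3⟩ := hUr.single_of_row hr hs h'.symm
      exact ⟨s', h1, h2, h3.trans hα⟩
    · obtain ⟨s', h1, h2, h3⟩ := hUc.single_of_row hc hs h'.symm
      exact ⟨s', h1, h2, h3.trans hα⟩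
  refine ⟨α s₀, fun e => ?_, fun s hs => ?_⟩
  · obtain ⟨s, h1, h2, h3⟩ := hall e
    exact ⟨s, h2, h3, fun s' h4 h5 => h1 s' (h4.trans h2.symm) (h5.trans h3.symm)⟩
  · have hU : slotPos p α {α s₀} = Finset.univ := by
      refine Finset.eq_univ_iff_forall.2 fun e => mem_slotPos.2 ?_
      obtain ⟨s, -, h2, h3⟩ := hall e
      exact ⟨s, by simp [h3], h2⟩
    have hmem₀ : α s₀ ∈ Finset.univ.image α := by simp
    have hsum3 : ∑ t ∈ Finset.univ.image α, numVert r c (slotPos p α {t}) = Fintype.card σ := by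
      rw [← hsum2]
      exact Finset.sum_congr rfl heq
    rw [← Finset.add_sum_erase _ _ hmem₀, hU] at hsum3
    have hcard' := Finset.card_erase_add_one hmem₀
    -- The value `α s₀` meets all vertices, so equality leaves an average of two vertices for each
    -- other value. Each meets at least two, hence exactly two.
    have htwo : numVert r c (slotPos p α {α s}) = 2 := by
      by_contra hne
      have h2 : ∀ t ∈ (Finset.univ.image α).erase (α s₀),
          2 ≤ numVert r c (slotPos p α {t}) := by
        intro t ht
        obtain ⟨s, -, rfl⟩ := Finset.mem_image.1 (Finset.mem_of_mem_erase ht)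
        exact two_le_numVert r c ⟨p s, mem_slotPos.2 ⟨s, by simp, rfl⟩⟩
      have hmem : α s ∈ (Finset.univ.image α).erase (α s₀) :=
        Finset.mem_erase.2 ⟨hs, by simp⟩
      have := Finset.sum_lt_sum h2 ⟨α s, hmem, lt_of_le_of_ne (h2 _ hmem) (Ne.symm hne)⟩
      rw [Finset.sum_const, smul_eq_mul] at this
      omega
    rw [heqs s] at htwo
    obtain ⟨s₁, hne, hα₁, hr₁, -⟩ := hUr s
    obtain ⟨s₂, hne₂, hα₂, hc₂, -⟩ := hUc s
    have huniq : ∀ s'', α s'' = α s → s'' = s ∨ s'' = s₁ := by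
      intro s'' hα''
      by_contra hcon
      push Not at hcon
      have h5 : ({s, s₁, s''} : Finset σ) ⊆ Finset.univ.filter fun s' => α s' = α s := by
        intro x hx
        simp only [Finset.mem_insert, Finset.mem_singleton] at hx
        simp only [Finset.mem_filter, Finset.mem_univ, true_and]
        rcases hx with rfl | rfl | rfl
        exacts [rfl, hα₁, hα'']
      have h6 := Finset.card_le_card h5
      rw [htwo, Finset.card_eq_three.2 ⟨s, s₁, s'', hne.symm, hcon.1.symm, hcon.2.symm, rfl⟩] at h6
      omega
    refine ⟨s₁, hne, hinj (Prod.ext hr₁ ?_), hα₁, huniq⟩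
    have : s₂ = s₁ := (huniq s₂ hα₂).resolve_left hne₂
    simpa [← this] using hc₂

end Tight

/-! ### Multilinearity of the joint cumulant. -/

section Multilinear

variable {Ω : Type*} [MeasurableSpace Ω]

/-- The random variables with finite moments of all orders form a vector space. -/
def allMomSubmodule (P : Measure Ω) [IsProbabilityMeasure P] : Submodule ℝ (Ω → ℝ) where
  carrier := {Z | AllMom P Z}
  add_mem' h h' := h.add h'
  zero_mem' := AllMom.const 0
  smul_mem' c _ h := h.const_mul c

variable {P : Measure Ω} [IsProbabilityMeasure P] {E : Type*} [Fintype E] [DecidableEq E]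

/-- Only the block containing `e` sees the variable at `e`, so each partition contributes a linear
function of that variable. -/
theorem prod_parts_update (π : Finpartition (Finset.univ : Finset E)) (X : E → Ω → ℝ) (e : E)
    (Z : Ω → ℝ) : ∏ B ∈ π.parts, ∫ ω, ∏ i ∈ B, Function.update X e Z i ω ∂P =
      (∫ ω, Z ω * ∏ i ∈ (π.part e).erase e, X i ω ∂P) *
        ∏ B ∈ π.parts.erase (π.part e), ∫ ω, ∏ i ∈ B, X i ω ∂P := by
  have hmem : π.part e ∈ π.parts := π.part_mem.2 (Finset.mem_univ e)
  have he : e ∈ π.part e := π.mem_part (Finset.mem_univ e)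
  rw [← Finset.mul_prod_erase _ _ hmem]
  congr 1
  · refine integral_congr_ae (Filter.Eventually.of_forall fun ω => ?_)
    simp only
    rw [← Finset.mul_prod_erase _ _ he, Function.update_self]
    congr 1
    exact Finset.prod_congr rfl fun i hi => by
      rw [Function.update_of_ne (Finset.ne_of_mem_erase hi)]
  · refine Finset.prod_congr rfl fun B hB => ?_
    refine integral_congr_ae (Filter.Eventually.of_forall fun ω => ?_)
    refine Finset.prod_congr rfl fun i hi => ?_
    rw [Function.update_of_ne]
    rintro rfl
    exact Finset.ne_of_mem_erase hB
      (π.eq_of_mem_parts (Finset.mem_of_mem_erase hB) hmem hi he)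

/-- The joint cumulant as a multilinear map. -/
def cumulantMap (P : Measure Ω) [IsProbabilityMeasure P] (E : Type*) [Fintype E]
    [dE : DecidableEq E] :
    MultilinearMap ℝ (fun _ : E => allMomSubmodule P) ℝ where
  toFun X := setCumulant (fun B => ∫ ω, ∏ i ∈ B, (X i : Ω → ℝ) ω ∂P) Finset.univ
  map_update_add' {inst} X e x y := by
    obtain rfl : dE = inst := Subsingleton.elim _ _
    have hup : ∀ z : allMomSubmodule P,
        (fun i => ((Function.update X e z i : allMomSubmodule P) : Ω → ℝ)) =
        Function.update (fun i => (X i : Ω → ℝ)) e (z : Ω → ℝ) := by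
      intro z
      ext i ω
      by_cases h : i = e
      · subst h; simp
      · simp [Function.update_of_ne h]
    simp only [setCumulant]
    rw [← Finset.sum_add_distrib]
    refine Finset.sum_congr rfl fun π _ => ?_
    have hX : ∀ z : allMomSubmodule P, ∏ B ∈ π.parts, ∫ ω, ∏ i ∈ B,
        ((Function.update X e z i : allMomSubmodule P) : Ω → ℝ) ω ∂P =
        (∫ ω, (z : Ω → ℝ) ω * ∏ i ∈ (π.part e).erase e, (X i : Ω → ℝ) ω ∂P) *
          ∏ B ∈ π.parts.erase (π.part e), ∫ ω, ∏ i ∈ B, (X i : Ω → ℝ) ω ∂P := fun z => by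
      have h2 := prod_parts_update (P := P) π (fun i => (X i : Ω → ℝ)) e (z : Ω → ℝ)
      rw [← hup] at h2
      exact h2
    rw [hX, hX, hX, ← mul_add, ← add_mul, ← integral_add]
    · simp only [Submodule.coe_add, Pi.add_apply, add_mul]
    · exact (AllMom.mul x.2 (AllMom.prod _ fun i _ => (X i).2)).integrable
    · exact (AllMom.mul y.2 (AllMom.prod _ fun i _ => (X i).2)).integrable
  map_update_smul' {inst} X e a x := by
    obtain rfl : dE = inst := Subsingleton.elim _ _
    have hup : ∀ z : allMomSubmodule P,
        (fun i => ((Function.update X e z i : allMomSubmodule P) : Ω → ℝ)) =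
        Function.update (fun i => (X i : Ω → ℝ)) e (z : Ω → ℝ) := by
      intro z
      ext i ω
      by_cases h : i = e
      · subst h; simp
      · simp [Function.update_of_ne h]
    simp only [setCumulant]
    rw [Finset.smul_sum]
    refine Finset.sum_congr rfl fun π _ => ?_
    have hX : ∀ z : allMomSubmodule P, ∏ B ∈ π.parts, ∫ ω, ∏ i ∈ B,
        ((Function.update X e z i : allMomSubmodule P) : Ω → ℝ) ω ∂P =
        (∫ ω, (z : Ω → ℝ) ω * ∏ i ∈ (π.part e).erase e, (X i : Ω → ℝ) ω ∂P) *
          ∏ B ∈ π.parts.erase (π.part e), ∫ ω, ∏ i ∈ B, (X i : Ω → ℝ) ω ∂P := fun z => by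
      have h2 := prod_parts_update (P := P) π (fun i => (X i : Ω → ℝ)) e (z : Ω → ℝ)
      rw [← hup] at h2
      exact h2
    rw [hX, hX]
    simp only [Submodule.coe_smul, Pi.smul_apply, smul_eq_mul, mul_assoc]
    rw [integral_const_mul]
    ring

/-- Expansion of the joint cumulant of linear combinations. -/
theorem setCumulant_sum {κ : E → Type*} (J : ∀ e, Finset (κ e)) (a : ∀ e, κ e → ℝ)
    (Y : ∀ e, κ e → Ω → ℝ) (hY : ∀ e j, AllMom P (Y e j)) :
    setCumulant (fun B => ∫ ω, ∏ e ∈ B, ∑ j ∈ J e, a e j * Y e j ω ∂P) Finset.univ =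
      ∑ f ∈ Fintype.piFinset J, (∏ e, a e (f e)) *
        setCumulant (fun B => ∫ ω, ∏ e ∈ B, Y e (f e) ω ∂P) Finset.univ := by
  have h1 := (cumulantMap P E).map_sum_finset (α := κ)
    (fun e j => a e j • (⟨Y e j, hY e j⟩ : allMomSubmodule P)) J
  have h2 : ∀ f : ∀ e, κ e, cumulantMap P E (fun e => a e (f e) •
      (⟨Y e (f e), hY e (f e)⟩ : allMomSubmodule P)) = (∏ e, a e (f e)) *
        setCumulant (fun B => ∫ ω, ∏ e ∈ B, Y e (f e) ω ∂P) Finset.univ := by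
    intro f
    rw [MultilinearMap.map_smul_univ]
    rfl
  simp only [h2] at h1
  rw [← h1]
  simp [cumulantMap]

end Multilinear

end CycleCorrelations

end

noncomputable section

namespace CycleCorrelations

theorem numVert_swap {E R K : Type*} [DecidableEq R] [DecidableEq K] (r : E → R) (c : E → K)
    (F : Finset E) : numVert r c F = numVert c r F := add_comm _ _

/-! ### Cumulants of single selections and of powers of the entries. -/

namespace RFModel

variable {mW mX : ℕ → ℝ} {n : ℕ} (M : RFModel mW mX n)

section Slots

variable {E σ : Type*} [DecidableEq E] [Fintype σ] [DecidableEq σ]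

/-- The joint moment of the summands selected by `α` at the positions in `B`. -/
def slotMom (r : E → Fin M.n₁) (c : E → Fin M.m) (p : σ → E) (α : σ → Fin n) (B : Finset E) : ℝ :=
  ∫ ω, ∏ s ∈ Finset.univ.filter (fun s => p s ∈ B), M.ξ (r (p s)) (α s) (c (p s)) ω ∂M.P

variable {r : E → Fin M.n₁} {c : E → Fin M.m} {p : σ → E} {α : σ → Fin n}

theorem slotMom_empty : M.slotMom r c p α ∅ = 1 := by
  simp [slotMom]

theorem slotMom_eq_zero_of_row {s : σ} {B : Finset E} (hs : p s ∈ B)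
    (h : ∀ s', p s' ∈ B → α s' = α s → r (p s') = r (p s) → s' = s) :
    M.slotMom r c p α B = 0 := by
  refine M.integral_prod_ξ_eq_zero_of_row (r (p s), α s) (Finset.card_eq_one.2 ⟨s, ?_⟩)
  ext s'
  simp only [Finset.mem_filter, Finset.mem_univ, true_and, Prod.mk.injEq, Finset.mem_singleton]
  constructor
  · rintro ⟨h1, h2, h3⟩
    exact h s' h1 h3 h2
  · rintro rfl
    exact ⟨hs, rfl, rfl⟩

theorem slotMom_eq_zero_of_col {s : σ} {B : Finset E} (hs : p s ∈ B)
    (h : ∀ s', p s' ∈ B → α s' = α s → c (p s') = c (p s) → s' = s) :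
    M.slotMom r c p α B = 0 := by
  refine M.integral_prod_ξ_eq_zero_of_col (α s, c (p s)) (Finset.card_eq_one.2 ⟨s, ?_⟩)
  ext s'
  simp only [Finset.mem_filter, Finset.mem_univ, true_and, Prod.mk.injEq, Finset.mem_singleton]
  constructor
  · rintro ⟨h1, h2, h3⟩
    exact h s' h1 h2 h3
  · rintro rfl
    exact ⟨hs, rfl, rfl⟩

/-- A slot without partner uses an entry of `W` or `X` exactly once. In each partition, the block
containing its position then has moment zero. -/
theorem noSingle_of_ne [Fintype E]
    (h : setCumulant (M.slotMom r c p α) Finset.univ ≠ 0) : NoSingle r c p α := by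
  intro s
  constructor
  · by_contra hcon
    push Not at hcon
    refine h (setCumulant_eq_zero_of_mem _ _ (Finset.mem_univ (p s)) fun B _ hB =>
      M.slotMom_eq_zero_of_row hB fun s' _ h1 h2 => ?_)
    by_contra hne
    exact hcon s' hne h1 h2
  · by_contra hcon
    push Not at hcon
    refine h (setCumulant_eq_zero_of_mem _ _ (Finset.mem_univ (p s)) fun B _ hB =>
      M.slotMom_eq_zero_of_col hB fun s' _ h1 h2 => ?_)
    by_contra hne
    exact hcon s' hne h1 h2

/-- If no entry is used on both sides of `F`, all joint moments factor over `F` and its complement,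
so the cumulant vanishes. -/
theorem strongSlotConn_of_ne [Fintype E]
    (h : setCumulant (M.slotMom r c p α) Finset.univ ≠ 0) : StrongSlotConn r c p α := by
  intro F hF hF'
  by_contra hcon
  push Not at hcon
  refine h (setCumulant_eq_zero_of_factor _ M.slotMom_empty F (fun S => ?_) Finset.univ
    (by simpa using hF) ?_)
  swap
  · obtain ⟨e, he⟩ := hF'
    exact ⟨e, by simpa using he⟩
  · simp only [slotMom, integral_prod_ξ]
    rw [mul_mul_mul_comm, ← Finset.prod_mul_distrib, ← Finset.prod_mul_distrib]
    -- Applied to the slots using one given entry: they all lie on one side, so the exponent on the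
    -- other side is zero and the corresponding moment is one.
    have split : ∀ (q : σ → Prop) [DecidablePred q], (∀ s s', q s → q s' → p s ∈ F → p s' ∈ F) →
        ((Finset.univ.filter fun s => p s ∈ S).filter q).card =
          ((Finset.univ.filter fun s => p s ∈ S ∩ F).filter q).card ∧
        ((Finset.univ.filter fun s => p s ∈ S \ F).filter q).card = 0 ∨
        ((Finset.univ.filter fun s => p s ∈ S).filter q).card =
          ((Finset.univ.filter fun s => p s ∈ S \ F).filter q).card ∧
        ((Finset.univ.filter fun s => p s ∈ S ∩ F).filter q).card = 0 := by
      intro q _ hq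
      by_cases hex : ∃ s, q s ∧ p s ∈ F
      · obtain ⟨s, hs, hsF⟩ := hex
        left
        constructor
        · congr 1
          ext s'
          simp only [Finset.mem_filter, Finset.mem_univ, true_and, Finset.mem_inter]
          exact ⟨fun h => ⟨⟨h.1, hq s s' hs h.2 hsF⟩, h.2⟩, fun h => ⟨h.1.1, h.2⟩⟩
        · rw [Finset.card_eq_zero, Finset.eq_empty_iff_forall_notMem]
          intro s' h
          simp only [Finset.mem_filter, Finset.mem_univ, true_and, Finset.mem_sdiff] at h
          exact h.1.2 (hq s s' hs h.2 hsF)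
      · push Not at hex
        right
        constructor
        · congr 1
          ext s'
          simp only [Finset.mem_filter, Finset.mem_univ, true_and, Finset.mem_sdiff]
          exact ⟨fun h => ⟨⟨h.1, hex s' h.2⟩, h.2⟩, fun h => ⟨h.1.1, h.2⟩⟩
        · rw [Finset.card_eq_zero, Finset.eq_empty_iff_forall_notMem]
          intro s' h
          simp only [Finset.mem_filter, Finset.mem_univ, true_and, Finset.mem_inter] at h
          exact hex s' h.2 h.1.2
    congr 1
    · refine Finset.prod_congr rfl fun x _ => ?_
      rcases split (fun s => (r (p s), α s) = x) (fun s s' h1 h2 h3 => by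
        by_contra h4
        have h5 := h1.trans h2.symm
        simp only [Prod.mk.injEq] at h5
        exact (hcon s s' h5.2 h3 h4).1 h5.1) with ⟨h1, h2⟩ | ⟨h1, h2⟩
      · rw [h1, h2, M.mW0, mul_one]
      · rw [h1, h2, M.mW0, one_mul]
    · refine Finset.prod_congr rfl fun x _ => ?_
      rcases split (fun s => (α s, c (p s)) = x) (fun s s' h1 h2 h3 => by
        by_contra h4
        have h5 := h1.trans h2.symm
        simp only [Prod.mk.injEq] at h5
        exact (hcon s s' h5.1 h3 h4).2 h5.2) with ⟨h1, h2⟩ | ⟨h1, h2⟩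
      · rw [h1, h2, M.mX0, mul_one]
      · rw [h1, h2, M.mX0, one_mul]

theorem integral_abs_ξ_pow_le (i : Fin M.n₁) (a : Fin n) (j : Fin M.m) (q : ℕ) :
    ∫ ω, |M.ξ i a j ω| ^ q ∂M.P ≤ (1 + mW (2 * q)) * (1 + mX (2 * q)) :=
  (M.toArray (fun _ : Unit => i) (fun _ => j) (fun _ _ _ => rfl)).mom_le a () q

end Slots

variable (mW mX)

theorem exists_abs_slotMom_le (σ : Type*) [Fintype σ] [DecidableEq σ] : ∃ K : ℝ, 1 ≤ K ∧
    ∀ (E : Type*) [DecidableEq E] (n : ℕ) (M : RFModel mW mX n) (r : E → Fin M.n₁)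
      (c : E → Fin M.m) (p : σ → E) (α : σ → Fin n) (B : Finset E),
      |M.slotMom r c p α B| ≤ K := by
  set N := Fintype.card σ with hN
  set b : ℝ := (1 + mW (2 * N)) * (1 + mX (2 * N)) with hb
  refine ⟨1 + ∑ s : σ, 2 ^ N * (1 + |b|), ?_, ?_⟩
  · have : 0 ≤ ∑ s : σ, 2 ^ N * (1 + |b|) := Finset.sum_nonneg fun s _ => by positivity
    linarith
  intro E _ n M r c p α B
  have hone : ∀ s ω, (1 : ℝ) ≤ 1 + |M.ξ (r (p s)) (α s) (c (p s)) ω| := fun s ω => by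
    linarith [abs_nonneg (M.ξ (r (p s)) (α s) (c (p s)) ω)]
  have hpt : ∀ ω, |∏ s ∈ Finset.univ.filter (fun s => p s ∈ B),
      M.ξ (r (p s)) (α s) (c (p s)) ω| ≤
      1 + ∑ s, 2 ^ N * (1 + |M.ξ (r (p s)) (α s) (c (p s)) ω| ^ N) := by
    intro ω
    rw [Finset.abs_prod]
    calc ∏ s ∈ Finset.univ.filter (fun s => p s ∈ B), |M.ξ (r (p s)) (α s) (c (p s)) ω|
        ≤ ∏ s ∈ Finset.univ.filter (fun s => p s ∈ B),
            (1 + |M.ξ (r (p s)) (α s) (c (p s)) ω|) :=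
          Finset.prod_le_prod (fun _ _ => abs_nonneg _) fun s _ => by linarith
      _ ≤ ∏ s, (1 + |M.ξ (r (p s)) (α s) (c (p s)) ω|) :=
by
          rw [Finset.prod_filter]
          refine Finset.prod_le_prod (fun s _ => ?_) fun s _ => ?_ <;> split_ifs <;>
            linarith [hone s ω]
      _ ≤ 1 + ∑ s, (1 + |M.ξ (r (p s)) (α s) (c (p s)) ω|) ^ N :=
          prod_le_one_add_sum_pow _ fun s => hone s ω
      _ ≤ _ := by
          gcongr with s _
          set y := |M.ξ (r (p s)) (α s) (c (p s)) ω| with hy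
          have hy0 : 0 ≤ y := abs_nonneg _
          rcases le_total y 1 with h | h
          · calc (1 + y) ^ N ≤ 2 ^ N := by
                  refine pow_le_pow_left₀ (by positivity) (by linarith) _
              _ ≤ _ := by nlinarith [pow_pos (zero_lt_two' ℝ) N, pow_nonneg hy0 N]
          · calc (1 + y) ^ N ≤ (2 * y) ^ N := by
                  refine pow_le_pow_left₀ (by positivity) (by linarith) _
              _ = 2 ^ N * y ^ N := mul_pow _ _ _
              _ ≤ _ := by nlinarith [pow_pos (zero_lt_two' ℝ) N]
  have hint : ∀ s ∈ (Finset.univ : Finset σ), Integrable (fun ω => 2 ^ N *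
      (1 + |M.ξ (r (p s)) (α s) (c (p s)) ω| ^ N)) M.P := fun s _ =>
    ((integrable_const _).add ((M.allMom_ξ _ _ _).2 N)).const_mul _
  calc |M.slotMom r c p α B| ≤ ∫ ω, |∏ s ∈ Finset.univ.filter (fun s => p s ∈ B),
        M.ξ (r (p s)) (α s) (c (p s)) ω| ∂M.P := abs_integral_le_integral_abs
    _ ≤ ∫ ω, (1 + ∑ s, 2 ^ N * (1 + |M.ξ (r (p s)) (α s) (c (p s)) ω| ^ N)) ∂M.P :=
        integral_mono (AllMom.prod _ fun s _ => M.allMom_ξ _ _ _).abs.integrable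
          ((integrable_const _).add (integrable_finsetSum _ hint)) hpt
    _ ≤ _ := by
        rw [integral_add (integrable_const _) (integrable_finsetSum _ hint),
          integral_finsetSum _ hint]
        simp only [integral_const, probReal_univ, one_smul]
        gcongr with s _
        rw [integral_const_mul, integral_add (integrable_const _) ((M.allMom_ξ _ _ _).2 N)]
        simp only [integral_const, probReal_univ, one_smul]
        gcongr
        exact (M.integral_abs_ξ_pow_le _ _ _ N).trans (le_abs_self b)

variable {mW mX}

section Powers

variable {E : Type*} [Fintype E] [DecidableEq E] (r : E → Fin M.n₁) (c : E → Fin M.m)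

theorem H_pow (i : Fin M.n₁) (j : Fin M.m) (d : ℕ) (ω : M.Ω) :
    M.H i j ω ^ d = ∑ α : Fin d → Fin n, eps n ^ d * ∏ s, M.ξ i (α s) j ω := by
  rw [H, mul_pow, Fintype.sum_pow, Finset.mul_sum]

theorem prod_filter_sigma (d : E → ℕ) (α : (Σ e, Fin (d e)) → Fin n) (B : Finset E) (ω : M.Ω) :
    ∏ s ∈ Finset.univ.filter (fun s : Σ e, Fin (d e) => s.1 ∈ B),
      M.ξ (r s.1) (α s) (c s.1) ω = ∏ e ∈ B, ∏ s, M.ξ (r e) (α ⟨e, s⟩) (c e) ω := by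
  rw [Finset.prod_sigma']
  refine Finset.prod_congr ?_ fun _ _ => rfl
  ext s
  simp

/-- Position `e` carries `d e` slots, one for each factor of the power; multilinearity expands the
cumulant into selections of an inner index for every slot. -/
theorem setCumulant_pow (d : E → ℕ) :
    setCumulant (fun B => ∫ ω, ∏ e ∈ B, M.H (r e) (c e) ω ^ d e ∂M.P) Finset.univ =
      eps n ^ (∑ e, d e) * ∑ α : (Σ e, Fin (d e)) → Fin n,
        setCumulant (M.slotMom r c Sigma.fst α) Finset.univ := by
  simp only [H_pow]
  rw [setCumulant_sum (P := M.P) (κ := fun e => Fin (d e) → Fin n) (fun e => Finset.univ)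
    (fun e _ => eps n ^ d e) (fun e α ω => ∏ s, M.ξ (r e) (α s) (c e) ω)
    (fun e α => AllMom.prod _ fun s _ => M.allMom_ξ _ _ _)]
  rw [Finset.prod_pow_eq_pow_sum, Fintype.piFinset_univ, ← Finset.mul_sum]
  congr 1
  refine (Fintype.sum_equiv (Equiv.piCurry fun (e : E) (_ : Fin (d e)) => Fin n) _ _
    fun α => ?_).symm
  congr 1
  ext B
  simp only [slotMom, prod_filter_sigma]
  rfl

theorem integral_prod_pow (d : E → ℕ) :
    ∫ ω, ∏ e, M.H (r e) (c e) ω ^ d e ∂M.P =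
      eps n ^ (∑ e, d e) * ∑ α : (Σ e, Fin (d e)) → Fin n,
        M.slotMom r c Sigma.fst α Finset.univ := by
  simp only [H_pow, Finset.prod_univ_sum, Fintype.piFinset_univ, Finset.prod_mul_distrib]
  rw [integral_finsetSum _ fun α _ => ((AllMom.prod _ fun e _ =>
    AllMom.prod _ fun s _ => M.allMom_ξ _ _ _).const_mul _).integrable]
  simp only [integral_const_mul]
  rw [← Finset.mul_sum, Finset.prod_pow_eq_pow_sum]
  congr 1
  refine (Fintype.sum_equiv (Equiv.piCurry fun (e : E) (_ : Fin (d e)) => Fin n) _ _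
    fun α => ?_).symm
  simp only [slotMom, prod_filter_sigma]
  rfl

end Powers

variable (mW mX)

/-- Cumulants of single selections are bounded uniformly, so the size is governed by the number of
selections with non-zero cumulant, which the hypothesis on `α` limits. -/
theorem exists_abs_setCumulant_pow_le (E : Type*) [Fintype E] [DecidableEq E] (d : E → ℕ) :
    ∃ C : ℝ, 0 ≤ C ∧ ∀ n, 3 ≤ n → ∀ (M : RFModel mW mX n) (r : E → Fin M.n₁) (c : E → Fin M.m)
      (k : ℕ), (∀ α : (Σ e, Fin (d e)) → Fin n,
        setCumulant (M.slotMom r c Sigma.fst α) Finset.univ ≠ 0 →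
          2 * (Finset.univ.image α).card + k ≤ Fintype.card (Σ e, Fin (d e))) →
      |setCumulant (fun B => ∫ ω, ∏ e ∈ B, M.H (r e) (c e) ω ^ d e ∂M.P) Finset.univ| ≤
        C * eps n ^ k := by
  obtain ⟨K, hK, hmom⟩ := exists_abs_slotMom_le mW mX (Σ e, Fin (d e))
  obtain ⟨C₁, hC₁, hcum⟩ := abs_setCumulant_le (Finset.univ : Finset E) K hK
  obtain ⟨C₂, hC₂, hcount⟩ := exists_card_filter_mul_eps_le (Σ e, Fin (d e))
  refine ⟨C₁ * C₂, by positivity, fun n hn M r c k hk => ?_⟩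
  rw [M.setCumulant_pow, abs_mul, abs_of_nonneg (pow_nonneg (eps_nonneg n) _)]
  have hcard : Fintype.card (Σ e, Fin (d e)) = ∑ e, d e := by simp
  have h1 : |∑ α : (Σ e, Fin (d e)) → Fin n, setCumulant (M.slotMom r c Sigma.fst α) Finset.univ| ≤
      ((Finset.univ.filter fun α : (Σ e, Fin (d e)) → Fin n =>
      2 * (Finset.univ.image α).card + k ≤ Fintype.card (Σ e, Fin (d e))).card : ℝ) * C₁ := by
    rw [← Finset.sum_filter_of_ne fun α _ h => hk α h, ← nsmul_eq_mul]
    exact (Finset.abs_sum_le_sum_abs _ _).trans (Finset.sum_le_card_nsmul _ _ _ fun α _ =>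
      hcum _ fun B _ _ => hmom E n M r c _ α B)
  have h2 := hcount n hn k
  rw [hcard] at h1 h2
  refine (mul_le_mul_of_nonneg_left h1 (pow_nonneg (eps_nonneg n) _)).trans ?_
  rw [← mul_assoc, mul_comm, mul_comm (eps n ^ _), mul_assoc]
  exact mul_le_mul_of_nonneg_left h2 hC₁

variable {mW mX}

section Bounds

variable {E : Type*} [Fintype E] [DecidableEq E] {d : E → ℕ} {r : E → Fin M.n₁} {c : E → Fin M.m}
  {α : (Σ e, Fin (d e)) → Fin n}

theorem card_image_add_le_of_ne
    (h : setCumulant (M.slotMom r c Sigma.fst α) Finset.univ ≠ 0) :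
    2 * (Finset.univ.image α).card + (numVert r c Finset.univ - 2) ≤
      Fintype.card (Σ e, Fin (d e)) := by
  have h1 := M.noSingle_of_ne h
  have h2 := M.strongSlotConn_of_ne h
  -- Without slots the connectedness forces at most one position; then there are at most two
  -- vertices and the truncated difference is zero.
  rcases isEmpty_or_nonempty (Σ e, Fin (d e)) with hσ | hσ
  · have hE : Subsingleton E := by
      by_contra hE
      rw [not_subsingleton_iff_nontrivial] at hE
      obtain ⟨e, e', hne⟩ := hE
      obtain ⟨s, -⟩ := h2 {e} (Finset.singleton_nonempty _) ⟨e', by simpa using hne.symm⟩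
      exact hσ.elim s
    have h3 : ∀ {R : Type} [DecidableEq R] (r : E → R), (Finset.univ.image r).card ≤ 1 :=
      fun r => Finset.card_image_le.trans (by
        rw [Finset.card_univ]
        exact Fintype.card_le_one_iff_subsingleton.2 hE)
    have h4 : numVert r c Finset.univ ≤ 2 := add_le_add (h3 r) (h3 c)
    simp only [Finset.univ_eq_empty, Finset.image_empty, Finset.card_empty]
    omega
  · have := h1.card_image_add_numVert_le h2.slotConn
    have := two_le_numVert r c ⟨hσ.some.1, Finset.mem_univ _⟩
    omega

/-- Connectedness at the leaf provides a value shared with another position. As the leaf is alone in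
its row (or column), the value is shared through the column (or row), where `numVert_lt_of_leaf`
makes the count strict. -/
theorem card_image_add_lt_of_ne [Nontrivial E]
    {e₀ : E} (he₀ : (∀ e, r e = r e₀ → e = e₀) ∨ ∀ e, c e = c e₀ → e = e₀)
    (h : setCumulant (M.slotMom r c Sigma.fst α) Finset.univ ≠ 0) :
    2 * (Finset.univ.image α).card + (numVert r c Finset.univ - 1) ≤
      Fintype.card (Σ e, Fin (d e)) := by
  have h1 := M.noSingle_of_ne h
  have h2 := M.strongSlotConn_of_ne h
  obtain ⟨e₁, hne⟩ := exists_ne e₀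
  obtain ⟨s, s', h3, h4, h5, h6⟩ := h2 {e₀} (Finset.singleton_nonempty _)
    ⟨e₁, by simpa using hne⟩
  have : Nonempty (Σ e, Fin (d e)) := ⟨s⟩
  obtain rfl : s.1 = e₀ := by simpa using h4
  have h7 : s'.1 ≠ s.1 := by simpa using h5
  have hv := two_le_numVert r c (Finset.univ_nonempty : (Finset.univ : Finset E).Nonempty)
  rcases he₀ with hl | hl
  · have h8 := h1.numVert_lt_of_leaf h3.symm h7
      (h6.resolve_left fun h => h7 (hl _ h.symm)).symm hl
    have := h1.card_image_add_numVert_lt h2.slotConn h8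
    omega
  · have h8 := h1.swap.numVert_lt_of_leaf h3.symm h7
      (h6.resolve_right fun h => h7 (hl _ h.symm)).symm hl
    have := h1.swap.card_image_add_numVert_lt h2.slotConn h8
    rw [numVert_swap] at this
    omega

end Bounds

end RFModel

end CycleCorrelations

end

noncomputable section

namespace CycleCorrelations

/-! ### Tight selections: their cumulant and their number. -/

section TightCount

theorem TwoPerRow.two_mul_card {E R : Type*} [Fintype E] [DecidableEq E] [DecidableEq R]
    {r : E → R} (h : TwoPerRow r) : 2 * (Finset.univ.image r).card = Fintype.card E := by
  refine le_antisymm (two_mul_card_image_le _ _ fun e _ => ?_) ?_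
  · obtain ⟨e', h1, h2, -⟩ := h e
    exact ⟨e', Finset.mem_univ _, h1, h2⟩
  · refine Finset.card_le_mul_card_image _ 2 fun i hi => ?_
    obtain ⟨e, -, rfl⟩ := Finset.mem_image.1 hi
    obtain ⟨e', h1, h2, h3⟩ := h e
    refine (Finset.card_le_card (t := {e, e'}) fun e'' he => ?_).trans Finset.card_le_two
    simpa using h3 e'' (Finset.mem_filter.1 he).2

theorem TwoPerRow.numVert {E R K : Type*} [Fintype E] [DecidableEq E] [DecidableEq R]
    [DecidableEq K] {r : E → R} {c : E → K} (hr : TwoPerRow r) (hc : TwoPerRow c) :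
    numVert r c Finset.univ = Fintype.card E := by
  have h1 := hr.two_mul_card
  have h2 := hc.two_mul_card
  unfold CycleCorrelations.numVert
  omega

/-- Slots with the common value are paired across the two positions of a row, all others within
their own position. -/
theorem TightAt.uniquePartner {E R σ τ : Type*} {r : E → R} {p : σ → E} {α : σ → τ} {t : τ}
    (h : TightAt p α t) (hr : TwoPerRow r) : UniquePartner r p α := by
  intro s
  by_cases hs : α s = t
  · obtain ⟨e', h1, h2, h3⟩ := hr (p s)
    obtain ⟨s', rfl, h5, h6⟩ := h.1 e'
    refine ⟨s', fun hss => h1 (by rw [hss]), h5.trans hs.symm, h2, fun s'' h7 h8 => ?_⟩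
    rcases h3 _ h8 with h9 | h9
    · left
      obtain ⟨s₁, -, -, h10⟩ := h.1 (p s)
      rw [h10 s'' h9 (h7.trans hs), h10 s rfl hs]
    · exact Or.inr (h6 s'' h9 (h7.trans hs))
  · obtain ⟨s', h1, h2, h3, h4⟩ := h.2 s hs
    exact ⟨s', h1, h3, by rw [h2], fun s'' h5 _ => h4 s'' h5⟩

/-- The common value is recognised by occurring once at a position, whereas other values come in
pairs; hence a tight selection determines it. -/
theorem TightAt.unique {E σ τ : Type*} [Nonempty E] {p : σ → E} {α : σ → τ} {t t' : τ}
    (h : TightAt p α t) (h' : TightAt p α t') : t = t' := by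
  by_contra hne
  obtain ⟨s, hs1, hs2, hs3⟩ := h'.1 ‹Nonempty E›.some
  obtain ⟨s', h1, h2, h3, -⟩ := h.2 s (by rw [hs2]; exact Ne.symm hne)
  exact h1 (hs3 s' (h2.trans hs1) (h3.trans hs2))

/-- The slots are matched in pairs at the same position with values not taken elsewhere. -/
def PairedSlots {E σ τ : Type*} (p : σ → E) (β : σ → τ) : Prop :=
  ∀ s, ∃ s', s' ≠ s ∧ p s' = p s ∧ β s' = β s ∧ ∀ s'', β s'' = β s → s'' = s ∨ s'' = s'

theorem PairedSlots.uniquePartner {E R σ τ : Type*} {r : E → R} {p : σ → E} {β : σ → τ}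
    (h : PairedSlots p β) : UniquePartner r p β := by
  intro s
  obtain ⟨s', h1, h2, h3, h4⟩ := h s
  exact ⟨s', h1, h3, by rw [h2], fun s'' h5 _ => h4 s'' h5⟩

variable {E τ : Type*} {d : E → ℕ}

/-- Insert one slot of value `t` at each position. -/
def insertSlots (t : τ) (k : ∀ e, Fin (d e + 1)) (β : (Σ e, Fin (d e)) → τ)
    (x : Σ e, Fin (d e + 1)) : τ :=
  Fin.insertNth (α := fun _ => τ) (k x.1) t (fun j => β ⟨x.1, j⟩) x.2

@[simp] theorem insertSlots_same (t : τ) (k : ∀ e, Fin (d e + 1)) (β : (Σ e, Fin (d e)) → τ)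
    (e : E) : insertSlots t k β ⟨e, k e⟩ = t := by
  simp [insertSlots]

@[simp] theorem insertSlots_succAbove (t : τ) (k : ∀ e, Fin (d e + 1))
    (β : (Σ e, Fin (d e)) → τ) (e : E) (j : Fin (d e)) :
    insertSlots t k β ⟨e, (k e).succAbove j⟩ = β ⟨e, j⟩ := by
  simp [insertSlots]

theorem tightAt_insertSlots {t : τ} {k : ∀ e, Fin (d e + 1)} {β : (Σ e, Fin (d e)) → τ}
    (hβ : PairedSlots Sigma.fst β) (ht : ∀ s, β s ≠ t) :
    TightAt Sigma.fst (insertSlots t k β) t := by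
  have hcase : ∀ e (x : Fin (d e + 1)), x = k e ∨ ∃ j, x = (k e).succAbove j := by
    intro e x
    rcases eq_or_ne x (k e) with h | h
    · exact Or.inl h
    · obtain ⟨j, hj⟩ := Fin.exists_succAbove_eq h
      exact Or.inr ⟨j, hj.symm⟩
  refine ⟨fun e => ⟨⟨e, k e⟩, rfl, insertSlots_same _ _ _ _, ?_⟩, ?_⟩
  · rintro ⟨e', x⟩ rfl h2
    rcases hcase e' x with rfl | ⟨j, rfl⟩
    · rfl
    · rw [insertSlots_succAbove] at h2
      exact absurd h2 (ht _)
  · rintro ⟨e, x⟩ hs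
    rcases hcase e x with rfl | ⟨j, rfl⟩
    · exact absurd (insertSlots_same _ _ _ _) hs
    · obtain ⟨⟨e', j'⟩, h1, h2, h3, h4⟩ := hβ ⟨e, j⟩
      obtain rfl : e' = e := h2
      refine ⟨⟨e', (k e').succAbove j'⟩, fun hss => h1 ?_, rfl, by simpa using h3, ?_⟩
      · rw [Fin.succAbove_right_injective (eq_of_heq (Sigma.mk.inj hss).2)]
      · rintro ⟨e'', x''⟩ hs''
        rw [insertSlots_succAbove] at hs''
        rcases hcase e'' x'' with rfl | ⟨j'', rfl⟩
        · rw [insertSlots_same] at hs''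
          exact absurd hs''.symm (ht _)
        · rw [insertSlots_succAbove] at hs''
          rcases h4 _ hs'' with h5 | h5
          · left
            cases h5
            rfl
          · right
            cases h5
            rfl

theorem TightAt.exists_insertSlots {t : τ} {α : (Σ e, Fin (d e + 1)) → τ}
    (h : TightAt Sigma.fst α t) : ∃ (k : ∀ e, Fin (d e + 1)) (β : (Σ e, Fin (d e)) → τ),
      PairedSlots Sigma.fst β ∧ (∀ s, β s ≠ t) ∧ insertSlots t k β = α := by
  have h1 : ∀ e, ∃ k : Fin (d e + 1), α ⟨e, k⟩ = t ∧ ∀ k', α ⟨e, k'⟩ = t → k' = k := by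
    intro e
    obtain ⟨⟨e', k⟩, rfl, h2, h3⟩ := h.1 e
    refine ⟨k, h2, fun k' hk' => ?_⟩
    simpa using h3 ⟨e', k'⟩ rfl hk'
  choose k hk hk' using h1
  have hne : ∀ e j, α ⟨e, (k e).succAbove j⟩ ≠ t := fun e j hj =>
    Fin.succAbove_ne _ _ (hk' e _ hj)
  refine ⟨k, fun s => α ⟨s.1, (k s.1).succAbove s.2⟩, ?_, fun s => hne _ _, ?_⟩
  · rintro ⟨e, j⟩
    obtain ⟨⟨e', x⟩, h2, h3, h4, h5⟩ := h.2 _ (hne e j)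
    obtain rfl : e' = e := h3
    have hx : x ≠ k e' := by
      rintro rfl
      exact hne e' j (h4.symm.trans (hk _))
    obtain ⟨j', rfl⟩ := Fin.exists_succAbove_eq hx
    refine ⟨⟨e', j'⟩, fun hs => h2 ?_, rfl, h4, ?_⟩
    · cases hs
      rfl
    · rintro ⟨e'', j''⟩ hs''
      rcases h5 _ hs'' with h6 | h6
      · left
        obtain rfl : e'' = e' := (Sigma.mk.inj h6).1
        obtain rfl : j'' = j := Fin.succAbove_right_injective (eq_of_heq (Sigma.mk.inj h6).2)
        rfl
      · right
        obtain rfl : e'' = e' := (Sigma.mk.inj h6).1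
        obtain rfl : j'' = j' := Fin.succAbove_right_injective (eq_of_heq (Sigma.mk.inj h6).2)
        rfl
  · ext ⟨e, x⟩
    rcases eq_or_ne x (k e) with h2 | h2
    · subst h2
      rw [insertSlots_same, hk]
    · obtain ⟨j, rfl⟩ := Fin.exists_succAbove_eq h2
      rw [insertSlots_succAbove]

-- A tight selection amounts to a paired selection with one slot less at each position, a value not
-- taken by it, and for each position the place at which the slot with that value is inserted.
open Classical in
theorem card_tight [Fintype E] [Nonempty E] (n : ℕ) (d : E → ℕ) :
    (Finset.univ.filter fun α : (Σ e, Fin (d e + 1)) → Fin n => ∃ t, TightAt Sigma.fst α t).card =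
      ∑ β ∈ Finset.univ.filter fun β : (Σ e, Fin (d e)) → Fin n => PairedSlots Sigma.fst β,
        (n - (Finset.univ.image β).card) * ∏ e, (d e + 1) := by
  have h1 : ∀ β : (Σ e, Fin (d e)) → Fin n, (n - (Finset.univ.image β).card) * ∏ e, (d e + 1) =
      ((Finset.univ.image β)ᶜ ×ˢ (Finset.univ : Finset (∀ e, Fin (d e + 1)))).card := by
    intro β
    rw [Finset.card_product, Finset.card_compl, Fintype.card_fin, Finset.card_univ,
      Fintype.card_pi]
    simp
  simp only [h1]
  rw [← Finset.card_sigma]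
  symm
  refine Finset.card_bij (fun x _ => insertSlots x.2.1 x.2.2 x.1) ?_ ?_ ?_
  · rintro ⟨β, t, k⟩ hx
    simp only [Finset.mem_sigma, Finset.mem_filter, Finset.mem_univ, true_and, Finset.mem_product,
      Finset.mem_compl, Finset.mem_image, not_exists, and_true] at hx ⊢
    exact ⟨t, tightAt_insertSlots hx.1 hx.2⟩
  · rintro ⟨β, t, k⟩ hx ⟨β', t', k'⟩ hx' heq
    simp only [Finset.mem_sigma, Finset.mem_filter, Finset.mem_univ, true_and, Finset.mem_product,
      Finset.mem_compl, Finset.mem_image, not_exists, and_true] at hx hx' heq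
    have h2 := tightAt_insertSlots (k := k) hx.1 hx.2
    have h3 := tightAt_insertSlots (k := k') hx'.1 hx'.2
    obtain rfl : t = t' := h2.unique (heq ▸ h3)
    obtain rfl : k = k' := by
      funext e
      obtain ⟨s, -, -, h4⟩ := h2.1 e
      have h5 := h4 ⟨e, k e⟩ rfl (insertSlots_same _ _ _ _)
      have h6 := h4 ⟨e, k' e⟩ rfl (by rw [heq, insertSlots_same])
      simpa using h5.trans h6.symm
    have : β = β' := by
      funext s
      rw [← insertSlots_succAbove t k β s.1 s.2, heq, insertSlots_succAbove]
    rw [this]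
  · intro α hα
    obtain ⟨t, ht⟩ := (Finset.mem_filter.1 hα).2
    obtain ⟨k, β, h2, h3, h4⟩ := ht.exists_insertSlots
    refine ⟨⟨β, t, k⟩, ?_, h4⟩
    simp only [Finset.mem_sigma, Finset.mem_filter, Finset.mem_univ, true_and, Finset.mem_product,
      Finset.mem_compl, Finset.mem_image, not_exists, and_true]
    exact ⟨h2, h3⟩

end TightCount

namespace RFModel

variable {mW mX : ℕ → ℝ} {n : ℕ} (M : RFModel mW mX n)
variable {E σ : Type*} [DecidableEq E] [Fintype E] [Fintype σ] [DecidableEq σ]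
variable {r : E → Fin M.n₁} {c : E → Fin M.m} {p : σ → E} {α : σ → Fin n}

theorem slotMom_univ_eq_one (hr : UniquePartner r p α) (hc : UniquePartner c p α) :
    M.slotMom r c p α Finset.univ = 1 := by
  have key : ∀ {R : Type} [DecidableEq R] {r : E → R}, UniquePartner r p α → ∀ i t,
      (Finset.univ.filter fun s => r (p s) = i ∧ α s = t).card = 0 ∨
      (Finset.univ.filter fun s => r (p s) = i ∧ α s = t).card = 2 := by
    intro R _ r hr i t
    by_cases hex : ∃ s, r (p s) = i ∧ α s = t
    · right
      obtain ⟨s, rfl, rfl⟩ := hex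
      obtain ⟨s', h1, h2, h3, h4⟩ := hr s
      refine Finset.card_eq_two.2 ⟨s, s', h1.symm, ?_⟩
      ext s''
      simp only [Finset.mem_filter, Finset.mem_univ, true_and, Finset.mem_insert,
        Finset.mem_singleton]
      constructor
      · rintro ⟨h5, h6⟩
        exact h4 s'' h6 h5
      · rintro (rfl | rfl)
        exacts [⟨rfl, rfl⟩, ⟨h3, h2⟩]
    · left
      rw [Finset.card_eq_zero, Finset.eq_empty_iff_forall_notMem]
      intro s hs
      exact hex ⟨s, (Finset.mem_filter.1 hs).2⟩
  unfold slotMom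
  apply M.integral_prod_ξ_eq_one
  · rintro ⟨i, t⟩
    simpa using key hr i t
  · rintro ⟨t, j⟩
    simpa [and_comm] using key hc j t

/-- A proper subset of positions contains one whose row or column mate is missing. Its slot with the
common value then has no partner and the moment is zero, so the cumulant is the full moment, in
which every entry occurs zero or two times. -/
theorem setCumulant_slotMom_eq_one [Nonempty E] (hr : TwoPerRow r) (hc : TwoPerRow c)
    (hpos : PosConn r c) {t : Fin n} (h : TightAt p α t) :
    setCumulant (M.slotMom r c p α) Finset.univ = 1 := by
  rw [setCumulant_eq_moment _ M.slotMom_empty _ Finset.univ_nonempty,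
    M.slotMom_univ_eq_one (h.uniquePartner hr) (h.uniquePartner hc)]
  intro B _ hB hne
  obtain ⟨e, he, e', he', hee⟩ := hpos B hB (by
    by_contra hcon
    push Not at hcon
    exact hne (Finset.eq_univ_iff_forall.2 hcon))
  obtain ⟨s, rfl, hs, huniq⟩ := h.1 e
  have hsp : p s ≠ e' := fun h => he' (h ▸ he)
  rcases hee with h1 | h1
  · refine M.slotMom_eq_zero_of_row he fun s' h2 h3 h4 => ?_
    obtain ⟨e₁, h5, h6, h7⟩ := hr (p s)
    have h8 := (h7 e' h1.symm).resolve_left (Ne.symm hsp)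
    rcases h7 _ h4 with h9 | h9
    · exact huniq s' h9 (h3.trans hs)
    · exact absurd (by rw [h8, ← h9]; exact h2) he'
  · refine M.slotMom_eq_zero_of_col he fun s' h2 h3 h4 => ?_
    obtain ⟨e₁, h5, h6, h7⟩ := hc (p s)
    have h8 := (h7 e' h1.symm).resolve_left (Ne.symm hsp)
    rcases h7 _ h4 with h9 | h9
    · exact huniq s' h9 (h3.trans hs)
    · exact absurd (by rw [h8, ← h9]; exact h2) he'

/-- Every value is taken by exactly two slots, so the row partner and the column partner coincide. A
common row and a common column mean the same position. -/
theorem pairedSlots_of_card (hinj : Function.Injective fun e => (r e, c e))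
    (h : M.slotMom r c p α Finset.univ ≠ 0)
    (hcard : Fintype.card σ ≤ 2 * (Finset.univ.image α).card) : PairedSlots p α := by
  have hrow : ∀ s, ∃ s', s' ≠ s ∧ α s' = α s ∧ r (p s') = r (p s) := by
    intro s
    by_contra hcon
    push Not at hcon
    refine h (M.slotMom_eq_zero_of_row (Finset.mem_univ (p s)) fun s' _ h1 h2 => ?_)
    by_contra hne
    exact hcon s' hne h1 h2
  have hcol : ∀ s, ∃ s', s' ≠ s ∧ α s' = α s ∧ c (p s') = c (p s) := by
    intro s
    by_contra hcon
    push Not at hcon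
    refine h (M.slotMom_eq_zero_of_col (Finset.mem_univ (p s)) fun s' _ h1 h2 => ?_)
    by_contra hne
    exact hcon s' hne h1 h2
  intro s
  have h2 := card_fiber_eq_two Finset.univ α (fun s _ => by
    obtain ⟨s', h1, h2, -⟩ := hrow s
    exact ⟨s', Finset.mem_univ _, h1, h2⟩) (by simpa using hcard) (b := α s) (by simp)
  obtain ⟨s', hne, hα, hr'⟩ := hrow s
  obtain ⟨s'', hne', hα', hc'⟩ := hcol s
  have huniq : ∀ x, α x = α s → x = s ∨ x = s' := by
    intro x hx
    by_contra hcon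
    push Not at hcon
    have h5 : ({s, s', x} : Finset σ) ⊆ Finset.univ.filter fun s' => α s' = α s := by
      intro y hy
      simp only [Finset.mem_insert, Finset.mem_singleton] at hy
      simp only [Finset.mem_filter, Finset.mem_univ, true_and]
      rcases hy with rfl | rfl | rfl
      exacts [rfl, hα, hx]
    have h6 := Finset.card_le_card h5
    rw [h2, Finset.card_eq_three.2 ⟨s, s', x, hne.symm, hcon.1.symm, hcon.2.symm, rfl⟩] at h6
    omega
  obtain rfl : s'' = s' := (huniq s'' hα').resolve_left hne'
  exact ⟨s'', hne, hinj (Prod.ext hr' hc'), hα, huniq⟩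

theorem PairedSlots.two_mul_card_image_le {τ : Type*} [DecidableEq τ] {α : σ → τ}
    (h : PairedSlots p α) : 2 * (Finset.univ.image α).card ≤ Fintype.card σ :=
  CycleCorrelations.two_mul_card_image_le _ _ fun s _ => by
    obtain ⟨s', h1, -, h3, -⟩ := h s
    exact ⟨s', Finset.mem_univ _, h1, h3⟩

end RFModel

end CycleCorrelations

end

noncomputable section

namespace CycleCorrelations

/-! ### Leading order of the cumulants of powers along a cycle. -/

namespace RFModel

variable (mW mX : ℕ → ℝ)

/-- The comparison of moments with `p = 2` and `r = 1`, each power being compared with its Gaussian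
mean as a constant function; the required order `1 * 3 - 2 = 1` is just equality of means. -/
theorem exists_abs_integral_prod_pow_sub_le (E : Type) [Fintype E] [DecidableEq E] (d : E → ℕ) :
    ∃ C : ℝ, 0 ≤ C ∧ ∀ n, 3 ≤ n → ∀ (M : RFModel mW mX n) (r : E → Fin M.n₁) (c : E → Fin M.m),
      Function.Injective (fun e => (r e, c e)) →
      |∫ ω, ∏ e, M.H (r e) (c e) ω ^ d e ∂M.P - ∏ e, ∫ x, x ^ d e ∂gaussianReal 0 1| ≤
        C * eps n := by
  have hF : ∀ e, Adm (fun _ x => x ^ d e) := fun e => Adm.id.pow (d e)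
  have hF' : ∀ e, Adm (fun (_ : ℕ) (_ : ℝ) => ∫ x, x ^ d e ∂gaussianReal 0 1) := fun e =>
    Adm.const fun _ _ => le_rfl
  obtain ⟨C, hC, hb⟩ := exists_abs_mom_sub_le (fun p => (1 + mW (2 * p)) * (1 + mX (2 * p)))
    le_rfl 1 le_rfl hF hF' fun e => by
      refine ⟨(hF e).sub (hF' e), fun n hn j hj => ?_⟩
      obtain rfl : j = 0 := by omega
      simp only [iteratedDeriv_zero]
      rw [integral_sub ((hF e).dom_self.integrable_gaussian hn ((hF e).continuous n))
        (integrable_const _)]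
      simp
  refine ⟨C, hC, fun n hn M r c hinj => ?_⟩
  have h := hb n hn (M.toArray r c hinj)
  rw [pow_one] at h
  have h1 : ∏ e, ∫ x, x ^ d e ∂gaussianReal 0 1 =
      ∫ _ω, ∏ e, ∫ x, x ^ d e ∂gaussianReal 0 1 ∂M.P := by
    rw [integral_const, probReal_univ, one_smul]
  rw [h1]
  exact h

-- Pairings are counted indirectly. They are the leading part of the expectation of the product of
-- powers, each with moment one, and that expectation is close to the product of the Gaussian
-- moments.
open Classical in
theorem exists_abs_card_paired_sub_le (E : Type) [Fintype E] [DecidableEq E] (d : E → ℕ) :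
    ∃ C : ℝ, 0 ≤ C ∧ ∀ n, 3 ≤ n → ∀ (M : RFModel mW mX n) (r : E → Fin M.n₁) (c : E → Fin M.m),
      Function.Injective (fun e => (r e, c e)) →
      |eps n ^ (∑ e, d e) * ((Finset.univ.filter fun β : (Σ e, Fin (d e)) → Fin n =>
        PairedSlots Sigma.fst β).card : ℝ) - ∏ e, ∫ x, x ^ d e ∂gaussianReal 0 1| ≤
        C * eps n := by
  obtain ⟨C, hC, hb⟩ := exists_abs_integral_prod_pow_sub_le mW mX E d
  obtain ⟨K, hK, hmom⟩ := exists_abs_slotMom_le mW mX (Σ e, Fin (d e))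
  obtain ⟨C₂, hC₂, hcount⟩ := exists_card_filter_mul_eps_le (Σ e, Fin (d e))
  refine ⟨C₂ * K + C, by positivity, fun n hn M r c hinj => ?_⟩
  have h1 := hb n hn M r c hinj
  have hcard : Fintype.card (Σ e, Fin (d e)) = ∑ e, d e := by simp
  rw [M.integral_prod_pow] at h1
  have h2 := hcount n hn 1
  rw [hcard, pow_one] at h2
  have h3 : ∑ α ∈ Finset.univ.filter (fun β : (Σ e, Fin (d e)) → Fin n =>
      PairedSlots Sigma.fst β), M.slotMom r c Sigma.fst α Finset.univ =
      ((Finset.univ.filter fun β : (Σ e, Fin (d e)) → Fin n =>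
        PairedSlots Sigma.fst β).card : ℝ) := by
    rw [Finset.sum_congr rfl fun α hα => M.slotMom_univ_eq_one
      (Finset.mem_filter.1 hα).2.uniquePartner (Finset.mem_filter.1 hα).2.uniquePartner]
    simp
  have h4 : |∑ α ∈ Finset.univ.filter (fun β : (Σ e, Fin (d e)) → Fin n =>
      ¬ PairedSlots Sigma.fst β), M.slotMom r c Sigma.fst α Finset.univ| ≤
      ((Finset.univ.filter fun α : (Σ e, Fin (d e)) → Fin n =>
      2 * (Finset.univ.image α).card + 1 ≤ ∑ e, d e).card : ℝ) * K := by
    rw [← Finset.sum_filter_of_ne (s := Finset.univ.filter _) (p := fun α =>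
      2 * (Finset.univ.image α).card + 1 ≤ ∑ e, d e), ← nsmul_eq_mul]
    · refine (Finset.abs_sum_le_sum_abs _ _).trans
        ((Finset.sum_le_sum_of_subset_of_nonneg (Finset.filter_subset_filter _
          (Finset.filter_subset _ _)) fun _ _ _ => abs_nonneg _).trans
          (Finset.sum_le_card_nsmul _ _ _ fun α _ => hmom E n M r c _ α _))
    · intro α hα hne
      by_contra hcon
      refine (Finset.mem_filter.1 hα).2 (M.pairedSlots_of_card hinj hne ?_)
      rw [hcard]
      omega
  rw [← Finset.sum_filter_add_sum_filter_not _ (fun β => PairedSlots Sigma.fst β), h3] at h1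
  set Q := ((Finset.univ.filter fun β : (Σ e, Fin (d e)) → Fin n =>
        PairedSlots Sigma.fst β).card : ℝ)
  set R := ∑ α ∈ Finset.univ.filter (fun β : (Σ e, Fin (d e)) → Fin n =>
      ¬ PairedSlots Sigma.fst β), M.slotMom r c Sigma.fst α Finset.univ
  have he := pow_nonneg (eps_nonneg n) (∑ e, d e)
  have h5 : |eps n ^ (∑ e, d e) * R| ≤ C₂ * K * eps n := by
    rw [abs_mul, abs_of_nonneg he]
    calc _ ≤ _ := mul_le_mul_of_nonneg_left h4 he
      _ = _ * eps n ^ (∑ e, d e) * K := by ring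
      _ ≤ C₂ * eps n * K := mul_le_mul_of_nonneg_right h2 (by linarith)
      _ = _ := by ring
  rw [mul_add] at h1
  rw [abs_le] at h1 h5 ⊢
  constructor <;> nlinarith [h1.1, h1.2, h5.1, h5.2]

open Classical in
/-- The joint cumulant of powers of the entries along a cycle. -/
theorem exists_abs_setCumulant_pow_sub_le (E : Type) [Fintype E] [DecidableEq E] [Nonempty E]
    (d : E → ℕ) :
    ∃ C : ℝ, 0 ≤ C ∧ ∀ n, 3 ≤ n → ∀ (M : RFModel mW mX n) (r : E → Fin M.n₁) (c : E → Fin M.m),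
      Function.Injective (fun e => (r e, c e)) → TwoPerRow r → TwoPerRow c → PosConn r c →
      |setCumulant (fun B => ∫ ω, ∏ e ∈ B, M.H (r e) (c e) ω ^ (d e + 1) ∂M.P) Finset.univ -
        n * eps n ^ Fintype.card E * ∏ e, ((d e + 1 : ℕ) * ∫ x, x ^ d e ∂gaussianReal 0 1)| ≤
        C * eps n ^ (Fintype.card E - 1) := by
  obtain ⟨C₁, hC₁, hpair⟩ := exists_abs_card_paired_sub_le mW mX E d
  obtain ⟨K, hK, hmom⟩ := exists_abs_slotMom_le mW mX (Σ e, Fin (d e + 1))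
  obtain ⟨C₂, hC₂, hcount⟩ := exists_card_filter_mul_eps_le (Σ e, Fin (d e + 1))
  obtain ⟨C₃, hC₃, hcum⟩ := abs_setCumulant_le (Finset.univ : Finset E) K hK
  obtain ⟨C₄, hC₄, hcount'⟩ := exists_card_filter_mul_eps_le (Σ e, Fin (d e))
  set D : ℝ := ∏ e, ((d e + 1 : ℕ) : ℝ) with hD
  have hD0 : 0 ≤ D := Finset.prod_nonneg fun e _ => Nat.cast_nonneg _
  set S : ℝ := ((∑ e, d e : ℕ) : ℝ) with hS
  have hS0 : 0 ≤ S := Nat.cast_nonneg _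
  refine ⟨C₂ * C₃ + D * S * C₄ + D * C₁, by positivity, fun n hn M r c hinj hr hc hpos => ?_⟩
  have he := eps_nonneg n
  have he1 := eps_le_one hn
  obtain ⟨k, hk⟩ : ∃ k, Fintype.card E = k + 1 :=
    Nat.exists_eq_succ_of_ne_zero Fintype.card_ne_zero
  have hcard : Fintype.card (Σ e, Fin (d e + 1)) = ∑ e, d e + (k + 1) := by
    simp [Finset.sum_add_distrib, hk]
  have hcard' : Fintype.card (Σ e, Fin (d e)) = ∑ e, d e := by simp
  have hv : numVert r c Finset.univ = k + 1 := by rw [hr.numVert hc, hk]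
  rw [M.setCumulant_pow, hk, Nat.add_sub_cancel]
  have hsum : ∑ e, (d e + 1) = ∑ e, d e + (k + 1) := by
    rw [Finset.sum_add_distrib, Finset.sum_const, Finset.card_univ, hk, smul_eq_mul, mul_one]
  rw [hsum]
  set Q := ((Finset.univ.filter fun β : (Σ e, Fin (d e)) → Fin n =>
        PairedSlots Sigma.fst β).card : ℝ) with hQ
  -- the tight part
  have h3 : ∑ α ∈ Finset.univ.filter (fun α : (Σ e, Fin (d e + 1)) → Fin n =>
      ∃ t, TightAt Sigma.fst α t), setCumulant (M.slotMom r c Sigma.fst α) Finset.univ =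
      ((Finset.univ.filter fun α : (Σ e, Fin (d e + 1)) → Fin n =>
        ∃ t, TightAt Sigma.fst α t).card : ℝ) := by
    rw [Finset.sum_congr rfl fun α hα => M.setCumulant_slotMom_eq_one hr hc hpos
      (Finset.mem_filter.1 hα).2.choose_spec]
    simp
  have h4 : |∑ α ∈ Finset.univ.filter (fun α : (Σ e, Fin (d e + 1)) → Fin n =>
      ¬ ∃ t, TightAt Sigma.fst α t), setCumulant (M.slotMom r c Sigma.fst α) Finset.univ| ≤
      ((Finset.univ.filter fun α : (Σ e, Fin (d e + 1)) → Fin n =>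
      2 * (Finset.univ.image α).card + k ≤ ∑ e, d e + (k + 1)).card : ℝ) * C₃ := by
    rw [← Finset.sum_filter_of_ne (s := Finset.univ.filter _) (p := fun α =>
      2 * (Finset.univ.image α).card + k ≤ ∑ e, d e + (k + 1)), ← nsmul_eq_mul]
    · refine (Finset.abs_sum_le_sum_abs _ _).trans
        ((Finset.sum_le_sum_of_subset_of_nonneg (Finset.filter_subset_filter _
          (Finset.filter_subset _ _)) fun _ _ _ => abs_nonneg _).trans
          (Finset.sum_le_card_nsmul _ _ _ fun α _ => hcum _ fun B _ _ => hmom E n M r c _ α B))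
    · intro α hα hne
      by_contra hcon
      refine (Finset.mem_filter.1 hα).2 (exists_tightAt hinj hr hc hpos (M.noSingle_of_ne hne)
        (M.strongSlotConn_of_ne hne) ?_)
      rw [hcard, hv]
      omega
  -- the number of tight values
  have h5 : |((Finset.univ.filter fun α : (Σ e, Fin (d e + 1)) → Fin n =>
        ∃ t, TightAt Sigma.fst α t).card : ℝ) - n * Q * D| ≤ S * Q * D := by
    have hct : (Finset.univ.filter fun α : (Σ e, Fin (d e + 1)) → Fin n =>
        ∃ t, TightAt Sigma.fst α t).card =
        ∑ β ∈ Finset.univ.filter fun β : (Σ e, Fin (d e)) → Fin n => PairedSlots Sigma.fst β,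
          (n - (Finset.univ.image β).card) * ∏ e, (d e + 1) := by
      convert card_tight n d
    rw [hct]
    push_cast
    have h6 : (n : ℝ) * Q * D = ∑ β ∈ Finset.univ.filter fun β : (Σ e, Fin (d e)) → Fin n =>
        PairedSlots Sigma.fst β, (n : ℝ) * D := by
      rw [Finset.sum_const, nsmul_eq_mul, ← hQ]
      ring
    have h7 : S * Q * D = ∑ β ∈ Finset.univ.filter fun β : (Σ e, Fin (d e)) → Fin n =>
        PairedSlots Sigma.fst β, S * D := by
      rw [Finset.sum_const, nsmul_eq_mul, ← hQ]
      ring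
    rw [h6, h7, ← Finset.sum_sub_distrib]
    refine (Finset.abs_sum_le_sum_abs _ _).trans (Finset.sum_le_sum fun β hβ => ?_)
    have h8 : (Finset.univ.image β).card ≤ n := by
      simpa using Finset.card_le_univ (Finset.univ.image β)
    have h9 : ((Finset.univ.image β).card : ℝ) ≤ S := by
      rw [hS, ← hcard', Nat.cast_le]
      exact Finset.card_image_le
    rw [Nat.cast_sub h8]
    have h10 : ∏ e, ((d e : ℝ) + 1) = D := by
      rw [hD]
      push_cast
      rfl
    rw [h10, ← sub_mul, abs_mul, abs_of_nonneg hD0]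
    refine mul_le_mul_of_nonneg_right ?_ hD0
    rw [sub_sub_cancel_left, abs_neg, Nat.abs_cast]
    exact h9
  have h2 := hcount n hn k
  rw [hcard] at h2
  have h11 : eps n ^ (∑ e, d e) * Q ≤ C₄ := by
    have h12 := hcount' n hn 0
    rw [hcard', pow_zero, mul_one] at h12
    refine le_trans ?_ h12
    rw [mul_comm]
    refine mul_le_mul_of_nonneg_right ?_ (pow_nonneg he _)
    refine Nat.cast_le.2 (Finset.card_le_card fun β hβ => ?_)
    have := PairedSlots.two_mul_card_image_le (Finset.mem_filter.1 hβ).2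
    rw [hcard'] at this
    exact Finset.mem_filter.2 ⟨Finset.mem_univ _, by omega⟩
  have h13 := hpair n hn M r c hinj
  rw [← hQ] at h13
  rw [← Finset.sum_filter_add_sum_filter_not _ (fun α : (Σ e, Fin (d e + 1)) → Fin n =>
      ∃ t, TightAt Sigma.fst α t), h3]
  set T := ((Finset.univ.filter fun α : (Σ e, Fin (d e + 1)) → Fin n =>
        ∃ t, TightAt Sigma.fst α t).card : ℝ)
  set R := ∑ α ∈ Finset.univ.filter (fun α : (Σ e, Fin (d e + 1)) → Fin n =>
      ¬ ∃ t, TightAt Sigma.fst α t), setCumulant (M.slotMom r c Sigma.fst α) Finset.univ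
  rw [Finset.prod_mul_distrib, ← hD]
  set G := ∏ e, ∫ x, x ^ d e ∂gaussianReal 0 1
  set s := ∑ e, d e
  have hek : 0 ≤ eps n ^ k := pow_nonneg he k
  have hes : 0 ≤ eps n ^ s := pow_nonneg he s
  have e1 : |eps n ^ (s + (k + 1)) * R| ≤ C₂ * C₃ * eps n ^ k := by
    rw [abs_mul, abs_of_nonneg (pow_nonneg he _)]
    calc _ ≤ _ := mul_le_mul_of_nonneg_left h4 (pow_nonneg he _)
      _ = _ * eps n ^ (s + (k + 1)) * C₃ := by ring
      _ ≤ C₂ * eps n ^ k * C₃ := mul_le_mul_of_nonneg_right h2 hC₃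
      _ = _ := by ring
  have e2 : |eps n ^ (s + (k + 1)) * (T - n * Q * D)| ≤ D * S * C₄ * eps n ^ k := by
    rw [abs_mul, abs_of_nonneg (pow_nonneg he _)]
    calc _ ≤ eps n ^ (s + (k + 1)) * (S * Q * D) := mul_le_mul_of_nonneg_left h5 (pow_nonneg he _)
      _ = (D * S * eps n ^ k) * (eps n ^ s * Q) * eps n := by ring
      _ ≤ (D * S * eps n ^ k) * C₄ * 1 := by
          have hQ0 : 0 ≤ eps n ^ s * Q := mul_nonneg hes (Nat.cast_nonneg _)
          gcongr
      _ = _ := by ring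
  have e3 : |eps n ^ (k + 1) * n * D * (eps n ^ s * Q - G)| ≤ D * C₁ * eps n ^ k := by
    rw [abs_mul, abs_of_nonneg (by positivity)]
    calc _ ≤ eps n ^ (k + 1) * n * D * (C₁ * eps n) :=
          mul_le_mul_of_nonneg_left h13 (by positivity)
      _ = D * C₁ * eps n ^ k * (n * eps n ^ 2) := by ring
      _ = _ := by rw [mul_eps_sq hn, mul_one]
  -- Three errors: selections that are not tight, the values that the common one has to avoid, and
  -- the number of pairings against the Gaussian moments. Each is of order `ε ^ k`, where `k + 1` is
  -- the number of positions.
  have hsplit : eps n ^ (s + (k + 1)) * (T + R) - n * eps n ^ (k + 1) * (D * G) =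
      eps n ^ (s + (k + 1)) * R + eps n ^ (s + (k + 1)) * (T - n * Q * D) +
        eps n ^ (k + 1) * n * D * (eps n ^ s * Q - G) := by ring
  rw [hsplit]
  refine (abs_add_le _ _).trans ?_
  refine (add_le_add ((abs_add_le _ _).trans (add_le_add e1 e2)) e3).trans (le_of_eq ?_)
  ring

end RFModel

end CycleCorrelations

end

noncomputable section

namespace CycleCorrelations

/-! ### From powers to admissible functions at distinct positions. -/

namespace RFModel

/-- The joint moments of functions of the entries of the product matrix. -/
def entryMom {mW mX : ℕ → ℝ} {n : ℕ} (M : RFModel mW mX n) {ι : Type*} (g : ι → ℕ → ℝ → ℝ)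
    (r : ι → Fin M.n₁) (c : ι → Fin M.m) (B : Finset ι) : ℝ :=
  ∫ ω, ∏ e ∈ B, g e n (M.H (r e) (c e) ω) ∂M.P

theorem entryMom_empty {mW mX : ℕ → ℝ} {n : ℕ} (M : RFModel mW mX n) {ι : Type*}
    (g : ι → ℕ → ℝ → ℝ) (r : ι → Fin M.n₁) (c : ι → Fin M.m) : M.entryMom g r c ∅ = 1 := by
  simp [entryMom]

variable (mW mX : ℕ → ℝ)

section

variable {E : Type} [Fintype E] [DecidableEq E]

/-- Factors outside `B` are replaced by the constant one, so a bound for full products serves all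
subsets. -/
theorem exists_abs_entryMom_le {g : E → ℕ → ℝ → ℝ} (hg : ∀ e, Adm (g e)) :
    ∃ K : ℝ, 1 ≤ K ∧ ∀ n, 3 ≤ n → ∀ (M : RFModel mW mX n) (r : E → Fin M.n₁) (c : E → Fin M.m),
      Function.Injective (fun e => (r e, c e)) → ∀ B, |M.entryMom g r c B| ≤ K := by
  have hF : ∀ (B : Finset E) e, Adm (fun n x => if e ∈ B then g e n x else 1) := by
    intro B e
    by_cases h : e ∈ B
    · simpa [h] using hg e
    · simpa [h] using Adm.one
  choose C hC hb using fun B => exists_abs_mom_le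
    (fun p => (1 + mW (2 * p)) * (1 + mX (2 * p))) (hF B)
  have hsum : 0 ≤ ∑ B, C B := Finset.sum_nonneg fun B _ => hC B
  refine ⟨1 + ∑ B, C B, by linarith, fun n hn M r c hinj B => ?_⟩
  have h := hb B n hn (M.toArray r c hinj) Finset.univ
  have h1 : M.entryMom g r c B = (M.toArray r c hinj).mom
      (fun p => (1 + mW (2 * p)) * (1 + mX (2 * p))) Finset.univ
      (fun e n x => if e ∈ B then g e n x else 1) := by
    unfold entryMom IndepArray.mom
    refine integral_congr_ae (Filter.Eventually.of_forall fun ω => ?_)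
    simp only [Finset.prod_ite_mem, Finset.univ_inter]
    rfl
  rw [h1]
  have h2 := Finset.single_le_sum (fun B _ => hC B) (Finset.mem_univ B)
  linarith

theorem exists_abs_entryMom_sub_le {q : ℕ} (hq : 2 ≤ q) (k : ℕ) (hk : k + 1 ≤ q)
    {g g' : E → ℕ → ℝ → ℝ} (hg : ∀ e, Adm (g e)) (hg' : ∀ e, Adm (g' e))
    (horth : ∀ e, GaussOrth (k * (q + 1) - q) (fun n x => g e n x - g' e n x)) :
    ∃ C : ℝ, 0 ≤ C ∧ ∀ n, 3 ≤ n → ∀ (M : RFModel mW mX n) (r : E → Fin M.n₁) (c : E → Fin M.m),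
      Function.Injective (fun e => (r e, c e)) → ∀ B,
        |M.entryMom g r c B - M.entryMom g' r c B| ≤ C * eps n ^ k := by
  have hF : ∀ {g : E → ℕ → ℝ → ℝ}, (∀ e, Adm (g e)) → ∀ (B : Finset E) e,
      Adm (fun n x => if e ∈ B then g e n x else 1) := by
    intro g hg B e
    by_cases h : e ∈ B
    · simpa [h] using hg e
    · simpa [h] using Adm.one
  have horth' : ∀ (B : Finset E) e, GaussOrth (k * (q + 1) - q) (fun n x =>
      (if e ∈ B then g e n x else 1) - if e ∈ B then g' e n x else 1) := by
    intro B e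
    by_cases h : e ∈ B
    · simpa [h] using horth e
    · simp only [h, if_false, sub_self]
      refine ⟨by simpa using (Adm.const (c := fun _ => 0) (B := 0) fun n _ => by simp),
        fun n _ d _ => ?_⟩
      have : (fun _ : ℝ => (0 : ℝ)) = 0 := rfl
      simp [iteratedDeriv_const]
  choose C hC hb using fun B => exists_abs_mom_sub_le
    (fun p => (1 + mW (2 * p)) * (1 + mX (2 * p))) hq k hk (hF hg B) (hF hg' B) (horth' B)
  refine ⟨∑ B, C B, Finset.sum_nonneg fun B _ => hC B, fun n hn M r c hinj B => ?_⟩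
  have h := hb B n hn (M.toArray r c hinj)
  have h1 : ∀ g : E → ℕ → ℝ → ℝ, M.entryMom g r c B = (M.toArray r c hinj).mom
      (fun p => (1 + mW (2 * p)) * (1 + mX (2 * p))) Finset.univ
      (fun e n x => if e ∈ B then g e n x else 1) := by
    intro g
    unfold entryMom IndepArray.mom
    refine integral_congr_ae (Filter.Eventually.of_forall fun ω => ?_)
    simp only [Finset.prod_ite_mem, Finset.univ_inter]
    rfl
  rw [h1, h1]
  exact h.trans (mul_le_mul_of_nonneg_right
    (Finset.single_le_sum (fun B _ => hC B) (Finset.mem_univ B)) (pow_nonneg (eps_nonneg n) _))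

/-- Joint cumulants of admissible functions at distinct positions are, up to any order, linear
combinations of joint cumulants of powers. -/
theorem exists_setCumulant_approx {g : E → ℕ → ℝ → ℝ} (hg : ∀ e, Adm (g e)) {k : ℕ}
    (hk : 2 ≤ k) : ∃ (J : ℕ) (a : E → ℕ → ℕ → ℝ) (A C : ℝ), 0 ≤ A ∧ 0 ≤ C ∧
      (∀ e d n, 3 ≤ n → |a e d n| ≤ A) ∧
      (∀ e n, 3 ≤ n → ∫ x, deriv (g e n) x ∂gaussianReal 0 1 =
        ∑ d ∈ Finset.range J, a e d n * (d * ∫ x, x ^ (d - 1) ∂gaussianReal 0 1)) ∧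
      ∀ n, 3 ≤ n → ∀ (M : RFModel mW mX n) (r : E → Fin M.n₁) (c : E → Fin M.m),
      Function.Injective (fun e => (r e, c e)) →
      |setCumulant (M.entryMom g r c) Finset.univ -
        ∑ f ∈ Fintype.piFinset fun _ : E => Finset.range J, (∏ e, a e (f e) n) *
          setCumulant (fun B => ∫ ω, ∏ e ∈ B, M.H (r e) (c e) ω ^ f e ∂M.P) Finset.univ| ≤
        C * eps n ^ k := by
  -- The number of vanishing means `r * (p + 1) - p` that yields the error `ε ^ k`, with `r = k` and
  -- the smallest Taylor order `p = k + 1`. It is at least two, so first derivatives are matched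
  -- too.
  set J := k * (k + 1 + 1) - (k + 1) with hJ
  have hJ2 : 2 ≤ J := by
    have : k * (k + 1 + 1) = k * (k + 1) + k := by ring
    have h2 : 2 * (k + 1) ≤ k * (k + 1) := Nat.mul_le_mul_right _ hk
    omega
  choose a A hA horth using fun e => (hg e).exists_poly J
  have hsumA : ∀ e, |A e| ≤ ∑ e, |A e| := fun e =>
    Finset.single_le_sum (fun e _ => abs_nonneg (A e)) (Finset.mem_univ e)
  have hpoly : ∀ e, Adm (fun n x => ∑ d ∈ Finset.range J, a e d n * x ^ d) := fun e =>
    Adm.sum _ fun d _ => (Adm.const (fun n hn => hA e d n hn)).mul (Adm.id.pow d)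
  obtain ⟨C₁, hC₁, h1⟩ := exists_abs_entryMom_sub_le mW mX (q := k + 1) (by omega) k le_rfl hg hpoly
    horth
  obtain ⟨K₁, hK₁, h2⟩ := exists_abs_entryMom_le mW mX hg
  obtain ⟨K₂, hK₂, h3⟩ := exists_abs_entryMom_le mW mX hpoly
  obtain ⟨C₂, hC₂, h4⟩ := abs_setCumulant_sub_le (Finset.univ : Finset E) (max K₁ K₂)
    (hK₁.trans (le_max_left _ _))
  refine ⟨J, a, ∑ e, |A e|, C₂ * C₁, Finset.sum_nonneg fun e _ => abs_nonneg _, by positivity,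
    fun e d n hn => ((hA e d n hn).trans (le_abs_self _)).trans (hsumA e), fun e n hn => ?_,
    fun n hn M r c hinj => ?_⟩
  -- Orthogonality of order one says that `g'` and the derivative of the polynomial have the same
  -- Gaussian mean.
  · have h5 := (horth e).2 n hn 1 (by omega)
    rw [iteratedDeriv_one] at h5
    have hd1 : Differentiable ℝ (g e n) := (hg e).differentiable n
    have hd2 : Differentiable ℝ (fun x => ∑ d ∈ Finset.range J, a e d n * x ^ d) :=
      (hpoly e).differentiable n
    have h6 : deriv (fun x => g e n x - ∑ d ∈ Finset.range J, a e d n * x ^ d) = fun x =>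
        deriv (g e n) x - ∑ d ∈ Finset.range J, a e d n * (d * x ^ (d - 1)) := by
      funext x
      rw [deriv_fun_sub hd1.differentiableAt hd2.differentiableAt]
      congr 1
      rw [deriv_fun_sum fun d _ => by fun_prop]
      refine Finset.sum_congr rfl fun d _ => ?_
      rw [deriv_const_mul_field, deriv_pow_field]
    have hi : ∀ d, Integrable (fun x : ℝ => x ^ d) (gaussianReal 0 1) := fun d =>
      (Adm.id.pow d).dom_self.integrable_gaussian hn ((Adm.id.pow d).continuous n)
    have hi2 : ∀ d ∈ Finset.range J, Integrable (fun x : ℝ => a e d n * (d * x ^ (d - 1)))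
        (gaussianReal 0 1) := fun d _ => ((hi _).const_mul _).const_mul _
    rw [h6, integral_sub ((hg e).deriv.dom_self.integrable_gaussian hn ((hg e).deriv.continuous n))
      (integrable_finsetSum _ hi2), integral_finsetSum _ hi2, sub_eq_zero] at h5
    rw [h5]
    simp only [integral_const_mul]
  · have h5 := h4 (M.entryMom g r c) (M.entryMom (fun e n x => ∑ d ∈ Finset.range J, a e d n * x ^ d)
      r c) (C₁ * eps n ^ k) (mul_nonneg hC₁ (pow_nonneg (eps_nonneg n) _)) fun B _ _ =>
        ⟨(h2 n hn M r c hinj B).trans (le_max_left _ _), (h3 n hn M r c hinj B).trans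
          (le_max_right _ _), h1 n hn M r c hinj B⟩
    rw [← mul_assoc] at h5
    have h6 := setCumulant_sum (P := M.P) (κ := fun _ : E => ℕ) (fun _ => Finset.range J)
      (fun e d => a e d n) (fun e d ω => M.H (r e) (c e) ω ^ d)
      fun e d => (M.allMom_H _ _).pow d
    rw [← h6]
    exact h5

/-- The approximation is taken to order `K + 2`, beyond every `k ≤ K`, so the decay of the cumulants
of powers carries over. -/
theorem exists_abs_setCumulant_le {g : E → ℕ → ℝ → ℝ} (hg : ∀ e, Adm (g e)) (K : ℕ) :
    ∃ C : ℝ, 0 ≤ C ∧ ∀ n, 3 ≤ n → ∀ (M : RFModel mW mX n) (r : E → Fin M.n₁) (c : E → Fin M.m),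
      Function.Injective (fun e => (r e, c e)) → ∀ k ≤ K,
      (∀ (d : E → ℕ) (α : (Σ e, Fin (d e)) → Fin n),
        setCumulant (M.slotMom r c Sigma.fst α) Finset.univ ≠ 0 →
          2 * (Finset.univ.image α).card + k ≤ Fintype.card (Σ e, Fin (d e))) →
      |setCumulant (M.entryMom g r c) Finset.univ| ≤ C * eps n ^ k := by
  obtain ⟨J, a, A, C₁, hA, hC₁, ha, -, happ⟩ := exists_setCumulant_approx mW mX hg
    (k := K + 2) (by omega)
  choose C₂ hC₂ hpow using fun d => exists_abs_setCumulant_pow_le mW mX E d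
  refine ⟨C₁ + ∑ f ∈ Fintype.piFinset fun _ : E => Finset.range J, A ^ Fintype.card E * C₂ f,
    add_nonneg hC₁ (Finset.sum_nonneg fun f _ => mul_nonneg (pow_nonneg hA _) (hC₂ f)),
    fun n hn M r c hinj k hk hcond => ?_⟩
  have h1 := happ n hn M r c hinj
  have h2 : |∑ f ∈ Fintype.piFinset fun _ : E => Finset.range J, (∏ e, a e (f e) n) *
      setCumulant (fun B => ∫ ω, ∏ e ∈ B, M.H (r e) (c e) ω ^ f e ∂M.P) Finset.univ| ≤
      ∑ f ∈ Fintype.piFinset fun _ : E => Finset.range J, A ^ Fintype.card E * C₂ f *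
        eps n ^ k := by
    refine (Finset.abs_sum_le_sum_abs _ _).trans (Finset.sum_le_sum fun f _ => ?_)
    rw [abs_mul, Finset.abs_prod, mul_assoc]
    refine mul_le_mul ?_ (hpow f n hn M r c k (hcond f)) (abs_nonneg _) (pow_nonneg hA _)
    rw [← Finset.card_univ, ← Finset.prod_const]
    exact Finset.prod_le_prod (fun _ _ => abs_nonneg _) fun e _ => ha e (f e) n hn
  have h3 : C₁ * eps n ^ (K + 2) ≤ C₁ * eps n ^ k :=
    mul_le_mul_of_nonneg_left (pow_le_pow_of_le_one (eps_nonneg n) (eps_le_one hn) (by omega)) hC₁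
  rw [← Finset.sum_mul] at h2
  rw [abs_le] at h1 h2 ⊢
  constructor <;> nlinarith [h1.1, h1.2, h2.1, h2.2]

/-- A zero exponent is allowed: the main term vanishes by its factor `d e = 0`, and the cumulant
vanishes because a position without slots cannot be connected to the others. -/
theorem exists_abs_setCumulant_pow_sub_le' [Nonempty E] (d : E → ℕ) :
    ∃ C : ℝ, 0 ≤ C ∧ ∀ n, 3 ≤ n → ∀ (M : RFModel mW mX n) (r : E → Fin M.n₁) (c : E → Fin M.m),
      Function.Injective (fun e => (r e, c e)) → TwoPerRow r → TwoPerRow c → PosConn r c →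
      |setCumulant (fun B => ∫ ω, ∏ e ∈ B, M.H (r e) (c e) ω ^ d e ∂M.P) Finset.univ -
        n * eps n ^ Fintype.card E * ∏ e, (d e * ∫ x, x ^ (d e - 1) ∂gaussianReal 0 1)| ≤
        C * eps n ^ (Fintype.card E - 1) := by
  by_cases hd : ∃ e, d e = 0
  · obtain ⟨e, he⟩ := hd
    refine ⟨0, le_rfl, fun n hn M r c hinj hr hc hpos => ?_⟩
    obtain ⟨e', hne, -⟩ := hr e
    have h1 : ∀ α : (Σ e, Fin (d e)) → Fin n,
        setCumulant (M.slotMom r c Sigma.fst α) Finset.univ = 0 := by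
      intro α
      by_contra h
      obtain ⟨⟨e₁, s⟩, -, -, h2, -⟩ := M.strongSlotConn_of_ne h {e} (Finset.singleton_nonempty _)
        ⟨e', by simpa using hne⟩
      obtain rfl : e₁ = e := by simpa using h2
      rw [he] at s
      exact s.elim0
    rw [M.setCumulant_pow, Finset.sum_eq_zero fun α _ => h1 α,
      Finset.prod_eq_zero (Finset.mem_univ e) (by rw [he]; simp)]
    simp
  · push Not at hd
    obtain ⟨C, hC, h⟩ := exists_abs_setCumulant_pow_sub_le mW mX E (fun e => d e - 1)
    refine ⟨C, hC, fun n hn M r c hinj hr hc hpos => ?_⟩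
    have h1 := h n hn M r c hinj hr hc hpos
    have h2 : ∀ e, d e - 1 + 1 = d e := fun e => Nat.sub_add_cancel (Nat.pos_of_ne_zero (hd e))
    simpa only [h2] using h1

/-- The joint cumulant of admissible functions of the entries along a cycle. -/
theorem exists_abs_setCumulant_cycle_sub_le [Nonempty E] {g : E → ℕ → ℝ → ℝ}
    (hg : ∀ e, Adm (g e)) :
    ∃ C : ℝ, 0 ≤ C ∧ ∀ n, 3 ≤ n → ∀ (M : RFModel mW mX n) (r : E → Fin M.n₁) (c : E → Fin M.m),
      Function.Injective (fun e => (r e, c e)) → TwoPerRow r → TwoPerRow c → PosConn r c →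
      |setCumulant (M.entryMom g r c) Finset.univ -
        n * eps n ^ Fintype.card E * ∏ e, ∫ x, deriv (g e n) x ∂gaussianReal 0 1| ≤
        C * eps n ^ (Fintype.card E - 1) := by
  obtain ⟨J, a, A, C₁, hA, hC₁, ha, hderiv, happ⟩ := exists_setCumulant_approx mW mX hg
    (k := Fintype.card E + 1) (by have := Fintype.card_pos (α := E); omega)
  choose C₂ hC₂ hpow using fun d => exists_abs_setCumulant_pow_sub_le' mW mX (E := E) d
  refine ⟨C₁ + ∑ f ∈ Fintype.piFinset fun _ : E => Finset.range J, A ^ Fintype.card E * C₂ f,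
    add_nonneg hC₁ (Finset.sum_nonneg fun f _ => mul_nonneg (pow_nonneg hA _) (hC₂ f)),
    fun n hn M r c hinj hr hc hpos => ?_⟩
  have h1 := happ n hn M r c hinj
  -- Multilinearity reassembles the sums of coefficients times `d ∫ x ^ (d - 1)` into the means of
  -- the derivatives.
  have h0 : n * eps n ^ Fintype.card E * ∏ e, ∫ x, deriv (g e n) x ∂gaussianReal 0 1 =
      ∑ f ∈ Fintype.piFinset fun _ : E => Finset.range J, (∏ e, a e (f e) n) *
        (n * eps n ^ Fintype.card E * ∏ e, (f e * ∫ x, x ^ (f e - 1) ∂gaussianReal 0 1)) := by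
    simp only [hderiv _ n hn, Finset.prod_univ_sum, Finset.mul_sum, Finset.prod_mul_distrib]
    exact Finset.sum_congr rfl fun f _ => by ring
  have h2 : |∑ f ∈ Fintype.piFinset fun _ : E => Finset.range J, (∏ e, a e (f e) n) *
      setCumulant (fun B => ∫ ω, ∏ e ∈ B, M.H (r e) (c e) ω ^ f e ∂M.P) Finset.univ -
      n * eps n ^ Fintype.card E * ∏ e, ∫ x, deriv (g e n) x ∂gaussianReal 0 1| ≤
      ∑ f ∈ Fintype.piFinset fun _ : E => Finset.range J, A ^ Fintype.card E * C₂ f *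
        eps n ^ (Fintype.card E - 1) := by
    rw [h0, ← Finset.sum_sub_distrib]
    refine (Finset.abs_sum_le_sum_abs _ _).trans (Finset.sum_le_sum fun f _ => ?_)
    rw [← mul_sub, abs_mul, Finset.abs_prod, mul_assoc (A ^ _)]
    refine mul_le_mul ?_ (hpow f n hn M r c hinj hr hc hpos) (abs_nonneg _) (pow_nonneg hA _)
    rw [← Finset.card_univ, ← Finset.prod_const]
    exact Finset.prod_le_prod (fun _ _ => abs_nonneg _) fun e _ => ha e (f e) n hn
  have h3 : C₁ * eps n ^ (Fintype.card E + 1) ≤ C₁ * eps n ^ (Fintype.card E - 1) :=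
    mul_le_mul_of_nonneg_left (pow_le_pow_of_le_one (eps_nonneg n) (eps_le_one hn) (by omega)) hC₁
  rw [← Finset.sum_mul] at h2
  have h4 := (abs_sub_le _ _ _).trans (add_le_add h1 h2)
  refine h4.trans ?_
  rw [add_mul]
  linarith

end

end RFModel

end CycleCorrelations

end

noncomputable section

namespace CycleCorrelations

/-! ### Repeated positions and decay of cumulants. -/

section Positions

variable {ι R K : Type*} [DecidableEq ι] [DecidableEq R] [DecidableEq K] {r : ι → R} {c : ι → K}

/-- The number of distinct positions among those indexed by `S`. -/
def posCard (r : ι → R) (c : ι → K) (S : Finset ι) : ℕ := (S.image fun l => (r l, c l)).card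

/-- The positions indexed by `S` form a forest. -/
def IsForest (r : ι → R) (c : ι → K) (S : Finset ι) : Prop :=
  ∀ S' ⊆ S, S'.Nonempty → posCard r c S' + 1 ≤ numVert r c S'

theorem IsForest.mono {S S' : Finset ι} (h : IsForest r c S) (hS : S' ⊆ S) : IsForest r c S' :=
  fun T hT => h T (hT.trans hS)

/-- Without a leaf each row and each column would contain two positions, so there would be no more
vertices than positions. -/
theorem IsForest.exists_leaf {S : Finset ι} (h : IsForest r c S) (hS : S.Nonempty)
    (hinj : Set.InjOn (fun l => (r l, c l)) S) :
    ∃ l ∈ S, (∀ l' ∈ S, r l' = r l → l' = l) ∨ ∀ l' ∈ S, c l' = c l → l' = l := by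
  by_contra hcon
  push Not at hcon
  have h1 := h S le_rfl hS
  have h2 : posCard r c S = S.card := Finset.card_image_of_injOn hinj
  have h3 := two_mul_card_image_le S r fun l hl => by
    obtain ⟨⟨l', a, b, d⟩, -⟩ := hcon l hl
    exact ⟨l', a, d, b⟩
  have h4 := two_mul_card_image_le S c fun l hl => by
    obtain ⟨-, l', a, b, d⟩ := hcon l hl
    exact ⟨l', a, d, b⟩
  unfold numVert at h1
  omega

/-- The exponents of `eps` controlling the joint cumulant of the entries indexed by `S`. -/
def DecayExp (r : ι → R) (c : ι → K) (S : Finset ι) (k : ℕ) : Prop :=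
  k + 2 ≤ numVert r c S ∨ IsForest r c S ∧ 2 ≤ posCard r c S ∧ k + 1 ≤ numVert r c S

theorem DecayExp.le {S : Finset ι} {k : ℕ} (h : DecayExp r c S k) : k ≤ 2 * S.card := by
  have h1 : numVert r c S ≤ 2 * S.card := by
    have h2 : (S.image r).card ≤ S.card := Finset.card_image_le
    have h3 : (S.image c).card ≤ S.card := Finset.card_image_le
    unfold numVert
    omega
  rcases h with h | h <;> omega

theorem image_insert_eq {β : Type*} [DecidableEq β] {f : ι → β} {i j : ι} (h : f i = f j)
    (T : Finset ι) : (insert i (insert j T)).image f = (insert i T).image f := by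
  simp [Finset.image_insert, h]

theorem DecayExp.merge {i j : ι} {T : Finset ι} {k : ℕ} (hr : r i = r j) (hc : c i = c j)
    (h : DecayExp r c (insert i (insert j T)) k) : DecayExp r c (insert i T) k := by
  have h1 : numVert r c (insert i (insert j T)) = numVert r c (insert i T) := by
    unfold numVert
    rw [image_insert_eq hr, image_insert_eq hc]
  have h2 : posCard r c (insert i (insert j T)) = posCard r c (insert i T) := by
    unfold posCard
    rw [image_insert_eq (by rw [hr, hc])]
  unfold DecayExp at h ⊢
  rw [h1, h2] at h
  refine h.imp_right fun h => ⟨h.1.mono ?_, h.2⟩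
  exact Finset.insert_subset_insert _ (Finset.subset_insert _ _)

/-- The two parts have the position of `i` and `j` in common, so their vertex numbers add up to at
least two more than the total, and the exponents `v - 2` add up. The extra unit of a forest is
needed only once, and some part has at least two positions to supply it. -/
theorem DecayExp.split {i j : ι} {T A : Finset ι} {k : ℕ} (hr : r i = r j) (hc : c i = c j)
    (hA : A ⊆ T) (h : DecayExp r c (insert i (insert j T)) k) :
    ∃ k₁ k₂, k ≤ k₁ + k₂ ∧ DecayExp r c (insert i A) k₁ ∧ DecayExp r c (insert j (T \ A)) k₂ := by
  have e1 : ∀ {β : Type _} [DecidableEq β] (f : ι → β), f i = f j →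
      (insert j (T \ A)).image f = (insert i (T \ A)).image f := by
    intro β _ f hf
    simp [Finset.image_insert, hf]
  have e2 : insert i A ∪ insert i (T \ A) = insert i T := by
    ext x
    simp only [Finset.mem_union, Finset.mem_insert, Finset.mem_sdiff]
    constructor
    · rintro ((h | h) | (h | h))
      exacts [Or.inl h, Or.inr (hA h), Or.inl h, Or.inr h.1]
    · rintro (h | h)
      · exact Or.inl (Or.inl h)
      · by_cases hx : x ∈ A
        · exact Or.inl (Or.inr hx)
        · exact Or.inr (Or.inr ⟨h, hx⟩)
  have hv := numVert_union_le r c (Finset.mem_insert_self i A) (Finset.mem_insert_self i (T \ A))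
  have hv2 : numVert r c (insert j (T \ A)) = numVert r c (insert i (T \ A)) := by
    unfold numVert
    have h1 : (insert j (T \ A)).image r = (insert i (T \ A)).image r := by
      simp [Finset.image_insert, hr]
    have h2 : (insert j (T \ A)).image c = (insert i (T \ A)).image c := by
      simp [Finset.image_insert, hc]
    rw [h1, h2]
  have hp2 : posCard r c (insert j (T \ A)) = posCard r c (insert i (T \ A)) := by
    unfold posCard
    rw [e1 _ (by rw [hr, hc])]
  rw [e2] at hv
  have hv1 := two_le_numVert r c (Finset.insert_nonempty i A)
  have hv3 := two_le_numVert r c (Finset.insert_nonempty i (T \ A))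
  have hsub1 : insert i A ⊆ insert i (insert j T) :=
    Finset.insert_subset_insert _ (hA.trans (Finset.subset_insert _ _))
  have hsub2 : insert j (T \ A) ⊆ insert i (insert j T) :=
    (Finset.insert_subset_insert _ Finset.sdiff_subset).trans (Finset.subset_insert _ _)
  have hVV : numVert r c (insert i (insert j T)) = numVert r c (insert i T) := by
    unfold numVert
    rw [image_insert_eq hr, image_insert_eq hc]
  unfold DecayExp
  rw [hv2, hp2]
  rcases h with h | ⟨hfor, hpos, h⟩
  · exact ⟨numVert r c (insert i A) - 2, numVert r c (insert i (T \ A)) - 2, by omega,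
      Or.inl (by omega), Or.inl (by omega)⟩
  · have hP : posCard r c (insert i (insert j T)) = posCard r c (insert i T) := by
      unfold posCard
      rw [image_insert_eq (by rw [hr, hc])]
    have hposor : 2 ≤ posCard r c (insert i A) ∨ 2 ≤ posCard r c (insert i (T \ A)) := by
      by_contra hcon
      push Not at hcon
      have h1 : posCard r c (insert i T) ≤ 1 := by
        unfold posCard at hcon ⊢
        rw [Finset.card_le_one]
        have h2 : ∀ x ∈ (insert i T).image (fun l => (r l, c l)), x = (r i, c i) := by
          intro x hx
          rw [← e2, Finset.image_union, Finset.mem_union] at hx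
          rcases hx with hx | hx
          · exact Finset.card_le_one.1 (Nat.lt_succ_iff.1 hcon.1) _ hx _
              (Finset.mem_image_of_mem _ (Finset.mem_insert_self _ _))
          · exact Finset.card_le_one.1 (Nat.lt_succ_iff.1 hcon.2) _ hx _
              (Finset.mem_image_of_mem _ (Finset.mem_insert_self _ _))
        intro x hx y hy
        rw [h2 x hx, h2 y hy]
      omega
    rcases hposor with hp | hp
    · exact ⟨numVert r c (insert i A) - 1, numVert r c (insert i (T \ A)) - 2, by omega,
        Or.inr ⟨hfor.mono hsub1, hp, by omega⟩, Or.inl (by omega)⟩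
    · exact ⟨numVert r c (insert i A) - 2, numVert r c (insert i (T \ A)) - 1, by omega,
        Or.inl (by omega), Or.inr ⟨hfor.mono hsub2, hp, by omega⟩⟩

end Positions

namespace RFModel

variable (mW mX : ℕ → ℝ) {ι : Type} [Fintype ι] [DecidableEq ι]

theorem setCumulant_entryMom_subtype {mW mX : ℕ → ℝ} {n : ℕ} (M : RFModel mW mX n)
    (g : ι → ℕ → ℝ → ℝ) (r : ι → Fin M.n₁) (c : ι → Fin M.m) (S : Finset ι) :
    setCumulant (M.entryMom g r c) S = setCumulant (M.entryMom (fun l : S => g l)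
      (fun l => r l) (fun l => c l)) Finset.univ := by
  have h1 : S = (Finset.univ : Finset S).map (Function.Embedding.subtype _) := by
    rw [Finset.univ_eq_attach]
    exact (Finset.attach_map_val).symm
  conv_lhs => rw [h1]
  rw [setCumulant_map _ _ (M.entryMom_empty g r c)]
  congr 1
  ext B
  simp [entryMom, Finset.prod_map]

/-- For distinct positions the first alternative of `DecayExp` is the general count, and the second
is the count with a leaf, which a forest has. -/
theorem exists_abs_setCumulant_injOn_le {g : ι → ℕ → ℝ → ℝ} (hg : ∀ l, Adm (g l))
    (S : Finset ι) (hS : S.Nonempty) :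
    ∃ C : ℝ, 0 ≤ C ∧ ∀ n, 3 ≤ n → ∀ (M : RFModel mW mX n) (r : ι → Fin M.n₁) (c : ι → Fin M.m),
      Set.InjOn (fun l => (r l, c l)) S → ∀ k, DecayExp r c S k →
      |setCumulant (M.entryMom g r c) S| ≤ C * eps n ^ k := by
  obtain ⟨C, hC, hb⟩ := exists_abs_setCumulant_le mW mX (E := S) (g := fun l => g l)
    (fun l => hg l) (2 * S.card)
  refine ⟨C, hC, fun n hn M r c hinj k hk => ?_⟩
  rw [setCumulant_entryMom_subtype]
  have hinj' : Function.Injective fun l : S => (r l, c l) := fun l l' h =>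
    Subtype.ext (hinj l.2 l'.2 h)
  have hv : numVert (fun l : S => r l) (fun l : S => c l) Finset.univ = numVert r c S := by
    have key : ∀ {β : Type} [DecidableEq β] (f : ι → β),
        (Finset.univ : Finset S).image (fun l : S => f l) = S.image f := by
      intro β _ f
      ext x
      simp
    unfold numVert
    rw [key r, key c]
  refine hb n hn M _ _ hinj' k hk.le fun d α hne => ?_
  rcases hk with hk | ⟨hfor, hpos, hk⟩
  · have := M.card_image_add_le_of_ne hne
    rw [hv] at this
    omega
  · obtain ⟨l, hl, hleaf⟩ := hfor.exists_leaf hS hinj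
    have hnt : Nontrivial S := by
      rw [← Fintype.one_lt_card_iff_nontrivial, Fintype.card_coe]
      exact lt_of_lt_of_le hpos Finset.card_image_le
    have := M.card_image_add_lt_of_ne (e₀ := ⟨l, hl⟩)
      (hleaf.imp (fun h e he => Subtype.ext (h e e.2 he)) fun h e he => Subtype.ext (h e e.2 he))
      hne
    rw [hv] at this
    omega

/-- Two functions at the same position multiply to one function there, which is again admissible. -/
theorem entryMom_merge {mW mX : ℕ → ℝ} {n : ℕ} (M : RFModel mW mX n) (g : ι → ℕ → ℝ → ℝ)
    {r : ι → Fin M.n₁} {c : ι → Fin M.m} {i j : ι} {T : Finset ι} (hij : i ≠ j) (hi : i ∉ T)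
    (hj : j ∉ T) (hr : r i = r j) (hc : c i = c j) :
    setCumulant (fun B => if i ∈ B then M.entryMom g r c (insert j B) else M.entryMom g r c B)
      (insert i T) = setCumulant (M.entryMom (Function.update g i fun n x => g i n x * g j n x)
        r c) (insert i T) := by
  refine setCumulant_congr fun B hB _ => ?_
  have hjB : j ∉ B := fun h => by
    rcases Finset.mem_insert.1 (hB h) with h | h
    exacts [hij h.symm, hj h]
  unfold entryMom
  split_ifs with hiB
  · refine integral_congr_ae (Filter.Eventually.of_forall fun ω => ?_)
    simp only
    rw [Finset.prod_insert hjB, ← Finset.mul_prod_erase _ _ hiB, ← Finset.mul_prod_erase _ _ hiB,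
      Function.update_self, ← hr, ← hc, ← mul_assoc, mul_comm (g j n _)]
    congr 1
    exact Finset.prod_congr rfl fun l hl => by
      rw [Function.update_of_ne (Finset.ne_of_mem_erase hl)]
  · refine integral_congr_ae (Filter.Eventually.of_forall fun ω => ?_)
    refine Finset.prod_congr rfl fun l hl => ?_
    rw [Function.update_of_ne]
    rintro rfl
    exact hiB hl

/-- Induction on the index set: as long as two indices have the same position, `setCumulant_merge`
expresses the cumulant by cumulants over smaller sets, whose exponents are controlled by
`DecayExp.merge` and `DecayExp.split`. -/
theorem exists_abs_setCumulant_decay (S : Finset ι) : S.Nonempty → ∀ {g : ι → ℕ → ℝ → ℝ},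
    (∀ l, Adm (g l)) → ∃ C : ℝ, 0 ≤ C ∧ ∀ n, 3 ≤ n → ∀ (M : RFModel mW mX n)
      (r : ι → Fin M.n₁) (c : ι → Fin M.m) (k : ℕ), DecayExp r c S k →
      |setCumulant (M.entryMom g r c) S| ≤ C * eps n ^ k := by
  induction S using Finset.strongInduction with
  | H S ih =>
  intro hS g hg
  have hex : ∀ (T : Finset ι) (g : ι → ℕ → ℝ → ℝ), ∃ C : ℝ, 0 ≤ C ∧ (T ⊂ S → T.Nonempty →
      (∀ l, Adm (g l)) → ∀ n, 3 ≤ n → ∀ (M : RFModel mW mX n)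
      (r : ι → Fin M.n₁) (c : ι → Fin M.m) (k : ℕ), DecayExp r c T k →
      |setCumulant (M.entryMom g r c) T| ≤ C * eps n ^ k) := by
    intro T g
    by_cases h : T ⊂ S ∧ T.Nonempty ∧ ∀ l, Adm (g l)
    · obtain ⟨C, hC, hb⟩ := ih T h.1 h.2.1 h.2.2
      exact ⟨C, hC, fun _ _ _ => hb⟩
    · exact ⟨0, le_rfl, fun h1 h2 h3 => absurd ⟨h1, h2, h3⟩ h⟩
  choose Cf hCf hCb using hex
  obtain ⟨C₀, hC₀, h0⟩ := exists_abs_setCumulant_injOn_le mW mX hg S hS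
  let gm : ι → ι → ι → ℕ → ℝ → ℝ := fun i j =>
    Function.update g i fun n x => g i n x * g j n x
  have hgm : ∀ i j l, Adm (gm i j l) := by
    intro i j l
    by_cases h : l = i
    · subst h
      simpa [gm] using (hg l).mul (hg j)
    · simpa [gm, Function.update_of_ne h] using hg l
  -- Which indices coincide depends on `r` and `c`, but the constant must not; hence a constant is
  -- prepared for each pair and all of them are added.
  let D : ι → ι → ℝ := fun i j => Cf (insert i ((S.erase i).erase j)) (gm i j) +
    ∑ A ∈ ((S.erase i).erase j).powerset,
      Cf (insert i A) g * Cf (insert j (((S.erase i).erase j) \ A)) g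
  have hD : ∀ i j, 0 ≤ D i j := fun i j => add_nonneg (hCf _ _)
    (Finset.sum_nonneg fun A _ => mul_nonneg (hCf _ _) (hCf _ _))
  have hDD : 0 ≤ ∑ i, ∑ j, D i j := Finset.sum_nonneg fun i _ => Finset.sum_nonneg fun j _ => hD i j
  refine ⟨C₀ + ∑ i, ∑ j, D i j, by positivity, fun n hn M r c k hk => ?_⟩
  have he := pow_nonneg (eps_nonneg n) k
  by_cases hinj : Set.InjOn (fun l => (r l, c l)) S
  · refine (h0 n hn M r c hinj k hk).trans (mul_le_mul_of_nonneg_right ?_ he)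
    linarith
  obtain ⟨i, hi, j, hj, hpos, hij⟩ : ∃ i ∈ S, ∃ j ∈ S, (r i, c i) = (r j, c j) ∧ i ≠ j := by
    simpa [Set.InjOn, and_assoc] using hinj
  have hr : r i = r j := congrArg Prod.fst hpos
  have hc : c i = c j := congrArg Prod.snd hpos
  have hDle : D i j ≤ ∑ i, ∑ j, D i j :=
    (Finset.single_le_sum (fun j _ => hD i j) (Finset.mem_univ j)).trans
      (Finset.single_le_sum (f := fun i => ∑ j, D i j)
        (fun i _ => Finset.sum_nonneg fun j _ => hD i j) (Finset.mem_univ i))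
  refine le_trans ?_ (mul_le_mul_of_nonneg_right (hDle.trans (le_add_of_nonneg_left hC₀)) he)
  set T := (S.erase i).erase j with hT
  have hiT : i ∉ T := by simp [hT]
  have hjT : j ∉ T := by simp [hT]
  have hST : S = insert i (insert j T) := by
    rw [hT, Finset.insert_erase (Finset.mem_erase.2 ⟨hij.symm, hj⟩), Finset.insert_erase hi]
  have hjS : ∀ A ⊆ T, insert i A ⊂ S := fun A hA => by
    rw [Finset.ssubset_iff_of_subset]
    · exact ⟨j, hj, fun h => (Finset.mem_insert.1 h).elim (fun h => hij h.symm) fun h => hjT (hA h)⟩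
    · rw [hST]
      exact Finset.insert_subset_insert _ (hA.trans (Finset.subset_insert _ _))
  have hiS : ∀ A ⊆ T, insert j A ⊂ S := fun A hA => by
    rw [Finset.ssubset_iff_of_subset]
    · exact ⟨i, hi, fun h => (Finset.mem_insert.1 h).elim hij fun h => hiT (hA h)⟩
    · rw [hST]
      exact (Finset.insert_subset_insert _ hA).trans (Finset.subset_insert _ _)
  have hk' := hk
  rw [hST] at hk'
  have hmerge := setCumulant_merge (M.entryMom g r c) (M.entryMom_empty g r c) hij hiT hjT
  rw [← hST, entryMom_merge M g hij hiT hjT hr hc] at hmerge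
  rw [hmerge]
  have b1 := hCb (insert i T) (gm i j) (hjS T le_rfl) (Finset.insert_nonempty _ _) (hgm i j)
    n hn M r c k (hk'.merge hr hc)
  have b2 : |∑ A ∈ T.powerset, setCumulant (M.entryMom g r c) (insert i A) *
      setCumulant (M.entryMom g r c) (insert j (T \ A))| ≤
      ∑ A ∈ T.powerset, Cf (insert i A) g * Cf (insert j (T \ A)) g * eps n ^ k := by
    refine (Finset.abs_sum_le_sum_abs _ _).trans (Finset.sum_le_sum fun A hA => ?_)
    have hA := Finset.mem_powerset.1 hA
    obtain ⟨k₁, k₂, hkk, h1, h2⟩ := hk'.split hr hc hA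
    have c1 := hCb (insert i A) g (hjS A hA) (Finset.insert_nonempty _ _) hg n hn M r c k₁ h1
    have c2 := hCb (insert j (T \ A)) g (hiS _ Finset.sdiff_subset) (Finset.insert_nonempty _ _)
      hg n hn M r c k₂ h2
    rw [abs_mul]
    refine (mul_le_mul c1 c2 (abs_nonneg _)
      (mul_nonneg (hCf _ _) (pow_nonneg (eps_nonneg n) _))).trans ?_
    rw [mul_mul_mul_comm, ← pow_add]
    exact mul_le_mul_of_nonneg_left
      (pow_le_pow_of_le_one (eps_nonneg n) (eps_le_one hn) hkk)
      (mul_nonneg (hCf _ _) (hCf _ _))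
  rw [← Finset.sum_mul] at b2
  refine (abs_sub _ _).trans ((add_le_add b1 b2).trans (le_of_eq ?_))
  simp only [D]
  ring

end RFModel

end CycleCorrelations

end

noncomputable section

namespace CycleCorrelations

/-! ### Recognising cycles, forests and leaves; independence of disconnected families. -/

section Dihedral

variable {α : Type*} {ρ γ : α → α}

/-- An equality would make an alternating word of odd length in two involutions fix a point.
Conjugation shortens the word by two letters, down to a fixed point of `ρ` or `γ`. -/
theorem iterate_comp_ne (hρ : Function.Involutive ρ) (hγ : Function.Involutive γ)
    (hρ' : ∀ x, ρ x ≠ x) (hγ' : ∀ x, γ x ≠ x) : ∀ (m : ℕ) (x : α), (ρ ∘ γ)^[m] x ≠ γ x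
  | 0, x => (hγ' x).symm
  | 1, x => hρ' _
  | m + 2, x => fun h => by
    refine iterate_comp_ne hρ hγ hρ' hγ' m ((ρ ∘ γ) x) ?_
    have h1 : (ρ ∘ γ) ((ρ ∘ γ)^[m] ((ρ ∘ γ) x)) = γ x := by
      rw [← Function.iterate_succ_apply' (ρ ∘ γ) m, ← Function.iterate_succ_apply (ρ ∘ γ) (m + 1)]
      exact h
    have h2 : γ ((ρ ∘ γ)^[m] ((ρ ∘ γ) x)) = ρ (γ x) := by
      rw [← h1]
      exact (hρ _).symm
    rw [← hγ ((ρ ∘ γ)^[m] ((ρ ∘ γ) x)), h2]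
    rfl

theorem iterate_ne_iterate (hρ : Function.Involutive ρ) (hγ : Function.Involutive γ)
    (hρ' : ∀ x, ρ x ≠ x) (hγ' : ∀ x, γ x ≠ x) (i j : ℕ) (x : α) :
    (ρ ∘ γ)^[i] x ≠ γ ((ρ ∘ γ)^[j] x) := by
  intro h
  rcases le_total j i with hij | hij
  · obtain ⟨m, rfl⟩ := Nat.exists_eq_add_of_le hij
    rw [add_comm, Function.iterate_add_apply] at h
    exact iterate_comp_ne hρ hγ hρ' hγ' m _ h
  · obtain ⟨m, rfl⟩ := Nat.exists_eq_add_of_le hij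
    rw [add_comm, Function.iterate_add_apply] at h
    refine iterate_comp_ne hρ hγ hρ' hγ' m ((ρ ∘ γ)^[i] x) ?_
    conv_rhs => rw [h]
    rw [hγ]

end Dihedral

theorem TwoPerRow.exists_partner {E R : Type*} {r : E → R} (h : TwoPerRow r) :
    ∃ ρ : E → E, Function.Involutive ρ ∧ (∀ e, ρ e ≠ e) ∧ (∀ e, r (ρ e) = r e) ∧
      ∀ e e', r e' = r e → e' = e ∨ e' = ρ e := by
  choose ρ h1 h2 h3 using h
  refine ⟨ρ, fun e => ?_, h1, h2, h3⟩
  exact (h3 e _ ((h2 _).trans (h2 e))).resolve_right (h1 _)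

/-- Let `ρ` and `γ` exchange the positions of a row and of a column. Starting from one position and
alternating them walks around a cycle; the orbit of `ρ ∘ γ` and its image under `γ` are disjoint,
and together they are everything by connectedness. -/
theorem isCycle_of_twoPerRow {n₁ m q : ℕ} [NeZero q] {a : Fin q → Fin n₁} {b : Fin q → Fin m}
    (ha : TwoPerRow a) (hb : TwoPerRow b) (hconn : PosConn a b) : IsCycle a b := by
  obtain ⟨ρ, hρ, hρ', haρ, hauniq⟩ := ha.exists_partner
  obtain ⟨γ, hγ, hγ', hbγ, hbuniq⟩ := hb.exists_partner
  set l₀ : Fin q := 0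
  set f := ρ ∘ γ with hf
  have hcross := fun i j => iterate_ne_iterate hρ hγ hρ' hγ' i j l₀
  have hfinj : Function.Injective f := hρ.injective.comp hγ.injective
  have hper : l₀ ∈ Function.periodicPts f := hfinj.mem_periodicPts l₀
  have hk := Function.minimalPeriod_pos_of_mem_periodicPts hper
  obtain ⟨k, hk'⟩ := Nat.exists_eq_succ_of_ne_zero hk.ne'
  have hρf : ∀ j, ∃ i, ρ (f^[j] l₀) = γ (f^[i] l₀) := by
    intro j
    refine ⟨j + k, ?_⟩
    have h1 : f^[j] l₀ = f (f^[j + k] l₀) := by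
      rw [← Function.iterate_succ_apply' f, Nat.succ_eq_add_one, add_assoc,
        Function.iterate_add_apply, ← Nat.succ_eq_add_one, ← hk', Function.iterate_minimalPeriod]
    rw [h1]
    exact hρ _
  have hinjit : ∀ i j : Fin (k + 1), f^[i] l₀ = f^[j] l₀ → i = j := by
    intro i j h
    refine Fin.ext (Function.iterate_injOn_Iio_minimalPeriod (f := f) (x := l₀) ?_ ?_ h)
    · exact Set.mem_Iio.2 (hk' ▸ i.2)
    · exact Set.mem_Iio.2 (hk' ▸ j.2)
  have hmod : ∀ j : ℕ, ∃ i : Fin (k + 1), f^[i] l₀ = f^[j] l₀ := fun j =>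
    ⟨⟨j % (k + 1), Nat.mod_lt _ (Nat.succ_pos k)⟩, by
      have := Function.iterate_mod_minimalPeriod_eq (f := f) (x := l₀) (n := j)
      rwa [hk'] at this⟩
  let e : Fin (k + 1) ⊕ Fin (k + 1) → Fin q :=
    Sum.elim (fun i => f^[i] l₀) fun i => γ (f^[i] l₀)
  have hall : ∀ x, ∃ j : ℕ, x = f^[j] l₀ ∨ x = γ (f^[j] l₀) := by
    classical
    by_contra hcon
    push Not at hcon
    obtain ⟨x, hx⟩ := hcon
    let F : Finset (Fin q) := Finset.univ.filter fun x => ∃ j : ℕ, x = f^[j] l₀ ∨ x = γ (f^[j] l₀)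
    obtain ⟨y, hy, z, hz, hyz⟩ := hconn F ⟨l₀, by
        simp only [F, Finset.mem_filter, Finset.mem_univ, true_and]
        exact ⟨0, Or.inl rfl⟩⟩
      ⟨x, by simpa [F] using hx⟩
    simp only [F, Finset.mem_filter, Finset.mem_univ, true_and] at hy hz
    apply hz
    have hzy : z ≠ y := by
      rintro rfl
      exact hz hy
    rcases hyz with h | h
    · rw [(hauniq y z h.symm).resolve_left hzy]
      obtain ⟨j, rfl | rfl⟩ := hy
      · obtain ⟨i, hi⟩ := hρf j
        exact ⟨i, Or.inr hi⟩
      · exact ⟨j + 1, Or.inl (by rw [Function.iterate_succ_apply']; rfl)⟩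
    · rw [(hbuniq y z h.symm).resolve_left hzy]
      obtain ⟨j, rfl | rfl⟩ := hy
      · exact ⟨j, Or.inr rfl⟩
      · exact ⟨j, Or.inl (hγ _)⟩
  have he : Function.Bijective e := by
    constructor
    · rintro (i | i) (j | j) h
      · rw [hinjit i j h]
      · exact absurd h (hcross _ _)
      · exact absurd h.symm (hcross _ _)
      · rw [hinjit i j (hγ.injective h)]
    · intro x
      obtain ⟨j, rfl | rfl⟩ := hall x
      · obtain ⟨i, hi⟩ := hmod j
        exact ⟨Sum.inl i, hi⟩
      · obtain ⟨i, hi⟩ := hmod j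
        exact ⟨Sum.inr i, congrArg γ hi⟩
  refine ⟨k + 1, Equiv.ofBijective e he, fun i => a (f^[i] l₀), fun i => b (f^[i] l₀), ?_, ?_, ?_⟩
  · intro i j h
    rcases hauniq _ _ h with h1 | h1
    · exact hinjit _ _ h1
    · obtain ⟨i', hi'⟩ := hρf j
      exact absurd (h1.trans hi') (hcross _ _)
  · intro i j h
    rcases hbuniq _ _ h with h1 | h1
    · exact hinjit _ _ h1
    · exact absurd h1 (hcross _ _)
  · intro l
    refine ⟨rfl, rfl, ?_, hbγ _⟩
    -- The cyclic successor of `l` agrees with `l + 1` modulo the period, so the closing edge of the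
    -- cycle needs no separate treatment.
    have h1 : f^[(finRotate (k + 1) l : ℕ)] l₀ = f (f^[l] l₀) := by
      rw [finRotate_apply, ← Function.iterate_succ_apply' f,
        ← Function.iterate_mod_minimalPeriod_eq (n := Nat.succ _), hk']
      congr 2
      simp [Fin.val_add]
    change a (γ (f^[l] l₀)) = a (f^[(finRotate (k + 1) l : ℕ)] l₀)
    rw [h1]
    exact (haρ _).symm

section Growth

variable {ι R K : Type*} [Fintype ι] [DecidableEq ι] [DecidableEq R] [DecidableEq K] {r : ι → R}
  {c : ι → K}

/-- In a connected family a subfamily can be enlarged by positions sharing a row or column with it.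
A new position brings at most one new vertex, so the excess of vertices over positions never
increases; an excess in the whole family is inherited by each subfamily. -/
theorem PosConn.numVert_add_posCard_le (h : PosConn r c) {S : Finset ι} (hS : S.Nonempty) :
    numVert r c Finset.univ + posCard r c S ≤ numVert r c S + posCard r c Finset.univ := by
  classical
  let good : Finset ι → Prop := fun T =>
    S ⊆ T ∧ numVert r c T + posCard r c S ≤ numVert r c S + posCard r c T
  obtain ⟨T, hT, hmax⟩ : ∃ T ∈ Finset.univ.filter good, ∀ B ∈ Finset.univ.filter good,
      B.card ≤ T.card :=
    Finset.exists_max_image _ _ ⟨S, Finset.mem_filter.2 ⟨Finset.mem_univ _, le_rfl, le_rfl⟩⟩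
  obtain ⟨-, hST, hle⟩ := Finset.mem_filter.1 hT
  by_cases hTu : T = Finset.univ
  · rwa [hTu] at hle
  exfalso
  obtain ⟨e, he, e', he', hee⟩ := h T (hS.mono hST) (by
    by_contra hcon
    push Not at hcon
    exact hTu (Finset.eq_univ_iff_forall.2 hcon))
  have hgood : good (insert e' T) := by
    refine ⟨hST.trans (Finset.subset_insert _ _), ?_⟩
    have hcr : ((insert e' T).image r).card ≤ (T.image r).card + 1 := by
      rw [Finset.image_insert]
      exact Finset.card_insert_le _ _
    have hcc : ((insert e' T).image c).card ≤ (T.image c).card + 1 := by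
      rw [Finset.image_insert]
      exact Finset.card_insert_le _ _
    by_cases hpos : (r e', c e') ∈ T.image fun l => (r l, c l)
    · obtain ⟨l, hl, hlp⟩ := Finset.mem_image.1 hpos
      have h1 : (insert e' T).image r = T.image r := by
        rw [Finset.image_insert, Finset.insert_eq_of_mem]
        exact Finset.mem_image.2 ⟨l, hl, congrArg Prod.fst hlp⟩
      have h2 : (insert e' T).image c = T.image c := by
        rw [Finset.image_insert, Finset.insert_eq_of_mem]
        exact Finset.mem_image.2 ⟨l, hl, congrArg Prod.snd hlp⟩
      have h3 : posCard r c (insert e' T) = posCard r c T := by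
        unfold posCard
        rw [Finset.image_insert, Finset.insert_eq_of_mem hpos]
      rw [h3]
      unfold numVert at hle ⊢
      rw [h1, h2]
      exact hle
    · have h3 : posCard r c (insert e' T) = posCard r c T + 1 := by
        unfold posCard
        rw [Finset.image_insert, Finset.card_insert_of_notMem hpos]
      rcases hee with h1 | h1
      · have h2 : (insert e' T).image r = T.image r := by
          rw [Finset.image_insert, Finset.insert_eq_of_mem]
          exact Finset.mem_image.2 ⟨e, he, h1⟩
        rw [h3]
        unfold numVert at hle ⊢
        rw [h2]
        omega
      · have h2 : (insert e' T).image c = T.image c := by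
          rw [Finset.image_insert, Finset.insert_eq_of_mem]
          exact Finset.mem_image.2 ⟨e, he, h1⟩
        rw [h3]
        unfold numVert at hle ⊢
        rw [h2]
        omega
  have := hmax _ (Finset.mem_filter.2 ⟨Finset.mem_univ _, hgood⟩)
  rw [Finset.card_insert_of_notMem he'] at this
  omega

end Growth

/-- Connected families of few positions, other than cycles, form a forest or have a leaf. -/
theorem forest_or_leaf {n₁ m q : ℕ} (hq : 2 ≤ q) {a : Fin q → Fin n₁} {b : Fin q → Fin m}
    (hconn : PosConn a b) (hqv : q ≤ numVert a b Finset.univ) (hcyc : ¬ IsCycle a b) :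
    (IsForest a b Finset.univ ∧ 2 ≤ posCard a b Finset.univ) ∨
      (Function.Injective fun l => (a l, b l)) ∧
        ∃ l, (∀ l', a l' = a l → l' = l) ∨ ∀ l', b l' = b l → l' = l := by
  have hle : posCard a b Finset.univ ≤ q := by
    refine Finset.card_image_le.trans ?_
    simp
  have hne : NeZero q := ⟨by omega⟩
  rcases Nat.lt_or_ge (posCard a b Finset.univ) (numVert a b Finset.univ) with hlt | hge
  · left
    refine ⟨fun S _ hS => ?_, ?_⟩
    · have := hconn.numVert_add_posCard_le hS
      omega
    · by_contra hcon
      apply hcyc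
      have h1 : posCard a b Finset.univ ≤ 1 := by omega
      have h2 : ∀ l l', a l = a l' ∧ b l = b l' := fun l l' => by
        have := Finset.card_le_one.1 h1 (a l, b l) (Finset.mem_image_of_mem _ (Finset.mem_univ l))
          (a l', b l') (Finset.mem_image_of_mem _ (Finset.mem_univ l'))
        exact Prod.mk.inj this
      have h3 : numVert a b Finset.univ ≤ 2 := by
        refine add_le_add (Finset.card_le_one.2 ?_) (Finset.card_le_one.2 ?_) <;>
        · simp only [Finset.mem_image, Finset.mem_univ, true_and]
          rintro _ ⟨l, rfl⟩ _ ⟨l', rfl⟩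
          first | exact (h2 l l').1 | exact (h2 l l').2
      obtain rfl : q = 2 := by omega
      refine ⟨1, finSumFinEquiv, fun _ => a 0, fun _ => b 0, Function.injective_of_subsingleton _,
        Function.injective_of_subsingleton _, fun l => ⟨(h2 _ _).1, (h2 _ _).2, (h2 _ _).1,
          (h2 _ _).2⟩⟩
  · right
    have hcard : posCard a b Finset.univ = (Finset.univ : Finset (Fin q)).card := by
      rw [Finset.card_univ, Fintype.card_fin]
      omega
    have hinj : Function.Injective fun l => (a l, b l) := by
      have := Finset.card_image_iff.1 hcard
      simpa [Set.injOn_univ] using this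
    refine ⟨hinj, ?_⟩
    -- Here `q` distinct positions meet exactly `q` vertices. Without a leaf each row and each
    -- column holds exactly two positions, which makes the family a cycle.
    by_contra hcon
    push Not at hcon
    have hA : ∀ l ∈ (Finset.univ : Finset (Fin q)), ∃ l' ∈ (Finset.univ : Finset (Fin q)),
        l' ≠ l ∧ a l' = a l := fun l _ => by
      obtain ⟨⟨l', h1, h2⟩, -⟩ := hcon l
      exact ⟨l', Finset.mem_univ _, h2, h1⟩
    have hB : ∀ l ∈ (Finset.univ : Finset (Fin q)), ∃ l' ∈ (Finset.univ : Finset (Fin q)),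
        l' ≠ l ∧ b l' = b l := fun l _ => by
      obtain ⟨-, l', h1, h2⟩ := hcon l
      exact ⟨l', Finset.mem_univ _, h2, h1⟩
    have h1 := two_mul_card_image_le _ a hA
    have h2 := two_mul_card_image_le _ b hB
    have htwo : ∀ {β : Type} [DecidableEq β] (f : Fin q → β),
        (∀ l ∈ (Finset.univ : Finset (Fin q)), ∃ l' ∈ (Finset.univ : Finset (Fin q)),
          l' ≠ l ∧ f l' = f l) →
        (Finset.univ : Finset (Fin q)).card ≤ 2 * (Finset.univ.image f).card → TwoPerRow f := by
      intro β _ f hf hcf l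
      have h3 := card_fiber_eq_two _ f hf hcf (b := f l) (by simp)
      obtain ⟨x, y, hxy, hset⟩ := Finset.card_eq_two.1 h3
      have hmem : ∀ z, f z = f l ↔ z = x ∨ z = y := fun z => by
        have : z ∈ Finset.univ.filter (fun s => f s = f l) ↔ z ∈ ({x, y} : Finset (Fin q)) := by
          rw [hset]
        simpa using this
      rcases (hmem l).1 rfl with rfl | rfl
      · exact ⟨y, hxy.symm, (hmem y).2 (Or.inr rfl), fun z hz => (hmem z).1 hz⟩
      · exact ⟨x, hxy, (hmem x).2 (Or.inl rfl), fun z hz => ((hmem z).1 hz).symm⟩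
    have h3 : (Finset.univ : Finset (Fin q)).card = q := by simp
    unfold numVert at hqv hge
    exact hcyc (isCycle_of_twoPerRow (htwo a hA (by omega)) (htwo b hB (by omega)) hconn)

namespace RFModel

variable {mW mX : ℕ → ℝ} {n : ℕ} (M : RFModel mW mX n)

/-- The positions split into two groups with disjoint rows and disjoint columns. These use disjoint
sets of entries of `W` and `X`, so they are independent. -/
theorem setCumulant_eq_zero_of_not_posConn {ι : Type*} [Fintype ι] [DecidableEq ι]
    {g : ι → ℕ → ℝ → ℝ} (hg : ∀ l, Adm (g l)) {r : ι → Fin M.n₁} {c : ι → Fin M.m}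
    (h : ¬ PosConn r c) : setCumulant (M.entryMom g r c) Finset.univ = 0 := by
  unfold PosConn at h
  push Not at h
  obtain ⟨F, hF, ⟨e, he⟩, hsep⟩ := h
  refine setCumulant_eq_zero_of_factor _ (M.entryMom_empty g r c) F (fun S => ?_) Finset.univ
    (by simpa using hF) ⟨e, by simpa using he⟩
  let val : ((Fin M.n₁ × Fin n) ⊕ (Fin n × Fin M.m) → ℝ) → ι → ℝ := fun x l =>
    eps n * ∑ t, x (Sum.inl (r l, t)) * x (Sum.inr (t, c l))
  let key : (Fin M.n₁ × Fin n) ⊕ (Fin n × Fin M.m) → Prop :=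
    Sum.elim (fun p => ∃ l ∈ F, r l = p.1) fun p => ∃ l ∈ F, c l = p.2
  classical
  let part : Bool → ((Fin M.n₁ × Fin n) ⊕ (Fin n × Fin M.m) → ℝ) → ι → ℝ := fun s x l =>
    if decide (l ∈ F) = s then val x l else 0
  have hpart : ∀ s, Measurable (part s) := fun s => measurable_pi_lambda _ fun l => by
    by_cases hs : decide (l ∈ F) = s
    · simp only [part, if_pos hs, val]
      exact Measurable.const_mul (Finset.measurable_fun_sum _ fun t _ =>
        (measurable_pi_apply (Sum.inl (r l, t))).mul (measurable_pi_apply (Sum.inr (t, c l)))) _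
    · simp only [part, if_neg hs]
      exact measurable_const
  have hind := iIndepFun_group M.indep M.meas (fun x => decide (key x)) part hpart
    (fun s x y hxy => by
      funext l
      by_cases hs : decide (l ∈ F) = s
      · simp only [part, if_pos hs]
        subst hs
        have h1 : ∀ t, x (Sum.inl (r l, t)) = y (Sum.inl (r l, t)) := by
          intro t
          apply hxy
          refine decide_eq_decide.2 ⟨?_, fun hl => ⟨l, hl, rfl⟩⟩
          rintro ⟨l', hl', heq⟩
          by_contra hl
          exact (hsep l' hl' l hl).1 heq
        have h2 : ∀ t, x (Sum.inr (t, c l)) = y (Sum.inr (t, c l)) := by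
          intro t
          apply hxy
          refine decide_eq_decide.2 ⟨?_, fun hl => ⟨l, hl, rfl⟩⟩
          rintro ⟨l', hl', heq⟩
          by_contra hl
          exact (hsep l' hl' l hl).2 heq
        simp only [val, h1, h2]
      · simp only [part, if_neg hs])
  have hcont : ∀ l, Measurable (g l n) := fun l => ((hg l).continuous n).measurable
  have hmeas : ∀ T : Finset ι, Measurable fun y : ι → ℝ => ∏ l ∈ T, g l n (y l) := fun T =>
    Finset.measurable_fun_prod _ fun l _ => (hcont l).comp (measurable_pi_apply l)
  have h0 : IndepFun (fun ω => part true fun x => M.V x ω) (fun ω => part false fun x => M.V x ω)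
      M.P := hind.indepFun (by simp)
  have h2 := h0.comp (hmeas (S ∩ F)) (hmeas (S \ F))
  have e1 : ∀ T ⊆ F, ∀ ω, ∏ l ∈ T, g l n (M.H (r l) (c l) ω) =
      ∏ l ∈ T, g l n (part true (fun x => M.V x ω) l) := by
    intro T hT ω
    refine Finset.prod_congr rfl fun l hl => ?_
    simp only [part, decide_eq_true (hT hl), if_true]
    rfl
  have e2 : ∀ ω, ∏ l ∈ S \ F, g l n (M.H (r l) (c l) ω) =
      ∏ l ∈ S \ F, g l n (part false (fun x => M.V x ω) l) := by
    intro ω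
    refine Finset.prod_congr rfl fun l hl => ?_
    simp only [part, decide_eq_false (Finset.mem_sdiff.1 hl).2, if_true]
    rfl
  unfold entryMom
  simp only [e1 (S ∩ F) Finset.inter_subset_right, e2]
  refine Eq.trans ?_ (IndepFun.integral_fun_mul_eq_mul_integral h2
    ((hmeas _).comp ((hpart _).comp (measurable_pi_lambda _ M.meas))).aestronglyMeasurable
    ((hmeas _).comp ((hpart _).comp (measurable_pi_lambda _ M.meas))).aestronglyMeasurable)
  refine integral_congr_ae (Filter.Eventually.of_forall fun ω => ?_)
  simp only [Function.comp]
  rw [← e1 (S ∩ F) Finset.inter_subset_right, ← e2]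
  rw [← Finset.prod_union (Finset.disjoint_left.2 fun l h1 h3 =>
    (Finset.mem_sdiff.1 h3).2 (Finset.mem_inter.1 h1).2), Finset.union_comm,
    Finset.sdiff_union_inter]

end RFModel

end CycleCorrelations

end

noncomputable section

namespace CycleCorrelations

/-! ### The cut-off activation: admissibility and Gaussian integrals. -/

/-- The cut-off activation function applied to a variable of standard deviation `σ`. -/
def scaledActivation (f χ : ℝ → ℝ) (σ : ℝ) (n : ℕ) (x : ℝ) : ℝ := cutActivation f χ n (σ * x)

theorem one_le_log {n : ℕ} (hn : 3 ≤ n) : 1 ≤ Real.log n := by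
  have h1 : (3 : ℝ) ≤ n := by exact_mod_cast hn
  rw [Real.le_log_iff_exp_le (by linarith)]
  linarith [Real.exp_one_lt_d9]

theorem IsCutoff.iteratedDeriv_eq_zero {χ : ℝ → ℝ} (hχ : IsCutoff χ) (j : ℕ) {y : ℝ}
    (hy : 2 < |y|) : iteratedDeriv j χ y = 0 := by
  have h : χ =ᶠ[nhds y] fun _ => (0 : ℝ) := by
    filter_upwards [(isOpen_lt continuous_const continuous_abs).mem_nhds hy] with z hz
    exact hχ.eq_zero z (le_of_lt hz)
  rw [h.iteratedDeriv_eq]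
  simp [iteratedDeriv_const]

theorem IsCutoff.exists_bound {χ : ℝ → ℝ} (hχ : IsCutoff χ) (j : ℕ) :
    ∃ B : ℝ, 0 ≤ B ∧ ∀ y, |iteratedDeriv j χ y| ≤ B := by
  have hc : Continuous (iteratedDeriv j χ) := hχ.smooth.continuous_iteratedDeriv j (by exact_mod_cast le_top)
  obtain ⟨B, hB⟩ := isCompact_Icc.exists_bound_of_continuousOn (s := Set.Icc (-2 : ℝ) 2)
    hc.continuousOn
  refine ⟨max B 0, le_max_right _ _, fun y => ?_⟩
  by_cases hy : 2 < |y|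
  · rw [hχ.iteratedDeriv_eq_zero j hy, abs_zero]
    exact le_max_right _ _
  · exact (hB y (abs_le.1 (not_lt.1 hy))).trans (le_max_left _ _)

theorem HasExpGrowth.exists_bound {f : ℝ → ℝ} (hf : HasExpGrowth f) (j : ℕ) :
    ∃ C : ℝ, 0 ≤ C ∧ ∀ x, |iteratedDeriv j f x| ≤ C * Real.exp (C * |x|) := by
  obtain ⟨C, hC⟩ := hf j
  refine ⟨C, ?_, hC⟩
  by_contra h
  have := (abs_nonneg _).trans (hC 0)
  nlinarith [Real.exp_pos (C * |0|)]

section Scaled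

variable {f χ : ℝ → ℝ} {σ : ℝ}

theorem contDiff_scaledActivation (hf : ContDiff ℝ (⊤ : ℕ∞) f) (hχ : IsCutoff χ) (n : ℕ) :
    ContDiff ℝ (⊤ : ℕ∞) (scaledActivation f χ σ n) := by
  have h1 : ContDiff ℝ (⊤ : ℕ∞) fun x : ℝ => f (σ * x) := hf.comp (contDiff_const.mul contDiff_id)
  have h2 : ContDiff ℝ (⊤ : ℕ∞) fun x : ℝ => χ ((Real.log n)⁻¹ * (σ * x)) :=
    hχ.smooth.comp (contDiff_const.mul (contDiff_const.mul contDiff_id))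
  exact h1.mul h2

/-- In Leibniz' rule the derivatives of the cut-off only bring powers of `(log n)⁻¹ ≤ 1`, so the
bounds are uniform in `n`. -/
theorem exists_iteratedDeriv_scaledActivation_le (hf : ContDiff ℝ (⊤ : ℕ∞) f)
    (hgrowth : HasExpGrowth f) (hχ : IsCutoff χ) (hσ : 0 < σ) (j : ℕ) :
    ∃ C : ℝ, 0 ≤ C ∧ ∀ n, 3 ≤ n → ∀ x,
      |iteratedDeriv j (scaledActivation f χ σ n) x| ≤ C * Real.exp (C * |x|) ∧
      (2 * Real.log n < σ * |x| → iteratedDeriv j (scaledActivation f χ σ n) x = 0) := by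
  choose Cf hCf hbf using fun j => hgrowth.exists_bound j
  choose B hB hbχ using fun j => hχ.exists_bound j
  set A : ℝ := ∑ i ∈ Finset.range (j + 1), (j.choose i) * (σ ^ i * Cf i) * (σ ^ (j - i) * B (j - i))
    with hA
  set c : ℝ := ∑ i ∈ Finset.range (j + 1), Cf i * σ with hc
  have hA0 : 0 ≤ A := Finset.sum_nonneg fun i _ => by
    have := hCf i; have := hB (j - i); positivity
  have hc0 : 0 ≤ c := Finset.sum_nonneg fun i _ => by have := hCf i; positivity
  refine ⟨max A c, hA0.trans (le_max_left _ _), fun n hn x => ?_⟩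
  have hlog := one_le_log hn
  have hf' : ∀ i, iteratedDeriv i (fun x => f (σ * x)) x = σ ^ i * iteratedDeriv i f (σ * x) :=
    fun i => by
      rw [iteratedDeriv_comp_const_mul (hf.of_le (by exact_mod_cast le_top))]
  have hχ' : ∀ i, iteratedDeriv i (fun x => χ ((Real.log n)⁻¹ * (σ * x))) x =
      ((Real.log n)⁻¹ * σ) ^ i * iteratedDeriv i χ ((Real.log n)⁻¹ * σ * x) := fun i => by
    have h1 : (fun x => χ ((Real.log n)⁻¹ * (σ * x))) = fun x => χ ((Real.log n)⁻¹ * σ * x) := by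
      funext x; rw [mul_assoc]
    rw [h1, iteratedDeriv_comp_const_mul (hχ.smooth.of_le (by exact_mod_cast le_top))]
  have hprod : iteratedDeriv j (scaledActivation f χ σ n) x =
      ∑ i ∈ Finset.range (j + 1), (j.choose i) * (σ ^ i * iteratedDeriv i f (σ * x)) *
        (((Real.log n)⁻¹ * σ) ^ (j - i) *
          iteratedDeriv (j - i) χ ((Real.log n)⁻¹ * σ * x)) := by
    have h1 : ContDiff ℝ (⊤ : ℕ∞) fun x : ℝ => f (σ * x) :=
      hf.comp (contDiff_const.mul contDiff_id)
    have h2 : ContDiff ℝ (⊤ : ℕ∞) fun x : ℝ => χ ((Real.log n)⁻¹ * (σ * x)) :=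
      hχ.smooth.comp (contDiff_const.mul (contDiff_const.mul contDiff_id))
    have h3 := iteratedDeriv_fun_mul (n := j) (x := x)
      (h1.contDiffAt.of_le (by exact_mod_cast le_top))
      (h2.contDiffAt.of_le (by exact_mod_cast le_top))
    simp only [hf', hχ'] at h3
    exact h3
  have hinv : (Real.log n)⁻¹ ≤ 1 := inv_le_one_of_one_le₀ hlog
  have hinv0 : 0 < (Real.log n)⁻¹ := by positivity
  rw [hprod]
  constructor
  · calc _ ≤ ∑ i ∈ Finset.range (j + 1), (j.choose i) * (σ ^ i * Cf i) * (σ ^ (j - i) * B (j - i)) *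
          Real.exp (c * |x|) := by
          refine (Finset.abs_sum_le_sum_abs _ _).trans (Finset.sum_le_sum fun i hi => ?_)
          have e1 : Real.exp (Cf i * |σ * x|) ≤ Real.exp (c * |x|) := by
            rw [Real.exp_le_exp, abs_mul, abs_of_pos hσ, ← mul_assoc]
            refine mul_le_mul_of_nonneg_right ?_ (abs_nonneg x)
            exact Finset.single_le_sum (f := fun i => Cf i * σ)
              (fun i _ => mul_nonneg (hCf i) hσ.le) hi
          have e2 : ((Real.log n)⁻¹ * σ) ^ (j - i) ≤ σ ^ (j - i) :=
            pow_le_pow_left₀ (by positivity) (by nlinarith) _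
          rw [abs_mul, abs_mul, abs_mul, abs_mul, Nat.abs_cast, abs_of_nonneg (pow_nonneg hσ.le i),
            abs_of_nonneg (pow_nonneg (mul_nonneg hinv0.le hσ.le) (j - i))]
          calc (j.choose i : ℝ) * (σ ^ i * |iteratedDeriv i f (σ * x)|) *
                (((Real.log n)⁻¹ * σ) ^ (j - i) *
                  |iteratedDeriv (j - i) χ ((Real.log n)⁻¹ * σ * x)|)
              ≤ (j.choose i : ℝ) * (σ ^ i * (Cf i * Real.exp (c * |x|))) *
                (σ ^ (j - i) * B (j - i)) := by
                have h1 := (hbf i (σ * x)).trans (mul_le_mul_of_nonneg_left e1 (hCf i))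
                have h2 := hbχ (j - i) ((Real.log n)⁻¹ * σ * x)
                have h3 := hCf i
                have h4 := hB (j - i)
                gcongr
            _ = _ := by ring
      _ = A * Real.exp (c * |x|) := by rw [← Finset.sum_mul]
      _ ≤ _ := by
          have h1 := le_max_left A c
          have h2 := le_max_right A c
          have h3 := abs_nonneg x
          gcongr
  · intro hx
    refine Finset.sum_eq_zero fun i _ => ?_
    rw [hχ.iteratedDeriv_eq_zero, mul_zero, mul_zero]
    rw [abs_mul, abs_mul, abs_of_pos hσ, abs_of_pos hinv0, mul_assoc, inv_mul_eq_div,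
      lt_div_iff₀ (by linarith)]
    exact hx

/-- The cut-off confines the derivatives to `|x| ≤ (2 / σ) log n`, where `exp_abs_le_wt` turns
exponential growth into a power of the weight. -/
theorem adm_scaledActivation (hf : ContDiff ℝ (⊤ : ℕ∞) f) (hgrowth : HasExpGrowth f)
    (hχ : IsCutoff χ) (hσ : 0 < σ) : Adm (scaledActivation f χ σ) := by
  refine ⟨contDiff_scaledActivation hf hχ, fun j => ?_⟩
  obtain ⟨C, hC, hb⟩ := exists_iteratedDeriv_scaledActivation_le hf hgrowth hχ hσ j
  set L : ℕ := ⌈2 / σ⌉₊ + 1 with hL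
  set k : ℕ := ⌈C⌉₊ with hk
  refine dom_of_le (C * 2 ^ (L * k)) (L * k) fun n hn x => ?_
  have hw := one_le_wt hn x
  have hlog := one_le_log hn
  by_cases hx : 2 * Real.log n < σ * |x|
  · rw [(hb n hn x).2 hx, abs_zero]
    positivity
  · refine (hb n hn x).1.trans ?_
    rw [mul_assoc, ← mul_pow]
    refine mul_le_mul_of_nonneg_left ?_ hC
    have h1 : |x| ≤ L * Real.log n := by
      have h2 : |x| ≤ 2 / σ * Real.log n := by
        rw [div_mul_eq_mul_div, le_div_iff₀ hσ]
        linarith [not_lt.1 hx]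
      refine h2.trans (mul_le_mul_of_nonneg_right ?_ (by linarith))
      rw [hL]
      push_cast
      linarith [Nat.le_ceil (2 / σ)]
    have h3 := exp_abs_le_wt hn (by omega : 1 ≤ L) h1
    calc Real.exp (C * |x|) ≤ Real.exp (k * |x|) := by
          rw [Real.exp_le_exp]
          exact mul_le_mul_of_nonneg_right (Nat.le_ceil C) (abs_nonneg x)
      _ = Real.exp |x| ^ k := by rw [Real.exp_nat_mul]
      _ ≤ ((2 * wt n x) ^ L) ^ k := pow_le_pow_left₀ (Real.exp_pos _).le h3 k
      _ = _ := by rw [pow_mul]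

/-- Functions of exponential growth agreeing up to logarithmic distance have close Gaussian
integrals. -/
theorem exists_abs_integral_sub_le {u : ℕ → ℝ → ℝ} {v : ℝ → ℝ}
    (hu : ∀ n, Continuous (u n)) (hv : Continuous v) (C : ℝ)
    (hub : ∀ n, 3 ≤ n → ∀ x, |u n x| ≤ C * Real.exp (C * |x|))
    (hvb : ∀ x, |v x| ≤ C * Real.exp (C * |x|))
    (huv : ∀ n : ℕ, 3 ≤ n → ∀ x, σ * |x| < Real.log n → u n x = v x) :
    ∃ D : ℝ, 0 ≤ D ∧ ∀ n, 3 ≤ n →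
      |∫ x, u n x ∂gaussianReal 0 1 - ∫ x, v x ∂gaussianReal 0 1| ≤ D * eps n := by
  have hC : 0 ≤ C := by
    by_contra h
    have := (abs_nonneg _).trans (hvb 0)
    nlinarith [Real.exp_pos (C * |0|)]
  have hint := integrable_exp_abs_gaussian (C + σ)
  have hI : 0 ≤ ∫ x, Real.exp ((C + σ) * |x|) ∂gaussianReal 0 1 :=
    integral_nonneg fun x => (Real.exp_pos _).le
  refine ⟨2 * C * ∫ x, Real.exp ((C + σ) * |x|) ∂gaussianReal 0 1, by positivity, fun n hn => ?_⟩
  have hn0 : (0 : ℝ) < n := by exact_mod_cast (by omega : 0 < n)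
  have hint' := (integrable_exp_abs_gaussian C).const_mul C
  have hui : Integrable (u n) (gaussianReal 0 1) := hint'.mono' (hu n).aestronglyMeasurable
    (Filter.Eventually.of_forall fun x => hub n hn x)
  have hvi : Integrable v (gaussianReal 0 1) := hint'.mono' hv.aestronglyMeasurable
    (Filter.Eventually.of_forall hvb)
  rw [← integral_sub hui hvi]
  -- Where the functions differ, `n ≤ exp (σ |x|)`; this extra exponential is integrable and pays
  -- for a factor `1 / n`.
  have hpt : ∀ x, |u n x - v x| ≤ 2 * C * (n : ℝ)⁻¹ * Real.exp ((C + σ) * |x|) := by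
    intro x
    by_cases hx : σ * |x| < Real.log n
    · rw [huv n hn x hx, sub_self, abs_zero]
      positivity
    · have h1 : (n : ℝ) ≤ Real.exp (σ * |x|) := by
        rw [← Real.log_le_iff_le_exp hn0]
        exact not_lt.1 hx
      have h2 : 1 ≤ (n : ℝ)⁻¹ * Real.exp (σ * |x|) := by
        rw [inv_mul_eq_div, le_div_iff₀ hn0]
        linarith
      have h3 : |u n x - v x| ≤ 2 * C * Real.exp (C * |x|) :=
        (abs_sub _ _).trans (by linarith [hub n hn x, hvb x])
      rw [add_mul, Real.exp_add]
      calc |u n x - v x| ≤ 2 * C * Real.exp (C * |x|) * 1 := by linarith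
        _ ≤ 2 * C * Real.exp (C * |x|) * ((n : ℝ)⁻¹ * Real.exp (σ * |x|)) :=
            mul_le_mul_of_nonneg_left h2 (by positivity)
        _ = _ := by ring
  have h4 : |∫ x, (u n x - v x) ∂gaussianReal 0 1| ≤
      ∫ x, 2 * C * (n : ℝ)⁻¹ * Real.exp ((C + σ) * |x|) ∂gaussianReal 0 1 := by
    refine (abs_integral_le_integral_abs).trans (integral_mono (hui.sub hvi).abs
      (hint.const_mul _) hpt)
  rw [integral_const_mul] at h4
  have h5 : (n : ℝ)⁻¹ ≤ eps n := by
    rw [← eps_sq, sq]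
    exact mul_le_of_le_one_left (eps_nonneg n) (eps_le_one hn)
  calc _ ≤ _ := h4
    _ ≤ 2 * C * eps n * ∫ x, Real.exp ((C + σ) * |x|) ∂gaussianReal 0 1 := by gcongr
    _ = _ := by ring

theorem scaledActivation_eq (hχ : IsCutoff χ) (hσ : 0 < σ) {n : ℕ} (hn : 3 ≤ n) {x : ℝ}
    (hx : σ * |x| < Real.log n) : scaledActivation f χ σ n x = f (σ * x) := by
  have hlog := one_le_log hn
  unfold scaledActivation cutActivation
  rw [hχ.eq_one, mul_one]
  rw [abs_mul, abs_mul, abs_of_pos hσ, abs_of_nonneg (by positivity), inv_mul_eq_div,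
    div_le_one (by linarith)]
  exact hx.le

theorem exists_bounds_scaled (hf : ContDiff ℝ (⊤ : ℕ∞) f) (hgrowth : HasExpGrowth f)
    (hχ : IsCutoff χ) (hσ : 0 < σ) (j : ℕ) : ∃ C : ℝ, 0 ≤ C ∧
      (∀ n, 3 ≤ n → ∀ x, |iteratedDeriv j (scaledActivation f χ σ n) x| ≤
        C * Real.exp (C * |x|)) ∧
      ∀ x, |iteratedDeriv j (fun x => f (σ * x)) x| ≤ C * Real.exp (C * |x|) := by
  obtain ⟨C₁, hC₁, h1⟩ := exists_iteratedDeriv_scaledActivation_le hf hgrowth hχ hσ j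
  obtain ⟨C₂, hC₂, h2⟩ := hgrowth.exists_bound j
  have hmono : ∀ {a b : ℝ}, 0 ≤ a → a ≤ b → ∀ x : ℝ,
      a * Real.exp (a * |x|) ≤ b * Real.exp (b * |x|) := fun ha hab x => by
    have := abs_nonneg x
    have hb := ha.trans hab
    gcongr
  refine ⟨C₁ + σ ^ j * C₂ + C₂ * σ, by positivity, fun n hn x => (h1 n hn x).1.trans
    (hmono hC₁ (by nlinarith [mul_nonneg hC₂ hσ.le, mul_nonneg (pow_nonneg hσ.le j) hC₂]) x),
    fun x => ?_⟩
  rw [iteratedDeriv_comp_const_mul (hf.of_le (by exact_mod_cast le_top)), abs_mul,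
    abs_of_nonneg (pow_nonneg hσ.le j)]
  refine (mul_le_mul_of_nonneg_left (h2 (σ * x)) (pow_nonneg hσ.le j)).trans ?_
  rw [abs_mul, abs_of_pos hσ, ← mul_assoc, ← mul_assoc]
  have h3 := abs_nonneg x
  have h4 : 0 ≤ σ ^ j * C₂ := by positivity
  have h5 : 0 ≤ C₂ * σ := by positivity
  gcongr <;> linarith

theorem exists_abs_integral_scaled_sub_le (hf : ContDiff ℝ (⊤ : ℕ∞) f) (hgrowth : HasExpGrowth f)
    (hχ : IsCutoff χ) (hσ : 0 < σ) : ∃ D : ℝ, 0 ≤ D ∧ ∀ n, 3 ≤ n →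
      |∫ x, scaledActivation f χ σ n x ∂gaussianReal 0 1 -
        ∫ x, f (σ * x) ∂gaussianReal 0 1| ≤ D * eps n := by
  obtain ⟨C, hC, h1, h2⟩ := exists_bounds_scaled hf hgrowth hχ hσ 0
  simp only [iteratedDeriv_zero] at h1 h2
  exact exists_abs_integral_sub_le (σ := σ) (fun n => (contDiff_scaledActivation hf hχ n).continuous)
    (hf.continuous.comp (continuous_const.mul continuous_id)) C h1 h2
    fun n hn x hx => scaledActivation_eq hχ hσ hn hx

theorem exists_abs_integral_scaled_sq_sub_le (hf : ContDiff ℝ (⊤ : ℕ∞) f)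
    (hgrowth : HasExpGrowth f) (hχ : IsCutoff χ) (hσ : 0 < σ) : ∃ D : ℝ, 0 ≤ D ∧ ∀ n, 3 ≤ n →
      |∫ x, scaledActivation f χ σ n x ^ 2 ∂gaussianReal 0 1 -
        ∫ x, f (σ * x) ^ 2 ∂gaussianReal 0 1| ≤ D * eps n := by
  obtain ⟨C, hC, h1, h2⟩ := exists_bounds_scaled hf hgrowth hχ hσ 0
  simp only [iteratedDeriv_zero] at h1 h2
  have hsq : ∀ y x : ℝ, |y| ≤ C * Real.exp (C * |x|) →
      |y ^ 2| ≤ (C ^ 2 + 2 * C) * Real.exp ((C ^ 2 + 2 * C) * |x|) := by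
    intro y x h
    rw [abs_pow]
    calc |y| ^ 2 ≤ (C * Real.exp (C * |x|)) ^ 2 := pow_le_pow_left₀ (abs_nonneg _) h 2
      _ = C ^ 2 * Real.exp (2 * C * |x|) := by
          rw [mul_pow, ← Real.exp_nat_mul]
          congr 2
          push_cast
          ring
      _ ≤ _ := by
          have h3 := abs_nonneg x
          gcongr <;> nlinarith
  exact exists_abs_integral_sub_le (σ := σ)
    (fun n => (contDiff_scaledActivation hf hχ n).continuous.pow 2)
    ((hf.continuous.comp (continuous_const.mul continuous_id)).pow 2) _
    (fun n hn x => hsq _ x (h1 n hn x)) (fun x => hsq _ x (h2 x))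
    fun n hn x hx => by rw [scaledActivation_eq hχ hσ hn hx]

theorem exists_abs_integral_deriv_scaled_sub_le (hf : ContDiff ℝ (⊤ : ℕ∞) f)
    (hgrowth : HasExpGrowth f) (hχ : IsCutoff χ) (hσ : 0 < σ) : ∃ D : ℝ, 0 ≤ D ∧ ∀ n, 3 ≤ n →
      |∫ x, deriv (scaledActivation f χ σ n) x ∂gaussianReal 0 1 -
        σ * ∫ x, deriv f (σ * x) ∂gaussianReal 0 1| ≤ D * eps n := by
  obtain ⟨C, hC, h1, h2⟩ := exists_bounds_scaled hf hgrowth hχ hσ 1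
  simp only [iteratedDeriv_one] at h1 h2
  have hd : deriv (fun x => f (σ * x)) = fun x => σ * deriv f (σ * x) := by
    funext x
    rw [deriv_comp_mul_left, smul_eq_mul]
  rw [← integral_const_mul]
  simp only [hd] at h2
  refine exists_abs_integral_sub_le (σ := σ)
    (fun n => (contDiff_scaledActivation hf hχ n).continuous_deriv (by exact_mod_cast le_top))
    (continuous_const.mul ((hf.continuous_deriv (by exact_mod_cast le_top)).comp
      (continuous_const.mul continuous_id))) C h1 h2 fun n hn x hx => ?_
  have h3 : scaledActivation f χ σ n =ᶠ[nhds x] fun x => f (σ * x) := by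
    have hopen : IsOpen {x : ℝ | σ * |x| < Real.log n} :=
      isOpen_lt (continuous_const.mul continuous_abs) continuous_const
    filter_upwards [hopen.mem_nhds hx] with y hy
    exact scaledActivation_eq hχ hσ hn hy
  rw [h3.deriv_eq, hd]

end Scaled

end CycleCorrelations

end

noncomputable section

namespace CycleCorrelations

/-! ### Mean, variance, cycles and non-cycles for the model. -/

section SmallCumulants

variable {ι : Type*} [DecidableEq ι]

theorem setCumulant_singleton (M : Finset ι → ℝ) (hM : M ∅ = 1) (i : ι) :
    setCumulant M {i} = M {i} := by
  have h := moment_insert_eq M hM (Finset.notMem_empty i)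
  simpa [hM] using h.symm

theorem setCumulant_pair (M : Finset ι → ℝ) (hM : M ∅ = 1) {i j : ι} (hij : i ≠ j) :
    setCumulant M {i, j} = M {i, j} - M {i} * M {j} := by
  have h := moment_insert_eq M hM (i := i) (A := {j}) (by simpa using hij)
  have h1 : ({j} : Finset ι).powerset = {∅, {j}} := by
    ext s
    simp [Finset.subset_singleton_iff]
  rw [h1, Finset.sum_pair (Finset.singleton_ne_empty j).symm] at h
  simp only [Finset.sdiff_empty, Finset.sdiff_self, hM, insert_empty_eq,
    setCumulant_singleton M hM] at h
  linarith

end SmallCumulants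

section CyclePositions

variable {k : ℕ} {R K : Type*} {r : Fin k → R} {c : Fin k → K}

theorem finRotate_ne_self (hk : 1 < k) (l : Fin k) : finRotate k l ≠ l := by
  obtain ⟨k, rfl⟩ : ∃ k', k = k' + 2 := ⟨k - 2, by omega⟩
  rw [finRotate_apply]
  simp

/-- For `k = 1` the two entries coincide; for `k > 1` the rotation has no fixed point, so the two
entries of a column lie in different rows. -/
theorem cycle_injective (hk : 1 < k) (hr : Function.Injective r) (hc : Function.Injective c) :
    Function.Injective fun e : Fin k ⊕ Fin k =>
      (Sum.elim r (fun l => r (finRotate k l)) e, Sum.elim c c e) := by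
  rintro (l | l) (l' | l') h
  · rw [hc (congrArg Prod.snd h)]
  · have h1 : l = l' := hc (congrArg Prod.snd h)
    subst h1
    exact absurd (hr (congrArg Prod.fst h)).symm (finRotate_ne_self hk l)
  · have h1 : l = l' := hc (congrArg Prod.snd h)
    subst h1
    exact absurd (hr (congrArg Prod.fst h)) (finRotate_ne_self hk l)
  · rw [hc (congrArg Prod.snd h)]

theorem cycle_twoPerRow (hr : Function.Injective r) :
    TwoPerRow (Sum.elim r fun l => r (finRotate k l)) := by
  rintro (l | l)
  · refine ⟨Sum.inr ((finRotate k).symm l), by simp,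
      congrArg r ((finRotate k).apply_symm_apply l), ?_⟩
    rintro (l' | l') h
    · exact Or.inl (congrArg _ (hr h))
    · refine Or.inr (congrArg _ ?_)
      rw [Equiv.eq_symm_apply]
      exact hr h
  · refine ⟨Sum.inl (finRotate k l), by simp, by simp, ?_⟩
    rintro (l' | l') h
    · exact Or.inr (congrArg _ (hr h))
    · exact Or.inl (congrArg _ ((finRotate k).injective (hr h)))

theorem cycle_twoPerCol (hc : Function.Injective c) : TwoPerRow (Sum.elim c c) := by
  rintro (l | l)
  · refine ⟨Sum.inr l, by simp, by simp, ?_⟩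
    rintro (l' | l') h
    · exact Or.inl (congrArg _ (hc h))
    · exact Or.inr (congrArg _ (hc h))
  · refine ⟨Sum.inl l, by simp, by simp, ?_⟩
    rintro (l' | l') h
    · exact Or.inr (congrArg _ (hc h))
    · exact Or.inl (congrArg _ (hc h))

open Fin.NatCast in
theorem mem_of_finRotate_closed {S : Set (Fin k)} (hS : ∀ l ∈ S, finRotate k l ∈ S) {l : Fin k}
    (hl : l ∈ S) (l' : Fin k) : l' ∈ S := by
  obtain ⟨k, rfl⟩ : ∃ k', k = k' + 1 := ⟨k - 1, by have := l.2; omega⟩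
  have key : ∀ j : ℕ, l + (j : Fin (k + 1)) ∈ S := by
    intro j
    induction j with
    | zero => simpa using hl
    | succ j ih =>
      have := hS _ ih
      rw [finRotate_apply] at this
      simpa [add_assoc] using this
  have := key (l' - l : Fin (k + 1)).val
  rwa [Fin.cast_val_eq_self, add_sub_cancel] at this

theorem cycle_posConn : PosConn (Sum.elim r fun l => r (finRotate k l)) (Sum.elim c c) := by
  intro F hF hF'
  by_contra! hcon
  obtain ⟨e', he'⟩ := hF'
  have hlr : ∀ l, Sum.inl l ∈ F → Sum.inr l ∈ F := fun l hl => by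
    by_contra h
    exact (hcon _ hl _ h).2 (by simp)
  have hrl : ∀ l, Sum.inr l ∈ F → Sum.inl l ∈ F := fun l hl => by
    by_contra h
    exact (hcon _ hl _ h).2 (by simp)
  have hrot : ∀ l, Sum.inl l ∈ F → Sum.inl (finRotate k l) ∈ F := fun l hl => by
    by_contra h
    exact (hcon _ (hlr l hl) _ h).1 (by simp)
  obtain ⟨l, hl⟩ : ∃ l, Sum.inl l ∈ F := by
    obtain ⟨l | l, hl⟩ := hF
    · exact ⟨l, hl⟩
    · exact ⟨l, hrl l hl⟩
  have hall : ∀ l', Sum.inl l' ∈ F :=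
    mem_of_finRotate_closed (S := {l | Sum.inl l ∈ F}) hrot hl
  rcases e' with l' | l'
  · exact he' (hall l')
  · exact he' (hlr l' (hall l'))

end CyclePositions

theorem exists_abs_pow_sub_pow_le (d : ℝ) (D : ℝ) (hD : 0 ≤ D) (p : ℕ) : ∃ C : ℝ, 0 ≤ C ∧
    ∀ (x ε : ℝ), 0 ≤ ε → ε ≤ 1 → |x - d| ≤ D * ε → |x ^ p - d ^ p| ≤ C * ε := by
  induction p with
  | zero => exact ⟨0, le_rfl, fun x ε _ _ _ => by simp⟩
  | succ p ih =>
    obtain ⟨C, hC, hb⟩ := ih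
    refine ⟨C * (|d| + D) + |d| ^ p * D, by positivity, fun x ε hε hε' h => ?_⟩
    have hx : |x| ≤ |d| + D := by
      have h1 := abs_sub_abs_le_abs_sub x d
      nlinarith
    calc |x ^ (p + 1) - d ^ (p + 1)| = |(x ^ p - d ^ p) * x + d ^ p * (x - d)| := by ring_nf
      _ ≤ |x ^ p - d ^ p| * |x| + |d| ^ p * |x - d| := by
        refine (abs_add_le _ _).trans_eq ?_
        rw [abs_mul, abs_mul, abs_pow]
      _ ≤ (C * ε) * (|d| + D) + |d| ^ p * (D * ε) := by
        have h1 := hb x ε hε hε' h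
        gcongr
      _ = _ := by ring

namespace RFModel

variable (mW mX : ℕ → ℝ)

theorem exists_abs_integral_sub_le {h : ℕ → ℝ → ℝ} (hh : Adm h) :
    ∃ C : ℝ, 0 ≤ C ∧ ∀ n, 3 ≤ n → ∀ (M : RFModel mW mX n) i j,
      |∫ ω, h n (M.H i j ω) ∂M.P - ∫ x, h n x ∂gaussianReal 0 1| ≤ C * eps n := by
  obtain ⟨B, hB, hb⟩ := hh.dom_self.abs_integral_gaussian_le
  have hc : Adm fun n _ => ∫ x, h n x ∂gaussianReal 0 1 := Adm.const hb
  obtain ⟨C, hC, hC'⟩ := exists_abs_entryMom_sub_le mW mX (E := Unit) (q := 2) le_rfl 1 le_rfl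
    (g := fun _ => h) (g' := fun _ n _ => ∫ x, h n x ∂gaussianReal 0 1) (fun _ => hh)
    (fun _ => hc) (fun _ => ⟨hh.sub hc, fun n hn d hd => by
      obtain rfl : d = 0 := by omega
      simp only [iteratedDeriv_zero]
      rw [integral_sub (hh.dom_self.integrable_gaussian hn (hh.continuous n))
        (integrable_const _)]
      simp⟩)
  refine ⟨C, hC, fun n hn M i j => ?_⟩
  have := hC' n hn M (fun _ => i) (fun _ => j) (fun _ _ _ => rfl) Finset.univ
  simpa [entryMom] using this

theorem exists_abs_variance_sub_le {h : ℕ → ℝ → ℝ} (hh : Adm h) {t₁ t₂ D₁ D₂ : ℝ}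
    (ht₁ : ∀ n, 3 ≤ n → |∫ x, h n x ∂gaussianReal 0 1 - t₁| ≤ D₁ * eps n)
    (ht₂ : ∀ n, 3 ≤ n → |∫ x, h n x ^ 2 ∂gaussianReal 0 1 - t₂| ≤ D₂ * eps n) :
    ∃ C : ℝ, 0 ≤ C ∧ ∀ n, 3 ≤ n → ∀ (M : RFModel mW mX n) i j,
      |∫ ω, h n (M.H i j ω) ^ 2 ∂M.P - (∫ ω, h n (M.H i j ω) ∂M.P) ^ 2 - (t₂ - t₁ ^ 2)| ≤
        C * eps n := by
  obtain ⟨C₁, hC₁, h1⟩ := exists_abs_integral_sub_le mW mX hh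
  obtain ⟨C₂, hC₂, h2⟩ := exists_abs_integral_sub_le mW mX (hh.pow 2)
  obtain ⟨C₃, hC₃, h3⟩ := exists_abs_pow_sub_pow_le t₁ (C₁ + |D₁|) (by positivity) 2
  refine ⟨C₂ + |D₂| + C₃, by positivity, fun n hn M i j => ?_⟩
  have he := eps_nonneg n
  have e1 := h2 n hn M i j
  have e2 := ht₂ n hn
  have e3 := h3 (∫ ω, h n (M.H i j ω) ∂M.P) (eps n) he (eps_le_one hn) (by
    have a1 := h1 n hn M i j
    have a2 := ht₁ n hn
    have a3 := abs_sub_le (∫ ω, h n (M.H i j ω) ∂M.P) (∫ x, h n x ∂gaussianReal 0 1) t₁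
    have a4 := mul_le_mul_of_nonneg_right (le_abs_self D₁) he
    linarith)
  have e4 := mul_le_mul_of_nonneg_right (le_abs_self D₂) he
  rw [abs_le] at *
  constructor <;> linarith [e1.1, e1.2, e2.1, e2.2, e3.1, e3.2]

/-- The general cycle formula with `2 k` equal functions; the prefactor is `n ε ^ (2 k) = ε ^ (2 k -
2)`, that is `n ^ (1 - k)`. -/
theorem exists_abs_setCumulant_cycleEntries_sub_le {h : ℕ → ℝ → ℝ} (hh : Adm h) {t D : ℝ}
    (hD : 0 ≤ D) (ht : ∀ n, 3 ≤ n → |∫ x, deriv (h n) x ∂gaussianReal 0 1 - t| ≤ D * eps n)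
    {k : ℕ} (hk : 1 < k) :
    ∃ C : ℝ, 0 ≤ C ∧ ∀ n, 3 ≤ n → ∀ (M : RFModel mW mX n) (r : Fin k → Fin M.n₁)
      (c : Fin k → Fin M.m), Function.Injective r → Function.Injective c →
      |setCumulant (M.entryMom (fun _ => h) (Sum.elim r fun l => r (finRotate k l))
        (Sum.elim c c)) Finset.univ - t ^ (2 * k) * eps n ^ (2 * k - 2)| ≤
          C * eps n ^ (2 * k - 1) := by
  have hne : Nonempty (Fin k ⊕ Fin k) := ⟨Sum.inl ⟨0, by omega⟩⟩
  obtain ⟨C₁, hC₁, h1⟩ := exists_abs_setCumulant_cycle_sub_le mW mX (E := Fin k ⊕ Fin k)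
    (g := fun _ => h) fun _ => hh
  obtain ⟨C₂, hC₂, h2⟩ := exists_abs_pow_sub_pow_le t D hD (2 * k)
  refine ⟨C₁ + C₂, by positivity, fun n hn M r c hr hc => ?_⟩
  have he := eps_nonneg n
  have e1 := h1 n hn M _ _ (cycle_injective hk hr hc) (cycle_twoPerRow hr) (cycle_twoPerCol hc)
    cycle_posConn
  have e2 := h2 _ (eps n) he (eps_le_one hn) (ht n hn)
  have hcard : Fintype.card (Fin k ⊕ Fin k) = 2 * k := by simp [two_mul]
  rw [hcard, Finset.prod_const, Finset.card_univ, hcard] at e1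
  have e3 : (n : ℝ) * eps n ^ (2 * k) = eps n ^ (2 * k - 2) := by
    have : 2 * k = (2 * k - 2) + 2 := by omega
    rw [this, pow_add, mul_left_comm, mul_eps_sq hn, mul_one]
    rfl
  have e4 : eps n ^ (2 * k - 1) = eps n ^ (2 * k - 2) * eps n := by
    rw [← pow_succ]
    congr 1
    omega
  rw [e3] at e1
  have e5 := mul_le_mul_of_nonneg_left e2 (pow_nonneg he (2 * k - 2))
  rw [← abs_of_nonneg (pow_nonneg he (2 * k - 2)), ← abs_mul,
    abs_of_nonneg (pow_nonneg he (2 * k - 2))] at e5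
  rw [e4] at e1 ⊢
  rw [abs_le] at *
  constructor <;> nlinarith [e1.1, e1.2, e5.1, e5.2]

/-- Disconnected families contribute zero. Otherwise the exponent `v - 2` is always available, and
`forest_or_leaf` provides `v - 1` when `2 ≤ q ≤ v`. -/
theorem exists_abs_setCumulant_not_cycle_le {h : ℕ → ℝ → ℝ} (hh : Adm h) {D : ℝ}
    (ht : ∀ n, 3 ≤ n → |∫ x, h n x ∂gaussianReal 0 1| ≤ D * eps n) {q : ℕ} (hq : 1 ≤ q) :
    ∃ C : ℝ, 0 ≤ C ∧ ∀ n, 3 ≤ n → ∀ (M : RFModel mW mX n) (a : Fin q → Fin M.n₁)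
      (b : Fin q → Fin M.m), ¬ IsCycle a b → ∀ k,
      (k + 2 ≤ numVert a b Finset.univ ∨
        q ≤ numVert a b Finset.univ ∧ k + 1 ≤ numVert a b Finset.univ) →
      |setCumulant (M.entryMom (fun _ => h) a b) Finset.univ| ≤ C * eps n ^ k := by
  have hne : Nonempty (Fin q) := ⟨⟨0, hq⟩⟩
  obtain ⟨C₁, hC₁, h1⟩ := exists_abs_setCumulant_decay mW mX (Finset.univ : Finset (Fin q))
    Finset.univ_nonempty (g := fun _ => h) fun _ => hh
  obtain ⟨C₂, hC₂, h2⟩ := exists_abs_setCumulant_le mW mX (E := Fin q)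
    (g := fun _ => h) (fun _ => hh) (2 * q)
  obtain ⟨C₃, hC₃, h3⟩ := exists_abs_integral_sub_le mW mX hh
  refine ⟨C₁ + C₂ + (C₃ + |D|), by positivity, fun n hn M a b hcyc k hk => ?_⟩
  have he := pow_nonneg (eps_nonneg n) k
  by_cases hconn : PosConn a b
  swap
  · rw [M.setCumulant_eq_zero_of_not_posConn (fun _ => hh) hconn, abs_zero]
    positivity
  have hdec : DecayExp a b Finset.univ k →
      |setCumulant (M.entryMom (fun _ => h) a b) Finset.univ| ≤
        (C₁ + C₂ + (C₃ + |D|)) * eps n ^ k := fun hd =>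
    (h1 n hn M a b k hd).trans (mul_le_mul_of_nonneg_right
      (by linarith [abs_nonneg D]) he)
  rcases hk with hk | ⟨hqv, hk⟩
  · exact hdec (Or.inl hk)
  -- A single entry has no leaf argument; its extra factor `ε` comes from the small Gaussian mean of
  -- `h`.
  rcases eq_or_lt_of_le hq with hq1 | hq2
  · subst hq1
    have hv : numVert a b Finset.univ = 2 := by simp [numVert]
    have huniv : (Finset.univ : Finset (Fin 1)) = {0} := rfl
    have e1 := h3 n hn M (a 0) (b 0)
    have e2 := ht n hn
    have e3 : |∫ ω, h n (M.H (a 0) (b 0) ω) ∂M.P| ≤ (C₁ + C₂ + (C₃ + |D|)) * eps n := by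
      have e4 := abs_sub_abs_le_abs_sub (∫ ω, h n (M.H (a 0) (b 0) ω) ∂M.P)
        (∫ x, h n x ∂gaussianReal 0 1)
      nlinarith [eps_nonneg n, le_abs_self D, mul_nonneg hC₁ (eps_nonneg n),
        mul_nonneg hC₂ (eps_nonneg n)]
    rw [huniv, setCumulant_singleton _ (M.entryMom_empty _ _ _)]
    have e5 : M.entryMom (fun _ => h) a b {0} = ∫ ω, h n (M.H (a 0) (b 0) ω) ∂M.P := by
      simp [entryMom]
    rw [e5]
    refine e3.trans (mul_le_mul_of_nonneg_left ?_ (by positivity))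
    calc eps n = eps n ^ 1 := (pow_one _).symm
      _ ≤ eps n ^ k := pow_le_pow_of_le_one (eps_nonneg n) (eps_le_one hn) (by omega)
  · rcases forest_or_leaf hq2 hconn hqv hcyc with ⟨hf, hp⟩ | ⟨hinj, l, hl⟩
    · exact hdec (Or.inr ⟨hf, hp, hk⟩)
    · have hnt : Nontrivial (Fin q) := by
        rw [← Fintype.one_lt_card_iff_nontrivial, Fintype.card_fin]
        exact hq2
      have hv : numVert a b Finset.univ ≤ 2 * q := by
        have h4 : (Finset.univ.image a).card ≤ q := by
          simpa using Finset.card_image_le (s := Finset.univ) (f := a)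
        have h5 : (Finset.univ.image b).card ≤ q := by
          simpa using Finset.card_image_le (s := Finset.univ) (f := b)
        unfold numVert
        omega
      refine (h2 n hn M a b hinj k (by omega) fun d α hne => ?_).trans
        (mul_le_mul_of_nonneg_right (by linarith [abs_nonneg D]) he)
      have := M.card_image_add_lt_of_ne hl hne
      omega

end RFModel

end CycleCorrelations

end

noncomputable section

namespace CycleCorrelations

/-! ### Transport of the given matrices to a normalised model on a product space. -/

theorem eps_eq_rpow (n : ℕ) : eps n = (n : ℝ) ^ (-(1 / 2) : ℝ) := by
  rw [eps, Real.sqrt_eq_rpow, Real.rpow_neg (Nat.cast_nonneg n)]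

theorem eps_pow_eq_rpow (n k : ℕ) : eps n ^ k = (n : ℝ) ^ (-((k : ℝ) / 2)) := by
  rw [eps_eq_rpow, ← Real.rpow_natCast, ← Real.rpow_mul (Nat.cast_nonneg n)]
  congr 1
  ring

/-- The normalised moments of an entry law. -/
def entryMoment (ν : Measure ℝ) (σ : ℝ) (p : ℕ) : ℝ := ∫ x, (x / σ) ^ p ∂ν

theorem IsEntryLaw.integrable_abs_div_pow {ν : Measure ℝ} {σ : ℝ} (h : IsEntryLaw ν σ) (p : ℕ) :
    Integrable (fun x => |x / σ| ^ p) ν := by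
  have h1 : (fun x : ℝ => |x / σ| ^ p) = fun x => ‖x ^ p‖ * (|σ| ^ p)⁻¹ := by
    funext x
    rw [abs_div, div_pow, Real.norm_eq_abs, abs_pow, div_eq_mul_inv]
  rw [h1]
  exact (h.moments p).norm.mul_const _

theorem IsEntryLaw.entryMoment_one {ν : Measure ℝ} {σ : ℝ} (h : IsEntryLaw ν σ) :
    entryMoment ν σ 1 = 0 := by
  simp only [entryMoment, pow_one, integral_div, h.mean, zero_div]

theorem IsEntryLaw.entryMoment_two {ν : Measure ℝ} {σ : ℝ} (h : IsEntryLaw ν σ) (hσ : 0 < σ) :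
    entryMoment ν σ 2 = 1 := by
  simp only [entryMoment, div_pow, integral_div, h.variance]
  exact div_self (by positivity)

section Transport

variable {σw σx : ℝ} {νW νX : Measure ℝ} {n n₁ m : ℕ}
  {Ω : Type*} [MeasurableSpace Ω] {P : Measure Ω}
  {W : Ω → Matrix (Fin n₁) (Fin n) ℝ} {X : Ω → Matrix (Fin n) (Fin m) ℝ} {f χ : ℝ → ℝ}

theorem IsIIDModel.hasLaw (h : IsIIDModel P νW νX W X) (v : (Fin n₁ × Fin n) ⊕ (Fin n × Fin m)) :
    HasLaw (Sum.elim (fun p ω => W ω p.1 p.2) (fun p ω => X ω p.1 p.2) v : Ω → ℝ)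
      (Sum.elim (fun _ => νW) (fun _ => νX) v) P := by
  rcases v with v | v
  · exact h.law_W v.1 v.2
  · exact h.law_X v.1 v.2

theorem jointCumulant_eq_zero_of_ae {ι : Type*} [Fintype ι] [DecidableEq ι] {Z : ι → Ω → ℝ} (i : ι)
    (h : ∀ᵐ ω ∂P, Z i ω = 0) : jointCumulant P Z = 0 := by
  change setCumulant (fun B => ∫ ω, ∏ l ∈ B, Z l ω ∂P) _ = 0
  refine setCumulant_eq_zero_of_mem _ _ (Finset.mem_univ i) fun B _ hi => ?_
  rw [integral_congr_ae (g := fun _ => 0), integral_zero]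
  filter_upwards [h] with ω hω
  exact Finset.prod_eq_zero hi hω

theorem IsEntryLaw.ae_eq_zero {ν : Measure ℝ} (h : IsEntryLaw ν 0) : ∀ᵐ x ∂ν, x = 0 := by
  have h1 := h.variance
  rw [zero_pow two_ne_zero, integral_eq_zero_iff_of_nonneg (fun x => sq_nonneg x) (h.moments 2)]
    at h1
  filter_upwards [h1] with x hx
  simpa using hx

theorem IsIIDModel.ae_mul_eq_zero (h : IsIIDModel P νW νX W X) (hW : IsEntryLaw νW σw)
    (hX : IsEntryLaw νX σx) (hσ : σw * σx = 0) (i : Fin n₁) (j : Fin m) :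
    ∀ᵐ ω ∂P, (W ω * X ω) i j = 0 := by
  have key : ∀ s, ∀ᵐ ω ∂P, W ω i s * X ω s j = 0 := by
    intro s
    rcases mul_eq_zero.1 hσ with h0 | h0
    · subst h0
      have h1 := hW.ae_eq_zero
      rw [← (h.law_W i s).map_eq] at h1
      filter_upwards [ae_of_ae_map (h.law_W i s).aemeasurable h1] with ω hω
      rw [hω, zero_mul]
    · subst h0
      have h1 := hX.ae_eq_zero
      rw [← (h.law_X s j).map_eq] at h1
      filter_upwards [ae_of_ae_map (h.law_X s j).aemeasurable h1] with ω hω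
      rw [hω, mul_zero]
  filter_upwards [ae_all_iff.2 key] with ω hω
  rw [Matrix.mul_apply]
  exact Finset.sum_eq_zero fun s _ => hω s

theorem IsIIDModel.map_eq (h : IsIIDModel P νW νX W X) :
    P.map (fun ω (v : (Fin n₁ × Fin n) ⊕ (Fin n × Fin m)) =>
      Sum.elim (fun p ω => W ω p.1 p.2) (fun p ω => X ω p.1 p.2) v ω) =
      Measure.pi (Sum.elim (fun _ => νW) fun _ => νX) := by
  rw [h.indep.map_fun_eq_pi_map fun v => (h.hasLaw v).aemeasurable]
  congr 1
  funext v
  exact (h.hasLaw v).map_eq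

variable [IsProbabilityMeasure νW] [IsProbabilityMeasure νX]

instance isProbabilityMeasure_elim {α β : Type*} (v : α ⊕ β) :
    IsProbabilityMeasure (Sum.elim (fun _ => νW) (fun _ => νX) v : Measure ℝ) := by
  cases v <;> simp only [Sum.elim_inl, Sum.elim_inr] <;> infer_instance

/-- The random feature model on the product of the laws of the entries. -/
def canonicalModel (hσw : 0 < σw) (hσx : 0 < σx) (hW : IsEntryLaw νW σw) (hX : IsEntryLaw νX σx)
    (n n₁ m : ℕ) :
    RFModel (entryMoment νW σw) (entryMoment νX σx) n where
  n₁ := n₁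
  m := m
  Ω := (Fin n₁ × Fin n) ⊕ (Fin n × Fin m) → ℝ
  P := Measure.pi (Sum.elim (fun _ => νW) fun _ => νX)
  V v ω := ω v / Sum.elim (fun _ => σw) (fun _ => σx) v
  meas v := (measurable_pi_apply v).div_const _
  indep := iIndepFun_pi (Ω := fun _ => ℝ)
    (μ := Sum.elim (fun _ => νW) fun _ => νX)
    (X := fun v x => x / Sum.elim (fun _ => σw) (fun _ => σx) v)
    fun v => (measurable_id.div_const _).aemeasurable
  int v p := by
    refine integrable_comp_eval
      (X := fun _ => ℝ)
      (μ := Sum.elim (fun _ => νW) fun _ => νX) (f := fun x => |x / Sum.elim (fun _ => σw) (fun _ => σx) v| ^ p) ?_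
    cases v
    · exact hW.integrable_abs_div_pow p
    · exact hX.integrable_abs_div_pow p
  mom_W v p := integral_comp_eval (X := fun _ => ℝ) (i := Sum.inl v)
    (μ := Sum.elim (fun _ => νW) fun _ => νX)
    (f := fun x => (x / σw) ^ p) (by fun_prop)
  mom_X v p := integral_comp_eval (X := fun _ => ℝ) (i := Sum.inr v)
    (μ := Sum.elim (fun _ => νW) fun _ => νX)
    (f := fun x => (x / σx) ^ p) (by fun_prop)
  mW0 := by simp [entryMoment]
  mX0 := by simp [entryMoment]
  mW1 := hW.entryMoment_one
  mX1 := hX.entryMoment_one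
  mW2 := hW.entryMoment_two hσw
  mX2 := hX.entryMoment_two hσx

/-- Cumulants depend only on the joint law of the entries, which is the product measure. The
standard deviations are moved from the entries into the activation. -/
theorem jointCumulant_featureMatrix (h : IsIIDModel P νW νX W X) (hf : Continuous f)
    (hχ : Continuous χ) (hσw : 0 < σw) (hσx : 0 < σx) (hW : IsEntryLaw νW σw)
    (hX : IsEntryLaw νX σx) {ι : Type*} [Fintype ι] [DecidableEq ι] (a : ι → Fin n₁)
    (b : ι → Fin m) :
    jointCumulant P (fun l ω => featureMatrix f χ W X ω (a l) (b l)) =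
      setCumulant ((canonicalModel hσw hσx hW hX n n₁ m).entryMom
        (fun _ => scaledActivation f χ (σw * σx)) a b) Finset.univ := by
  change setCumulant (fun B => ∫ ω, ∏ l ∈ B, featureMatrix f χ W X ω (a l) (b l) ∂P) _ = _
  refine setCumulant_congr fun B _ _ => ?_
  set F : ((Fin n₁ × Fin n) ⊕ (Fin n × Fin m) → ℝ) → ℝ := fun x =>
    ∏ l ∈ B, cutActivation f χ n (eps n * ∑ s, x (Sum.inl (a l, s)) * x (Sum.inr (s, b l)))
    with hF
  have hFc : Continuous F := by
    rw [hF]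
    unfold cutActivation
    fun_prop
  have h1 : ∀ ω, ∏ l ∈ B, featureMatrix f χ W X ω (a l) (b l) =
      F fun v => Sum.elim (fun p ω => W ω p.1 p.2) (fun p ω => X ω p.1 p.2) v ω := fun ω => by
    simp only [hF, featureMatrix, Matrix.map_apply, Matrix.smul_apply, Matrix.mul_apply,
      smul_eq_mul, Sum.elim_inl, Sum.elim_inr, eps]
  simp only [h1]
  rw [← integral_map (f := F)
    (aemeasurable_pi_lambda _ fun v => (h.hasLaw v).aemeasurable)
    hFc.aestronglyMeasurable, h.map_eq]
  refine integral_congr_ae (Filter.Eventually.of_forall fun x => ?_)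
  simp only [hF]
  refine Finset.prod_congr rfl fun l _ => ?_
  unfold scaledActivation RFModel.H RFModel.ξ canonicalModel
  simp only [Sum.elim_inl, Sum.elim_inr]
  congr 1
  rw [mul_left_comm, Finset.mul_sum _ _ (σw * σx)]
  refine congrArg (eps n * ·) (Finset.sum_congr rfl fun s _ => ?_)
  field_simp


end Transport

/-- A continuous function that vanishes almost everywhere vanishes. Since the variance estimate is
relative to `θ₁`, it has to be exact when `θ₁ = 0`. -/
theorem eq_zero_of_theta₁_eq_zero {f : ℝ → ℝ} {σw σx : ℝ} (hf : Continuous f)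
    (hint : Integrable (fun x => f (σw * σx * x) ^ 2) (gaussianReal 0 1)) (hσ : σw * σx ≠ 0)
    (h : theta₁ σw σx f = 0) (y : ℝ) : f y = 0 := by
  rw [theta₁, integral_eq_zero_iff_of_nonneg (fun x => sq_nonneg _) hint] at h
  have h1 := (gaussianReal_absolutelyContinuous' 0 one_ne_zero).ae_eq h
  have h2 := congrFun (Measure.eq_of_ae_eq h1
    ((hf.comp (continuous_const.mul continuous_id)).pow 2) continuous_zero) ((σw * σx)⁻¹ * y)
  simp only [Pi.zero_apply, ne_eq, OfNat.ofNat_ne_zero, not_false_eq_true, pow_eq_zero_iff] at h2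
  rwa [mul_inv_cancel_left₀ hσ] at h2

end CycleCorrelations

end

noncomputable section

/-! ### The degenerate case and the conclusion. -/

namespace CycleCorrelations

theorem two_le_numIndices {n₁ m q : ℕ} (hq : 1 ≤ q) (a : Fin q → Fin n₁) (b : Fin q → Fin m) :
    2 ≤ numIndices a b := by
  have hne : (Finset.univ : Finset (Fin q)).Nonempty := ⟨⟨0, hq⟩, Finset.mem_univ _⟩
  have h1 := (hne.image a).card_pos
  have h2 := (hne.image b).card_pos
  unfold numIndices
  omega

theorem integrable_scaled_sq {f χ : ℝ → ℝ} {σ : ℝ} (hf : ContDiff ℝ (⊤ : ℕ∞) f)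
    (hgrowth : HasExpGrowth f) (hχ : IsCutoff χ) (hσ : 0 < σ) :
    Integrable (fun x => f (σ * x) ^ 2) (gaussianReal 0 1) := by
  obtain ⟨C, -, -, h2⟩ := exists_bounds_scaled hf hgrowth hχ hσ 0
  simp only [iteratedDeriv_zero] at h2
  refine ((integrable_exp_abs_gaussian (2 * C)).const_mul (C ^ 2)).mono'
    ((hf.continuous.comp (continuous_const.mul continuous_id)).pow 2).aestronglyMeasurable
    (Filter.Eventually.of_forall fun x => ?_)
  rw [Real.norm_eq_abs, abs_pow]
  refine (pow_le_pow_left₀ (abs_nonneg _) (h2 x) 2).trans_eq ?_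
  rw [mul_pow, ← Real.exp_nat_mul]
  congr 2
  push_cast
  ring

namespace RFModel

theorem exists_abs_integral_le (mW mX : ℕ → ℝ) {h : ℕ → ℝ → ℝ} (hh : Adm h) {D : ℝ}
    (ht : ∀ n, 3 ≤ n → |∫ x, h n x ∂gaussianReal 0 1| ≤ D * eps n) :
    ∃ C : ℝ, 0 ≤ C ∧ ∀ n, 3 ≤ n → ∀ (M : RFModel mW mX n) i j,
      |∫ ω, h n (M.H i j ω) ∂M.P| ≤ C * eps n := by
  obtain ⟨C, hC, hb⟩ := exists_abs_integral_sub_le mW mX hh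
  refine ⟨C + |D|, by positivity, fun n hn M i j => ?_⟩
  have e1 := hb n hn M i j
  have e2 := ht n hn
  have e3 := abs_sub_abs_le_abs_sub (∫ ω, h n (M.H i j ω) ∂M.P) (∫ x, h n x ∂gaussianReal 0 1)
  have e4 := mul_le_mul_of_nonneg_right (le_abs_self D) (eps_nonneg n)
  linarith

variable {mW mX : ℕ → ℝ} {n : ℕ} (M : RFModel mW mX n)

theorem setCumulant_entryMom_one (h : ℕ → ℝ → ℝ) (i : Fin M.n₁) (j : Fin M.m) :
    setCumulant (M.entryMom (fun _ : Fin 1 => h) (fun _ => i) fun _ => j) Finset.univ =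
      ∫ ω, h n (M.H i j ω) ∂M.P := by
  rw [show (Finset.univ : Finset (Fin 1)) = {0} from rfl,
    setCumulant_singleton _ (M.entryMom_empty _ _ _)]
  simp [entryMom]

theorem setCumulant_entryMom_two (h : ℕ → ℝ → ℝ) (i : Fin M.n₁) (j : Fin M.m) :
    setCumulant (M.entryMom (fun _ : Fin 2 => h) (fun _ => i) fun _ => j) Finset.univ =
      ∫ ω, h n (M.H i j ω) ^ 2 ∂M.P - (∫ ω, h n (M.H i j ω) ∂M.P) ^ 2 := by
  rw [show (Finset.univ : Finset (Fin 2)) = {0, 1} from rfl,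
    setCumulant_pair _ (M.entryMom_empty _ _ _) (by decide)]
  simp [entryMom, sq]

end RFModel

/-- One of the two matrices vanishes almost surely, and the mean condition reads `f 0 = 0`. So `Y =
0` almost surely, both `θ`'s are zero, and the constant zero works. -/
theorem degenerate_bounds {σw σx : ℝ} {νW νX : Measure ℝ}
    (hW : IsEntryLaw νW σw) (hX : IsEntryLaw νX σx) {f χ : ℝ → ℝ} (hσ : σw * σx = 0)
    (hmean : ∫ x, f (σw * σx * x) ∂(gaussianReal 0 1) = 0) {K n n₁ m : ℕ}
    {Ω : Type*} [MeasurableSpace Ω] {P : Measure Ω}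
    {W : Ω → Matrix (Fin n₁) (Fin n) ℝ} {X : Ω → Matrix (Fin n) (Fin m) ℝ}
    (h : IsIIDModel P νW νX W X) :
    let Y := featureMatrix f χ W X
    (∀ i j, |jointCumulant P ![fun ω => Y ω i j]| ≤ 0 * (n : ℝ) ^ (-(1 / 2) : ℝ)) ∧
    (∀ i j, |jointCumulant P ![fun ω => Y ω i j, fun ω => (Y ω)ᴴ j i] - theta₁ σw σx f| ≤
      0 * theta₁ σw σx f * (n : ℝ) ^ (-(1 / 2) : ℝ)) ∧
    (∀ k : ℕ, 1 < k → k ≤ K → ∀ (r : Fin k → Fin n₁) (c : Fin k → Fin m),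
      Function.Injective r → Function.Injective c →
      |jointCumulant P (cycleEntries Y r c) - theta₂ σw σx f ^ k * (n : ℝ) ^ (1 - k : ℝ)| ≤
        0 * (n : ℝ) ^ (1 - k : ℝ) * (n : ℝ) ^ (-(1 / 2) : ℝ)) ∧
    (∀ q : ℕ, 1 ≤ q → q ≤ K → ∀ (a : Fin q → Fin n₁) (b : Fin q → Fin m), ¬ IsCycle a b →
      |jointCumulant P (fun l ω => Y ω (a l) (b l))| ≤
        0 * (n : ℝ) ^ (1 - numIndices a b + (max q (numIndices a b) : ℕ) / 2 : ℝ) *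
          (n : ℝ) ^ (-(1 / 2) : ℝ)) := by
  intro Y
  have hf0 : f 0 = 0 := by simpa [hσ] using hmean
  have hY : ∀ i j, ∀ᵐ ω ∂P, Y ω i j = 0 := fun i j => by
    filter_upwards [h.ae_mul_eq_zero hW hX hσ i j] with ω hω
    simp [Y, featureMatrix, hω, cutActivation, hf0]
  have hθ₁ : theta₁ σw σx f = 0 := by simp [theta₁, hσ, hf0]
  have hθ₂ : theta₂ σw σx f = 0 := by simp [theta₂, hσ]
  refine ⟨fun i j => ?_, fun i j => ?_, fun k hk _ r c _ _ => ?_, fun q hq _ a b _ => ?_⟩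
  · rw [jointCumulant_eq_zero_of_ae 0 (hY i j)]
    simp
  · rw [jointCumulant_eq_zero_of_ae 0 (hY i j), hθ₁]
    simp
  · rw [jointCumulant_eq_zero_of_ae (Sum.inl ⟨0, by omega⟩) (hY _ _), hθ₂,
      zero_pow (by omega)]
    simp
  · rw [jointCumulant_eq_zero_of_ae ⟨0, hq⟩ (hY _ _)]
    simp

end CycleCorrelations

end

theorem proposition3p5
    (σw σx : ℝ) (hσw : 0 ≤ σw) (hσx : 0 ≤ σx)
    (νW νX : Measure ℝ) [IsProbabilityMeasure νW] [IsProbabilityMeasure νX]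
    (hW : IsEntryLaw νW σw) (hX : IsEntryLaw νX σx)
    (f χ : ℝ → ℝ) (hf : ContDiff ℝ (⊤ : ℕ∞) f) (hgrowth : HasExpGrowth f)
    (hmean : ∫ x, f (σw * σx * x) ∂(gaussianReal 0 1) = 0)
    (hχ : IsCutoff χ) (K : ℕ) :
    ∃ (C : ℝ) (N : ℕ), ∀ n₀ : ℕ, N ≤ n₀ → ∀ (n₁ m : ℕ)
      (Ω : Type*) [MeasurableSpace Ω] (P : Measure Ω) [IsProbabilityMeasure P]
      (W : Ω → Matrix (Fin n₁) (Fin n₀) ℝ) (X : Ω → Matrix (Fin n₀) (Fin m) ℝ),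
      IsIIDModel P νW νX W X →
      let Y := featureMatrix f χ W X
      -- the mean
      (∀ i j, |jointCumulant P ![fun ω => Y ω i j]| ≤ C * (n₀ : ℝ) ^ (-(1 / 2) : ℝ)) ∧
      -- the variance
      (∀ i j, |jointCumulant P ![fun ω => Y ω i j, fun ω => (Y ω)ᴴ j i] - theta₁ σw σx f| ≤
        C * theta₁ σw σx f * (n₀ : ℝ) ^ (-(1 / 2) : ℝ)) ∧
      -- the cycles of length `2k`, `k > 1`
      (∀ k : ℕ, 1 < k → k ≤ K → ∀ (r : Fin k → Fin n₁) (c : Fin k → Fin m),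
        Function.Injective r → Function.Injective c →
        |jointCumulant P (cycleEntries Y r c) -
            theta₂ σw σx f ^ k * (n₀ : ℝ) ^ (1 - k : ℝ)| ≤
          C * (n₀ : ℝ) ^ (1 - k : ℝ) * (n₀ : ℝ) ^ (-(1 / 2) : ℝ)) ∧
      -- all other joint cumulants
      (∀ q : ℕ, 1 ≤ q → q ≤ K → ∀ (a : Fin q → Fin n₁) (b : Fin q → Fin m),
        ¬ IsCycle a b →
        |jointCumulant P (fun l ω => Y ω (a l) (b l))| ≤
          C * (n₀ : ℝ) ^ (1 - numIndices a b + (max q (numIndices a b) : ℕ) / 2 : ℝ) *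
            (n₀ : ℝ) ^ (-(1 / 2) : ℝ)) := by
  set σ := σw * σx with hσdef
  have hσ0 : 0 ≤ σ := mul_nonneg hσw hσx
  rcases hσ0.eq_or_lt with hσ | hσ
  · exact ⟨0, 3, fun n hn n₁ m Ω _ P _ W X h =>
      degenerate_bounds hW hX hσ.symm hmean (K := K) h⟩
  · have hσw' : 0 < σw := hσw.lt_of_ne fun h0 => by simp [hσdef, ← h0] at hσ
    have hσx' : 0 < σx := hσx.lt_of_ne fun h0 => by simp [hσdef, ← h0] at hσ
    set s := scaledActivation f χ σ with hs
    have hadm : Adm s := adm_scaledActivation hf hgrowth hχ hσ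
    obtain ⟨D₁, -, hD₁⟩ := exists_abs_integral_scaled_sub_le hf hgrowth hχ hσ
    obtain ⟨D₂, -, hD₂⟩ := exists_abs_integral_scaled_sq_sub_le hf hgrowth hχ hσ
    obtain ⟨D₃, hD₃0, hD₃⟩ := exists_abs_integral_deriv_scaled_sub_le hf hgrowth hχ hσ
    rw [hmean] at hD₁
    have hD₁' : ∀ n, 3 ≤ n → |∫ x, s n x ∂gaussianReal 0 1| ≤ D₁ * eps n := fun n hn => by
      simpa using hD₁ n hn
    set mW := entryMoment νW σw
    set mX := entryMoment νX σx
    obtain ⟨C₁, hC₁, h1⟩ := RFModel.exists_abs_integral_le mW mX hadm hD₁'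
    obtain ⟨C₂, hC₂, h2⟩ := RFModel.exists_abs_variance_sub_le mW mX hadm hD₁ hD₂
    -- Constants are chosen for every `k`, with a dummy value outside the range, and then summed
    -- over `k ≤ K`.
    have h3 : ∀ k : ℕ, ∃ C : ℝ, 0 ≤ C ∧ (1 < k → ∀ n, 3 ≤ n → ∀ (M : RFModel mW mX n)
        (r : Fin k → Fin M.n₁) (c : Fin k → Fin M.m), Function.Injective r →
        Function.Injective c →
        |setCumulant (M.entryMom (fun _ => s) (Sum.elim r fun l => r (finRotate k l))
          (Sum.elim c c)) Finset.univ - theta₂ σw σx f ^ k * eps n ^ (2 * k - 2)| ≤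
            C * eps n ^ (2 * k - 1)) := fun k => by
      by_cases hk : 1 < k
      · obtain ⟨C, hC, h⟩ :=
          RFModel.exists_abs_setCumulant_cycleEntries_sub_le mW mX hadm hD₃0 hD₃ hk
        simp only [pow_mul] at h
        exact ⟨C, hC, fun _ => h⟩
      · exact ⟨0, le_rfl, fun h => absurd h hk⟩
    have h4 : ∀ q : ℕ, ∃ C : ℝ, 0 ≤ C ∧ (1 ≤ q → ∀ n, 3 ≤ n → ∀ (M : RFModel mW mX n)
        (a : Fin q → Fin M.n₁) (b : Fin q → Fin M.m), ¬ IsCycle a b → ∀ k,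
        (k + 2 ≤ numVert a b Finset.univ ∨
          q ≤ numVert a b Finset.univ ∧ k + 1 ≤ numVert a b Finset.univ) →
        |setCumulant (M.entryMom (fun _ => s) a b) Finset.univ| ≤ C * eps n ^ k) := fun q => by
      by_cases hq : 1 ≤ q
      · obtain ⟨C, hC, h⟩ := RFModel.exists_abs_setCumulant_not_cycle_le mW mX hadm hD₁' hq
        exact ⟨C, hC, fun _ => h⟩
      · exact ⟨0, le_rfl, fun h => absurd h hq⟩
    choose C₃ hC₃ h3 using h3
    choose C₄ hC₄ h4 using h4
    have hθ : 0 ≤ theta₁ σw σx f := integral_nonneg fun x => sq_nonneg _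
    set S₃ := ∑ k ∈ Finset.range (K + 1), C₃ k with hS₃
    set S₄ := ∑ k ∈ Finset.range (K + 1), C₄ k with hS₄
    have hS₃0 : 0 ≤ S₃ := Finset.sum_nonneg fun k _ => hC₃ k
    have hS₄0 : 0 ≤ S₄ := Finset.sum_nonneg fun k _ => hC₄ k
    have hquot : 0 ≤ C₂ / theta₁ σw σx f := div_nonneg hC₂ hθ
    -- The quotient turns the absolute variance error into one relative to `θ₁`; if `θ₁ = 0` it is
    -- zero by convention and that case is exact. From `n = 3` on, `log n ≥ 1`.
    refine ⟨C₁ + C₂ / theta₁ σw σx f + S₃ + S₄, 3, fun n hn n₁ m Ω _ P _ W X h => ?_⟩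
    intro Y
    have htr : ∀ {ι : Type} [Fintype ι] [DecidableEq ι] (a : ι → Fin n₁) (b : ι → Fin m),
        jointCumulant P (fun l ω => Y ω (a l) (b l)) =
          setCumulant ((canonicalModel hσw' hσx' hW hX n n₁ m).entryMom (fun _ => s) a b)
            Finset.univ := fun a b =>
      jointCumulant_featureMatrix h hf.continuous hχ.smooth.continuous hσw' hσx' hW hX a b
    set M := canonicalModel hσw' hσx' hW hX n n₁ m with hM
    have he := eps_nonneg n
    have hn1 : (1 : ℝ) ≤ n := by exact_mod_cast (by omega : 1 ≤ n)
    have hn0 : (0 : ℝ) < n := by linarith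
    refine ⟨fun i j => ?_, fun i j => ?_, fun k hk hkK r c hr hc => ?_,
      fun q hq hqK a b hcyc => ?_⟩
    · rw [← eps_eq_rpow]
      have e1 : (![fun ω => Y ω i j] : Fin 1 → Ω → ℝ) = fun l ω => Y ω i j := by
        funext l ω
        fin_cases l
        rfl
      rw [e1, (htr (fun _ => i) (fun _ => j)).trans (M.setCumulant_entryMom_one s i j)]
      refine (h1 n hn M i j).trans (mul_le_mul_of_nonneg_right ?_ he)
      linarith
    · rw [← eps_eq_rpow]
      have e1 : (![fun ω => Y ω i j, fun ω => (Y ω)ᴴ j i] : Fin 2 → Ω → ℝ) =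
          fun l ω => Y ω i j := by
        funext l ω
        fin_cases l <;> simp
      rw [e1, (htr (fun _ => i) (fun _ => j)).trans (M.setCumulant_entryMom_two s i j)]
      rcases hθ.eq_or_lt with hθ0 | hθ0
      · have hf0 : ∀ y, f y = 0 := eq_zero_of_theta₁_eq_zero hf.continuous
          (integrable_scaled_sq hf hgrowth hχ hσ) hσ.ne' hθ0.symm
        have hs0 : ∀ x, s n x = 0 := fun x => by
          simp [hs, scaledActivation, cutActivation, hf0]
        simp [hs0, ← hθ0]
      · refine ((by simpa [theta₁] using h2 n hn M i j :
          _ ≤ C₂ * eps n)).trans (mul_le_mul_of_nonneg_right ?_ he)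
        calc C₂ = C₂ / theta₁ σw σx f * theta₁ σw σx f := (div_mul_cancel₀ _ hθ0.ne').symm
          _ ≤ _ := mul_le_mul_of_nonneg_right (by linarith) hθ0.le
    · have e1 : cycleEntries Y r c = fun l ω =>
          Y ω (Sum.elim r (fun l => r (finRotate k l)) l) (Sum.elim c c l) := by
        funext l ω
        rcases l with l | l <;> simp [cycleEntries]
      have e2 : (n : ℝ) ^ (1 - k : ℝ) = eps n ^ (2 * k - 2) := by
        rw [eps_pow_eq_rpow]
        congr 1
        rw [Nat.cast_sub (by omega)]
        push_cast
        ring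
      have e3 : eps n ^ (2 * k - 2) * eps n = eps n ^ (2 * k - 1) := by
        rw [← pow_succ]
        congr 1
        omega
      rw [e1, htr, e2, ← eps_eq_rpow, mul_assoc, e3]
      refine (h3 k hk n hn M r c hr hc).trans (mul_le_mul_of_nonneg_right ?_ (by positivity))
      have := Finset.single_le_sum (f := C₃) (fun k _ => hC₃ k)
        (Finset.mem_range.2 (Nat.lt_succ_of_le hkK))
      linarith
    · have hv : 2 ≤ numIndices a b := two_le_numIndices hq a b
      set v := numIndices a b with hvdef
      have hle : C₄ q ≤ C₁ + C₂ / theta₁ σw σx f + S₃ + S₄ := by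
        have := Finset.single_le_sum (f := C₄) (fun k _ => hC₄ k)
          (Finset.mem_range.2 (Nat.lt_succ_of_le hqK))
        linarith
      have hmain : ∀ k : ℕ, (k + 2 ≤ v ∨ q ≤ v ∧ k + 1 ≤ v) →
          -((k : ℝ) / 2) ≤ 1 - v + (max q v : ℕ) / 2 + -(1 / 2) →
          |jointCumulant P (fun l ω => Y ω (a l) (b l))| ≤
            (C₁ + C₂ / theta₁ σw σx f + S₃ + S₄) *
              (n : ℝ) ^ (1 - v + (max q v : ℕ) / 2 : ℝ) * (n : ℝ) ^ (-(1 / 2) : ℝ) := by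
        intro k hk hexp
        rw [htr, mul_assoc, ← Real.rpow_add hn0]
        refine (h4 q hq n hn M a b hcyc k hk).trans ?_
        rw [eps_pow_eq_rpow]
        exact mul_le_mul hle (Real.rpow_le_rpow_of_exponent_le hn1 hexp)
          (Real.rpow_nonneg hn0.le _) ((hC₄ q).trans hle)
      -- For `q ≤ v` the claimed exponent is exactly that of `ε ^ (v - 1)`. For `q > v` the bound
      -- allows at least `ε ^ (v - 2)`, because `q ≥ v + 1`.
      rcases le_or_gt q v with hqv | hqv
      · refine hmain (v - 1) (Or.inr ⟨hqv, by omega⟩) ?_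
        rw [max_eq_right hqv, Nat.cast_sub (by omega)]
        push_cast
        linarith
      · refine hmain (v - 2) (Or.inl (by omega)) ?_
        rw [max_eq_left hqv.le, Nat.cast_sub hv]
        have : (v : ℝ) + 1 ≤ q := by exact_mod_cast hqv
        push_cast
        linarith
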